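/- **Setting.** Let $\alpha,b,d>0$ and $c\in\mathbb R$, and let $f,g,h$ be real analytic functions of $(x,y,z)$ near $0\in\mathbb R^3$ (extended to complex arguments), each of order at least three at the origin. For $\psi,s,\theta\in\mathbb C$ put $\rho=\rho(\psi,s)=-\,i\sqrt{\tfrac{d+1}{b}}\;s^{-1}\sqrt{1-\tfrac{2b}{d+1}s^2\psi}$ (principal roots), so that $\rho^2=-\frac{d+1}{b}s^{-2}+2\psi$, and, with $f,g,h$ evaluated at $(\rho\cos\theta,\rho\sin\theta,s^{-1})$, $$\hat F(\psi)=\rho\,(\cos\theta\, f+\sin\theta\, g),\qquad \hat G(\psi)=\rho^{-1}(\cos\theta\, g-\sin\theta\, f),\qquad \hat H(\psi)=h .$$ The inner equation for $\psi(s,\theta)$ is $$-\alpha\partial_\theta\psi+d\,\partial_s\psi-\tfrac2s\psi=\tfrac cs\partial_\theta\psi+\hat F(\psi)+\tfrac{d+1}{b\,s}\hat H(\psi)-\hat G(\psi)\,\partial_\theta\psi+s^2\big(2b\psi+\hat H(\psi)\big)\partial_s\psi .$$ For $0<\beta_0<\pi/2$ and $\kappa,\sigma>0$ let $$D^u=\{s\in\mathbb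 C:|\operatorname{Im}s|\ge\tan\beta_0\operatorname{Re}s+\kappa\},\quad D^s=-D^u,\quad E_{in}=D^u\cap D^s\cap\{\operatorname{Im}s<0\},\quad T_\sigma=\{\theta:|\operatorname{Im}\theta|\le\sigma\}.$$ All functions of $\theta$ are $2\pi$-periodic. An *inner solution* on $D\times T_\sigma$ is an analytic, $2\pi$-periodic in $\theta$, solution of the inner equation such that, for some $M$, $|\psi|\le M|s|^{-3}$ and $|\partial_s\psi|,|\partial_\theta\psi|\le M|s|^{-4}$ on $D\times T_\sigma$. Given inner solutions $\psi^u$ on $D^u\times T_\sigma$ and $\psi^s$ on $D^s\times T_\sigma$, put $\psi_\lambda=\frac{\psi^u+\psi^s}2+\lambda\frac{\psi^u-\psi^s}2$ and $$a_1=\tfrac12\!\int_{-1}^1\!\Big(\partial_\psi\hat F(\psi_\lambda)+\tfrac{d+1}{b\,s}\partial_\psi\hat H(\psi_\lambda)-\partial_\psi\hat G(\psi_\lambda)\,\partial_\theta\psi_\lambda+s^2\,\partial_\psi\hat H(\psi_\lambda)\,\partial_s\psi_\lambda\Big)d\lambda+b\,s^2\,\partial_s(\psi^u+\psi^s),$$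 $$a_2=b\,s^2(\psi^u+\psi^s)+\tfrac12s^2\!\int_{-1}^1\hat H(\psi_\lambda)\,d\lambda,\qquad a_3=-\tfrac12\int_{-1}^1\hat G(\psi_\lambda)\,d\lambda .$$ **Theorem 2.4.** There is a constant $L_0\in\mathbb R$, depending only on $\alpha,b,c,d,f,g,h$, such that for all $0<\beta_0<\pi/2$ and $\sigma>0$ there is $\kappa_0>0$ such that for every $\kappa\ge\kappa_0$ the following holds. There are inner solutions on $D^u\times T_\sigma$ and on $D^s\times T_\sigma$; and if $\psi^u$, $\psi^s$ are such solutions, then $$\lim_{|s|\to\infty,\ s\in E_{in}}\ \frac{s}{2\pi}\int_0^{2\pi}a_2(s,\theta)\,d\theta=d\,L_0,$$ and the difference $\Delta\psi_{in}=\psi^u-\psi^s$ can be written on $E_{in}\times T_\sigma$ as $$\Delta\psi_{in}(s,\theta)=P^{in}(s,\theta)\,\tilde k\big(\xi_{in}(s,\theta)\big),\qquad P^{in}=s^{2/d}\big(1+P_1^{in}(s,\theta)\big),\qquad \tilde k(\tau)=\sum_{l<0}\Upsilon_{in}^{[l]}e^{il\tau},$$ $$\xi_{in}(s,\theta)=\theta+\tfrac{\alpha}{d}s+\tfrac{1}{d}(c+\alpha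 L_0)\log s+\varphi(s,\theta)$$ (principal branches), where $\tilde k$ is $2\pi$-periodic and its series converges at every $\tau=\xi_{in}(s,\theta)$; $P_1^{in}$ and $\varphi$ are analytic on $E_{in}\times T_\sigma$ and $2\pi$-periodic in $\theta$; $P=P^{in}$ solves $$-\alpha\partial_\theta P+d\,\partial_sP-\tfrac2sP=a_1P+a_2\,\partial_sP+\big(\tfrac cs+a_3\big)\partial_\theta P ;$$ $k=\xi_{in}$ solves $$-\alpha\partial_\theta k+d\,\partial_sk=a_2\,\partial_sk+\big(\tfrac cs+a_3\big)\partial_\theta k ;$$ and the map $(s,\theta)\mapsto(\xi_{in}(s,\theta),\theta)$ is injective on $E_{in}\times T_\sigma$. Moreover there is $M>0$ such that $|\Upsilon_{in}^{[l]}|\le M$ for all $l<0$ and, on $E_{in}\times T_\sigma$, $$|\varphi|,\ |\partial_s\varphi|,\ |P_1^{in}|\le\frac M{|s|},\qquad |\partial_sP_1^{in}|\le\frac M{|s|^2}.$$ -/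

import Mathlib

open Complex Set Filter Topology

noncomputable section

/-- Data of the inner equation of the Hopf-zero singularity: the real constants `α, b, c, d` and the
terms `f, g, h` of order at least three of the vector field at zero value of the unfolding
parameters, as functions of the three complexified phase variables `(x, y, z)`. -/
structure InnerSystem where
  α : ℝ
  b : ℝ
  c : ℝ
  d : ℝ
  f : ℂ × ℂ × ℂ → ℂ
  g : ℂ × ℂ × ℂ → ℂ
  h : ℂ × ℂ × ℂ → ℂ

/-- `F` is (the complexification of) a real analytic function near the origin of `ℝ³` whose Taylor
expansion at the origin starts with terms of order at least three. -/
structure IsCubicRemainder (F : ℂ × ℂ × ℂ → ℂ) : Prop where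
  analytic : AnalyticAt ℂ F 0
  cubic : F =O[𝓝 0] fun p => ‖p‖ ^ 3
  real : ∀ᶠ p : ℝ × ℝ × ℝ in 𝓝 0, (F ((p.1 : ℂ), (p.2.1 : ℂ), (p.2.2 : ℂ))).im = 0

/-- The unstable inner domain `{s : |Im s| ≥ tan β₀ Re s + κ}`. -/
def unstableDomain (β₀ κ : ℝ) : Set ℂ := {s | Real.tan β₀ * s.re + κ ≤ |s.im|}

/-- The stable inner domain, the reflection `-D` of the unstable one. -/
def stableDomain (β₀ κ : ℝ) : Set ℂ := {s | -s ∈ unstableDomain β₀ κ}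

/-- The domain `E` on which both inner solutions are compared. -/
def innerOverlap (β₀ κ : ℝ) : Set ℂ :=
  unstableDomain β₀ κ ∩ stableDomain β₀ κ ∩ {s | s.im < 0}

/-- The complex strip `|Im θ| ≤ σ`. Functions on `{θ ∈ ℂ / 2πℤ : |Im θ| ≤ σ}` are represented by
functions on this strip that are `2π`-periodic in `θ`. -/
def strip (σ : ℝ) : Set ℂ := {θ | |θ.im| ≤ σ}

/-- Partial derivative with respect to the first variable `s`. -/
def pds (ψ : ℂ → ℂ → ℂ) (s θ : ℂ) : ℂ := deriv (fun z => ψ z θ) s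

/-- Partial derivative with respect to the second variable `θ`. -/
def pdθ (ψ : ℂ → ℂ → ℂ) (s θ : ℂ) : ℂ := deriv (fun w => ψ s w) θ

/-- `ψ` is analytic on `D × {|Im θ| ≤ σ}` (in a neighbourhood of each of its points) and
`2π`-periodic in `θ`. -/
structure IsAnalyticPeriodic (D : Set ℂ) (σ : ℝ) (ψ : ℂ → ℂ → ℂ) : Prop where
  analytic : AnalyticOnNhd ℂ (fun p : ℂ × ℂ => ψ p.1 p.2) (D ×ˢ strip σ)
  periodic : ∀ s ∈ D, ∀ θ ∈ strip σ, ψ s (θ + 2 * Real.pi) = ψ s θ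

namespace InnerSystem

/-- The radius `ρ = √(-(d+1)/(b s²) + 2ψ)`. The branch of the square root is
`-i √((d+1)/b) s⁻¹ √(1 - 2 b s² ψ / (d+1))` with principal square roots: it is single valued on the
inner domains, it is the limit of `δ √(2 r)` with the root that is positive for real arguments, and
for `Im s < 0` and `s² ψ` small it is the principal square root. -/
def rho (S : InnerSystem) (ψ s : ℂ) : ℂ :=
  -I * (Real.sqrt ((S.d + 1) / S.b) : ℂ) / s *
    (1 - 2 * S.b / (S.d + 1) * s ^ 2 * ψ) ^ ((1 : ℂ) / 2)

/-- `ρ` is indeed a square root of `-(d+1)/(b s²) + 2ψ`. -/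
theorem rho_sq (S : InnerSystem) (hb : 0 < S.b) (hd : 0 < S.d) (ψ s : ℂ) (hs : s ≠ 0) :
    S.rho ψ s ^ 2 = (S.d + 1) / S.b * (-(s ^ 2)⁻¹) + 2 * ψ := by
  have h1 : ((1 - 2 * S.b / (S.d + 1) * s ^ 2 * ψ) ^ ((1 : ℂ) / 2)) ^ 2
      = 1 - 2 * S.b / (S.d + 1) * s ^ 2 * ψ := by
    simp [one_div]
  have h2 : ((Real.sqrt ((S.d + 1) / S.b) : ℝ) : ℂ) ^ 2 = (S.d + 1) / S.b := by
    rw [← Complex.ofReal_pow, Real.sq_sqrt (by positivity)]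
    push_cast
    rfl
  have hb' : (S.b : ℂ) ≠ 0 := by exact_mod_cast hb.ne'
  have hd' : (S.d : ℂ) + 1 ≠ 0 := by
    have : S.d + 1 ≠ 0 := by positivity
    exact_mod_cast this
  unfold rho
  rw [mul_pow, h1, div_pow, mul_pow, h2, neg_sq, I_sq]
  field_simp
  ring

/-- The point `(ρ cos θ, ρ sin θ, s⁻¹)` at which the perturbation is evaluated. -/
def point (S : InnerSystem) (ψ s θ : ℂ) : ℂ × ℂ × ℂ :=
  (S.rho ψ s * cos θ, S.rho ψ s * sin θ, s⁻¹)

def Fhat (S : InnerSystem) (ψ s θ : ℂ) : ℂ :=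
  S.rho ψ s * (cos θ * S.f (S.point ψ s θ) + sin θ * S.g (S.point ψ s θ))

def Ghat (S : InnerSystem) (ψ s θ : ℂ) : ℂ :=
  (S.rho ψ s)⁻¹ * (cos θ * S.g (S.point ψ s θ) - sin θ * S.f (S.point ψ s θ))

def Hhat (S : InnerSystem) (ψ s θ : ℂ) : ℂ := S.h (S.point ψ s θ)

/-- The inner equation for `ψ` at the point `(s, θ)`. -/
def InnerEquationAt (S : InnerSystem) (ψ : ℂ → ℂ → ℂ) (s θ : ℂ) : Prop :=
  -S.α * pdθ ψ s θ + S.d * pds ψ s θ - 2 * s⁻¹ * ψ s θ =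
    S.c * s⁻¹ * pdθ ψ s θ + S.Fhat (ψ s θ) s θ
      + (S.d + 1) / S.b * s⁻¹ * S.Hhat (ψ s θ) s θ
      - S.Ghat (ψ s θ) s θ * pdθ ψ s θ
      + s ^ 2 * (2 * S.b * ψ s θ + S.Hhat (ψ s θ) s θ) * pds ψ s θ

/-- An inner solution on `D × {|Im θ| ≤ σ}`: an analytic, `2π`-periodic in `θ`, solution of the
inner equation that decays like `|s|⁻³`, with first derivatives that decay like `|s|⁻⁴`. -/
structure IsInnerSolution (S : InnerSystem) (D : Set ℂ) (σ : ℝ) (ψ : ℂ → ℂ → ℂ) : Prop where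
  regular : IsAnalyticPeriodic D σ ψ
  equation : ∀ s ∈ D, ∀ θ ∈ strip σ, S.InnerEquationAt ψ s θ
  bound : ∃ M : ℝ, ∀ s ∈ D, ∀ θ ∈ strip σ,
    ‖ψ s θ‖ ≤ M / ‖s‖ ^ 3 ∧ ‖pds ψ s θ‖ ≤ M / ‖s‖ ^ 4 ∧ ‖pdθ ψ s θ‖ ≤ M / ‖s‖ ^ 4

/-- The segment `ψ_λ = (ψᵘ + ψˢ)/2 + λ (ψᵘ - ψˢ)/2` between the two inner solutions. -/
def seg (ψu ψs : ℂ → ℂ → ℂ) (l : ℝ) (s θ : ℂ) : ℂ :=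
  (ψu s θ + ψs s θ) / 2 + l * ((ψu s θ - ψs s θ) / 2)

/-- The coefficient `a₁` of the linear equation for the difference. -/
def a₁ (S : InnerSystem) (ψu ψs : ℂ → ℂ → ℂ) (s θ : ℂ) : ℂ :=
  1 / 2 * (∫ l in (-1 : ℝ)..1, deriv (fun w => S.Fhat w s θ) (seg ψu ψs l s θ))
    + (S.d + 1) / (2 * S.b) * s⁻¹
      * (∫ l in (-1 : ℝ)..1, deriv (fun w => S.Hhat w s θ) (seg ψu ψs l s θ))
    - 1 / 2 * (∫ l in (-1 : ℝ)..1,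
        deriv (fun w => S.Ghat w s θ) (seg ψu ψs l s θ) * pdθ (seg ψu ψs l) s θ)
    + S.b * s ^ 2 * (pds ψu s θ + pds ψs s θ)
    + 1 / 2 * s ^ 2 * (∫ l in (-1 : ℝ)..1,
        deriv (fun w => S.Hhat w s θ) (seg ψu ψs l s θ) * pds (seg ψu ψs l) s θ)

/-- The coefficient `a₂` of the linear equation for the difference. -/
def a₂ (S : InnerSystem) (ψu ψs : ℂ → ℂ → ℂ) (s θ : ℂ) : ℂ :=
  S.b * s ^ 2 * (ψu s θ + ψs s θ)
    + 1 / 2 * s ^ 2 * (∫ l in (-1 : ℝ)..1, S.Hhat (seg ψu ψs l s θ) s θ)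

/-- The coefficient `a₃` of the linear equation for the difference. -/
def a₃ (S : InnerSystem) (ψu ψs : ℂ → ℂ → ℂ) (s θ : ℂ) : ℂ :=
  -(1 / 2) * (∫ l in (-1 : ℝ)..1, S.Ghat (seg ψu ψs l s θ) s θ)

/-- The mean of `a₂(s, ·)` over one period. -/
def a₂mean (S : InnerSystem) (ψu ψs : ℂ → ℂ → ℂ) (s : ℂ) : ℂ :=
  1 / (2 * Real.pi) * (∫ t in (0 : ℝ)..(2 * Real.pi), S.a₂ ψu ψs s (t : ℂ))

/-- The linear equation satisfied by the difference `ψᵘ - ψˢ`, for an unknown `P`. -/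
def DifferenceEquationAt (S : InnerSystem) (ψu ψs P : ℂ → ℂ → ℂ) (s θ : ℂ) : Prop :=
  -S.α * pdθ P s θ + S.d * pds P s θ - 2 * s⁻¹ * P s θ =
    S.a₁ ψu ψs s θ * P s θ + S.a₂ ψu ψs s θ * pds P s θ
      + (S.c * s⁻¹ + S.a₃ ψu ψs s θ) * pdθ P s θ

/-- The associated homogeneous transport equation, for an unknown `k`. -/
def TransportEquationAt (S : InnerSystem) (ψu ψs k : ℂ → ℂ → ℂ) (s θ : ℂ) : Prop :=
  -S.α * pdθ k s θ + S.d * pds k s θ =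
    S.a₂ ψu ψs s θ * pds k s θ + (S.c * s⁻¹ + S.a₃ ψu ψs s θ) * pdθ k s θ

/-- `P = s^{2/d} (1 + P₁)`, with the principal branch of the power. -/
def prefactor (S : InnerSystem) (P₁ : ℂ → ℂ → ℂ) (s θ : ℂ) : ℂ :=
  s ^ ((2 / S.d : ℝ) : ℂ) * (1 + P₁ s θ)

/-- `ξ = θ + α s / d + (c + α L₀) log s / d + φ`, with the principal branch of the logarithm. -/
def phase (S : InnerSystem) (L₀ : ℝ) (φ : ℂ → ℂ → ℂ) (s θ : ℂ) : ℂ :=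
  θ + S.α / S.d * s + (S.c + S.α * L₀) / S.d * log s + φ s θ

end InnerSystem

end

/-! The proof treats `1 / s` as a small element of a Banach algebra. This turns the inner equation
into contraction problems, and the structure of the difference then follows from an argument on
first integrals.

Functions of `(s, θ)` are represented by Fourier series in `θ`, weighted by `exp (σ |l|)`, whose
coefficients are bounded holomorphic functions of `s / κ` on a fixed open set. In this algebra `1 /
s` has norm `O(1 / κ)`, so a large `κ` is a small parameter. The nonlinear terms are lifted to the
algebra by power series (`exists_lift_analytic`), and their order three at the origin factors out
explicit powers of `1 / s` (`exists_lift_cubicPart`, `exists_lifts`). On the mode `l ≠ 0` the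
operator `-α ∂_θ + d ∂_s` is an ordinary differential operator, inverted by integration along rays
or segments with a gain of `1 / |l|`; the mode `l = 0` is inverted by radial integration. Both first
derivatives of the result are bounded in terms of the right-hand side, so no derivative is lost.

For existence, the solution is `s⁻³ (ψ₀ + s⁻¹ Ψ)` and the right-hand side produced by `Ψ` is the
unknown of a contraction (`exists_formal_solution`). For uniqueness, arbitrary inner solutions are
expanded in Fourier series, and the same inverse operators show that the difference of two of them
is bounded by a small multiple of itself (`IsInnerSolution.unique`). Any given pair of inner
solutions therefore coincides with the constructed pair on the overlap.

The difference of the pair solves a linear equation with `a₁, a₃ = O(s⁻²)` and `a₂ = O(s⁻¹)`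
(`exists_coefficients`). A linear contraction produces `p` and `φ` such that `s^(2/d) exp p` solves
the difference equation and `ξ` solves the transport equation (`exists_phase_prefactor`). The
oscillating part of the `s⁻¹` coefficient of `a₂` is absorbed by `φ`; its mean can only be absorbed
by a logarithm, which determines `L₀`. The mean is real because a half turn in `θ` leaves only even
powers of the purely imaginary leading coefficient of the radius.

The quotient of the difference by `s^(2/d) exp p` is a first integral of the same vector field as
`ξ`, hence a function of `ξ`. Read off along the negative imaginary axis, this function is
holomorphic and `2π`-periodic in a lower half-plane and tends to zero, so it equals `F (exp (-i ξ))`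
with `F` holomorphic in a disc and `F 0 = 0` (`exists_cusp`). Finally `F q = Υ q^m (1 + q H q)`. The
factor `1 + q H q` is again a function of `ξ` and is exponentially close to one as `|s|` grows, so
it may be moved into the prefactor (`exists_splitting`). What remains for the periodic function is a
single exponential, so boundedness of the coefficients and convergence of the series are immediate.
-/

open Complex Set Filter Topology Asymptotics MeasureTheory
open scoped NNReal ENNReal BoundedContinuousFunction
open TopologicalSpace (Opens)
set_option linter.unusedSectionVars false

noncomputable section

open Complex Set Filter Topology
open scoped NNReal ENNReal

/-! ### The Banach algebra of weighted Fourier series. -/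

/-- The weight `exp (σ |l|)` of the `l`-th Fourier mode. -/
def modeWeight (σ : ℝ≥0) (l : ℤ) : ℝ := Real.exp (σ * |(l : ℝ)|)

theorem modeWeight_pos (σ : ℝ≥0) (l : ℤ) : 0 < modeWeight σ l := Real.exp_pos _

theorem modeWeight_zero (σ : ℝ≥0) : modeWeight σ 0 = 1 := by simp [modeWeight]

theorem modeWeight_add_le (σ : ℝ≥0) (i j : ℤ) :
    modeWeight σ (i + j) ≤ modeWeight σ i * modeWeight σ j := by
  rw [modeWeight, modeWeight, modeWeight, ← Real.exp_add, ← mul_add]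
  push_cast
  gcongr
  exact abs_add_le _ _

/-- The structure constants of the product in the basis of normalized Fourier modes. -/
def modeRatio (σ : ℝ≥0) (i j : ℤ) : ℂ :=
  ((modeWeight σ (i + j) / (modeWeight σ i * modeWeight σ j) : ℝ) : ℂ)

theorem norm_modeRatio_le (σ : ℝ≥0) (i j : ℤ) : ‖modeRatio σ i j‖ ≤ 1 := by
  have h := mul_pos (modeWeight_pos σ i) (modeWeight_pos σ j)
  rw [modeRatio, Complex.norm_real, Real.norm_of_nonneg (div_nonneg (modeWeight_pos σ _).le h.le)]
  exact (div_le_one h).2 (modeWeight_add_le σ i j)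

theorem modeRatio_zero_left (σ : ℝ≥0) (j : ℤ) : modeRatio σ 0 j = 1 := by
  simp [modeRatio, modeWeight_zero, (modeWeight_pos σ j).ne']

theorem modeRatio_comm (σ : ℝ≥0) (i j : ℤ) : modeRatio σ i j = modeRatio σ j i := by
  simp [modeRatio, add_comm i j, mul_comm]

/-- This cocycle identity is what makes the product of normalized modes associative. -/
theorem modeRatio_assoc (σ : ℝ≥0) (i j k : ℤ) :
    modeRatio σ i j * modeRatio σ (i + j) k = modeRatio σ j k * modeRatio σ i (j + k) := by
  have h1 := (modeWeight_pos σ i).ne'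
  have h2 := (modeWeight_pos σ j).ne'
  have h3 := (modeWeight_pos σ k).ne'
  have h4 := (modeWeight_pos σ (i + j)).ne'
  have h5 := (modeWeight_pos σ (j + k)).ne'
  simp only [modeRatio, ← Complex.ofReal_mul, add_assoc]
  congr 1
  field_simp

/-- Absolutely convergent Fourier series with coefficients in `B`, with the norm
`∑ |u_l| exp (σ |l|)`. The coordinates are those in the basis of normalized modes. -/
def WienerAlg (B : Type*) [NormedCommRing B] (_σ : ℝ≥0) : Type _ := lp (fun _ : ℤ => B) 1

namespace WienerAlg

variable {B : Type*} [NormedCommRing B] [NormedAlgebra ℂ B] [CompleteSpace B] {σ : ℝ≥0}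

instance : NormedAddCommGroup (WienerAlg B σ) :=
  inferInstanceAs (NormedAddCommGroup (lp (fun _ : ℤ => B) 1))
instance : NormedSpace ℂ (WienerAlg B σ) :=
  inferInstanceAs (NormedSpace ℂ (lp (fun _ : ℤ => B) 1))
instance : CompleteSpace (WienerAlg B σ) :=
  inferInstanceAs (CompleteSpace (lp (fun _ : ℤ => B) 1))

/-- The coefficient of a normalized mode. -/
def coeff (u : WienerAlg B σ) (l : ℤ) : B := (show lp (fun _ : ℤ => B) 1 from u) l

/-- The element with a single mode. -/
def single (σ : ℝ≥0) (l : ℤ) : B →L[ℂ] WienerAlg B σ :=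
  lp.singleContinuousLinearMap ℂ (fun _ : ℤ => B) 1 l

theorem ext_coeff {u v : WienerAlg B σ} (h : ∀ l, u.coeff l = v.coeff l) : u = v :=
  lp.ext (funext h)

theorem coeff_add (u v : WienerAlg B σ) (l : ℤ) : (u + v).coeff l = u.coeff l + v.coeff l := rfl

theorem coeff_smul (c : ℂ) (u : WienerAlg B σ) (l : ℤ) : (c • u).coeff l = c • u.coeff l := rfl

theorem coeff_single (l m : ℤ) (b : B) : (single σ l b).coeff m = if m = l then b else 0 := by
  by_cases h : m = l
  · subst h
    rw [if_pos rfl]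
    exact lp.single_apply_self (E := fun _ : ℤ => B) 1 m b
  · rw [if_neg h]
    exact lp.single_apply_ne (E := fun _ : ℤ => B) 1 l b h

theorem norm_single (l : ℤ) (b : B) : ‖single σ l b‖ = ‖b‖ := by
  have h := lp.norm_single (E := fun _ : ℤ => B) (p := 1) one_pos l b
  exact h

theorem hasSum_norm (u : WienerAlg B σ) : HasSum (fun l => ‖u.coeff l‖) ‖u‖ := by
  have h := lp.hasSum_norm (E := fun _ : ℤ => B) (p := 1) (by simp) u
  simp only [ENNReal.toReal_one, Real.rpow_one] at h
  exact h

theorem summable_norm (u : WienerAlg B σ) : Summable fun l => ‖u.coeff l‖ := u.hasSum_norm.summable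

theorem norm_coeff_le (u : WienerAlg B σ) (l : ℤ) : ‖u.coeff l‖ ≤ ‖u‖ :=
  lp.norm_apply_le_norm (by simp) u l

theorem hasSum_single (u : WienerAlg B σ) : HasSum (fun l => single σ l (u.coeff l)) u :=
  lp.hasSum_single (by simp) u

/-- A coefficient sequence that is absolutely summable. -/
def ofSummable (a : ℤ → B) (ha : Summable fun l => ‖a l‖) : WienerAlg B σ :=
  (⟨a, show Memℓp a 1 from memℓp_gen (by simpa using ha)⟩ : lp (fun _ : ℤ => B) 1)

theorem coeff_ofSummable (a : ℤ → B) (ha : Summable fun l => ‖a l‖) (l : ℤ) :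
    (ofSummable a ha : WienerAlg B σ).coeff l = a l := rfl

section Lift

variable {E : Type*} [NormedAddCommGroup E] [NormedSpace ℂ E]

/-- Finite sums of single modes are dense. The algebraic identities below (commutativity,
associativity, multiplicativity of evaluation) are checked on modes and extended by continuity. -/
theorem clm_ext {f g : WienerAlg B σ →L[ℂ] E} (h : ∀ l b, f (single σ l b) = g (single σ l b)) :
    f = g := by
  ext u
  have h1 := (hasSum_single u).mapL f
  have h2 := (hasSum_single u).mapL g
  simp only [h] at h1
  exact h1.unique h2

variable [CompleteSpace E]

theorem summable_lift (T : ℤ → B →L[ℂ] E) (C : ℝ) (hC : ∀ l, ‖T l‖ ≤ C) (u : WienerAlg B σ) :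
    Summable fun l => T l (u.coeff l) :=
  .of_norm_bounded (u.summable_norm.mul_left C) fun l =>
    ((T l).le_opNorm _).trans (mul_le_mul_of_nonneg_right (hC l) (norm_nonneg _))

/-- The continuous linear map with prescribed values on the modes. -/
def lift (σ : ℝ≥0) (T : ℤ → B →L[ℂ] E) (C : ℝ) (hC : ∀ l, ‖T l‖ ≤ C) : WienerAlg B σ →L[ℂ] E :=
  LinearMap.mkContinuous
    { toFun := fun u => ∑' l, T l (u.coeff l)
      map_add' := fun u v => by
        simp only [coeff_add, map_add]
        exact (summable_lift T C hC u).tsum_add (summable_lift T C hC v)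
      map_smul' := fun c u => by
        simp only [coeff_smul, map_smul, RingHom.id_apply]
        exact (summable_lift T C hC u).tsum_const_smul c } C fun u => by
    refine tsum_of_norm_bounded (u.hasSum_norm.mul_left C) fun l => ?_
    exact ((T l).le_opNorm _).trans (mul_le_mul_of_nonneg_right (hC l) (norm_nonneg _))

theorem lift_apply (T : ℤ → B →L[ℂ] E) (C : ℝ) (hC : ∀ l, ‖T l‖ ≤ C) (u : WienerAlg B σ) :
    lift σ T C hC u = ∑' l, T l (u.coeff l) := rfl

theorem lift_single (T : ℤ → B →L[ℂ] E) (C : ℝ) (hC : ∀ l, ‖T l‖ ≤ C) (l : ℤ) (b : B) :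
    lift σ T C hC (single σ l b) = T l b := by
  rw [lift_apply, tsum_eq_single l]
  · simp [coeff_single]
  · intro m hm; simp [coeff_single, hm]

theorem norm_lift_le (T : ℤ → B →L[ℂ] E) (C : ℝ) (hC : ∀ l, ‖T l‖ ≤ C) : ‖lift σ T C hC‖ ≤ C :=
  LinearMap.mkContinuous_norm_le _ ((norm_nonneg _).trans (hC 0)) _

end Lift

/-- The term of the product of two series with the given pair of modes. -/
def mulTerm (u v : WienerAlg B σ) (p : ℤ × ℤ) : WienerAlg B σ :=
  single σ (p.1 + p.2) (modeRatio σ p.1 p.2 • (u.coeff p.1 * v.coeff p.2))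

theorem norm_mulTerm_le (u v : WienerAlg B σ) (p : ℤ × ℤ) :
    ‖mulTerm u v p‖ ≤ ‖u.coeff p.1‖ * ‖v.coeff p.2‖ := by
  rw [mulTerm, norm_single]
  refine (norm_smul_le _ _).trans ?_
  calc _ ≤ 1 * ‖u.coeff p.1 * v.coeff p.2‖ := by gcongr; exact norm_modeRatio_le σ _ _
    _ ≤ _ := by rw [one_mul]; exact norm_mul_le _ _

theorem hasSum_norm_mul (u v : WienerAlg B σ) :
    HasSum (fun p : ℤ × ℤ => ‖u.coeff p.1‖ * ‖v.coeff p.2‖) (‖u‖ * ‖v‖) :=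
  u.hasSum_norm.mul v.hasSum_norm
    (u.summable_norm.mul_of_nonneg v.summable_norm (fun _ => norm_nonneg _) fun _ => norm_nonneg _)

theorem summable_mulTerm (u v : WienerAlg B σ) : Summable (mulTerm u v) :=
  .of_norm_bounded (hasSum_norm_mul u v).summable (norm_mulTerm_le u v)

/-- The product of Fourier series as a continuous bilinear map. -/
def mulL : WienerAlg B σ →L[ℂ] WienerAlg B σ →L[ℂ] WienerAlg B σ :=
  LinearMap.mkContinuous₂
    (LinearMap.mk₂ ℂ (fun u v => ∑' p, mulTerm u v p)
      (fun u u' v => by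
        rw [← (summable_mulTerm u v).tsum_add (summable_mulTerm u' v)]
        simp only [mulTerm, coeff_add, add_mul, smul_add, map_add])
      (fun c u v => by
        rw [← (summable_mulTerm u v).tsum_const_smul c]
        simp only [mulTerm, coeff_smul, smul_mul_assoc, smul_comm c, map_smul])
      (fun u v v' => by
        rw [← (summable_mulTerm u v).tsum_add (summable_mulTerm u v')]
        simp only [mulTerm, coeff_add, mul_add, smul_add, map_add])
      (fun c u v => by
        rw [← (summable_mulTerm u v).tsum_const_smul c]
        simp only [mulTerm, coeff_smul, mul_smul_comm, smul_comm c, map_smul])) 1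
    fun u v => by
      rw [one_mul]
      exact tsum_of_norm_bounded (hasSum_norm_mul u v) (norm_mulTerm_le u v)

theorem mulL_apply (u v : WienerAlg B σ) : mulL u v = ∑' p, mulTerm u v p := rfl

theorem norm_mulL_le (u v : WienerAlg B σ) : ‖mulL u v‖ ≤ ‖u‖ * ‖v‖ :=
  tsum_of_norm_bounded (hasSum_norm_mul u v) (norm_mulTerm_le u v)

theorem mulL_single (i j : ℤ) (a b : B) :
    mulL (single σ i a) (single σ j b) = single σ (i + j) (modeRatio σ i j • (a * b)) := by
  rw [mulL_apply, tsum_eq_single (i, j)]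
  · simp [mulTerm, coeff_single]
  · rintro ⟨k, l⟩ h
    by_cases hk : k = i
    · have hl : l ≠ j := fun hl => h (by rw [hk, hl])
      simp [mulTerm, coeff_single, hl]
    · simp [mulTerm, coeff_single, hk]

theorem mulL_comm (u v : WienerAlg B σ) : mulL u v = mulL v u := by
  have : (mulL : WienerAlg B σ →L[ℂ] _) = mulL.flip := by
    refine clm_ext fun i a => clm_ext fun j b => ?_
    rw [ContinuousLinearMap.flip_apply, mulL_single, mulL_single, add_comm, modeRatio_comm,
      mul_comm a]
  exact congrArg (fun f => f u v) this

theorem mulL_assoc (u v w : WienerAlg B σ) : mulL (mulL u v) w = mulL u (mulL v w) := by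
  -- The three factors are released one at a time: each identity is linear and continuous in the
  -- next factor, so its validity on modes suffices.
  have h1 : ∀ i a j b (w : WienerAlg B σ),
      mulL (mulL (single σ i a) (single σ j b)) w = mulL (single σ i a) (mulL (single σ j b) w) := by
    intro i a j b w
    have : mulL (mulL (single σ i a) (single σ j b))
        = (mulL (single σ i a)).comp (mulL (single σ j b)) := by
      refine clm_ext fun k c => ?_
      rw [ContinuousLinearMap.comp_apply]
      simp only [mulL_single, smul_mul_assoc, mul_smul_comm, smul_smul, add_assoc, mul_assoc]
      rw [mul_comm, modeRatio_assoc, mul_comm]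
    exact congrArg (fun f => f w) this
  have h2 : ∀ i a (v w : WienerAlg B σ),
      mulL (mulL (single σ i a) v) w = mulL (single σ i a) (mulL v w) := by
    intro i a v w
    have : (mulL.flip w).comp (mulL (single σ i a))
        = (mulL (single σ i a)).comp (mulL.flip w) :=
      clm_ext fun j b => h1 i a j b w
    exact congrArg (fun f => f v) this
  have : (mulL.flip w).comp (mulL.flip v) = mulL.flip (mulL v w) :=
    clm_ext fun i a => h2 i a v w
  exact congrArg (fun f => f u) this

instance : Mul (WienerAlg B σ) := ⟨fun u v => mulL u v⟩
instance : One (WienerAlg B σ) := ⟨single σ 0 1⟩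

theorem mul_def (u v : WienerAlg B σ) : u * v = mulL u v := rfl
theorem one_def : (1 : WienerAlg B σ) = single σ 0 1 := rfl

theorem one_mulL (u : WienerAlg B σ) : mulL 1 u = u := by
  have : mulL (1 : WienerAlg B σ) = ContinuousLinearMap.id ℂ _ := by
    refine clm_ext fun j b => ?_
    rw [one_def, mulL_single, modeRatio_zero_left]
    simp
  exact congrArg (fun f => f u) this

instance : NormedCommRing (WienerAlg B σ) where
  __ := (inferInstance : NormedAddCommGroup (WienerAlg B σ))
  left_distrib u v w := map_add (mulL u) v w
  right_distrib u v w := by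
    rw [mul_def, map_add]; rfl
  zero_mul u := by rw [mul_def, map_zero]; rfl
  mul_zero u := map_zero (mulL u)
  mul_assoc := mulL_assoc
  one_mul := one_mulL
  mul_one u := (mulL_comm u 1).trans (one_mulL u)
  mul_comm := mulL_comm
  dist_eq u v := by rw [dist_eq_norm, ← norm_neg, neg_sub, sub_eq_neg_add]
  norm_mul_le := norm_mulL_le

instance : NormedAlgebra ℂ (WienerAlg B σ) where
  __ := (inferInstance : NormedSpace ℂ (WienerAlg B σ))
  algebraMap :=
    { toFun := fun c => c • 1
      map_one' := one_smul _ _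
      map_mul' := fun a b => by
        rw [mul_def, map_smul, map_smul, smul_apply, one_mulL, smul_smul,
          mul_comm]
      map_zero' := zero_smul _ _
      map_add' := fun a b => add_smul _ _ _ }
  commutes' c u := mul_comm _ _
  smul_def' c u := by
    change c • u = mulL (c • 1) u
    rw [map_smul, smul_apply, one_mulL]
  norm_smul_le := norm_smul_le

instance [NormOneClass B] : NormOneClass (WienerAlg B σ) :=
  ⟨by rw [one_def, norm_single, norm_one]⟩

/-- Extension of a contractive algebra homomorphism of the coefficients to the Fourier series. -/
def map {B' : Type*} [NormedCommRing B'] [NormedAlgebra ℂ B'] [CompleteSpace B'] (σ : ℝ≥0)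
    (f : B →L[ℂ] B') (hf : ‖f‖ ≤ 1) : WienerAlg B σ →L[ℂ] WienerAlg B' σ :=
  lift σ (fun l => (single σ l).comp f) 1 fun l =>
    ContinuousLinearMap.opNorm_le_bound _ zero_le_one fun b => by
      rw [ContinuousLinearMap.comp_apply, norm_single]
      exact f.le_of_opNorm_le hf b

end WienerAlg

/-! ### Analytic functional calculus on a commutative Banach algebra. -/

open Complex Set Filter Topology Asymptotics
open scoped NNReal ENNReal

section FunctionalCalculus

variable {A : Type*} [NormedCommRing A] [NormedAlgebra ℂ A] [CompleteSpace A] [NormOneClass A]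

/-- A contractive character of a Banach algebra. -/
def IsContractive (χ : A →ₐ[ℂ] ℂ) : Prop := ∀ a, ‖χ a‖ ≤ ‖a‖

theorem IsContractive.norm_comp_le {χ : A →ₐ[ℂ] ℂ} (hχ : IsContractive χ) (P : Fin 3 → A) :
    ‖fun i => χ (P i)‖ ≤ ‖P‖ :=
  (pi_norm_le_iff_of_nonneg (norm_nonneg _)).2 fun i => (hχ _).trans (norm_le_pi_norm P i)

/-- A contractive character does not increase norms, so one neighbourhood serves all characters.
This uniformity allows the evaluations at all points `(s, θ)` to be handled at once. -/
theorem eventually_character {Q : (Fin 3 → ℂ) → Prop} (h : ∀ᶠ v in 𝓝 0, Q v) :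
    ∀ᶠ P : Fin 3 → A in 𝓝 0, ∀ χ : A →ₐ[ℂ] ℂ, IsContractive χ → Q fun i => χ (P i) := by
  obtain ⟨ε, hε, h⟩ := Metric.eventually_nhds_iff.1 h
  refine Metric.eventually_nhds_iff.2 ⟨ε, hε, fun P hP χ hχ => h ?_⟩
  rw [dist_zero_right] at hP ⊢
  exact (hχ.norm_comp_le P).trans_lt hP

/-- The multilinear maps on a Banach algebra with the same coefficients as a power series. -/
def liftSeries (A : Type*) [NormedCommRing A] [NormedAlgebra ℂ A]
    (p : FormalMultilinearSeries ℂ (Fin 3 → ℂ) ℂ) : FormalMultilinearSeries ℂ (Fin 3 → A) A :=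
  fun n => ∑ ι : Fin n → Fin 3, (p n fun k => Pi.single (ι k) 1) •
    (ContinuousMultilinearMap.mkPiAlgebra ℂ (Fin n) A).compContinuousLinearMap
      fun k => ContinuousLinearMap.proj (ι k)

theorem liftSeries_apply (p : FormalMultilinearSeries ℂ (Fin 3 → ℂ) ℂ) (n : ℕ)
    (P : Fin n → Fin 3 → A) :
    liftSeries A p n P = ∑ ι : Fin n → Fin 3, (p n fun k => Pi.single (ι k) 1) • ∏ k, P k (ι k) := by
  simp [liftSeries]

/-- There are `3 ^ n` monomials of degree `n`, and each coefficient is a value of `p n` on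
coordinate vectors of norm one. -/
theorem norm_liftSeries_le (p : FormalMultilinearSeries ℂ (Fin 3 → ℂ) ℂ) (n : ℕ) :
    ‖liftSeries A p n‖ ≤ 3 ^ n * ‖p n‖ := by
  refine ContinuousMultilinearMap.opNorm_le_bound (by positivity) fun P => ?_
  rw [liftSeries_apply]
  have h : ∀ ι ∈ (Finset.univ : Finset (Fin n → Fin 3)),
      ‖(p n fun k => Pi.single (ι k) 1) • ∏ k, P k (ι k)‖ ≤ ‖p n‖ * ∏ k, ‖P k‖ := by
    intro ι _
    rw [norm_smul]
    gcongr
    · refine ((p n).le_opNorm _).trans ?_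
      refine mul_le_of_le_one_right (norm_nonneg _) (Finset.prod_le_one (fun _ _ => norm_nonneg _) ?_)
      intro k _
      exact (Pi.norm_single (G := fun _ : Fin 3 => ℂ) (i := ι k) 1).le.trans (by simp)
    · refine (Finset.norm_prod_le _ _).trans ?_
      exact Finset.prod_le_prod (fun _ _ => norm_nonneg _) fun k _ => norm_le_pi_norm (P k) (ι k)
  refine (norm_sum_le_of_le _ h).trans ?_
  simp [mul_assoc]

theorem character_liftSeries (p : FormalMultilinearSeries ℂ (Fin 3 → ℂ) ℂ) (n : ℕ)
    (χ : A →ₐ[ℂ] ℂ) (P : Fin 3 → A) :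
    χ (liftSeries A p n fun _ => P) = p n fun _ i => χ (P i) := by
  have h : (fun i => χ (P i)) = ∑ i, χ (P i) • (Pi.single i 1 : Fin 3 → ℂ) := by
    ext j; simp [Finset.sum_apply, Pi.single_apply]
  rw [h, liftSeries_apply, map_sum]
  rw [ContinuousMultilinearMap.map_sum]
  refine Finset.sum_congr rfl fun ι _ => ?_
  rw [ContinuousMultilinearMap.map_smul_univ, map_smul, map_prod, smul_eq_mul, smul_eq_mul, mul_comm]

/-- The power series of `φ` is summed in `A` instead of `ℂ`; the radius shrinks at most by a factor
related to the `3 ^ n` monomials. A contractive character is continuous and multiplicative, so it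
passes through the sum and returns the value of `φ`. -/
theorem exists_lift_analytic {φ : (Fin 3 → ℂ) → ℂ} (hφ : AnalyticAt ℂ φ 0) :
    ∃ Φ : (Fin 3 → A) → A, AnalyticAt ℂ Φ 0 ∧
      ∀ᶠ P in 𝓝 0, ∀ χ : A →ₐ[ℂ] ℂ, IsContractive χ → χ (Φ P) = φ fun i => χ (P i) := by
  obtain ⟨p, hp⟩ := hφ
  obtain ⟨r, hp⟩ := hp
  obtain ⟨C, a, hC, ha, hCa⟩ := p.le_mul_pow_of_radius_pos (hp.r_pos.trans_le hp.r_le)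
  have hrad : 0 < (liftSeries A p).radius := by
    have h3 : (0 : ℝ) < 1 / (3 * a) := by positivity
    refine lt_of_lt_of_le ?_ ((liftSeries A p).le_radius_of_bound C (r := ⟨1 / (3 * a), h3.le⟩) ?_)
    · exact ENNReal.coe_pos.2 (by exact_mod_cast h3)
    · intro n
      calc ‖liftSeries A p n‖ * (1 / (3 * a)) ^ n ≤ (3 ^ n * (C * a ^ n)) * (1 / (3 * a)) ^ n := by
            gcongr
            exact (norm_liftSeries_le p n).trans (by gcongr; exact hCa n)
        _ = C := by
            rw [one_div, inv_pow, mul_pow]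
            field_simp
  have hq := (liftSeries A p).hasFPowerSeriesOnBall hrad
  refine ⟨(liftSeries A p).sum, hq.analyticAt, ?_⟩
  have h1 : ∀ᶠ P : Fin 3 → A in 𝓝 0, P ∈ Metric.eball (0 : Fin 3 → A) (liftSeries A p).radius :=
    Metric.eball_mem_nhds _ hrad
  have h2 : ∀ᶠ v : Fin 3 → ℂ in 𝓝 0, v ∈ Metric.eball (0 : Fin 3 → ℂ) r :=
    Metric.eball_mem_nhds _ hp.r_pos
  filter_upwards [h1, eventually_character h2] with P hP1 hP2 χ hχ
  have hs := hq.hasSum hP1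
  rw [zero_add] at hs
  have hχc : Continuous χ := AddMonoidHomClass.continuous_of_bound χ 1
    fun a => (hχ a).trans (one_mul _).ge
  have hs1 := hs.map χ hχc
  have hs2 := hp.hasSum (hP2 χ hχ)
  rw [zero_add] at hs2
  have h3 : (χ ∘ fun n => liftSeries A p n fun _ => P) = fun n => p n fun _ i => χ (P i) :=
    funext fun n => character_liftSeries p n χ P
  rw [h3] at hs1
  exact hs1.unique hs2

end FunctionalCalculus

/-! ### Cubic leading parts through Hadamard's lemma. -/

/-- Hadamard's lemma for analytic functions of three variables. -/
theorem AnalyticAt.hadamard {φ : (Fin 3 → ℂ) → ℂ} (hφ : AnalyticAt ℂ φ 0) :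
    ∃ ψ : Fin 3 → (Fin 3 → ℂ) → ℂ, (∀ i, AnalyticAt ℂ (ψ i) 0) ∧
      ∀ᶠ v in 𝓝 0, φ v = φ 0 + ∑ i, v i * ψ i v := by
  obtain ⟨p, hp⟩ := hφ
  obtain ⟨r, hp⟩ := hp
  have hrad : 0 < p.shift.radius := by
    rw [p.radius_shift]; exact hp.r_pos.trans_le hp.r_le
  have hq := p.shift.hasFPowerSeriesOnBall hrad
  refine ⟨fun i v => p.shift.sum v (Pi.single i 1), fun i => ?_, ?_⟩
  · exact (ContinuousLinearMap.apply ℂ ℂ (Pi.single i 1 : Fin 3 → ℂ)).analyticAt _ |>.comp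
      hq.analyticAt
  · filter_upwards [Metric.eball_mem_nhds _ hrad, Metric.eball_mem_nhds _ hp.r_pos] with v h1 h2
    have hs1 := (hq.hasSum h1).mapL (ContinuousLinearMap.apply ℂ ℂ v)
    have hs2 := (hp.hasSum h2)
    rw [zero_add] at hs1 hs2
    rw [← hasSum_nat_add_iff' 1] at hs2
    have h0 : φ 0 = p 0 fun _ => v := (hp.coeff_zero _).symm
    have h3 : p.shift.sum v v = φ v - p 0 fun _ => v := by
      refine hs1.unique ?_
      convert hs2 using 1
      · ext n
        simp only [ContinuousLinearMap.apply_apply, FormalMultilinearSeries.shift,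
          ContinuousMultilinearMap.curryRight_apply]
        congr 1
        ext i
        refine Fin.lastCases ?_ (fun j => ?_) i <;> simp
      · simp
    have h4 : p.shift.sum v v = ∑ i, v i * p.shift.sum v (Pi.single i 1) := by
      have hv : v = ∑ i, v i • (Pi.single i 1 : Fin 3 → ℂ) := by
        ext j; simp [Finset.sum_apply, Pi.single_apply]
      conv_lhs => rw [congrArg (p.shift.sum v) hv, map_sum]
      simp
    rw [← h4, h3, h0]; ring

/-- A quadratic polynomial of one variable of order three at the origin vanishes. -/
theorem quadratic_coeff_eq_zero {a b c : ℂ}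
    (h : (fun t : ℂ => a + b * t + c * t ^ 2) =O[𝓝 0] fun t => ‖t‖ ^ 3) : a = 0 ∧ b = 0 ∧ c = 0 := by
  obtain ⟨C, hC⟩ := h.bound
  obtain ⟨ε, hε, hC⟩ := Metric.eventually_nhds_iff.1 hC
  have hC0 : ∀ t : ℝ, 0 < t → t < ε → ‖a + b * t + c * t ^ 2‖ ≤ C * t ^ 3 ∧
      ‖a - b * t + c * t ^ 2‖ ≤ C * t ^ 3 := by
    intro t ht hte
    have h1 := @hC (t : ℂ) (by simpa [abs_of_pos ht] using hte)
    have h2 := @hC (-t : ℂ) (by simpa [abs_of_pos ht] using hte)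
    simp only [norm_neg, Complex.norm_real, Real.norm_of_nonneg ht.le, norm_pow] at h1 h2
    refine ⟨by simpa [abs_of_pos ht] using h1, ?_⟩
    have : a + b * (-t : ℂ) + c * (-t : ℂ) ^ 2 = a - b * t + c * t ^ 2 := by ring
    rw [this] at h2
    simpa [abs_of_pos ht] using h2
  have ha : a = 0 := by
    have := @hC 0 (by simpa using hε)
    simpa using this
  subst ha
  have key : ∀ x : ℂ, (∀ t : ℝ, 0 < t → t < min ε 1 → ‖x‖ ≤ C * t) → x = 0 := by
    intro x hx
    rw [← norm_le_zero_iff]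
    have hl : Tendsto (fun t : ℝ => C * t) (𝓝[>] 0) (𝓝 0) := by
      have : Tendsto (fun t : ℝ => C * t) (𝓝 0) (𝓝 (C * 0)) :=
        (continuous_const.mul continuous_id).tendsto 0
      rw [mul_zero] at this
      exact this.mono_left nhdsWithin_le_nhds
    refine ge_of_tendsto hl ?_
    filter_upwards [Ioo_mem_nhdsGT (show (0 : ℝ) < min ε 1 by positivity)] with t ht
    exact hx t ht.1 ht.2
  have hCnn : 0 ≤ C := by
    have h1 := (hC0 (ε / 2) (by positivity) (by linarith)).1
    have h2 : 0 ≤ C * (ε / 2) ^ 3 := (norm_nonneg _).trans h1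
    by_contra hneg
    push Not at hneg
    nlinarith [show 0 < (ε / 2) ^ 3 by positivity]
  refine ⟨rfl, key b fun t ht hte => ?_, key c fun t ht hte => ?_⟩
  · obtain ⟨h1, h2⟩ := hC0 t ht (hte.trans_le (min_le_left _ _))
    have h3 := norm_sub_le_of_le h1 h2
    have : (0 + b * t + c * t ^ 2) - (0 - b * t + c * t ^ 2) = b * (2 * t : ℝ) := by push_cast; ring
    rw [this, norm_mul, Complex.norm_real, Real.norm_of_nonneg (by positivity)] at h3
    have ht1 : t < 1 := hte.trans_le (min_le_right _ _)
    have h4 : ‖b‖ * (2 * t) ≤ (C * t) * (2 * t) := by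
      refine h3.trans ?_
      nlinarith [mul_nonneg hCnn (by positivity : (0:ℝ) ≤ t ^ 2)]
    exact le_of_mul_le_mul_right h4 (by positivity)
  · obtain ⟨h1, h2⟩ := hC0 t ht (hte.trans_le (min_le_left _ _))
    have h3 := norm_add_le_of_le h1 h2
    have : (0 + b * t + c * t ^ 2) + (0 - b * t + c * t ^ 2) = c * (2 * t ^ 2 : ℝ) := by
      push_cast; ring
    rw [this, norm_mul, Complex.norm_real, Real.norm_of_nonneg (by positivity)] at h3
    have h4 : ‖c‖ * (2 * t ^ 2) ≤ (C * t) * (2 * t ^ 2) := by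
      refine h3.trans (le_of_eq (by ring))
    exact le_of_mul_le_mul_right h4 (by positivity)

/-- The cubic form with the given coefficients. -/
def cubicForm {R : Type*} [CommRing R] [Algebra ℂ R] (c : Fin 3 → Fin 3 → Fin 3 → ℂ)
    (v : Fin 3 → R) : R := ∑ i, ∑ j, ∑ k, c i j k • (v i * v j * v k)

/-- `f` is the sum of a cubic form and a remainder of order four. -/
def HasCubicPart (f : ℂ × ℂ × ℂ → ℂ) (c : Fin 3 → Fin 3 → Fin 3 → ℂ) : Prop :=
  ∃ ψ : Fin 3 → Fin 3 → Fin 3 → Fin 3 → (Fin 3 → ℂ) → ℂ, (∀ i j k l, AnalyticAt ℂ (ψ i j k l) 0) ∧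
    ∀ᶠ v : Fin 3 → ℂ in 𝓝 0, f (v 0, v 1, v 2) = cubicForm c v +
      ∑ i, ∑ j, ∑ k, ∑ l, v i * v j * v k * v l * ψ i j k l v

theorem cubicForm_smul {R : Type*} [CommRing R] [Algebra ℂ R] (c : Fin 3 → Fin 3 → Fin 3 → ℂ)
    (t : R) (v : Fin 3 → R) : cubicForm c (fun i => t * v i) = t ^ 3 * cubicForm c v := by
  simp only [cubicForm, Finset.mul_sum]
  refine Finset.sum_congr rfl fun i _ => Finset.sum_congr rfl fun j _ =>
    Finset.sum_congr rfl fun k _ => ?_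
  rw [mul_smul_comm]
  congr 1
  ring

theorem map_cubicForm {R R' : Type*} [CommRing R] [Algebra ℂ R] [CommRing R'] [Algebra ℂ R']
    (χ : R →ₐ[ℂ] R') (c : Fin 3 → Fin 3 → Fin 3 → ℂ) (v : Fin 3 → R) :
    χ (cubicForm c v) = cubicForm c fun i => χ (v i) := by
  simp [cubicForm, map_sum]

/-- Hadamard's lemma is applied four times in succession. The quotients of the third level, frozen
at the origin, give the cubic form; those of the fourth level give the remainder. -/
theorem IsCubicRemainder.exists_cubicPart {f : ℂ × ℂ × ℂ → ℂ} (hf : IsCubicRemainder f) :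
    ∃ c, HasCubicPart f c := by
  let e : (Fin 3 → ℂ) →L[ℂ] ℂ × ℂ × ℂ := (ContinuousLinearMap.proj 0).prod
    ((ContinuousLinearMap.proj 1).prod (ContinuousLinearMap.proj 2))
  have hφ : AnalyticAt ℂ (fun v => f (e v)) 0 :=
    AnalyticAt.fun_comp (by simpa using hf.analytic) (e.analyticAt 0)
  obtain ⟨ψ₁, hψ₁, h₁⟩ := hφ.hadamard
  choose ψ₂ hψ₂ h₂ using fun i => (hψ₁ i).hadamard
  choose ψ₃ hψ₃ h₃ using fun i j => (hψ₂ i j).hadamard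
  choose ψ₄ hψ₄ h₄ using fun i j k => (hψ₃ i j k).hadamard
  have h₂' := eventually_all.2 h₂
  have h₃' := eventually_all.2 fun i => eventually_all.2 (h₃ i)
  have h₄' := eventually_all.2 fun i => eventually_all.2 fun j => eventually_all.2 (h₄ i j)
  -- Along the line spanned by `v`, the terms of degree below three form a quadratic polynomial in
  -- `t` that is `O(t ^ 3)`, so its coefficients vanish.
  have key : ∀ v : Fin 3 → ℂ, f (e 0) = 0 ∧ ∑ i, v i * ψ₁ i 0 = 0 ∧
      ∑ i, ∑ j, v i * v j * ψ₂ i j 0 = 0 := by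
    intro v
    apply quadratic_coeff_eq_zero
    have ht : Tendsto (fun t : ℂ => t • v) (𝓝 0) (𝓝 0) := by
      have : ContinuousAt (fun t : ℂ => t • v) 0 := by fun_prop
      simpa [ContinuousAt] using this
    have hexp : ∀ᶠ t : ℂ in 𝓝 0, f (e (t • v)) - ∑ i, ∑ j, ∑ k,
        t ^ 3 * (v i * v j * v k * ψ₃ i j k (t • v)) = f (e 0) + (∑ i, v i * ψ₁ i 0) * t +
          (∑ i, ∑ j, v i * v j * ψ₂ i j 0) * t ^ 2 := by
      filter_upwards [ht.eventually h₁, ht.eventually h₂', ht.eventually h₃'] with t e1 e2 e3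
      rw [e1]
      simp only [e2, e3, Fin.sum_univ_three, Pi.smul_apply, smul_eq_mul]
      ring
    refine IsBigO.congr' ?_ hexp EventuallyEq.rfl
    have hO3 : ∀ i j k, (fun t : ℂ => t ^ 3 * (v i * v j * v k * ψ₃ i j k (t • v)))
        =O[𝓝 0] fun t => ‖t‖ ^ 3 := by
      intro i j k
      have hc : (fun t : ℂ => v i * v j * v k * ψ₃ i j k (t • v)) =O[𝓝 0] fun _ => (1 : ℝ) := by
        refine Tendsto.isBigO_one ℝ (c := v i * v j * v k * ψ₃ i j k 0) ?_
        exact tendsto_const_nhds.mul ((hψ₃ i j k).continuousAt.tendsto.comp ht)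
      have hp : (fun t : ℂ => t ^ 3) =O[𝓝 0] fun t => ‖t‖ ^ 3 :=
        IsBigO.of_bound 1 (by simp)
      simpa using hp.mul hc
    refine IsBigO.sub ?_ ?_
    · have hcub := hf.cubic.comp_tendsto (show Tendsto (fun t : ℂ => e (t • v)) (𝓝 0) (𝓝 0) by
        have := (e.continuous.tendsto 0).comp ht
        rwa [map_zero] at this)
      refine hcub.trans (IsBigO.of_bound (‖e v‖ ^ 3) ?_)
      refine Eventually.of_forall fun t => ?_
      simp [norm_smul, mul_pow, mul_comm]
    · refine IsBigO.fun_sum fun i _ => IsBigO.fun_sum fun j _ => IsBigO.fun_sum fun k _ => hO3 i j k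
  refine ⟨fun i j k => ψ₃ i j k 0, ψ₄, hψ₄, ?_⟩
  filter_upwards [h₁, h₂', h₃', h₄'] with v e1 e2 e3 e4
  obtain ⟨k0, k1, k2⟩ := key v
  have : f (v 0, v 1, v 2) = f (e v) := rfl
  rw [this, e1]
  have hexp : f (e 0) + ∑ i, v i * ψ₁ i v = f (e 0) + (∑ i, v i * ψ₁ i 0) +
      (∑ i, ∑ j, v i * v j * ψ₂ i j 0) + ((∑ i, ∑ j, ∑ k, ψ₃ i j k 0 * (v i * v j * v k)) +
      ∑ i, ∑ j, ∑ k, ∑ l, v i * v j * v k * v l * ψ₄ i j k l v) := by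
    simp only [← Finset.sum_add_distrib, add_assoc]
    congr 1
    refine Finset.sum_congr rfl fun i _ => ?_
    rw [e2, mul_add, Finset.mul_sum]
    congr 1
    refine Finset.sum_congr rfl fun j _ => ?_
    rw [e3, mul_add, Finset.mul_sum, mul_add, Finset.mul_sum]
    rw [mul_assoc]
    congr 1
    refine Finset.sum_congr rfl fun k _ => ?_
    rw [e4, mul_add, Finset.mul_sum]
    simp only [mul_add, Finset.mul_sum]
    congr 1
    · ring
    · refine Finset.sum_congr rfl fun l _ => ?_
      ring
  rw [hexp, k0, k1, k2]
  simp [cubicForm]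

/-! ### Lifting functions of order three with explicit powers factored out. -/

section Remainder

variable {A : Type*} [NormedCommRing A] [NormedAlgebra ℂ A] [CompleteSpace A] [NormOneClass A]

/-- `F` is analytic at the origin, with value `F₀` there and a remainder that is divisible by the
two variables. -/
structure HasRem (F : A × A → A) (F₀ : A) : Prop where
  analyticAt : AnalyticAt ℂ F 0
  exists_rem : ∃ F₁ F₂ : A × A → A, AnalyticAt ℂ F₁ 0 ∧ AnalyticAt ℂ F₂ 0 ∧
    ∀ᶠ p in 𝓝 0, F p = F₀ + p.1 * F₁ p + p.2 * F₂ p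

theorem HasRem.const (a : A) : HasRem (fun _ => a) a :=
  ⟨analyticAt_const, 0, 0, analyticAt_const, analyticAt_const, by simp⟩

theorem HasRem.fst_mul {F : A × A → A} (hF : AnalyticAt ℂ F 0) : HasRem (fun p => p.1 * F p) 0 :=
  ⟨analyticAt_fst.mul hF, F, 0, hF, analyticAt_const, by simp⟩

theorem HasRem.add {F G : A × A → A} {F₀ G₀ : A} (hF : HasRem F F₀) (hG : HasRem G G₀) :
    HasRem (fun p => F p + G p) (F₀ + G₀) := by
  obtain ⟨F₁, F₂, h1, h2, hF'⟩ := hF.exists_rem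
  obtain ⟨G₁, G₂, h3, h4, hG'⟩ := hG.exists_rem
  refine ⟨hF.analyticAt.add hG.analyticAt, fun p => F₁ p + G₁ p, fun p => F₂ p + G₂ p,
    h1.add h3, h2.add h4, ?_⟩
  filter_upwards [hF', hG'] with p e1 e2
  rw [e1, e2]; ring

theorem HasRem.mul {F G : A × A → A} {F₀ G₀ : A} (hF : HasRem F F₀) (hG : HasRem G G₀) :
    HasRem (fun p => F p * G p) (F₀ * G₀) := by
  obtain ⟨F₁, F₂, h1, h2, hF'⟩ := hF.exists_rem
  obtain ⟨G₁, G₂, h3, h4, hG'⟩ := hG.exists_rem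
  refine ⟨hF.analyticAt.mul hG.analyticAt, fun p => F₁ p * G p + F₀ * G₁ p,
    fun p => F₂ p * G p + F₀ * G₂ p, (h1.mul hG.analyticAt).add (analyticAt_const.mul h3),
    (h2.mul hG.analyticAt).add (analyticAt_const.mul h4), ?_⟩
  filter_upwards [hF', hG'] with p e1 e2
  rw [e1]
  linear_combination F₀ * e2

theorem HasRem.smul {F : A × A → A} {F₀ : A} (c : ℂ) (hF : HasRem F F₀) :
    HasRem (fun p => c • F p) (c • F₀) := by
  obtain ⟨F₁, F₂, h1, h2, hF'⟩ := hF.exists_rem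
  refine ⟨analyticAt_const.fun_smul hF.analyticAt, fun p => c • F₁ p, fun p => c • F₂ p,
    analyticAt_const.fun_smul h1, analyticAt_const.fun_smul h2, ?_⟩
  filter_upwards [hF'] with p e1
  rw [e1]; simp [smul_add]

theorem HasRem.sum {ι : Type*} (s : Finset ι) {F : ι → A × A → A} {F₀ : ι → A}
    (hF : ∀ i, HasRem (F i) (F₀ i)) : HasRem (fun p => ∑ i ∈ s, F i p) (∑ i ∈ s, F₀ i) := by
  classical
  induction s using Finset.induction_on with
  | empty => simpa using HasRem.const (0 : A)
  | insert i s hi ih =>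
    simp only [Finset.sum_insert hi]
    exact (hF i).add ih

/-- The lift depends on the second variable only. It is built from the Hadamard quotient of `φ`, so
that the divisible remainder is visible. -/
theorem exists_lift_hasRem {φ : ℂ → ℂ} (hφ : AnalyticAt ℂ φ 0) :
    ∃ Φ : A × A → A, HasRem Φ (algebraMap ℂ A (φ 0)) ∧
      ∀ᶠ p in 𝓝 0, ∀ χ : A →ₐ[ℂ] ℂ, IsContractive χ → χ (Φ p) = φ (χ p.2) := by
  have hφ' : AnalyticAt ℂ (fun v : Fin 3 → ℂ => φ (v 0)) 0 :=
    AnalyticAt.fun_comp (by simpa using hφ)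
      ((ContinuousLinearMap.proj (R := ℂ) (φ := fun _ : Fin 3 => ℂ) 0).analyticAt 0)
  obtain ⟨ψ, hψ, h⟩ := hφ'.hadamard
  obtain ⟨Ψ, hΨ, hχΨ⟩ := exists_lift_analytic (A := A) (hψ 0)
  let ι : A × A →L[ℂ] (Fin 3 → A) :=
    (ContinuousLinearMap.single ℂ (fun _ : Fin 3 => A) 0).comp (ContinuousLinearMap.snd ℂ A A)
  have hι : Tendsto ι (𝓝 0) (𝓝 0) := by simpa using ι.continuous.tendsto 0
  have hΨι : AnalyticAt ℂ (fun p => Ψ (ι p)) 0 :=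
    AnalyticAt.fun_comp (by simpa using hΨ) (ι.analyticAt 0)
  refine ⟨fun p => algebraMap ℂ A (φ 0) + p.2 * Ψ (ι p), ⟨?_, 0, fun p => Ψ (ι p),
    analyticAt_const, hΨι, by simp⟩, ?_⟩
  · exact analyticAt_const.add (analyticAt_snd.mul hΨι)
  · filter_upwards [hι.eventually hχΨ, hι.eventually (eventually_character h)] with p e1 e2 χ hχ
    have e3 := e2 χ hχ
    have h1 : ∀ i, i ≠ 0 → ι p i = 0 := fun i hi => by simp [ι, hi]
    have h0 : ι p 0 = p.2 := by simp [ι]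
    rw [Fin.sum_univ_three, h1 1 (by decide), h1 2 (by decide), h0] at e3
    rw [e3, map_add, map_mul, e1 χ hχ]
    simp

/-- In the application the first variable stands for `1 / s`, and `f` is evaluated at `1 / s` times
a bounded direction. The factor `s⁻³` is extracted from the cubic expansion itself, without dividing
by an element of the algebra. -/
theorem exists_lift_cubicPart {f : ℂ × ℂ × ℂ → ℂ} {c : Fin 3 → Fin 3 → Fin 3 → ℂ}
    (hf : HasCubicPart f c) {V : Fin 3 → A × A → A} {V₀ : Fin 3 → A}
    (hV : ∀ i, HasRem (V i) (V₀ i)) :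
    ∃ F : A × A → A, HasRem F (cubicForm c V₀) ∧
      ∀ᶠ p in 𝓝 0, ∀ χ : A →ₐ[ℂ] ℂ, IsContractive χ →
        f (χ p.1 * χ (V 0 p), χ p.1 * χ (V 1 p), χ p.1 * χ (V 2 p)) = χ p.1 ^ 3 * χ (F p) := by
  obtain ⟨ψ, hψ, h⟩ := hf
  choose Ψ hΨ hχΨ using fun i j k l => exists_lift_analytic (A := A) (hψ i j k l)
  let P : A × A → Fin 3 → A := fun p i => p.1 * V i p
  have hP : AnalyticAt ℂ P 0 := analyticAt_pi_iff.2 fun i => analyticAt_fst.mul (hV i).analyticAt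
  have hP0 : P 0 = 0 := by ext i; simp [P]
  have hPt : Tendsto P (𝓝 0) (𝓝 0) := by simpa [ContinuousAt, hP0] using hP.continuousAt
  have hΨP : ∀ i j k l, AnalyticAt ℂ (fun p => Ψ i j k l (P p)) 0 := fun i j k l =>
    AnalyticAt.fun_comp (by simpa [hP0] using hΨ i j k l) hP
  refine ⟨fun p => cubicForm c (fun i => V i p) +
    p.1 * ∑ i, ∑ j, ∑ k, ∑ l, V i p * V j p * V k p * V l p * Ψ i j k l (P p), ?_, ?_⟩
  · rw [← add_zero (cubicForm c V₀)]
    refine HasRem.add ?_ (HasRem.fst_mul ?_)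
    · exact HasRem.sum _ fun i => HasRem.sum _ fun j => HasRem.sum _ fun k =>
        (((hV i).mul (hV j)).mul (hV k)).smul _
    · refine Finset.analyticAt_fun_sum _ fun i _ => Finset.analyticAt_fun_sum _ fun j _ =>
        Finset.analyticAt_fun_sum _ fun k _ => Finset.analyticAt_fun_sum _ fun l _ => ?_
      exact (((((hV i).analyticAt.mul (hV j).analyticAt).mul (hV k).analyticAt).mul
        (hV l).analyticAt).mul (hΨP i j k l))
  · have hall := eventually_all.2 fun i => eventually_all.2 fun j => eventually_all.2 fun k =>
      eventually_all.2 fun l => hPt.eventually (hχΨ i j k l)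
    filter_upwards [hPt.eventually (eventually_character h), hall] with p e1 e2 χ hχ
    have e3 := e1 χ hχ
    simp only [P, map_mul] at e3
    rw [e3, cubicForm_smul, map_add, map_cubicForm, mul_add, map_mul, map_sum]
    congr 1
    simp only [map_sum, map_mul, e2 _ _ _ _ χ hχ, Finset.mul_sum, P]
    refine Finset.sum_congr rfl fun i _ => Finset.sum_congr rfl fun j _ =>
      Finset.sum_congr rfl fun k _ => Finset.sum_congr rfl fun l _ => ?_
    ring

end Remainder

/-! ### Bounded holomorphic functions as a Banach algebra. -/

open Complex Set Filter Topology Asymptotics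

/-- Extension by zero of a function on an open set. -/
def zeroExt (U : Opens ℂ) (f : U → ℂ) (s : ℂ) : ℂ := open Classical in if h : s ∈ U then f ⟨s, h⟩ else 0

theorem zeroExt_of_mem {U : Opens ℂ} (f : U → ℂ) {s : ℂ} (hs : s ∈ U) :
    zeroExt U f s = f ⟨s, hs⟩ := dif_pos hs

/-- The subalgebra of holomorphic functions in the bounded continuous functions on an open set. -/
def holSubalgebra (U : Opens ℂ) : Subalgebra ℂ (U →ᵇ ℂ) where
  carrier := {f | DifferentiableOn ℂ (zeroExt U f) U}
  mul_mem' {f g} hf hg := (DifferentiableOn.mul hf hg).congr fun s hs => by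
    simp [zeroExt_of_mem _ hs]
  add_mem' {f g} hf hg := (DifferentiableOn.add hf hg).congr fun s hs => by
    simp [zeroExt_of_mem _ hs]
  algebraMap_mem' c := (differentiableOn_const c).congr fun s hs => by
    simp [zeroExt_of_mem _ hs]

/-- Uniform limits of holomorphic functions are holomorphic. This gives the completeness of the
coefficient algebra. -/
theorem isClosed_holSubalgebra (U : Opens ℂ) : IsClosed (holSubalgebra U : Set (U →ᵇ ℂ)) := by
  refine IsSeqClosed.isClosed fun f g hf hfg => ?_
  have h1 : TendstoUniformly (fun n => (f n : U → ℂ)) g atTop :=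
    BoundedContinuousFunction.tendsto_iff_tendstoUniformly.1 hfg
  have h2 : TendstoUniformlyOn (fun n => zeroExt U (f n)) (zeroExt U g) atTop U := by
    rw [Metric.tendstoUniformlyOn_iff]
    intro ε hε
    filter_upwards [Metric.tendstoUniformly_iff.1 h1 ε hε] with n hn s hs
    rw [zeroExt_of_mem _ hs, zeroExt_of_mem _ hs]
    exact hn ⟨s, hs⟩
  exact h2.tendstoLocallyUniformlyOn.differentiableOn (Eventually.of_forall hf) U.isOpen

/-- The Banach algebra of bounded holomorphic functions on an open set. -/
def HolB (U : Opens ℂ) : Type := holSubalgebra U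

namespace HolB

variable {U V : Opens ℂ}

instance : NormedCommRing (HolB U) := inferInstanceAs (NormedCommRing (holSubalgebra U))
instance : NormedAlgebra ℂ (HolB U) := inferInstanceAs (NormedAlgebra ℂ (holSubalgebra U))
instance : CompleteSpace (HolB U) := (isClosed_holSubalgebra U).completeSpace_coe
instance [Nonempty U] : NormOneClass (HolB U) := ⟨norm_one (α := U →ᵇ ℂ)⟩

/-- The underlying bounded continuous function. -/
def toBCF (u : HolB U) : U →ᵇ ℂ := (show holSubalgebra U from u).1

/-- The underlying function, extended by zero. -/
def fn (u : HolB U) : ℂ → ℂ := zeroExt U u.toBCF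

theorem fn_apply (u : HolB U) {s : ℂ} (hs : s ∈ U) : u.fn s = u.toBCF ⟨s, hs⟩ :=
  zeroExt_of_mem _ hs

theorem differentiableOn_fn (u : HolB U) : DifferentiableOn ℂ u.fn U :=
  (show holSubalgebra U from u).2

theorem fn_add (u v : HolB U) {s : ℂ} (hs : s ∈ U) : (u + v).fn s = u.fn s + v.fn s := by
  rw [fn_apply _ hs, fn_apply _ hs, fn_apply _ hs]; rfl

theorem fn_mul (u v : HolB U) {s : ℂ} (hs : s ∈ U) : (u * v).fn s = u.fn s * v.fn s := by
  rw [fn_apply _ hs, fn_apply _ hs, fn_apply _ hs]; rfl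

theorem fn_smul (c : ℂ) (u : HolB U) {s : ℂ} (hs : s ∈ U) : (c • u).fn s = c * u.fn s := by
  rw [fn_apply _ hs, fn_apply _ hs]; rfl

theorem fn_one {s : ℂ} (hs : s ∈ U) : (1 : HolB U).fn s = 1 := by
  rw [fn_apply _ hs]; rfl

theorem fn_zero (s : ℂ) : (0 : HolB U).fn s = 0 := by
  by_cases hs : s ∈ U
  · rw [fn_apply _ hs]; rfl
  · exact dif_neg hs

theorem norm_fn_le (u : HolB U) (s : ℂ) : ‖u.fn s‖ ≤ ‖u‖ := by
  by_cases hs : s ∈ U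
  · rw [fn_apply _ hs]
    exact u.toBCF.norm_coe_le_norm _
  · rw [show u.fn s = 0 from dif_neg hs, norm_zero]
    exact norm_nonneg _

theorem ext_fn {u v : HolB U} (h : ∀ s ∈ U, u.fn s = v.fn s) : u = v := by
  apply Subtype.ext
  refine BoundedContinuousFunction.ext fun ⟨s, hs⟩ => ?_
  have h1 := h s hs
  rw [fn_apply _ hs, fn_apply _ hs] at h1
  exact h1

/-- A bounded holomorphic function as an element of the algebra. -/
def ofFun (f : ℂ → ℂ) (hf : DifferentiableOn ℂ f U) (M : ℝ) (hM : ∀ s ∈ U, ‖f s‖ ≤ M) : HolB U :=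
  ⟨BoundedContinuousFunction.ofNormedAddCommGroup (fun s : U => f s)
    (continuousOn_iff_continuous_domRestrict.1 hf.continuousOn) M fun s => hM s s.2,
    hf.congr fun s hs => by rw [zeroExt_of_mem _ hs]; rfl⟩

theorem fn_ofFun {f : ℂ → ℂ} (hf : DifferentiableOn ℂ f U) {M : ℝ} (hM : ∀ s ∈ U, ‖f s‖ ≤ M)
    {s : ℂ} (hs : s ∈ U) : (ofFun f hf M hM).fn s = f s := fn_apply _ hs

theorem norm_le_of_fn {u : HolB U} {M : ℝ} (hM0 : 0 ≤ M) (hM : ∀ s ∈ U, ‖u.fn s‖ ≤ M) : ‖u‖ ≤ M := by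
  refine (BoundedContinuousFunction.norm_le (f := u.toBCF) hM0).2 fun ⟨s, hs⟩ => ?_
  rw [← fn_apply _ hs]
  exact hM s hs

/-- Evaluation at a point. -/
def evalHom {s : ℂ} (hs : s ∈ U) : HolB U →ₐ[ℂ] ℂ where
  toFun u := u.fn s
  map_one' := fn_one hs
  map_mul' u v := fn_mul u v hs
  map_zero' := fn_zero s
  map_add' u v := fn_add u v hs
  commutes' c := by rw [Algebra.algebraMap_eq_smul_one, fn_smul _ _ hs, fn_one hs]; simp

/-- Evaluation at a point as a continuous linear map. -/
def evalL {s : ℂ} (hs : s ∈ U) : HolB U →L[ℂ] ℂ :=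
  (evalHom hs).toLinearMap.mkContinuous 1 fun u => by
    rw [one_mul]; exact norm_fn_le u s

theorem evalL_apply {s : ℂ} (hs : s ∈ U) (u : HolB U) : evalL hs u = u.fn s := rfl

theorem norm_evalL_le {s : ℂ} (hs : s ∈ U) : ‖(evalL hs : HolB U →L[ℂ] ℂ)‖ ≤ 1 :=
  LinearMap.mkContinuous_norm_le _ zero_le_one _

/-- A continuous linear map between algebras of holomorphic functions, from its values. -/
def clm (L : HolB U → ℂ → ℂ) (hd : ∀ u, DifferentiableOn ℂ (L u) V)
    (hadd : ∀ u v, ∀ s ∈ V, L (u + v) s = L u s + L v s)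
    (hsmul : ∀ (c : ℂ) u, ∀ s ∈ V, L (c • u) s = c * L u s) (C : ℝ)
    (hC : ∀ u, ∀ s ∈ V, ‖L u s‖ ≤ C * ‖u‖) : HolB U →L[ℂ] HolB V :=
  LinearMap.mkContinuous
    { toFun := fun u => ofFun (L u) (hd u) (C * ‖u‖) (hC u)
      map_add' := fun u v => ext_fn fun s hs => by
        rw [fn_add _ _ hs, fn_ofFun _ _ hs, fn_ofFun _ _ hs, fn_ofFun _ _ hs, hadd u v s hs]
      map_smul' := fun c u => ext_fn fun s hs => by
        rw [RingHom.id_apply, fn_smul _ _ hs, fn_ofFun _ _ hs, fn_ofFun _ _ hs, hsmul c u s hs] }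
    (max C 0) fun u => by
      refine norm_le_of_fn (by positivity) fun s hs => ?_
      refine (norm_fn_le _ s).trans ?_
      refine norm_le_of_fn (by positivity) fun s hs => ?_
      change ‖(ofFun (L u) (hd u) (C * ‖u‖) (hC u)).fn s‖ ≤ _
      rw [fn_ofFun _ _ hs]
      exact (hC u s hs).trans (by gcongr; exact le_max_left _ _)

theorem fn_clm (L : HolB U → ℂ → ℂ) (hd : ∀ u, DifferentiableOn ℂ (L u) V)
    (hadd : ∀ u v, ∀ s ∈ V, L (u + v) s = L u s + L v s)
    (hsmul : ∀ (c : ℂ) u, ∀ s ∈ V, L (c • u) s = c * L u s) (C : ℝ)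
    (hC : ∀ u, ∀ s ∈ V, ‖L u s‖ ≤ C * ‖u‖) (u : HolB U) {s : ℂ} (hs : s ∈ V) :
    (clm L hd hadd hsmul C hC u).fn s = L u s := fn_ofFun (hd u) (hC u) hs

theorem norm_clm_le (L : HolB U → ℂ → ℂ) (hd : ∀ u, DifferentiableOn ℂ (L u) V)
    (hadd : ∀ u v, ∀ s ∈ V, L (u + v) s = L u s + L v s)
    (hsmul : ∀ (c : ℂ) u, ∀ s ∈ V, L (c • u) s = c * L u s) (C : ℝ) (hC0 : 0 ≤ C)
    (hC : ∀ u, ∀ s ∈ V, ‖L u s‖ ≤ C * ‖u‖) : ‖clm L hd hadd hsmul C hC‖ ≤ C :=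
  (LinearMap.mkContinuous_norm_le _ (le_max_right _ _) _).trans (max_eq_left hC0).le

/-- Restriction to a smaller open set. -/
def restrict (h : V ≤ U) : HolB U →L[ℂ] HolB V :=
  clm (fun u => u.fn) (fun u => u.differentiableOn_fn.mono h) (fun u v s hs => fn_add u v (h hs))
    (fun c u s hs => fn_smul c u (h hs)) 1 fun u s _ => by rw [one_mul]; exact norm_fn_le u s

theorem fn_restrict (h : V ≤ U) (u : HolB U) {s : ℂ} (hs : s ∈ V) :
    (restrict h u).fn s = u.fn s := fn_clm _ _ _ _ _ _ u hs

theorem norm_restrict_le (h : V ≤ U) : ‖restrict h‖ ≤ 1 := norm_clm_le _ _ _ _ _ zero_le_one _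

end HolB

/-! ### Evaluation of Fourier series with holomorphic coefficients. -/

/-- The value of a normalized Fourier mode. -/
def modeFun (σ : ℝ≥0) (l : ℤ) (θ : ℂ) : ℂ := exp (I * l * θ) / modeWeight σ l

/-- When `τ < σ` the weight beats the growth of the mode geometrically in `|l|`, which makes the
series of modes summable in operator norm inside the open strip. -/
theorem norm_modeFun_le {σ : ℝ≥0} {τ : ℝ} {θ : ℂ} (hθ : |θ.im| ≤ τ) (l : ℤ) :
    ‖modeFun σ l θ‖ ≤ Real.exp (-((σ - τ) * |(l : ℝ)|)) := by
  have h1 : (I * l * θ).re = -(l * θ.im) := by simp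
  rw [modeFun, norm_div, Complex.norm_exp, h1, Complex.norm_real,
    Real.norm_of_nonneg (modeWeight_pos σ l).le, modeWeight, ← Real.exp_sub]
  gcongr
  have h2 : -(l * θ.im) ≤ |(l : ℝ)| * τ := by
    refine (neg_le_abs _).trans ?_
    rw [abs_mul]
    gcongr
  linarith

theorem norm_modeFun_le_one {σ : ℝ≥0} {θ : ℂ} (hθ : |θ.im| ≤ σ) (l : ℤ) : ‖modeFun σ l θ‖ ≤ 1 := by
  simpa using norm_modeFun_le (σ := σ) hθ l

theorem modeFun_add (σ : ℝ≥0) (i j : ℤ) (θ : ℂ) :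
    modeRatio σ i j * modeFun σ (i + j) θ = modeFun σ i θ * modeFun σ j θ := by
  have h1 : (modeWeight σ i : ℂ) ≠ 0 := by exact_mod_cast (modeWeight_pos σ i).ne'
  have h2 : (modeWeight σ j : ℂ) ≠ 0 := by exact_mod_cast (modeWeight_pos σ j).ne'
  have h3 : (modeWeight σ (i + j) : ℂ) ≠ 0 := by exact_mod_cast (modeWeight_pos σ (i + j)).ne'
  simp only [modeFun, modeRatio]
  rw [show I * ((i + j : ℤ) : ℂ) * θ = I * i * θ + I * j * θ by push_cast; ring, Complex.exp_add]
  push_cast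
  field_simp

theorem hasDerivAt_modeFun (σ : ℝ≥0) (l : ℤ) (θ : ℂ) :
    HasDerivAt (modeFun σ l) (I * l * modeFun σ l θ) θ := by
  have h : HasDerivAt (fun w : ℂ => exp (I * l * w) / (modeWeight σ l : ℂ))
      (exp (I * l * θ) * (I * l * 1) / (modeWeight σ l : ℂ)) θ :=
    (((hasDerivAt_id θ).const_mul (I * l)).cexp).div_const (modeWeight σ l : ℂ)
  refine h.congr_deriv ?_
  rw [modeFun]
  ring

namespace WienerAlg

variable {U V : Opens ℂ} {σ : ℝ≥0}

/-- The value at `(s, θ)` of a Fourier series with holomorphic coefficients. -/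
def ev (u : WienerAlg (HolB U) σ) (s θ : ℂ) : ℂ := ∑' l, (u.coeff l).fn s * modeFun σ l θ

theorem norm_evTerm_le (u : WienerAlg (HolB U) σ) (s : ℂ) {θ : ℂ} (hθ : |θ.im| ≤ σ) (l : ℤ) :
    ‖(u.coeff l).fn s * modeFun σ l θ‖ ≤ ‖u.coeff l‖ := by
  rw [norm_mul, ← mul_one ‖u.coeff l‖]
  exact mul_le_mul (HolB.norm_fn_le _ s) (norm_modeFun_le_one hθ l) (norm_nonneg _) (norm_nonneg _)

theorem summable_ev (u : WienerAlg (HolB U) σ) (s : ℂ) {θ : ℂ} (hθ : |θ.im| ≤ σ) :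
    Summable fun l => (u.coeff l).fn s * modeFun σ l θ :=
  .of_norm_bounded u.summable_norm (norm_evTerm_le u s hθ)

theorem norm_ev_le (u : WienerAlg (HolB U) σ) (s : ℂ) {θ : ℂ} (hθ : |θ.im| ≤ σ) :
    ‖ev u s θ‖ ≤ ‖u‖ := tsum_of_norm_bounded u.hasSum_norm (norm_evTerm_le u s hθ)

/-- Evaluation at a point as a continuous linear map. -/
def evL {s θ : ℂ} (hs : s ∈ U) (hθ : |θ.im| ≤ σ) : WienerAlg (HolB U) σ →L[ℂ] ℂ :=
  lift σ (fun l => modeFun σ l θ • HolB.evalL hs) 1 fun l => by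
    rw [norm_smul, ← one_mul (1 : ℝ)]
    exact mul_le_mul (norm_modeFun_le_one hθ l) (HolB.norm_evalL_le hs) (norm_nonneg _) zero_le_one

theorem evL_apply {s θ : ℂ} (hs : s ∈ U) (hθ : |θ.im| ≤ σ) (u : WienerAlg (HolB U) σ) :
    evL hs hθ u = ev u s θ := by
  rw [evL, lift_apply, ev]
  refine tsum_congr fun l => ?_
  simp [HolB.evalL_apply, mul_comm]

theorem ev_single (l : ℤ) (b : HolB U) {s : ℂ} {θ : ℂ} (hs : s ∈ U) (hθ : |θ.im| ≤ σ) :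
    ev (single σ l b) s θ = b.fn s * modeFun σ l θ := by
  rw [← evL_apply hs hθ, evL, lift_single]
  simp [HolB.evalL_apply, mul_comm]

theorem ev_mul (u v : WienerAlg (HolB U) σ) {s θ : ℂ} (hs : s ∈ U) (hθ : |θ.im| ≤ σ) :
    ev (u * v) s θ = ev u s θ * ev v s θ := by
  have h1 : ∀ i a (v : WienerAlg (HolB U) σ),
      evL hs hθ (mulL (single σ i a) v) = evL hs hθ (single σ i a) * evL hs hθ v := by
    intro i a v
    have : (evL hs hθ).comp (mulL (single σ i a)) = evL hs hθ (single σ i a) • evL hs hθ := by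
      refine clm_ext fun j b => ?_
      rw [ContinuousLinearMap.comp_apply, mulL_single]
      simp only [evL_apply, smul_apply, smul_eq_mul, ev_single _ _ hs hθ, HolB.fn_smul _ _ hs,
        HolB.fn_mul _ _ hs]
      linear_combination (a.fn s * b.fn s) * modeFun_add σ i j θ
    exact congrArg (fun f => f v) this
  have : (evL hs hθ).comp (mulL.flip v) = evL hs hθ v • evL hs hθ := by
    refine clm_ext fun i a => ?_
    rw [ContinuousLinearMap.comp_apply, ContinuousLinearMap.flip_apply, h1]
    simp [mul_comm]
  have h := congrArg (fun f => f u) this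
  simp only [ContinuousLinearMap.comp_apply, ContinuousLinearMap.flip_apply, smul_apply,
    smul_eq_mul, evL_apply] at h
  rw [mul_def, h, mul_comm]

theorem ev_one {s θ : ℂ} (hs : s ∈ U) (hθ : |θ.im| ≤ σ) :
    ev (1 : WienerAlg (HolB U) σ) s θ = 1 := by
  rw [one_def, ev_single _ _ hs hθ, HolB.fn_one hs]
  simp [modeFun, modeWeight_zero]

/-- Evaluation at a point as an algebra homomorphism. -/
def evHom {s θ : ℂ} (hs : s ∈ U) (hθ : |θ.im| ≤ σ) : WienerAlg (HolB U) σ →ₐ[ℂ] ℂ :=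
  AlgHom.ofLinearMap (evL hs hθ).toLinearMap
    (by simpa [evL_apply] using ev_one hs hθ)
    (fun u v => by simpa [evL_apply] using ev_mul u v hs hθ)

theorem evHom_apply {s θ : ℂ} (hs : s ∈ U) (hθ : |θ.im| ≤ σ) (u : WienerAlg (HolB U) σ) :
    evHom hs hθ u = ev u s θ := evL_apply hs hθ u

theorem isContractive_evHom {s θ : ℂ} (hs : s ∈ U) (hθ : |θ.im| ≤ σ) :
    IsContractive (evHom (U := U) (σ := σ) hs hθ) := fun u => by
  rw [evHom_apply]; exact norm_ev_le u s hθ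

/-- Differentiation in the angle is not bounded on the algebra, so the element with the
differentiated coefficients is supplied as `v`. The formula itself is termwise differentiation of a
normally convergent series on the open strip. -/
theorem hasDerivAt_ev_angle {u v : WienerAlg (HolB U) σ}
    (h : ∀ l, v.coeff l = (I * l) • u.coeff l) {s θ : ℂ} (hs : s ∈ U) (hθ : |θ.im| < σ) :
    HasDerivAt (fun w => ev u s w) (ev v s θ) θ := by
  have hopen : IsOpen {w : ℂ | |w.im| < σ} := isOpen_lt (by fun_prop) continuous_const
  have hd : ∀ l, DifferentiableOn ℂ (fun w => (u.coeff l).fn s * modeFun σ l w)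
      {w : ℂ | |w.im| < σ} := fun l w _ =>
    ((hasDerivAt_modeFun σ l w).differentiableAt.const_mul _).differentiableWithinAt
  have hb : ∀ l, ∀ w ∈ {w : ℂ | |w.im| < σ}, ‖(u.coeff l).fn s * modeFun σ l w‖ ≤ ‖u.coeff l‖ :=
    fun l w hw => norm_evTerm_le u s (le_of_lt hw) l
  have h1 := hasSum_deriv_of_summable_norm u.summable_norm hd hopen hb hθ
  have h2 := (differentiableOn_tsum_of_summable_norm u.summable_norm hd hopen hb).differentiableAt
    (hopen.mem_nhds hθ)
  have h3 : ev v s θ = deriv (fun w => ev u s w) θ := by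
    refine Eq.trans ?_ h1.tsum_eq
    refine tsum_congr fun l => ?_
    rw [((hasDerivAt_modeFun σ l θ).const_mul _).deriv, h, HolB.fn_smul _ _ hs]
    ring
  rw [h3]
  exact h2.hasDerivAt

theorem hasDerivAt_ev_fst {u v : WienerAlg (HolB U) σ}
    (h : ∀ l, ∀ s ∈ U, HasDerivAt (u.coeff l).fn ((v.coeff l).fn s) s) {s θ : ℂ} (hs : s ∈ U)
    (hθ : |θ.im| ≤ σ) : HasDerivAt (fun x => ev u x θ) (ev v s θ) s := by
  have hd : ∀ l, DifferentiableOn ℂ (fun x => (u.coeff l).fn x * modeFun σ l θ) U := fun l =>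
    (u.coeff l).differentiableOn_fn.mul_const _
  have hb : ∀ l, ∀ x ∈ (U : Set ℂ), ‖(u.coeff l).fn x * modeFun σ l θ‖ ≤ ‖u.coeff l‖ :=
    fun l x _ => norm_evTerm_le u x hθ l
  have h1 := hasSum_deriv_of_summable_norm u.summable_norm hd U.isOpen hb hs
  have h2 := (differentiableOn_tsum_of_summable_norm u.summable_norm hd U.isOpen
    hb).differentiableAt (U.isOpen.mem_nhds hs)
  have h3 : ev v s θ = deriv (fun x => ev u x θ) s := by
    refine Eq.trans ?_ h1.tsum_eq
    refine tsum_congr fun l => ?_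
    rw [((h l s hs).mul_const _).deriv]
  rw [h3]
  exact h2.hasDerivAt

theorem summable_exp_neg_abs {ε : ℝ} (hε : 0 < ε) :
    Summable fun l : ℤ => Real.exp (-(ε * |(l : ℝ)|)) := by
  have h : Summable fun n : ℕ => Real.exp (-ε) ^ n :=
    summable_geometric_of_lt_one (Real.exp_pos _).le (by simpa using hε)
  refine Summable.of_nat_of_neg ?_ ?_ <;> refine h.congr fun n => ?_ <;>
    rw [← Real.exp_nat_mul] <;> simp [mul_comm]

/-- The two variables are separated: the value is the pairing of a holomorphic curve in `s`, with
values in the numerical Fourier algebra, with a holomorphic curve in `θ`, with values in its dual.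
Joint analyticity then follows from analyticity of a bilinear map. -/
theorem analyticAt_ev (u : WienerAlg (HolB U) σ) {s θ : ℂ} (hs : s ∈ U) (hθ : |θ.im| < σ) :
    AnalyticAt ℂ (fun p : ℂ × ℂ => ev u p.1 p.2) (s, θ) := by
  obtain ⟨τ, hτ, hτσ⟩ := exists_between hθ
  have hopen : IsOpen {w : ℂ | |w.im| < τ} := isOpen_lt (by fun_prop) continuous_const
  let coeffL : ℤ → WienerAlg ℂ σ →L[ℂ] ℂ := fun l =>
    lift σ (fun m => if m = l then ContinuousLinearMap.id ℂ ℂ else 0) 1 fun m => by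
      split_ifs
      · exact ContinuousLinearMap.norm_id_le
      · simp
  have hcoeffL : ∀ l, ‖coeffL l‖ ≤ 1 := fun l => norm_lift_le _ _ _
  have hA : DifferentiableOn ℂ (fun x => ∑' l, single σ l ((u.coeff l).fn x)) U := by
    refine differentiableOn_tsum_of_summable_norm u.summable_norm (fun l => ?_) U.isOpen ?_
    · exact (single σ l).differentiable.comp_differentiableOn (u.coeff l).differentiableOn_fn
    · intro l x _
      rw [norm_single]
      exact HolB.norm_fn_le _ x
  have hE : DifferentiableOn ℂ (fun w => ∑' l, modeFun σ l w • coeffL l) {w : ℂ | |w.im| < τ} := by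
    refine differentiableOn_tsum_of_summable_norm
      (summable_exp_neg_abs (ε := σ - τ) (by linarith)) (fun l => ?_) hopen ?_
    · intro w _
      exact ((hasDerivAt_modeFun σ l w).differentiableAt.smul_const _).differentiableWithinAt
    · intro l w hw
      rw [norm_smul]
      refine (mul_le_of_le_one_right (norm_nonneg _) (hcoeffL l)).trans ?_
      exact norm_modeFun_le (le_of_lt hw) l
  have hA' : AnalyticAt ℂ (fun p : ℂ × ℂ => ∑' l, single σ l ((u.coeff l).fn p.1)) (s, θ) :=
    (hA.analyticAt (U.isOpen.mem_nhds hs)).fun_comp (x := (s, θ)) analyticAt_fst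
  have hE' : AnalyticAt ℂ (fun p : ℂ × ℂ => ∑' l, modeFun σ l p.2 • coeffL l) (s, θ) :=
    (hE.analyticAt (hopen.mem_nhds (show θ ∈ {w : ℂ | |w.im| < τ} from hτ))).fun_comp
      (x := (s, θ)) analyticAt_snd
  refine AnalyticAt.congr (AnalyticAt.comp₂
    ((ContinuousLinearMap.id ℂ (WienerAlg ℂ σ →L[ℂ] ℂ)).analyticAt_bilinear _) hE' hA') ?_
  have hnhds : ∀ᶠ p : ℂ × ℂ in 𝓝 (s, θ), |p.2.im| < τ :=
    (hopen.preimage continuous_snd).mem_nhds (show (s, θ) ∈ Prod.snd ⁻¹' {w : ℂ | |w.im| < τ} from hτ)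
  filter_upwards [hnhds] with p hp
  have hs1 : Summable fun l => modeFun σ l p.2 • coeffL l := by
    refine .of_norm_bounded (summable_exp_neg_abs (ε := σ - τ) (by linarith)) fun l => ?_
    rw [norm_smul]
    refine (mul_le_of_le_one_right (norm_nonneg _) (hcoeffL l)).trans ?_
    exact norm_modeFun_le (le_of_lt hp) l
  have hs2 : Summable fun l => single σ l ((u.coeff l).fn p.1) := by
    refine .of_norm_bounded u.summable_norm fun l => ?_
    rw [norm_single]
    exact HolB.norm_fn_le _ _
  have h3 : ∀ l, coeffL l (∑' m, single σ m ((u.coeff m).fn p.1)) = (u.coeff l).fn p.1 := by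
    intro l
    rw [(coeffL l).map_tsum hs2, tsum_eq_single l]
    · simp [coeffL, lift_single]
    · intro m hm
      simp [coeffL, lift_single, hm]
  have h4 := (ContinuousLinearMap.apply ℂ ℂ
    (∑' m, single σ m ((u.coeff m).fn p.1))).map_tsum hs1
  simp only [ContinuousLinearMap.apply_apply] at h4
  rw [ContinuousLinearMap.id_apply, h4, ev]
  refine tsum_congr fun l => ?_
  rw [smul_apply, h3, smul_eq_mul, mul_comm]

end WienerAlg

/-! ### Integral solution formulas for the individual modes. -/

/-- Differentiation of an integral of holomorphic functions under a uniform integrable bound. -/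
theorem hasDerivAt_integral_of_holomorphic {μ : Measure ℝ} {U : Set ℂ} (hU : IsOpen U)
    {H : ℝ → ℂ → ℂ} {bound : ℝ → ℝ} (hd : ∀ᵐ t ∂μ, DifferentiableOn ℂ (H t) U)
    (hm : ∀ s ∈ U, AEStronglyMeasurable (fun t => H t s) μ)
    (hb : ∀ᵐ t ∂μ, ∀ s ∈ U, ‖H t s‖ ≤ bound t) (hbi : Integrable bound μ) {s : ℂ} (hs : s ∈ U) :
    Integrable (fun t => deriv (H t) s) μ ∧
      HasDerivAt (fun x => ∫ t, H t x ∂μ) (∫ t, deriv (H t) s ∂μ) s := by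
  obtain ⟨ε, hε, hεU⟩ := Metric.isOpen_iff.1 hU s hs
  set r := ε / 3 with hr
  have hr0 : 0 < r := by positivity
  have hsub : ∀ x ∈ Metric.ball s r, Metric.closedBall x r ⊆ U := by
    intro x hx y hy
    apply hεU
    rw [Metric.mem_ball] at hx ⊢
    rw [Metric.mem_closedBall] at hy
    linarith [dist_triangle y x s]
  have hI : ∀ x ∈ U, Integrable (fun t => H t x) μ := fun x hx =>
    hbi.mono' (hm x hx) (hb.mono fun t ht => ht x hx)
  refine hasDerivAt_integral_of_dominated_loc_of_deriv_le (F := fun x t => H t x)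
    (F' := fun x t => deriv (H t) x) (bound := fun t => bound t / r)
    (Metric.ball_mem_nhds s hr0) ?_ (hI s hs) ?_ ?_ (hbi.div_const r) ?_
  · filter_upwards [hU.mem_nhds hs] with x hx using hm x hx
  -- The derivative is the limit of difference quotients along a sequence of points of `U`, which
  -- yields its measurability in `t`.
  · have hseq : ∀ n : ℕ, s + ((r / (n + 2) : ℝ) : ℂ) ∈ U := by
      intro n
      apply hsub s (Metric.mem_ball_self hr0)
      rw [Metric.mem_closedBall, dist_eq_norm, add_sub_cancel_left, Complex.norm_real,
        Real.norm_of_nonneg (by positivity)]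
      exact div_le_self hr0.le (by linarith [(Nat.cast_nonneg n : (0 : ℝ) ≤ n)])
    refine aestronglyMeasurable_of_tendsto_ae atTop
      (f := fun n : ℕ => fun t => slope (H t) s (s + ((r / (n + 2) : ℝ) : ℂ))) (fun n => ?_) ?_
    · simp only [slope, vsub_eq_sub, smul_eq_mul]
      exact ((hm _ (hseq n)).sub (hm s hs)).const_mul _
    · filter_upwards [hd] with t ht
      have h1 := ((ht.differentiableAt (hU.mem_nhds hs)).hasDerivAt).tendsto_slope
      refine h1.comp (tendsto_nhdsWithin_iff.2 ⟨?_, Eventually.of_forall fun n => ?_⟩)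
      · have h2 : Tendsto (fun n : ℕ => r / ((n : ℝ) + 2)) atTop (𝓝 0) :=
          Tendsto.div_atTop tendsto_const_nhds
            (tendsto_atTop_add_const_right _ _ tendsto_natCast_atTop_atTop)
        have h3 := ((Complex.continuous_ofReal.tendsto 0).comp h2).const_add s
        simpa using h3
      · have : ((r / (n + 2) : ℝ) : ℂ) ≠ 0 := by
          exact_mod_cast (by positivity : (0 : ℝ) < r / (n + 2)).ne'
        simpa using this
  · filter_upwards [hd, hb] with t ht htb x hx
    refine Complex.norm_deriv_le_of_forall_mem_sphere_norm_le hr0 ?_ fun z hz => ?_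
    · exact (ht.mono (hsub x hx)).diffContOnCl_ball Subset.rfl
    · exact htb z (hsub x hx (Metric.sphere_subset_closedBall hz))
  · filter_upwards [hd] with t ht x hx
    exact (ht.differentiableAt (hU.mem_nhds (hsub x hx
      (Metric.mem_closedBall_self hr0.le)))).hasDerivAt

namespace HolB

variable {U : Opens ℂ}

theorem hasDerivAt_fn (u : HolB U) {s : ℂ} (hs : s ∈ U) : HasDerivAt u.fn (deriv u.fn s) s :=
  (u.differentiableOn_fn.differentiableAt (U.isOpen.mem_nhds hs)).hasDerivAt

section Ray

variable {v : ℂ} (hv : ∀ s ∈ U, ∀ t : ℝ, 0 ≤ t → s + t * v ∈ U) {a : ℝ} (ha : a * v.im < 0)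
include hv ha

theorem norm_exp_ray (t : ℝ) : ‖exp (-(I * a * v) * t)‖ = Real.exp (a * v.im * t) := by
  rw [Complex.norm_exp]
  congr 1
  simp

theorem continuousOn_ray (u : HolB U) {s : ℂ} (hs : s ∈ U) :
    ContinuousOn (fun t : ℝ => exp (-(I * a * v) * t) * u.fn (s + t * v)) (Ici 0) := by
  refine ContinuousOn.mul (by fun_prop) ?_
  exact u.differentiableOn_fn.continuousOn.comp (by fun_prop) fun t ht => hv s hs t ht

theorem integrableOn_ray (u : HolB U) {s : ℂ} (hs : s ∈ U) :
    IntegrableOn (fun t : ℝ => exp (-(I * a * v) * t) * u.fn (s + t * v)) (Ioi 0) := by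
  have h1 : IntegrableOn (fun t : ℝ => Real.exp (a * v.im * t) * ‖u‖) (Ioi 0) := by
    have := (exp_neg_integrableOn_Ioi 0 (b := -(a * v.im)) (by linarith)).mul_const ‖u‖
    simpa [IntegrableOn] using this
  refine Integrable.mono' h1 (((continuousOn_ray hv ha u hs).mono
    Ioi_subset_Ici_self).aestronglyMeasurable measurableSet_Ioi) (Eventually.of_forall fun t => ?_)
  rw [norm_mul, norm_exp_ray hv ha]
  gcongr
  exact norm_fn_le _ _

/-- The integrand is the derivative of the exponential times `u` along the ray. The boundary term at
infinity vanishes since the exponential decays and `u` is bounded. -/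
theorem integral_ray_deriv (u : HolB U) {s : ℂ} (hs : s ∈ U) {f' : ℝ → ℂ}
    (hf' : ∀ t ∈ Ici (0 : ℝ), f' t = exp (-(I * a * v) * t) *
      (v * deriv u.fn (s + t * v) - I * a * v * u.fn (s + t * v)))
    (hi : IntegrableOn f' (Ioi 0)) : ∫ t in Ioi (0 : ℝ), f' t = -u.fn s := by
  have hderiv : ∀ t ∈ Ici (0 : ℝ), HasDerivAt
      (fun t : ℝ => exp (-(I * a * v) * t) * u.fn (s + t * v)) (f' t) t := by
    intro t ht
    have h1 : HasDerivAt (fun t : ℝ => s + (t : ℂ) * v) (1 * v) t :=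
      (Complex.ofRealCLM.hasDerivAt.mul_const v).const_add s
    have h2 := (u.hasDerivAt_fn (hv s hs t ht)).comp t h1
    have h3 : HasDerivAt (fun t : ℝ => exp (-(I * a * v) * t))
        (exp (-(I * a * v) * t) * (-(I * a * v) * 1)) t :=
      (Complex.ofRealCLM.hasDerivAt.const_mul (-(I * a * v))).cexp
    refine (h3.mul h2).congr_deriv ?_
    rw [hf' t ht]
    simp only [Function.comp]
    ring
  have hlim : Tendsto (fun t : ℝ => exp (-(I * a * v) * t) * u.fn (s + t * v)) atTop (𝓝 0) := by
    have h4 : Tendsto (fun t : ℝ => Real.exp (a * v.im * t) * ‖u‖) atTop (𝓝 (0 * ‖u‖)) := by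
      refine Tendsto.mul_const _ ?_
      exact Real.tendsto_exp_atBot.comp (tendsto_id.const_mul_atTop_of_neg ha)
    rw [zero_mul] at h4
    refine squeeze_zero_norm (fun t => ?_) h4
    rw [norm_mul, norm_exp_ray hv ha]
    gcongr
    exact norm_fn_le _ _
  have := integral_Ioi_of_hasDerivAt_of_tendsto' hderiv hi hlim
  rw [this]
  simp

/-- The solution of `O' = i a O + χ` by integration along a ray. -/
def rayFun (v : ℂ) (a : ℝ) (u : HolB U) (s : ℂ) : ℂ :=
  -v * ∫ t in Ioi (0 : ℝ), exp (-(I * a * v) * t) * u.fn (s + t * v)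

/-- The factor `1 / |a|` is the gain of one derivative: `a` will be proportional to the index of the
mode. The remaining constant depends on the direction of the ray only. -/
theorem norm_rayFun_le (u : HolB U) {s : ℂ} :
    ‖rayFun v a u s‖ ≤ ‖v‖ / |v.im| / |a| * ‖u‖ := by
  have h1 : IntegrableOn (fun t : ℝ => Real.exp (a * v.im * t) * ‖u‖) (Ioi 0) := by
    have := (exp_neg_integrableOn_Ioi 0 (b := -(a * v.im)) (by linarith)).mul_const ‖u‖
    simpa [IntegrableOn] using this
  have h2 : ‖∫ t in Ioi (0 : ℝ), exp (-(I * a * v) * t) * u.fn (s + t * v)‖ ≤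
      ∫ t in Ioi (0 : ℝ), Real.exp (a * v.im * t) * ‖u‖ := by
    refine norm_integral_le_of_norm_le h1 (Eventually.of_forall fun t => ?_)
    rw [norm_mul, norm_exp_ray hv ha]
    gcongr
    exact norm_fn_le _ _
  rw [integral_mul_const, integral_exp_mul_Ioi ha] at h2
  rw [rayFun, norm_mul, norm_neg]
  calc _ ≤ ‖v‖ * (-Real.exp (a * v.im * 0) / (a * v.im) * ‖u‖) := by gcongr
    _ = _ := by
        rw [mul_zero, Real.exp_zero, div_div, ← abs_mul, mul_comm v.im a, abs_of_neg ha]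
        field_simp

theorem hasDerivAt_rayFun (u : HolB U) {s : ℂ} (hs : s ∈ U) :
    HasDerivAt (rayFun v a u) (I * a * rayFun v a u s + u.fn s) s := by
  have hexp : Integrable (fun t : ℝ => Real.exp (a * v.im * t) * ‖u‖)
      (volume.restrict (Ioi 0)) := by
    have := (exp_neg_integrableOn_Ioi 0 (b := -(a * v.im)) (by linarith)).mul_const ‖u‖
    simpa [IntegrableOn] using this
  have hpos : ∀ᵐ t ∂(volume.restrict (Ioi (0 : ℝ))), 0 < t := ae_restrict_mem measurableSet_Ioi
  have hder : ∀ t : ℝ, 0 ≤ t → ∀ x ∈ U, HasDerivAt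
      (fun x => exp (-(I * a * v) * t) * u.fn (x + t * v))
      (exp (-(I * a * v) * t) * deriv u.fn (x + t * v)) x := by
    intro t ht x hx
    have h2 := (u.hasDerivAt_fn (hv x hx t ht)).comp x ((hasDerivAt_id x).add_const (t * v))
    rw [mul_one] at h2
    exact h2.const_mul _
  obtain ⟨hint, hD⟩ := hasDerivAt_integral_of_holomorphic U.isOpen
    (H := fun (t : ℝ) x => exp (-(I * a * v) * t) * u.fn (x + t * v))
    (hpos.mono fun t ht x hx => (hder t ht.le x hx).differentiableAt.differentiableWithinAt)
    (fun x hx => (integrableOn_ray hv ha u hx).aestronglyMeasurable)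
    (Eventually.of_forall fun t x _ => by
      rw [norm_mul, norm_exp_ray hv ha]
      gcongr
      exact norm_fn_le _ _) hexp hs
  refine (hD.const_mul (-v)).congr_deriv ?_
  have hcongr : ∀ᵐ (t : ℝ) ∂(volume.restrict (Ioi (0 : ℝ))),
      deriv (fun x => exp (-(I * a * v) * t) * u.fn (x + t * v)) s =
        exp (-(I * a * v) * t) * deriv u.fn (s + t * v) :=
    hpos.mono fun t ht => (hder t ht.le s hs).deriv
  have hint2 := hint.congr hcongr
  have hI := integrableOn_ray hv ha u hs
  have key := integral_ray_deriv hv ha u hs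
    (f' := fun t => v * (exp (-(I * a * v) * t) * deriv u.fn (s + t * v)) -
      I * a * v * (exp (-(I * a * v) * t) * u.fn (s + t * v)))
    (fun t _ => by ring) ((hint2.const_mul v).sub (hI.const_mul (I * a * v)))
  rw [integral_sub (hint2.const_mul v) (hI.const_mul (I * a * v)), integral_const_mul,
    integral_const_mul] at key
  rw [integral_congr_ae hcongr, rayFun]
  linear_combination -key

/-- Homogeneous solutions are multiples of `exp (i a s)`, which grows along the ray; a bounded
solution is therefore determined by its equation. -/
theorem rayFun_eq_of_hasDerivAt {u w : HolB U}
    (h : ∀ s ∈ U, HasDerivAt w.fn (I * a * w.fn s + u.fn s) s) {s : ℂ} (hs : s ∈ U) :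
    rayFun v a u s = w.fn s := by
  have hI := integrableOn_ray hv ha u hs
  have key := integral_ray_deriv hv ha w hs
    (f' := fun t => v * (exp (-(I * a * v) * t) * u.fn (s + t * v)))
    (fun t ht => by rw [(h _ (hv s hs t ht)).deriv]; ring) (hI.const_mul v)
  rw [integral_const_mul] at key
  rw [rayFun]
  linear_combination -key

end Ray

section Radial

variable (hU : ∀ s ∈ U, ∀ t : ℝ, 1 ≤ t → t * s ∈ U) {ν : ℝ} (hν : 1 < ν)
include hU hν

theorem continuousOn_radial (u : HolB U) {s : ℂ} (hs : s ∈ U) (p : ℝ) :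
    ContinuousOn (fun t : ℝ => ((t ^ p : ℝ) : ℂ) * u.fn (t * s)) (Ici 1) := by
  refine ContinuousOn.mul ?_ ?_
  · refine Complex.continuous_ofReal.comp_continuousOn ?_
    exact continuousOn_id.rpow_const fun t ht => Or.inl (zero_lt_one.trans_le ht).ne'
  · exact u.differentiableOn_fn.continuousOn.comp (by fun_prop) fun t ht => hU s hs t ht

theorem integrable_radial_bound (u : HolB U) :
    IntegrableOn (fun t : ℝ => t ^ (-ν) * ‖u‖) (Ioi 1) :=
  (integrableOn_Ioi_rpow_of_lt (by linarith) one_pos).mul_const _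

theorem norm_radial_le (u : HolB U) (s : ℂ) {t : ℝ} (ht : 1 < t) :
    ‖((t ^ (-ν) : ℝ) : ℂ) * u.fn (t * s)‖ ≤ t ^ (-ν) * ‖u‖ := by
  rw [norm_mul, Complex.norm_real, Real.norm_of_nonneg (by positivity)]
  gcongr
  exact norm_fn_le _ _

theorem integrableOn_radial (u : HolB U) {s : ℂ} (hs : s ∈ U) :
    IntegrableOn (fun t : ℝ => ((t ^ (-ν) : ℝ) : ℂ) * u.fn (t * s)) (Ioi 1) := by
  refine Integrable.mono' (integrable_radial_bound hU hν u) (((continuousOn_radial hU hν u hs _).mono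
    Ioi_subset_Ici_self).aestronglyMeasurable measurableSet_Ioi) ?_
  filter_upwards [ae_restrict_mem measurableSet_Ioi] with t ht
  exact norm_radial_le hU hν u s ht

theorem integral_radial_deriv (u : HolB U) {s : ℂ} (hs : s ∈ U) {f' : ℝ → ℂ}
    (hf' : ∀ t ∈ Ici (1 : ℝ), f' t = ((t ^ (-ν) : ℝ) : ℂ) *
      (t * s * deriv u.fn (t * s) - (ν - 1) * u.fn (t * s)))
    (hi : IntegrableOn f' (Ioi 1)) : ∫ t in Ioi (1 : ℝ), f' t = -u.fn s := by
  have hderiv : ∀ t ∈ Ici (1 : ℝ), HasDerivAt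
      (fun t : ℝ => ((t ^ (1 - ν) : ℝ) : ℂ) * u.fn (t * s)) (f' t) t := by
    intro t ht
    have ht0 : (0 : ℝ) < t := zero_lt_one.trans_le ht
    have h1 : HasDerivAt (fun t : ℝ => (t : ℂ) * s) (1 * s) t :=
      Complex.ofRealCLM.hasDerivAt.mul_const s
    have h2 := (u.hasDerivAt_fn (hU s hs t ht)).comp t h1
    have h3 := (Real.hasDerivAt_rpow_const (p := 1 - ν) (Or.inl ht0.ne')).ofReal_comp
    refine (h3.mul h2).congr_deriv ?_
    rw [hf' t ht]
    have h4 : t ^ (1 - ν) = t * t ^ (-ν) := by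
      rw [sub_eq_add_neg, Real.rpow_add ht0, Real.rpow_one]
    have h5 : t ^ (1 - ν - 1) = t ^ (-ν) := by congr 1; ring
    rw [h4, h5]
    simp only [Function.comp]
    push_cast
    ring
  have hlim : Tendsto (fun t : ℝ => ((t ^ (1 - ν) : ℝ) : ℂ) * u.fn (t * s)) atTop (𝓝 0) := by
    have h4 : Tendsto (fun t : ℝ => t ^ (1 - ν) * ‖u‖) atTop (𝓝 (0 * ‖u‖)) := by
      refine Tendsto.mul_const _ ?_
      have := tendsto_rpow_neg_atTop (y := ν - 1) (by linarith)
      rwa [neg_sub] at this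
    rw [zero_mul] at h4
    refine squeeze_zero_norm' ?_ h4
    filter_upwards [eventually_gt_atTop 0] with t ht
    rw [norm_mul, Complex.norm_real, Real.norm_of_nonneg (by positivity)]
    gcongr
    exact norm_fn_le _ _
  have := integral_Ioi_of_hasDerivAt_of_tendsto' hderiv hi hlim
  rw [this]
  simp

/-- The solution of `s g' = (ν - 1) g + χ` by radial integration. -/
def radialFun (ν : ℝ) (u : HolB U) (s : ℂ) : ℂ :=
  -∫ t in Ioi (1 : ℝ), ((t ^ (-ν) : ℝ) : ℂ) * u.fn (t * s)

theorem norm_radialFun_le (u : HolB U) (s : ℂ) : ‖radialFun ν u s‖ ≤ 1 / (ν - 1) * ‖u‖ := by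
  have h2 : ‖∫ t in Ioi (1 : ℝ), ((t ^ (-ν) : ℝ) : ℂ) * u.fn (t * s)‖ ≤
      ∫ t in Ioi (1 : ℝ), t ^ (-ν) * ‖u‖ := by
    refine norm_integral_le_of_norm_le (integrable_radial_bound hU hν u) ?_
    filter_upwards [ae_restrict_mem measurableSet_Ioi] with t ht
    exact norm_radial_le hU hν u s ht
  rw [integral_mul_const, integral_Ioi_rpow_of_lt (by linarith) one_pos, Real.one_rpow] at h2
  rw [radialFun, norm_neg]
  refine h2.trans (le_of_eq ?_)
  congr 1
  rw [show -ν + 1 = -(ν - 1) by ring, neg_div_neg_eq]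

/-- Differentiation under the integral produces `t u'(t s)`, which up to the factor `s` is a
derivative in `t` and is integrated by parts. -/
theorem hasDerivAt_radialFun (u : HolB U) {s : ℂ} (hs : s ∈ U) (hs0 : s ≠ 0) :
    HasDerivAt (radialFun ν u) (s⁻¹ * ((ν - 1) * radialFun ν u s + u.fn s)) s := by
  have hpos : ∀ᵐ t ∂(volume.restrict (Ioi (1 : ℝ))), 1 < t := ae_restrict_mem measurableSet_Ioi
  have hder : ∀ t : ℝ, 1 ≤ t → ∀ x ∈ U, HasDerivAt
      (fun x => ((t ^ (-ν) : ℝ) : ℂ) * u.fn (t * x))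
      (((t ^ (-ν) : ℝ) : ℂ) * (deriv u.fn (t * x) * (t * 1))) x := by
    intro t ht x hx
    exact ((u.hasDerivAt_fn (hU x hx t ht)).comp x ((hasDerivAt_id x).const_mul (t : ℂ))).const_mul _
  obtain ⟨hint, hD⟩ := hasDerivAt_integral_of_holomorphic U.isOpen
    (H := fun (t : ℝ) x => ((t ^ (-ν) : ℝ) : ℂ) * u.fn (t * x))
    (hpos.mono fun t ht x hx => (hder t ht.le x hx).differentiableAt.differentiableWithinAt)
    (fun x hx => (integrableOn_radial hU hν u hx).aestronglyMeasurable)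
    (hpos.mono fun t ht x _ => norm_radial_le hU hν u x ht) (integrable_radial_bound hU hν u) hs
  refine hD.neg.congr_deriv ?_
  have hcongr : ∀ᵐ (t : ℝ) ∂(volume.restrict (Ioi (1 : ℝ))),
      deriv (fun x => ((t ^ (-ν) : ℝ) : ℂ) * u.fn (t * x)) s =
        ((t ^ (-ν) : ℝ) : ℂ) * (deriv u.fn (t * s) * (t * 1)) :=
    hpos.mono fun t ht => (hder t ht.le s hs).deriv
  have hint2 := hint.congr hcongr
  have hI := integrableOn_radial hU hν u hs
  have key := integral_radial_deriv hU hν u hs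
    (f' := fun t => s * (((t ^ (-ν) : ℝ) : ℂ) * (deriv u.fn (t * s) * (t * 1))) -
      (ν - 1) * (((t ^ (-ν) : ℝ) : ℂ) * u.fn (t * s)))
    (fun t _ => by ring) ((hint2.const_mul s).sub (hI.const_mul _))
  rw [integral_sub (hint2.const_mul s) (hI.const_mul _), integral_const_mul,
    integral_const_mul] at key
  rw [integral_congr_ae hcongr, radialFun, eq_comm, inv_mul_eq_iff_eq_mul₀ hs0]
  linear_combination key

/-- Homogeneous solutions behave like `s ^ (ν - 1)` under dilations and are unbounded because `ν >
1`, so boundedness selects the integral. -/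
theorem radialFun_eq_of_hasDerivAt {u w : HolB U}
    (h : ∀ s ∈ U, s * deriv w.fn s = (ν - 1) * w.fn s + u.fn s) {s : ℂ} (hs : s ∈ U) :
    radialFun ν u s = w.fn s := by
  have hI := integrableOn_radial hU hν u hs
  have key := integral_radial_deriv hU hν w hs
    (f' := fun t => ((t ^ (-ν) : ℝ) : ℂ) * u.fn (t * s))
    (fun t ht => by rw [h _ (hU s hs t ht)]; ring) hI
  rw [radialFun, key, neg_neg]

end Radial

section Apex

variable {p : ℂ} (hp : ∀ s ∈ U, ∀ t : ℝ, 0 < t → t ≤ 1 → p + t * (s - p) ∈ U) {c : ℝ} (hc : 0 < c)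
  (hpc : ∀ s ∈ U, (s - p).im ≤ -(c * ‖s - p‖)) {a : ℝ} (ha : a < 0)
include hp hc hpc ha

/-- The solution of `O' = i a O + χ` by integration along the segment from an apex. -/
def apexFun (p : ℂ) (a : ℝ) (u : HolB U) (s : ℂ) : ℂ :=
  ∫ t in Ioc (0 : ℝ) 1, exp (I * a * (1 - t) * (s - p)) * ((s - p) * u.fn (p + t * (s - p)))

theorem norm_exp_apex {s : ℂ} (hs : s ∈ U) {t : ℝ} (ht1 : t ≤ 1) :
    ‖exp (I * a * (1 - t) * (s - p))‖ ≤ Real.exp (-(-a * c * ‖s - p‖) * (1 - t)) := by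
  rw [Complex.norm_exp]
  gcongr
  have h1 : (I * a * (1 - t) * (s - p)).re = -(a * (1 - t) * (s - p).im) := by
    have : I * a * (1 - t) * (s - p) = I * (((a * (1 - t) : ℝ) : ℂ) * (s - p)) := by push_cast; ring
    rw [this, Complex.I_mul_re, Complex.im_ofReal_mul]
  rw [h1]
  have h2 := hpc s hs
  nlinarith [mul_nonneg (neg_nonneg.2 ha.le) (sub_nonneg.2 ht1)]

theorem norm_apexFun_le (u : HolB U) {s : ℂ} (hs : s ∈ U) :
    ‖apexFun p a u s‖ ≤ 1 / c / |a| * ‖u‖ := by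
  set R := ‖s - p‖ with hR
  -- If `s` were the apex, the open set would contain a point directly above it, against the cone
  -- condition.
  have hR0 : 0 < R := by
    rw [hR, norm_pos_iff]
    intro h0
    have h1 := hp s hs
    obtain ⟨ε, hε, hεU⟩ := Metric.isOpen_iff.1 U.isOpen s hs
    have h2 : s + I * (ε / 2 : ℝ) ∈ U := hεU (by
      rw [Metric.mem_ball, dist_eq_norm, add_sub_cancel_left, norm_mul, Complex.norm_I, one_mul,
        Complex.norm_real, Real.norm_of_nonneg (by positivity)]
      linarith)
    have h3 := hpc _ h2
    have h4 : s + I * (ε / 2 : ℝ) - p = I * (ε / 2 : ℝ) := by linear_combination h0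
    rw [h4, Complex.I_mul_im, Complex.ofReal_re] at h3
    have : 0 ≤ c * ‖I * ((ε / 2 : ℝ) : ℂ)‖ := by positivity
    linarith
  have hq : 0 < -a * c * R := by have := neg_pos.2 ha; positivity
  have h1 : ‖apexFun p a u s‖ ≤
      ∫ t in Ioc (0 : ℝ) 1, Real.exp (-(-a * c * R) * (1 - t)) * (R * ‖u‖) := by
    refine norm_integral_le_of_norm_le ?_ ?_
    · have : Continuous fun t : ℝ => Real.exp (-(-a * c * R) * (1 - t)) * (R * ‖u‖) := by fun_prop
      exact (this.intervalIntegrable 0 1).1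
    · filter_upwards [ae_restrict_mem measurableSet_Ioc] with t ht
      rw [norm_mul, norm_mul]
      gcongr
      · exact norm_exp_apex hp hc hpc ha hs ht.2
      · exact norm_fn_le _ _
  have h2 : ∫ t in Ioc (0 : ℝ) 1, Real.exp (-(-a * c * R) * (1 - t)) * (R * ‖u‖) =
      (1 - Real.exp (-(-a * c * R))) / (-a * c * R) * (R * ‖u‖) := by
    rw [integral_mul_const]
    congr 1
    rw [← intervalIntegral.integral_of_le zero_le_one]
    have hd : ∀ t ∈ uIcc (0 : ℝ) 1, HasDerivAt
        (fun t => Real.exp (-(-a * c * R) * (1 - t)) / (-a * c * R))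
        (Real.exp (-(-a * c * R) * (1 - t))) t := by
      intro t _
      have h := ((((hasDerivAt_id t).const_sub 1).const_mul (-(-a * c * R))).exp).div_const
        (-a * c * R)
      refine h.congr_deriv ?_
      rw [neg_mul_neg, mul_one, mul_div_assoc, div_self hq.ne', mul_one, id]
    rw [intervalIntegral.integral_eq_sub_of_hasDerivAt hd
      ((by fun_prop : Continuous fun t : ℝ => Real.exp (-(-a * c * R) * (1 - t))).intervalIntegrable
        0 1)]
    simp only [sub_self, mul_zero, Real.exp_zero, sub_zero, mul_one]
    ring
  rw [h2] at h1
  refine h1.trans ?_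
  rw [abs_of_neg ha]
  have h3 : (1 - Real.exp (-(-a * c * R))) / (-a * c * R) * (R * ‖u‖) ≤
      1 / (-a * c * R) * (R * ‖u‖) := by
    gcongr
    linarith [Real.exp_pos (-(-a * c * R))]
  refine h3.trans (le_of_eq ?_)
  have := neg_pos.2 ha
  field_simp

/-- After the factor `exp (i a (x - p))` is taken out, what remains is a primitive of `g` along the
segment from the apex. Its `s`-derivative has the integrand `d/dt (t g (p + t (s - p)))`. -/
theorem hasDerivAt_apexFun (u : HolB U) {s : ℂ} (hs : s ∈ U) :
    HasDerivAt (apexFun p a u) (I * a * apexFun p a u s + u.fn s) s := by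
  let g : ℂ → ℂ := fun w => exp (-(I * a) * (w - p)) * u.fn w
  have hg : ∀ w ∈ U, HasDerivAt g (deriv g w) w := fun w hw =>
    DifferentiableAt.hasDerivAt (DifferentiableAt.mul (by fun_prop)
      (u.hasDerivAt_fn hw).differentiableAt)
  have hgc : ContinuousOn g U := fun w hw => (hg w hw).continuousAt.continuousWithinAt
  have hmem : ∀ᵐ t ∂(volume.restrict (Ioc (0 : ℝ) 1)), t ∈ Ioc (0 : ℝ) 1 :=
    ae_restrict_mem measurableSet_Ioc
  have happ : ∀ x, apexFun p a u x = exp (I * a * (x - p)) *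
      ∫ t in Ioc (0 : ℝ) 1, (x - p) * g (p + t * (x - p)) := by
    intro x
    rw [apexFun, ← integral_const_mul]
    congr 1
    ext t
    simp only [g]
    have : exp (I * a * (1 - t) * (x - p)) =
        exp (I * a * (x - p)) * exp (-(I * a) * (p + t * (x - p) - p)) := by
      rw [← Complex.exp_add]; congr 1; ring
    rw [this]; ring
  set R := ‖s - p‖ + 1 with hR
  set U' : Set ℂ := (U : Set ℂ) ∩ Metric.ball p R with hU'
  have hU'o : IsOpen U' := U.isOpen.inter Metric.isOpen_ball
  have hsU' : s ∈ U' := ⟨hs, by rw [Metric.mem_ball, dist_eq_norm]; linarith⟩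
  have hder : ∀ t : ℝ, t ∈ Ioc (0 : ℝ) 1 → ∀ x ∈ U, HasDerivAt
      (fun x => (x - p) * g (p + t * (x - p)))
      (1 * g (p + t * (x - p)) + (x - p) * (deriv g (p + t * (x - p)) * (t * 1))) x := by
    intro t ht x hx
    have h1 : HasDerivAt (fun x : ℂ => p + t * (x - p)) (t * 1) x :=
      (((hasDerivAt_id x).sub_const p).const_mul (t : ℂ)).const_add p
    have h2 : HasDerivAt (fun x : ℂ => g (p + t * (x - p)))
        (deriv g (p + t * (x - p)) * (t * 1)) x :=
      HasDerivAt.comp x (hg _ (hp x hx t ht.1 ht.2)) h1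
    exact ((hasDerivAt_id x).sub_const p).mul h2
  have hmeas : ∀ x ∈ U, ContinuousOn (fun t : ℝ => (x - p) * g (p + t * (x - p))) (Ioc 0 1) :=
    fun x hx => continuousOn_const.mul (hgc.comp (by fun_prop) fun t ht => hp x hx t ht.1 ht.2)
  have hbound : ∀ t ∈ Ioc (0 : ℝ) 1, ∀ x ∈ Metric.ball p R, ‖g (p + t * (x - p))‖ ≤
      Real.exp (|a| * R) * ‖u‖ := by
    intro t ht x hx
    rw [Metric.mem_ball, dist_eq_norm] at hx
    simp only [g]
    rw [norm_mul]
    gcongr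
    · rw [add_sub_cancel_left, Complex.norm_exp]
      gcongr
      refine (Complex.re_le_norm _).trans ?_
      simp only [norm_mul, norm_neg, Complex.norm_I, one_mul, Complex.norm_real, Real.norm_eq_abs]
      gcongr
      rw [abs_of_pos ht.1]
      calc t * ‖x - p‖ ≤ 1 * ‖x - p‖ := by gcongr; exact ht.2
        _ ≤ R := by linarith
    · exact norm_fn_le _ _
  obtain ⟨hint, hD⟩ := hasDerivAt_integral_of_holomorphic (μ := volume.restrict (Ioc (0 : ℝ) 1)) hU'o
    (H := fun (t : ℝ) x => (x - p) * g (p + t * (x - p)))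
    (bound := fun _ => R * (Real.exp (|a| * R) * ‖u‖))
    (hmem.mono fun t ht x hx => (hder t ht x hx.1).differentiableAt.differentiableWithinAt)
    (fun x hx => (hmeas x hx.1).aestronglyMeasurable measurableSet_Ioc)
    (hmem.mono fun t ht x hx => by
      have hx2 := hx.2
      rw [norm_mul]
      gcongr
      · rw [Metric.mem_ball, dist_eq_norm] at hx2; exact hx2.le
      · exact hbound t ht x hx.2) (integrable_const _) hsU'
  have hcongr : ∀ᵐ (t : ℝ) ∂(volume.restrict (Ioc (0 : ℝ) 1)),
      deriv (fun x => (x - p) * g (p + t * (x - p))) s =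
        1 * g (p + t * (s - p)) + (s - p) * (deriv g (p + t * (s - p)) * (t * 1)) :=
    hmem.mono fun t ht => (hder t ht s hs).deriv
  have hint2 := hint.congr hcongr
  have key : ∫ t in Ioc (0 : ℝ) 1,
      (1 * g (p + t * (s - p)) + (s - p) * (deriv g (p + t * (s - p)) * (t * 1))) = g s := by
    rw [← intervalIntegral.integral_of_le zero_le_one]
    -- The apex need not belong to `U`, so continuity at `t = 0` comes from the factor `t` and the
    -- boundedness of `g` along the segment.
    have hcont : ContinuousOn (fun t : ℝ => (t : ℂ) * g (p + t * (s - p))) (Icc 0 1) := by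
      intro t ht
      rcases ht.1.eq_or_lt with h0 | h0
      · subst h0
        have h5 : Tendsto (fun t : ℝ => |t| * (Real.exp (|a| * R) * ‖u‖)) (𝓝[Icc 0 1] 0)
            (𝓝 (|0| * (Real.exp (|a| * R) * ‖u‖))) :=
          ((continuous_abs.mul continuous_const).tendsto 0).mono_left nhdsWithin_le_nhds
        rw [abs_zero, zero_mul] at h5
        have h6 : ((0 : ℝ) : ℂ) * g (p + ((0 : ℝ) : ℂ) * (s - p)) = 0 := by simp
        rw [ContinuousWithinAt, h6]
        refine squeeze_zero_norm' ?_ h5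
        filter_upwards [self_mem_nhdsWithin] with t ht
        rcases ht.1.eq_or_lt with h0 | h0
        · rw [← h0]; simp
        · rw [norm_mul, Complex.norm_real, Real.norm_eq_abs]
          gcongr
          exact hbound t ⟨h0, ht.2⟩ s hsU'.2
      · refine ContinuousWithinAt.mul (by fun_prop) ?_
        have h7 : ContinuousAt g (p + t * (s - p)) := (hg _ (hp s hs t h0 ht.2)).continuousAt
        exact (ContinuousAt.comp (f := fun t : ℝ => p + (t : ℂ) * (s - p)) h7
          (by fun_prop)).continuousWithinAt
    rw [intervalIntegral.integral_eq_sub_of_hasDerivAt_of_le zero_le_one hcont (fun t ht => ?_)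
      ((intervalIntegrable_iff_integrableOn_Ioc_of_le zero_le_one).2 hint2)]
    · simp
    · have h1 : HasDerivAt (fun t : ℝ => p + (t : ℂ) * (s - p)) (1 * (s - p)) t :=
        (Complex.ofRealCLM.hasDerivAt.mul_const (s - p)).const_add p
      have h2 := (hg _ (hp s hs t ht.1 ht.2.le)).comp t h1
      have h3 : HasDerivAt (fun t : ℝ => (t : ℂ)) 1 t := Complex.ofRealCLM.hasDerivAt
      refine (h3.mul h2).congr_deriv ?_
      simp only [Function.comp]
      ring
  rw [integral_congr_ae hcongr, key] at hD
  have hE : HasDerivAt (fun x => exp (I * a * (x - p))) (exp (I * a * (s - p)) * (I * a * 1)) s :=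
    (((hasDerivAt_id s).sub_const p).const_mul (I * a)).cexp
  have hfun : apexFun p a u = fun x => exp (I * a * (x - p)) *
      ∫ t in Ioc (0 : ℝ) 1, (x - p) * g (p + t * (x - p)) := funext happ
  rw [hfun]
  refine (hE.mul hD).congr_deriv ?_
  have hgs : exp (I * a * (s - p)) * g s = u.fn s := by
    simp only [g]
    rw [← mul_assoc, ← Complex.exp_add]
    rw [show I * a * (s - p) + -(I * a) * (s - p) = 0 by ring, Complex.exp_zero, one_mul]
  linear_combination hgs

end Apex

end HolB

/-! ### Operators acting mode by mode, and recovery of Fourier coefficients. -/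

namespace WienerAlg

section Diag

variable {B : Type*} [NormedCommRing B] [NormedAlgebra ℂ B] [CompleteSpace B] {σ : ℝ≥0}

/-- The coefficient of a mode as a continuous linear map. -/
def coeffL (l : ℤ) : WienerAlg B σ →L[ℂ] B :=
  LinearMap.mkContinuous { toFun := fun u => u.coeff l, map_add' := fun u v => coeff_add u v l,
                           map_smul' := fun c u => coeff_smul c u l } 1 fun u => by
    rw [one_mul]; exact norm_coeff_le u l

theorem coeffL_apply (l : ℤ) (u : WienerAlg B σ) : coeffL l u = u.coeff l := rfl

theorem coeff_zero (l : ℤ) : (0 : WienerAlg B σ).coeff l = 0 := map_zero (coeffL (σ := σ) l)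

theorem coeff_sub (u v : WienerAlg B σ) (l : ℤ) : (u - v).coeff l = u.coeff l - v.coeff l :=
  map_sub (coeffL (σ := σ) l) u v

/-- The operator that acts on each Fourier coefficient separately. -/
def diag (T : ℤ → B →L[ℂ] B) (C : ℝ) (hC : ∀ l, ‖T l‖ ≤ C) : WienerAlg B σ →L[ℂ] WienerAlg B σ :=
  lift σ (fun l => (single σ l).comp (T l)) C fun l =>
    ContinuousLinearMap.opNorm_le_bound _ ((norm_nonneg _).trans (hC 0)) fun b => by
      rw [ContinuousLinearMap.comp_apply, norm_single]
      exact (T l).le_of_opNorm_le (hC l) b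

theorem norm_diag_le (T : ℤ → B →L[ℂ] B) (C : ℝ) (hC : ∀ l, ‖T l‖ ≤ C) :
    ‖diag (σ := σ) T C hC‖ ≤ C := norm_lift_le _ _ _

theorem coeff_diag (T : ℤ → B →L[ℂ] B) (C : ℝ) (hC : ∀ l, ‖T l‖ ≤ C) (u : WienerAlg B σ) (l : ℤ) :
    (diag T C hC u).coeff l = T l (u.coeff l) := by
  have : (coeffL l).comp (diag (σ := σ) T C hC) = (T l).comp (coeffL l) := by
    refine clm_ext fun m b => ?_
    rw [ContinuousLinearMap.comp_apply, ContinuousLinearMap.comp_apply, diag, lift_single,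
      ContinuousLinearMap.comp_apply, coeffL_apply, coeffL_apply, coeff_single, coeff_single]
    split_ifs with h
    · rw [h]
    · rw [map_zero]
  exact congrArg (fun f => f u) this

theorem coeff_map {B' : Type*} [NormedCommRing B'] [NormedAlgebra ℂ B'] [CompleteSpace B']
    (f : B →L[ℂ] B') (hf : ‖f‖ ≤ 1) (u : WienerAlg B σ) (l : ℤ) :
    (map σ f hf u).coeff l = f (u.coeff l) := by
  have : (coeffL l).comp (map σ f hf) = f.comp (coeffL l) := by
    refine clm_ext fun m b => ?_
    rw [ContinuousLinearMap.comp_apply, ContinuousLinearMap.comp_apply, map, lift_single,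
      ContinuousLinearMap.comp_apply, coeffL_apply, coeffL_apply, coeff_single, coeff_single]
    split_ifs with h
    · rfl
    · rw [map_zero]
  exact congrArg (fun f => f u) this

theorem norm_map_le {B' : Type*} [NormedCommRing B'] [NormedAlgebra ℂ B'] [CompleteSpace B']
    (f : B →L[ℂ] B') (hf : ‖f‖ ≤ 1) : ‖map σ f hf‖ ≤ 1 := norm_lift_le _ _ _

/-- The projection to the zeroth mode. -/
def meanL : WienerAlg B σ →L[ℂ] WienerAlg B σ :=
  diag (fun l => if l = 0 then ContinuousLinearMap.id ℂ B else 0) 1 fun l => by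
    split_ifs
    · exact ContinuousLinearMap.norm_id_le
    · simp

theorem coeff_meanL (u : WienerAlg B σ) (l : ℤ) :
    (meanL u).coeff l = if l = 0 then u.coeff 0 else 0 := by
  rw [meanL, coeff_diag]
  split_ifs with h
  · rw [h]; rfl
  · rfl

theorem meanL_eq_single (u : WienerAlg B σ) : meanL u = single σ 0 (u.coeff 0) :=
  ext_coeff fun l => by rw [coeff_meanL, coeff_single]

/-- The antiderivative in the angle, on the nonzero modes. -/
def primL : WienerAlg B σ →L[ℂ] WienerAlg B σ :=
  diag (fun l => if l = 0 then 0 else (I * l)⁻¹ • ContinuousLinearMap.id ℂ B) 1 fun l => by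
    split_ifs with h
    · simp
    · rw [norm_smul, norm_inv, norm_mul, Complex.norm_I, one_mul, Complex.norm_intCast]
      refine mul_le_one₀ (inv_le_one_of_one_le₀ ?_) (norm_nonneg _) ContinuousLinearMap.norm_id_le
      exact_mod_cast Int.one_le_abs h

theorem coeff_primL (u : WienerAlg B σ) (l : ℤ) :
    (primL u).coeff l = if l = 0 then 0 else (I * l)⁻¹ • u.coeff l := by
  rw [primL, coeff_diag]
  split_ifs with h <;> rfl

theorem norm_primL_le : ‖(primL : WienerAlg B σ →L[ℂ] _)‖ ≤ 1 := norm_diag_le _ _ _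

end Diag

section Fourier

variable {U V : Opens ℂ} {σ : ℝ≥0}

theorem ev_restrict (h : V ≤ U) (u : WienerAlg (HolB U) σ) {s : ℂ} (hs : s ∈ V) (θ : ℂ) :
    ev (map σ (HolB.restrict h) (HolB.norm_restrict_le h) u) s θ = ev u s θ := by
  rw [ev, ev]
  refine tsum_congr fun l => ?_
  rw [coeff_map, HolB.fn_restrict h _ hs]

theorem integral_exp_int (n : ℤ) :
    ∫ t in (0 : ℝ)..(2 * Real.pi), exp (I * n * t) = if n = 0 then (2 * Real.pi : ℂ) else 0 := by
  split_ifs with h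
  · subst h; simp
  · have hn : (n : ℂ) ≠ 0 := by exact_mod_cast h
    have h1 : I * (n : ℂ) ≠ 0 := mul_ne_zero I_ne_zero hn
    rw [integral_exp_mul_complex h1]
    have : I * n * ((2 * Real.pi : ℝ) : ℂ) = n * (2 * Real.pi * I) := by push_cast; ring
    rw [this, Complex.exp_int_mul_two_pi_mul_I]
    simp

theorem integral_ev_mul_exp (u : WienerAlg (HolB U) σ) (s : ℂ) (l : ℤ) :
    ∫ t in (0 : ℝ)..(2 * Real.pi), ev u s t * exp (-(I * l * t)) =
      2 * Real.pi * (u.coeff l).fn s / modeWeight σ l := by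
  have hσ : ∀ t : ℝ, |(t : ℂ).im| ≤ (σ : ℝ) := fun t => by simp
  have h1 : HasSum (fun m : ℤ => ∫ t in (0 : ℝ)..(2 * Real.pi),
      (u.coeff m).fn s * modeFun σ m t * exp (-(I * l * t)))
      (∫ t in (0 : ℝ)..(2 * Real.pi), ev u s t * exp (-(I * l * t))) := by
    have hc : ∀ m : ℤ, Continuous fun t : ℝ =>
        (u.coeff m).fn s * modeFun σ m t * exp (-(I * l * t)) := fun m => by
      simp only [modeFun]; fun_prop
    refine intervalIntegral.hasSum_integral_of_dominated_convergence
      (fun m _ => ‖u.coeff m‖) (fun m => (hc m).aestronglyMeasurable) ?_ ?_ ?_ ?_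
    · intro m
      refine Eventually.of_forall fun t _ => ?_
      have : ‖exp (-(I * l * t))‖ = 1 := by rw [Complex.norm_exp]; simp
      rw [norm_mul, this, mul_one]
      exact norm_evTerm_le u s (hσ t) m
    · exact Eventually.of_forall fun t _ => u.summable_norm
    · exact intervalIntegrable_const
    · exact Eventually.of_forall fun t _ => (summable_ev u s (hσ t)).hasSum.mul_right _
  have h2 : ∀ m : ℤ, ∫ t in (0 : ℝ)..(2 * Real.pi),
      (u.coeff m).fn s * modeFun σ m t * exp (-(I * l * t)) =
        if m = l then 2 * Real.pi * (u.coeff l).fn s / modeWeight σ l else 0 := by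
    intro m
    have h3 : ∀ t : ℝ, (u.coeff m).fn s * modeFun σ m t * exp (-(I * l * t)) =
        (u.coeff m).fn s / modeWeight σ m * exp (I * (m - l : ℤ) * t) := by
      intro t
      have : exp (I * (m - l : ℤ) * t) = exp (I * m * t) * exp (-(I * l * t)) := by
        rw [← Complex.exp_add]; congr 1; push_cast; ring
      rw [this, modeFun]; ring
    simp only [h3]
    rw [intervalIntegral.integral_const_mul, integral_exp_int]
    by_cases h : m = l
    · subst h; simp; ring
    · rw [if_neg (sub_ne_zero.2 h), if_neg h, mul_zero]
  simp only [h2] at h1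
  exact h1.unique (hasSum_ite_eq l _)

/-- Fourier coefficients are integrals over real angles, so identities in the algebra need to be
verified only there, whatever the weight. -/
theorem ext_ev {u v : WienerAlg (HolB U) σ} (h : ∀ s ∈ U, ∀ t : ℝ, ev u s t = ev v s t) : u = v := by
  refine ext_coeff fun l => HolB.ext_fn fun s hs => ?_
  have h1 := integral_ev_mul_exp u s l
  simp only [h s hs] at h1
  rw [integral_ev_mul_exp v s l] at h1
  have hw : (modeWeight σ l : ℂ) ≠ 0 := by exact_mod_cast (modeWeight_pos σ l).ne'
  have hπ : (Real.pi : ℂ) ≠ 0 := by exact_mod_cast Real.pi_ne_zero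
  field_simp at h1
  exact h1.symm

theorem integral_ev (u : WienerAlg (HolB U) σ) (s : ℂ) :
    ∫ t in (0 : ℝ)..(2 * Real.pi), ev u s t = 2 * Real.pi * (u.coeff 0).fn s := by
  have := integral_ev_mul_exp u s 0
  simpa [modeWeight_zero] using this

end Fourier

end WienerAlg

/-! ### The solution formulas as bounded operators. -/

namespace HolB

variable {U : Opens ℂ}

/-- Integration along rays as an operator. -/
def rayL {v : ℂ} (hv : ∀ s ∈ U, ∀ t : ℝ, 0 ≤ t → s + t * v ∈ U) {a : ℝ} (ha : a * v.im < 0) :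
    HolB U →L[ℂ] HolB U :=
  clm (rayFun v a)
    (fun u s hs => (hasDerivAt_rayFun hv ha u hs).differentiableAt.differentiableWithinAt)
    (fun u w s hs => by
      have e : ∀ t ∈ Ioi (0 : ℝ), exp (-(I * a * v) * t) * (u + w).fn (s + t * v) =
          exp (-(I * a * v) * t) * u.fn (s + t * v) + exp (-(I * a * v) * t) * w.fn (s + t * v) :=
        fun t ht => by rw [fn_add _ _ (hv s hs t (le_of_lt ht)), mul_add]
      rw [rayFun, setIntegral_congr_fun measurableSet_Ioi e,
        integral_add (integrableOn_ray hv ha u hs) (integrableOn_ray hv ha w hs), mul_add]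
      rfl)
    (fun c u s hs => by
      have e : ∀ t ∈ Ioi (0 : ℝ), exp (-(I * a * v) * t) * (c • u).fn (s + t * v) =
          c * (exp (-(I * a * v) * t) * u.fn (s + t * v)) :=
        fun t ht => by rw [fn_smul _ _ (hv s hs t (le_of_lt ht))]; ring
      rw [rayFun, setIntegral_congr_fun measurableSet_Ioi e, integral_const_mul, rayFun]
      ring)
    (‖v‖ / |v.im| / |a|) fun u s _ => norm_rayFun_le hv ha u

theorem norm_rayL_le {v : ℂ} (hv : ∀ s ∈ U, ∀ t : ℝ, 0 ≤ t → s + t * v ∈ U) {a : ℝ}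
    (ha : a * v.im < 0) : ‖rayL hv ha‖ ≤ ‖v‖ / |v.im| / |a| := by
  rw [rayL]; exact norm_clm_le _ _ _ _ _ (by positivity) _

theorem fn_rayL {v : ℂ} (hv : ∀ s ∈ U, ∀ t : ℝ, 0 ≤ t → s + t * v ∈ U) {a : ℝ}
    (ha : a * v.im < 0) (u : HolB U) {s : ℂ} (hs : s ∈ U) : (rayL hv ha u).fn s = rayFun v a u s := by
  rw [rayL]; exact fn_clm _ _ _ _ _ _ u hs

/-- Radial integration as an operator. -/
def radialL (hU : ∀ s ∈ U, ∀ t : ℝ, 1 ≤ t → t * s ∈ U) (h0 : (0 : ℂ) ∉ U) {ν : ℝ} (hν : 1 < ν) :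
    HolB U →L[ℂ] HolB U :=
  clm (radialFun ν)
    (fun u s hs => (hasDerivAt_radialFun hU hν u hs
      (fun h => h0 (h ▸ hs))).differentiableAt.differentiableWithinAt)
    (fun u w s hs => by
      have e : ∀ t ∈ Ioi (1 : ℝ), ((t ^ (-ν) : ℝ) : ℂ) * (u + w).fn (t * s) =
          ((t ^ (-ν) : ℝ) : ℂ) * u.fn (t * s) + ((t ^ (-ν) : ℝ) : ℂ) * w.fn (t * s) :=
        fun t ht => by rw [fn_add _ _ (hU s hs t (le_of_lt ht)), mul_add]
      rw [radialFun, setIntegral_congr_fun measurableSet_Ioi e,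
        integral_add (integrableOn_radial hU hν u hs) (integrableOn_radial hU hν w hs), neg_add]
      rfl)
    (fun c u s hs => by
      have e : ∀ t ∈ Ioi (1 : ℝ), ((t ^ (-ν) : ℝ) : ℂ) * (c • u).fn (t * s) =
          c * (((t ^ (-ν) : ℝ) : ℂ) * u.fn (t * s)) :=
        fun t ht => by rw [fn_smul _ _ (hU s hs t (le_of_lt ht))]; ring
      rw [radialFun, setIntegral_congr_fun measurableSet_Ioi e, integral_const_mul, radialFun]
      ring)
    (1 / (ν - 1)) fun u s _ => norm_radialFun_le hU hν u s

theorem norm_radialL_le (hU : ∀ s ∈ U, ∀ t : ℝ, 1 ≤ t → t * s ∈ U) (h0 : (0 : ℂ) ∉ U) {ν : ℝ}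
    (hν : 1 < ν) : ‖radialL hU h0 hν‖ ≤ 1 / (ν - 1) := by
  rw [radialL]; exact norm_clm_le _ _ _ _ _ (div_nonneg zero_le_one (by linarith)) _

theorem fn_radialL (hU : ∀ s ∈ U, ∀ t : ℝ, 1 ≤ t → t * s ∈ U) (h0 : (0 : ℂ) ∉ U) {ν : ℝ}
    (hν : 1 < ν) (u : HolB U) {s : ℂ} (hs : s ∈ U) :
    (radialL hU h0 hν u).fn s = radialFun ν u s := by
  rw [radialL]; exact fn_clm _ _ _ _ _ _ u hs

/-- Integration along segments from an apex as an operator. -/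
def apexL {p : ℂ} (hp : ∀ s ∈ U, ∀ t : ℝ, 0 < t → t ≤ 1 → p + t * (s - p) ∈ U) {c : ℝ} (hc : 0 < c)
    (hpc : ∀ s ∈ U, (s - p).im ≤ -(c * ‖s - p‖)) {a : ℝ} (ha : a < 0) : HolB U →L[ℂ] HolB U :=
  have hint : ∀ (u : HolB U), ∀ s ∈ U, Integrable (fun t : ℝ =>
      exp (I * a * (1 - t) * (s - p)) * ((s - p) * u.fn (p + t * (s - p))))
      (volume.restrict (Ioc (0 : ℝ) 1)) := fun u s hs => by
    have hcont : ContinuousOn (fun t : ℝ =>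
        exp (I * a * (1 - t) * (s - p)) * ((s - p) * u.fn (p + t * (s - p)))) (Ioc 0 1) := by
      refine ContinuousOn.mul (by fun_prop) (continuousOn_const.mul ?_)
      exact u.differentiableOn_fn.continuousOn.comp (by fun_prop) fun t ht => hp s hs t ht.1 ht.2
    refine Integrable.mono' (g := fun _ => ‖s - p‖ * ‖u‖) (integrable_const _)
      (hcont.aestronglyMeasurable measurableSet_Ioc) ?_
    filter_upwards [ae_restrict_mem measurableSet_Ioc] with t ht
    rw [norm_mul, norm_mul]
    have h1 := norm_exp_apex hp hc hpc ha hs ht.2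
    have h2 : Real.exp (-(-a * c * ‖s - p‖) * (1 - t)) ≤ 1 := by
      rw [Real.exp_le_one_iff]
      have h3 : 0 ≤ -a * c * ‖s - p‖ := by have := neg_pos.2 ha; positivity
      have h4 := ht.2
      nlinarith
    calc _ ≤ 1 * (‖s - p‖ * ‖u‖) := by
          gcongr
          · exact h1.trans h2
          · exact norm_fn_le _ _
      _ = _ := one_mul _
  clm (apexFun p a)
    (fun u s hs => (hasDerivAt_apexFun hp hc hpc ha u hs).differentiableAt.differentiableWithinAt)
    (fun u w s hs => by
      have e : ∀ t ∈ Ioc (0 : ℝ) 1,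
          exp (I * a * (1 - t) * (s - p)) * ((s - p) * (u + w).fn (p + t * (s - p))) =
          exp (I * a * (1 - t) * (s - p)) * ((s - p) * u.fn (p + t * (s - p))) +
          exp (I * a * (1 - t) * (s - p)) * ((s - p) * w.fn (p + t * (s - p))) :=
        fun t ht => by rw [fn_add _ _ (hp s hs t ht.1 ht.2)]; ring
      rw [apexFun, setIntegral_congr_fun measurableSet_Ioc e,
        integral_add (hint u s hs) (hint w s hs)]
      rfl)
    (fun c u s hs => by
      have e : ∀ t ∈ Ioc (0 : ℝ) 1,
          exp (I * a * (1 - t) * (s - p)) * ((s - p) * (c • u).fn (p + t * (s - p))) =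
          c * (exp (I * a * (1 - t) * (s - p)) * ((s - p) * u.fn (p + t * (s - p)))) :=
        fun t ht => by rw [fn_smul _ _ (hp s hs t ht.1 ht.2)]; ring
      rw [apexFun, setIntegral_congr_fun measurableSet_Ioc e, integral_const_mul, apexFun])
    (1 / c / |a|) fun u s hs => norm_apexFun_le hp hc hpc ha u hs

theorem norm_apexL_le {p : ℂ} (hp : ∀ s ∈ U, ∀ t : ℝ, 0 < t → t ≤ 1 → p + t * (s - p) ∈ U) {c : ℝ}
    (hc : 0 < c) (hpc : ∀ s ∈ U, (s - p).im ≤ -(c * ‖s - p‖)) {a : ℝ} (ha : a < 0) :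
    ‖apexL hp hc hpc ha‖ ≤ 1 / c / |a| := by
  rw [apexL]; exact norm_clm_le _ _ _ _ _ (by positivity) _

theorem fn_apexL {p : ℂ} (hp : ∀ s ∈ U, ∀ t : ℝ, 0 < t → t ≤ 1 → p + t * (s - p) ∈ U) {c : ℝ}
    (hc : 0 < c) (hpc : ∀ s ∈ U, (s - p).im ≤ -(c * ‖s - p‖)) {a : ℝ} (ha : a < 0) (u : HolB U)
    {s : ℂ} (hs : s ∈ U) : (apexL hp hc hpc ha u).fn s = apexFun p a u s := by
  rw [apexL]; exact fn_clm _ _ _ _ _ _ u hs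

end HolB

/-! ### The complex domains and their solution operators. -/

/-- An open set, invariant under expansions and away from the origin, with bounded solution
operators for the equations `O' = i a O + χ`. -/
structure ModeDomain (U : Opens ℂ) where
  T : ℝ → HolB U →L[ℂ] HolB U
  C : ℝ
  C_nonneg : 0 ≤ C
  norm_T_le : ∀ a, a ≠ 0 → ‖T a‖ ≤ C / |a|
  hasDerivAt_T : ∀ a, a ≠ 0 → ∀ χ, ∀ s ∈ U, HasDerivAt (T a χ).fn (I * a * (T a χ).fn s + χ.fn s) s
  radius : ℝ
  radius_pos : 0 < radius
  radius_le : ∀ s ∈ U, radius ≤ ‖s‖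
  dilate : ∀ s ∈ U, ∀ t : ℝ, 1 ≤ t → t * s ∈ U

/-- The solution operators of a domain are inverses on bounded functions. -/
def ModeDomain.IsUnique {U : Opens ℂ} (D : ModeDomain U) : Prop :=
  ∀ a : ℝ, a ≠ 0 → ∀ u w : HolB U, (∀ s ∈ U, HasDerivAt w.fn (I * a * w.fn s + u.fn s) s) → D.T a u = w

/-- The complement of a closed sector, truncated away from the origin. -/
def wedge (m : ℝ) : Opens ℂ := ⟨{s | m * s.re + 1 / 2 < |s.im|},
  isOpen_lt (by fun_prop) (by fun_prop)⟩

theorem mem_wedge {m : ℝ} {s : ℂ} : s ∈ wedge m ↔ m * s.re + 1 / 2 < |s.im| := Iff.rfl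

instance (m : ℝ) : Nonempty (wedge m) := ⟨⟨I, by rw [mem_wedge]; simp; norm_num⟩⟩

/-- The direction of the rays of integration in a wedge. -/
def wedgeDir (m a : ℝ) : ℂ := ⟨-m, if 0 < a then -m ^ 2 else m ^ 2⟩

/-- Along the ray `m * re` decreases at rate `m ^ 2`, while `|im|` decreases at most at that rate,
so the defining inequality is preserved. -/
theorem wedge_ray (m a : ℝ) : ∀ s ∈ wedge m, ∀ t : ℝ, 0 ≤ t → s + t * wedgeDir m a ∈ wedge m := by
  intro s hs t ht
  rw [mem_wedge] at hs ⊢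
  have h2 : |s.im| ≤ |(s + t * wedgeDir m a).im| + t * m ^ 2 := by
    have h3 : s.im = (s + t * wedgeDir m a).im - t * (wedgeDir m a).im := by simp
    have h4 : |t * (wedgeDir m a).im| = t * m ^ 2 := by
      rw [abs_mul, abs_of_nonneg ht]
      congr 1
      rw [wedgeDir]
      split_ifs <;> simp
    calc |s.im| = |(s + t * wedgeDir m a).im - t * (wedgeDir m a).im| := by rw [← h3]
      _ ≤ _ := abs_sub _ _
      _ = _ := by rw [h4]
  have h1 : (s + t * wedgeDir m a).re = s.re - t * m := by simp [wedgeDir]; ring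
  rw [h1]
  nlinarith

theorem wedgeDir_im {m a : ℝ} (hm : m ≠ 0) (ha : a ≠ 0) : a * (wedgeDir m a).im < 0 := by
  have h2 : 0 < m ^ 2 := by positivity
  rw [wedgeDir]
  split_ifs with h
  · change a * (-m ^ 2) < 0; nlinarith
  · have : a < 0 := lt_of_le_of_ne (not_lt.1 h) ha
    change a * m ^ 2 < 0; nlinarith

theorem wedgeDir_ratio {m a : ℝ} : ‖wedgeDir m a‖ / |(wedgeDir m a).im| = Real.sqrt (m ^ 2 + m ^ 4) / m ^ 2 := by
  have h1 : |(wedgeDir m a).im| = m ^ 2 := by rw [wedgeDir]; split_ifs <;> simp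
  have h2 : ‖wedgeDir m a‖ = Real.sqrt (m ^ 2 + m ^ 4) := by
    rw [Complex.norm_eq_sqrt_sq_add_sq]
    congr 1
    rw [wedgeDir]
    split_ifs <;> ring
  rw [h1, h2]

/-- The truncated sectors have bounded solution operators. -/
def wedgeDomain (m : ℝ) (hm : m ≠ 0) : ModeDomain (wedge m) where
  T a := if h : a ≠ 0 then HolB.rayL (wedge_ray m a) (wedgeDir_im hm h) else 0
  C := Real.sqrt (m ^ 2 + m ^ 4) / m ^ 2
  C_nonneg := by positivity
  norm_T_le a ha := by
    rw [dif_pos ha, ← wedgeDir_ratio (a := a)]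
    exact HolB.norm_rayL_le _ _
  hasDerivAt_T a ha χ s hs := by
    rw [dif_pos ha]
    have h1 : ∀ x ∈ wedge m, (HolB.rayL (wedge_ray m a) (wedgeDir_im hm ha) χ).fn x =
      HolB.rayFun (wedgeDir m a) a χ x := fun x hx => HolB.fn_rayL _ _ χ hx
    rw [h1 s hs]
    refine (HolB.hasDerivAt_rayFun (wedge_ray m a) (wedgeDir_im hm ha) χ hs).congr_of_eventuallyEq ?_
    filter_upwards [(wedge m).isOpen.mem_nhds hs] with x hx using h1 x hx
  radius := 1 / (2 * (1 + |m|))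
  radius_pos := by positivity
  radius_le s hs := by
    rw [mem_wedge] at hs
    have h1 := Complex.abs_re_le_norm s
    have h2 := Complex.abs_im_le_norm s
    have h3 : -(|m| * |s.re|) ≤ m * s.re := by rw [← abs_mul]; exact neg_abs_le _
    have h4 : |m| * |s.re| ≤ |m| * ‖s‖ := by gcongr
    rw [div_le_iff₀ (by positivity)]
    nlinarith
  dilate s hs t ht := by
    rw [mem_wedge] at hs ⊢
    rw [Complex.re_ofReal_mul, Complex.im_ofReal_mul, abs_mul, abs_of_pos (by linarith)]
    nlinarith

/-- A wedge contains rays in a decaying direction for both signs of `a`, so boundedness alone fixes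
the solution. This is the source of the uniqueness of inner solutions. -/
theorem wedgeDomain_isUnique (m : ℝ) (hm : m ≠ 0) : (wedgeDomain m hm).IsUnique := by
  intro a ha u w h
  refine HolB.ext_fn fun s hs => ?_
  have : (wedgeDomain m hm).T a = HolB.rayL (wedge_ray m a) (wedgeDir_im hm ha) := dif_pos ha
  rw [this]
  exact (HolB.fn_rayL _ _ u hs).trans
    (HolB.rayFun_eq_of_hasDerivAt (wedge_ray m a) (wedgeDir_im hm ha) h hs)

/-- A truncated sector around the negative imaginary axis. -/
def lowerSector (m : ℝ) : Opens ℂ := ⟨{s | m * |s.re| + 1 / 2 < -s.im},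
  isOpen_lt (by fun_prop) (by fun_prop)⟩

theorem mem_lowerSector {m : ℝ} {s : ℂ} : s ∈ lowerSector m ↔ m * |s.re| + 1 / 2 < -s.im := Iff.rfl

instance (m : ℝ) : Nonempty (lowerSector m) := ⟨⟨-I, by rw [mem_lowerSector]; simp; norm_num⟩⟩

theorem lowerSector_ray (m : ℝ) : ∀ s ∈ lowerSector m, ∀ t : ℝ, 0 ≤ t → s + t * (-I) ∈ lowerSector m := by
  intro s hs t ht
  rw [mem_lowerSector] at hs ⊢
  simp
  linarith

theorem lowerSector_apex (m : ℝ) : ∀ s ∈ lowerSector m, ∀ t : ℝ, 0 < t → t ≤ 1 →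
    -I / 2 + t * (s - -I / 2) ∈ lowerSector m := by
  intro s hs t ht _
  rw [mem_lowerSector] at hs ⊢
  have h1 : (-I / 2 + t * (s - -I / 2) : ℂ).re = t * s.re := by simp
  have h2 : (-I / 2 + t * (s - -I / 2) : ℂ).im = -1 / 2 + t * (s.im + 1 / 2) := by simp; ring_nf; simp
  rw [h1, h2, abs_mul, abs_of_pos ht]
  nlinarith

theorem lowerSector_cone {m : ℝ} (hm : 0 < m) : ∀ s ∈ lowerSector m,
    (s - -I / 2).im ≤ -(m / (1 + m) * ‖s - -I / 2‖) := by
  intro s hs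
  rw [mem_lowerSector] at hs
  have h3 := Complex.norm_le_abs_re_add_abs_im (s - -I / 2)
  have h1 : (s - -I / 2 : ℂ).re = s.re := by simp
  have h2 : (s - -I / 2 : ℂ).im = s.im + 1 / 2 := by simp; ring
  rw [h1, h2] at h3
  have h0 : 0 ≤ m * |s.re| := by positivity
  rw [abs_of_neg (show s.im + 1 / 2 < 0 by linarith)] at h3
  rw [h2, le_neg, div_mul_eq_mul_div, div_le_iff₀ (by positivity)]
  nlinarith

/-- The lower sector has bounded solution operators. -/
def lowerDomain (m : ℝ) (hm : 0 < m) : ModeDomain (lowerSector m) where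
  -- For `a > 0` the decaying direction points down and stays in the sector. For `a < 0` it points
  -- up and leaves it, so integration starts at the apex `-i / 2`; this selects one bounded solution
  -- among others.
  T a := if h : a < 0 then HolB.apexL (lowerSector_apex m) (by positivity) (lowerSector_cone hm) h
    else if h : 0 < a then HolB.rayL (lowerSector_ray m) (a := a) (by simpa using h : a * (-I).im < 0) else 0
  C := (1 + m) / m
  C_nonneg := by positivity
  norm_T_le a ha := by
    rcases ha.lt_or_gt with h | h
    · rw [dif_pos h]
      have e : (1 + m) / m = 1 / (m / (1 + m)) := by rw [one_div_div]
      rw [e]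
      exact HolB.norm_apexL_le _ _ _ _
    · rw [dif_neg h.le.not_gt, dif_pos h]
      have e : ‖-I‖ / |(-I).im| / |a| ≤ (1 + m) / m / |a| := by
        refine div_le_div_of_nonneg_right ?_ (abs_nonneg a)
        rw [le_div_iff₀ hm]
        simp
      exact (HolB.norm_rayL_le _ _).trans e
  hasDerivAt_T a ha χ s hs := by
    rcases ha.lt_or_gt with h | h
    · rw [dif_pos h]
      have h1 : ∀ x ∈ lowerSector m, (HolB.apexL (lowerSector_apex m) (by positivity)
        (lowerSector_cone hm) h χ).fn x = HolB.apexFun (-I / 2) a χ x :=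
        fun x hx => HolB.fn_apexL _ _ _ _ χ hx
      rw [h1 s hs]
      refine (HolB.hasDerivAt_apexFun (lowerSector_apex m) (c := m / (1 + m)) (by positivity)
        (lowerSector_cone hm) h χ hs).congr_of_eventuallyEq ?_
      filter_upwards [(lowerSector m).isOpen.mem_nhds hs] with x hx using h1 x hx
    · rw [dif_neg h.le.not_gt, dif_pos h]
      have hv : a * (-I).im < 0 := by simpa using h
      have h1 : ∀ x ∈ lowerSector m, (HolB.rayL (lowerSector_ray m) hv χ).fn x =
        HolB.rayFun (-I) a χ x := fun x hx => HolB.fn_rayL _ _ χ hx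
      rw [h1 s hs]
      refine (HolB.hasDerivAt_rayFun (lowerSector_ray m) hv χ hs).congr_of_eventuallyEq ?_
      filter_upwards [(lowerSector m).isOpen.mem_nhds hs] with x hx using h1 x hx
  radius := 1 / 2
  radius_pos := by norm_num
  radius_le s hs := by
    rw [mem_lowerSector] at hs
    have h2 := Complex.abs_im_le_norm s
    have h0 : 0 ≤ m * |s.re| := by positivity
    linarith [neg_le_abs s.im]
  dilate s hs t ht := by
    rw [mem_lowerSector] at hs ⊢
    rw [Complex.re_ofReal_mul, Complex.im_ofReal_mul, abs_mul, abs_of_pos (by linarith)]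
    nlinarith

/-- Both the unstable and the stable wedge contain the lower sector, since only `|m'|` enters. There
the two solutions can be compared in one algebra. -/
theorem lowerSector_le_wedge {m m' : ℝ} (h : |m'| ≤ m) : lowerSector m ≤ wedge m' := by
  intro s hs
  rw [mem_wedge]
  have hs' : m * |s.re| + 1 / 2 < -s.im := hs
  have h1 : m' * s.re ≤ m * |s.re| := by
    refine (le_abs_self _).trans ?_
    rw [abs_mul]
    gcongr
  linarith [neg_le_abs s.im]

/-! ### Trigonometric elements, partial derivatives and inverse operators at scale `κ`. -/

namespace WienerAlg

variable {U : Opens ℂ} {σ : ℝ≥0}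

theorem coeff_single_zero_mul (b : HolB U) (u : WienerAlg (HolB U) σ) (l : ℤ) :
    (single σ 0 b * u).coeff l = b * u.coeff l := by
  have : (coeffL l).comp (mulL (single σ 0 b)) =
      (ContinuousLinearMap.mul ℂ (HolB U) b).comp (coeffL l) := by
    refine clm_ext fun m a => ?_
    simp only [ContinuousLinearMap.comp_apply, mulL_single, modeRatio_zero_left, one_smul,
      coeffL_apply, coeff_single, zero_add, ContinuousLinearMap.mul_apply']
    split_ifs <;> simp
  exact congrArg (fun f => f u) this

theorem ev_add (u v : WienerAlg (HolB U) σ) {s θ : ℂ} (hs : s ∈ U) (hθ : |θ.im| ≤ σ) :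
    ev (u + v) s θ = ev u s θ + ev v s θ := by
  simp only [← evHom_apply hs hθ, map_add]

theorem ev_sub (u v : WienerAlg (HolB U) σ) {s θ : ℂ} (hs : s ∈ U) (hθ : |θ.im| ≤ σ) :
    ev (u - v) s θ = ev u s θ - ev v s θ := by
  simp only [← evHom_apply hs hθ, map_sub]

theorem ev_smul (c : ℂ) (u : WienerAlg (HolB U) σ) {s θ : ℂ} (hs : s ∈ U) (hθ : |θ.im| ≤ σ) :
    ev (c • u) s θ = c * ev u s θ := by
  simp only [← evHom_apply hs hθ, map_smul, smul_eq_mul]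

theorem ev_add_two_pi (u : WienerAlg (HolB U) σ) (s θ : ℂ) :
    ev u s (θ + 2 * Real.pi) = ev u s θ := by
  rw [ev, ev]
  refine tsum_congr fun l => ?_
  rw [modeFun, modeFun]
  have : I * l * (θ + 2 * Real.pi) = I * l * θ + l * (2 * Real.pi * I) := by ring
  rw [this, Complex.exp_add, Complex.exp_int_mul_two_pi_mul_I, mul_one]

/-- The element whose values are `exp (i l θ)`. -/
def modeEl (U : Opens ℂ) (σ : ℝ≥0) (l : ℤ) : WienerAlg (HolB U) σ :=
  single σ l ((modeWeight σ l : ℂ) • 1)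

theorem ev_modeEl (l : ℤ) {s θ : ℂ} (hs : s ∈ U) (hθ : |θ.im| ≤ σ) :
    ev (modeEl U σ l) s θ = exp (I * l * θ) := by
  have hw : (modeWeight σ l : ℂ) ≠ 0 := by exact_mod_cast (modeWeight_pos σ l).ne'
  rw [modeEl, ev_single _ _ hs hθ, HolB.fn_smul _ _ hs, HolB.fn_one hs, modeFun]
  field_simp

/-- The element whose values are `cos θ`. -/
def cosEl (U : Opens ℂ) (σ : ℝ≥0) : WienerAlg (HolB U) σ :=
  (1 / 2 : ℂ) • (modeEl U σ 1 + modeEl U σ (-1))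

/-- The element whose values are `sin θ`. -/
def sinEl (U : Opens ℂ) (σ : ℝ≥0) : WienerAlg (HolB U) σ :=
  (I / 2 : ℂ) • (modeEl U σ (-1) - modeEl U σ 1)

theorem ev_cosEl {s θ : ℂ} (hs : s ∈ U) (hθ : |θ.im| ≤ σ) : ev (cosEl U σ) s θ = cos θ := by
  rw [cosEl, ev_smul _ _ hs hθ, ev_add _ _ hs hθ, ev_modeEl _ hs hθ, ev_modeEl _ hs hθ, Complex.cos]
  push_cast
  rw [show I * 1 * θ = θ * I by ring, show I * -1 * θ = -θ * I by ring]
  ring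

theorem ev_sinEl {s θ : ℂ} (hs : s ∈ U) (hθ : |θ.im| ≤ σ) : ev (sinEl U σ) s θ = sin θ := by
  rw [sinEl, ev_smul _ _ hs hθ, ev_sub _ _ hs hθ, ev_modeEl _ hs hθ, ev_modeEl _ hs hθ, Complex.sin]
  push_cast
  rw [show I * 1 * θ = θ * I by ring, show I * -1 * θ = -θ * I by ring]
  ring

/-- The coefficients do not depend on the first variable. -/
def IsConst (u : WienerAlg (HolB U) σ) : Prop :=
  ∀ l, ∀ s ∈ U, ∀ s' ∈ U, (u.coeff l).fn s = (u.coeff l).fn s'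

theorem isConst_iff {u : WienerAlg (HolB U) σ} :
    IsConst u ↔ ∀ s ∈ U, ∀ s' ∈ U, ∀ t : ℝ, ev u s t = ev u s' t := by
  refine ⟨fun h s hs s' hs' t => ?_, fun h l s hs s' hs' => ?_⟩
  · rw [ev, ev]
    exact tsum_congr fun l => by rw [h l s hs s' hs']
  · have h1 := integral_ev_mul_exp u s l
    simp only [h s hs s' hs'] at h1
    rw [integral_ev_mul_exp u s' l] at h1
    have hw : (modeWeight σ l : ℂ) ≠ 0 := by exact_mod_cast (modeWeight_pos σ l).ne'
    have hπ : (Real.pi : ℂ) ≠ 0 := by exact_mod_cast Real.pi_ne_zero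
    field_simp at h1
    exact h1.symm

theorem isConst_of_ev {u : WienerAlg (HolB U) σ} {f : ℝ → ℂ} (h : ∀ s ∈ U, ∀ t : ℝ, ev u s t = f t) :
    IsConst u := isConst_iff.2 fun s hs s' hs' t => (h s hs t).trans (h s' hs' t).symm

/-- `uθ` and `us` are the partial derivatives of the function `u` in the rescaled variables. -/
structure HasPartials (κ : ℝ) (u uθ us : WienerAlg (HolB U) σ) : Prop where
  angle : ∀ s : ℂ, s / κ ∈ U → ∀ θ : ℂ, |θ.im| < σ →
    HasDerivAt (fun w => ev u (s / κ) w) (ev uθ (s / κ) θ) θ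
  fst : ∀ s : ℂ, s / κ ∈ U → ∀ θ : ℂ, |θ.im| < σ →
    HasDerivAt (fun x => ev u (x / κ) θ) (ev us (s / κ) θ) s

theorem eventually_div_mem {κ : ℝ} {s : ℂ} (hs : s / κ ∈ U) : ∀ᶠ x in 𝓝 s, x / (κ : ℂ) ∈ U :=
  (continuous_id.div_const (κ : ℂ)).continuousAt.eventually (U.isOpen.mem_nhds hs)

theorem eventually_im_lt {θ : ℂ} (hθ : |θ.im| < σ) : ∀ᶠ w : ℂ in 𝓝 θ, |w.im| < σ :=
  (isOpen_lt (by fun_prop) continuous_const : IsOpen {w : ℂ | |w.im| < σ}).mem_nhds hθ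

namespace HasPartials

variable {κ : ℝ} {u uθ us v vθ vs : WienerAlg (HolB U) σ}

theorem add (hu : HasPartials κ u uθ us) (hv : HasPartials κ v vθ vs) :
    HasPartials κ (u + v) (uθ + vθ) (us + vs) where
  angle s hs θ hθ := by
    rw [ev_add _ _ hs hθ.le]
    refine ((hu.angle s hs θ hθ).add (hv.angle s hs θ hθ)).congr_of_eventuallyEq ?_
    filter_upwards [eventually_im_lt hθ] with w hw using ev_add _ _ hs hw.le
  fst s hs θ hθ := by
    rw [ev_add _ _ hs hθ.le]
    refine ((hu.fst s hs θ hθ).add (hv.fst s hs θ hθ)).congr_of_eventuallyEq ?_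
    filter_upwards [eventually_div_mem hs] with x hx using ev_add _ _ hx hθ.le

theorem mul (hu : HasPartials κ u uθ us) (hv : HasPartials κ v vθ vs) :
    HasPartials κ (u * v) (uθ * v + u * vθ) (us * v + u * vs) where
  angle s hs θ hθ := by
    rw [ev_add _ _ hs hθ.le, ev_mul _ _ hs hθ.le, ev_mul _ _ hs hθ.le]
    refine ((hu.angle s hs θ hθ).mul (hv.angle s hs θ hθ)).congr_of_eventuallyEq ?_
    filter_upwards [eventually_im_lt hθ] with w hw using ev_mul _ _ hs hw.le
  fst s hs θ hθ := by
    rw [ev_add _ _ hs hθ.le, ev_mul _ _ hs hθ.le, ev_mul _ _ hs hθ.le]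
    refine ((hu.fst s hs θ hθ).mul (hv.fst s hs θ hθ)).congr_of_eventuallyEq ?_
    filter_upwards [eventually_div_mem hs] with x hx using ev_mul _ _ hx hθ.le

theorem smul (c : ℂ) (hu : HasPartials κ u uθ us) : HasPartials κ (c • u) (c • uθ) (c • us) where
  angle s hs θ hθ := by
    rw [ev_smul _ _ hs hθ.le]
    refine ((hu.angle s hs θ hθ).const_mul c).congr_of_eventuallyEq ?_
    filter_upwards [eventually_im_lt hθ] with w hw using ev_smul _ _ hs hw.le
  fst s hs θ hθ := by
    rw [ev_smul _ _ hs hθ.le]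
    refine ((hu.fst s hs θ hθ).const_mul c).congr_of_eventuallyEq ?_
    filter_upwards [eventually_div_mem hs] with x hx using ev_smul _ _ hx hθ.le

theorem of_coeff (hκ : κ ≠ 0) (hθ : ∀ l, uθ.coeff l = (I * l) • u.coeff l)
    (hs : ∀ l, ∀ s ∈ U, HasDerivAt (u.coeff l).fn (κ * (us.coeff l).fn s) s) :
    HasPartials κ u uθ us where
  angle s hs θ hθ' := hasDerivAt_ev_angle hθ hs hθ'
  fst s hs' θ hθ' := by
    have h1 : HasDerivAt (fun x => ev u x θ) (ev ((κ : ℂ) • us) (s / κ) θ) (s / κ) :=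
      hasDerivAt_ev_fst (fun l x hx => by rw [coeff_smul, HolB.fn_smul _ _ hx]; exact hs l x hx)
        hs' hθ'.le
    have h2 : HasDerivAt (fun x : ℂ => x / (κ : ℂ)) (1 / (κ : ℂ)) s := (hasDerivAt_id s).div_const _
    have h3 := HasDerivAt.comp s h1 h2
    refine h3.congr_deriv ?_
    have hκ' : (κ : ℂ) ≠ 0 := by exact_mod_cast hκ
    rw [ev_smul _ _ hs' hθ'.le]
    field_simp

theorem of_isConst (hκ : κ ≠ 0) (hu : IsConst u) (hθ : ∀ l, uθ.coeff l = (I * l) • u.coeff l) :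
    HasPartials κ u uθ 0 := by
  refine of_coeff hκ hθ fun l s hs => ?_
  rw [coeff_zero, HolB.fn_zero, mul_zero]
  refine (hasDerivAt_const s ((u.coeff l).fn s)).congr_of_eventuallyEq ?_
  filter_upwards [U.isOpen.mem_nhds hs] with x hx using hu l x hx s hs

/-- The mean has no periodic primitive, which is why it is removed from the angular derivative. -/
theorem of_prim (hκ : κ ≠ 0) (hu : IsConst u) : HasPartials κ (primL u) (u - meanL u) 0 := by
  refine of_isConst hκ (fun l s hs s' hs' => ?_) fun l => ?_
  · rw [coeff_primL]
    split_ifs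
    · rw [HolB.fn_zero, HolB.fn_zero]
    · rw [HolB.fn_smul _ _ hs, HolB.fn_smul _ _ hs', hu l s hs s' hs']
  · rw [coeff_sub, coeff_meanL, coeff_primL]
    split_ifs with h
    · rw [h]; simp
    · have h1 : I * (l : ℂ) ≠ 0 := mul_ne_zero I_ne_zero (by exact_mod_cast h)
      rw [smul_smul, mul_inv_cancel₀ h1, one_smul, sub_zero]

end HasPartials

section Scaled

variable (D : ModeDomain U)

include D in
theorem zero_notMem : (0 : ℂ) ∉ U := fun h => by
  have := D.radius_le 0 h
  rw [norm_zero] at this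
  linarith [D.radius_pos]

include D in
theorem differentiableOn_inv_domain : DifferentiableOn ℂ (fun s : ℂ => s⁻¹) U := fun _ hs =>
  (differentiableAt_inv (fun h => zero_notMem D (h ▸ hs))).differentiableWithinAt

theorem norm_inv_le_domain : ∀ s ∈ U, ‖s⁻¹‖ ≤ D.radius⁻¹ := fun s hs => by
  rw [norm_inv]; exact inv_anti₀ D.radius_pos (D.radius_le s hs)

/-- The element whose rescaled values are `1 / s`. -/
def zEl (σ : ℝ≥0) (κ : ℝ) : WienerAlg (HolB U) σ :=
  single σ 0 ((κ⁻¹ : ℂ) • HolB.ofFun (fun s => s⁻¹) (differentiableOn_inv_domain D) D.radius⁻¹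
    (norm_inv_le_domain D))

theorem coeff_zEl_mul (κ : ℝ) (u : WienerAlg (HolB U) σ) (l : ℤ) {s : ℂ} (hs : s ∈ U) :
    ((zEl D σ κ * u).coeff l).fn s = (κ : ℂ)⁻¹ * s⁻¹ * (u.coeff l).fn s := by
  rw [zEl, coeff_single_zero_mul, HolB.fn_mul _ _ hs, HolB.fn_smul _ _ hs, HolB.fn_ofFun _ _ hs]

theorem ev_zEl {κ : ℝ} (hκ : κ ≠ 0) {s θ : ℂ} (hs : s / κ ∈ U) (hθ : |θ.im| ≤ σ) :
    ev (zEl D σ κ) (s / κ) θ = s⁻¹ := by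
  have hκ' : (κ : ℂ) ≠ 0 := by exact_mod_cast hκ
  rw [zEl, ev_single _ _ hs hθ, HolB.fn_smul _ _ hs, HolB.fn_ofFun _ _ hs]
  simp [modeFun, modeWeight_zero]
  field_simp

/-- This is where `κ` enters as a small parameter: smallness of `1 / s` in norm follows from
largeness of `κ`. -/
theorem norm_zEl_le {κ : ℝ} (hκ : 0 < κ) : ‖zEl D σ κ‖ ≤ D.radius⁻¹ / κ := by
  have hr := D.radius_pos
  rw [zEl, norm_single, norm_smul, norm_inv, Complex.norm_real, Real.norm_of_nonneg hκ.le,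
    inv_mul_eq_div]
  gcongr
  refine HolB.norm_le_of_fn (by positivity) fun s hs => ?_
  rw [HolB.fn_ofFun _ _ hs]
  exact norm_inv_le_domain D s hs

theorem hasPartials_zEl {κ : ℝ} (hκ : κ ≠ 0) :
    HasPartials κ (zEl D σ κ) 0 (-(zEl D σ κ * zEl D σ κ)) where
  angle s hs θ hθ := by
    have h0 : ev (0 : WienerAlg (HolB U) σ) (s / κ) θ = 0 := by
      rw [← evHom_apply hs hθ.le, map_zero]
    rw [h0]
    refine (hasDerivAt_const θ s⁻¹).congr_of_eventuallyEq ?_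
    filter_upwards [eventually_im_lt hθ] with w hw using ev_zEl D hκ hs hw.le
  fst s hs θ hθ := by
    have hs0 : s ≠ 0 := fun h => zero_notMem D (by simpa [h] using hs)
    rw [← evHom_apply hs hθ.le, map_neg, map_mul, evHom_apply, ev_zEl D hκ hs hθ.le]
    have h1 := hasDerivAt_inv hs0
    refine (h1.congr_deriv (by field_simp)).congr_of_eventuallyEq ?_
    filter_upwards [eventually_div_mem hs] with x hx using ev_zEl D hκ hx hθ.le

variable {α d κ : ℝ} (hα : 0 < α) (hd : 0 < d) (hκ : 0 < κ)

include hα hd hκ in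
-- The rescaling contributes `κ` and the mode operator `1 / (κ |l|)`; the product is uniform in `κ`
-- and decays like `1 / |l|`, enough to control an angular derivative.
theorem norm_osc_mode_le {l : ℤ} (h : l ≠ 0) :
    ‖(κ / d : ℂ) • D.T (α * l * κ / d)‖ ≤ D.C / α / |(l : ℝ)| := by
  have hl : (l : ℝ) ≠ 0 := by exact_mod_cast h
  have h1 := D.norm_T_le (α * l * κ / d) (by positivity)
  have h2 : ‖(κ / d : ℂ)‖ = κ / d := by
    rw [norm_div, Complex.norm_real, Complex.norm_real, Real.norm_of_nonneg hκ.le,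
      Real.norm_of_nonneg hd.le]
  rw [norm_smul, h2]
  calc κ / d * ‖D.T (α * l * κ / d)‖ ≤ κ / d * (D.C / |α * l * κ / d|) := by gcongr
    _ = _ := by
      rw [abs_div, abs_mul, abs_mul, abs_of_pos hα, abs_of_pos hd, abs_of_pos hκ]
      have : |(l : ℝ)| ≠ 0 := abs_ne_zero.2 hl
      field_simp

/-- The solution operator of `-α ∂_θ O + d ∂_s O = χ` on the nonzero modes. -/
def oscL : WienerAlg (HolB U) σ →L[ℂ] WienerAlg (HolB U) σ :=
  diag (fun l => if l = 0 then 0 else (κ / d : ℂ) • D.T (α * l * κ / d)) (D.C / α) fun l => by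
    have hC := D.C_nonneg
    split_ifs with h
    · rw [_root_.norm_zero]; positivity
    · refine (norm_osc_mode_le D hα hd hκ h).trans (div_le_self (by positivity) ?_)
      exact_mod_cast Int.one_le_abs h

/-- The angular derivative of the solution operator on the nonzero modes. -/
def oscθL : WienerAlg (HolB U) σ →L[ℂ] WienerAlg (HolB U) σ :=
  diag (fun l => if l = 0 then 0 else (I * l) • ((κ / d : ℂ) • D.T (α * l * κ / d))) (D.C / α)
    fun l => by
      have hC := D.C_nonneg
      split_ifs with h
      · rw [_root_.norm_zero]; positivity
      · have hl : (l : ℝ) ≠ 0 := by exact_mod_cast h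
        have : |(l : ℝ)| ≠ 0 := abs_ne_zero.2 hl
        rw [norm_smul, norm_mul, Complex.norm_I, one_mul, Complex.norm_intCast]
        calc |(l : ℝ)| * _ ≤ |(l : ℝ)| * (D.C / α / |(l : ℝ)|) := by
              gcongr; exact norm_osc_mode_le D hα hd hκ h
          _ ≤ _ := by field_simp; rfl

theorem norm_oscL_le : ‖oscL (σ := σ) D hα hd hκ‖ ≤ D.C / α := norm_diag_le _ _ _

theorem norm_oscθL_le : ‖oscθL (σ := σ) D hα hd hκ‖ ≤ D.C / α := norm_diag_le _ _ _

/-- The `s`-derivative is read off from the equation that is being solved. All first derivatives are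
thus bounded linear functions of `χ`, and the fixed-point arguments lose no derivative. -/
theorem hasPartials_oscL (χ : WienerAlg (HolB U) σ) :
    HasPartials κ (oscL D hα hd hκ χ) (oscθL D hα hd hκ χ)
      ((1 / d : ℂ) • ((α : ℂ) • oscθL D hα hd hκ χ + χ - meanL χ)) := by
  have hd' : (d : ℂ) ≠ 0 := by exact_mod_cast hd.ne'
  refine HasPartials.of_coeff hκ.ne' (fun l => ?_) fun l s hs => ?_
  · rw [oscL, oscθL, coeff_diag, coeff_diag]
    split_ifs with h
    · simp
    · rfl
  · rw [coeff_smul, coeff_sub, coeff_add, coeff_smul, oscL, oscθL, coeff_diag, coeff_diag,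
      coeff_meanL, HolB.fn_smul _ _ hs]
    split_ifs with h
    · subst h
      have e : ((α : ℂ) • (0 : HolB U →L[ℂ] HolB U) (χ.coeff 0) + χ.coeff 0 - χ.coeff 0) = 0 := by simp
      rw [e, zero_apply, HolB.fn_zero, mul_zero, mul_zero]
      refine (hasDerivAt_const s (0 : ℂ)).congr_of_eventuallyEq ?_
      exact Eventually.of_forall fun x => HolB.fn_zero x
    · have hl : (l : ℝ) ≠ 0 := by exact_mod_cast h
      have h1 := (D.hasDerivAt_T (α * l * κ / d) (by positivity) (χ.coeff l) s hs).const_mul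
        (κ / d : ℂ)
      have h2 : ∀ x ∈ U, (((κ / d : ℂ) • D.T (α * l * κ / d)) (χ.coeff l)).fn x =
          (κ / d : ℂ) * (D.T (α * l * κ / d) (χ.coeff l)).fn x := fun x hx => by
        rw [smul_apply, HolB.fn_smul _ _ hx]
      refine (h1.congr_deriv ?_).congr_of_eventuallyEq ?_
      · rw [sub_zero, HolB.fn_add _ _ hs, HolB.fn_smul _ _ hs, smul_apply, HolB.fn_smul _ _ hs,
          h2 s hs]
        push_cast
        field_simp
      · filter_upwards [U.isOpen.mem_nhds hs] with x hx using h2 x hx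

/-- The solution operator of `d s ∂_s g = d (ν - 1) g + χ` on the zeroth mode. -/
def radL {ν : ℝ} (hν : 1 < ν) (d : ℝ) : WienerAlg (HolB U) σ →L[ℂ] WienerAlg (HolB U) σ :=
  diag (fun l => if l = 0 then (d⁻¹ : ℂ) • HolB.radialL D.dilate (zero_notMem D) hν else 0)
    (|d|⁻¹ * (1 / (ν - 1))) fun l => by
      have : 0 < ν - 1 := by linarith
      split_ifs
      · rw [norm_smul, norm_inv, Complex.norm_real, Real.norm_eq_abs]
        gcongr
        exact HolB.norm_radialL_le _ _ _
      · rw [_root_.norm_zero]; positivity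

theorem norm_radL_le {ν : ℝ} (hν : 1 < ν) (d : ℝ) :
    ‖radL (σ := σ) D hν d‖ ≤ |d|⁻¹ * (1 / (ν - 1)) := norm_diag_le _ _ _

include hκ in
-- On the zeroth mode the radial equation makes `s ∂_s` a bounded function of the data, so the
-- derivative even carries a factor `1 / s`.
theorem hasPartials_radL {ν : ℝ} (hν : 1 < ν) (d : ℝ) (χ : WienerAlg (HolB U) σ) :
    HasPartials κ (radL D hν d χ) 0
      (zEl D σ κ * ((d⁻¹ : ℂ) • meanL χ + ((ν - 1 : ℝ) : ℂ) • radL D hν d χ)) := by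
  refine HasPartials.of_coeff hκ.ne' (fun l => ?_) fun l s hs => ?_
  · rw [coeff_zero, radL, coeff_diag]
    split_ifs with h
    · rw [h]; simp
    · simp
  · have hκ' : (κ : ℂ) ≠ 0 := by exact_mod_cast hκ.ne'
    rw [coeff_zEl_mul D κ _ l hs, coeff_add, coeff_smul, coeff_smul, radL, coeff_diag, coeff_meanL]
    split_ifs with h
    · subst h
      have hs0 : s ≠ 0 := fun h => zero_notMem D (h ▸ hs)
      have h1 := (HolB.hasDerivAt_radialFun D.dilate hν (χ.coeff 0) hs hs0).const_mul (d⁻¹ : ℂ)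
      have h2 : ∀ x ∈ U, (((d⁻¹ : ℂ) • HolB.radialL D.dilate (zero_notMem D) hν) (χ.coeff 0)).fn x =
          (d⁻¹ : ℂ) * HolB.radialFun ν (χ.coeff 0) x := fun x hx => by
        rw [smul_apply, HolB.fn_smul _ _ hx, HolB.fn_radialL _ _ _ _ hx]
      refine (h1.congr_deriv ?_).congr_of_eventuallyEq ?_
      · rw [HolB.fn_add _ _ hs, HolB.fn_smul _ _ hs, HolB.fn_smul _ _ hs, h2 s hs]
        push_cast
        field_simp
        ring
      · filter_upwards [U.isOpen.mem_nhds hs] with x hx using h2 x hx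
    · have e : (d⁻¹ : ℂ) • (0 : HolB U) + ((ν - 1 : ℝ) : ℂ) • (0 : HolB U →L[ℂ] HolB U) (χ.coeff l) =
          0 := by simp
      rw [e, zero_apply, HolB.fn_zero, mul_zero, mul_zero]
      refine (hasDerivAt_const s (0 : ℂ)).congr_of_eventuallyEq ?_
      exact Eventually.of_forall fun x => HolB.fn_zero x

end Scaled

/-- The derivatives of the rescaled function. -/
theorem HasPartials.pds_eq {κ : ℝ} {u uθ us : WienerAlg (HolB U) σ} (h : HasPartials κ u uθ us)
    {s θ : ℂ} (hs : s / κ ∈ U) (hθ : |θ.im| < σ) :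
    pds (fun s θ => ev u (s / κ) θ) s θ = ev us (s / κ) θ := (h.fst s hs θ hθ).deriv

theorem HasPartials.pdθ_eq {κ : ℝ} {u uθ us : WienerAlg (HolB U) σ} (h : HasPartials κ u uθ us)
    {s θ : ℂ} (hs : s / κ ∈ U) (hθ : |θ.im| < σ) :
    pdθ (fun s θ => ev u (s / κ) θ) s θ = ev uθ (s / κ) θ := (h.angle s hs θ hθ).deriv

theorem isAnalyticPeriodic_ev {κ τ : ℝ} (hτ : τ < σ) (u : WienerAlg (HolB U) σ) {E : Set ℂ}
    (hE : ∀ s ∈ E, s / κ ∈ U) : IsAnalyticPeriodic E τ fun s θ => ev u (s / κ) θ where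
  analytic p hp := by
    have h1 : |p.2.im| < σ := lt_of_le_of_lt hp.2 hτ
    have h2 := analyticAt_ev u (hE _ hp.1) h1
    refine AnalyticAt.fun_comp (g := fun q : ℂ × ℂ => ev u q.1 q.2) (f := fun q : ℂ × ℂ =>
      (q.1 / (κ : ℂ), q.2)) h2 ?_
    exact (analyticAt_fst.div_const).prod analyticAt_snd
  periodic s _ θ _ := ev_add_two_pi u _ θ

end WienerAlg

/-! ### Existence of inner solutions. -/

/-- A perturbed equation `χ = N (a + L χ)` with small data has a solution. -/
theorem exists_fixedPoint_of_analyticAt {X F : Type*} [NormedAddCommGroup X] [NormedSpace ℂ X]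
    [CompleteSpace X] [NormedAddCommGroup F] [NormedSpace ℂ F] {N : F → X} (hN : AnalyticAt ℂ N 0) :
    ∃ ε > 0, ∀ (a : F) (L : X →L[ℂ] F), ‖a‖ ≤ ε → ‖L‖ ≤ ε →
      ∃ χ, χ = N (a + L χ) ∧ ‖χ‖ ≤ ‖N 0‖ + 1 := by
  obtain ⟨K, t, ht, hK⟩ := (hN.contDiffAt (n := 1)).exists_lipschitzOnWith
  obtain ⟨r, hr, hrt⟩ := Metric.mem_nhds_iff.1 ht
  set R := ‖N 0‖ + 1 with hR
  have hR1 : 1 ≤ R := by have := norm_nonneg (N 0); linarith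
  -- The first entry keeps the arguments inside the ball where `N` is Lipschitz. The second makes
  -- the images stay within `1 / 2` of `N 0` and the contraction factor at most `1 / 2`.
  set ε := min (r / (2 * (1 + R))) (1 / (2 * (K + 1) * (1 + R))) with hε
  have hKp : (0 : ℝ) < K + 1 := by positivity
  have hε0 : 0 < ε := lt_min (by positivity) (by positivity)
  have hε1 : ε * (1 + R) < r := by
    have : ε * (1 + R) ≤ r / (2 * (1 + R)) * (1 + R) := by gcongr; exact min_le_left _ _
    have e : r / (2 * (1 + R)) * (1 + R) = r / 2 := by field_simp
    linarith
  have hε2 : K * (ε * (1 + R)) ≤ 1 / 2 := by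
    have h1 : ε * (1 + R) ≤ 1 / (2 * (K + 1) * (1 + R)) * (1 + R) := by gcongr; exact min_le_right _ _
    have e : 1 / (2 * ((K : ℝ) + 1) * (1 + R)) * (1 + R) = 1 / (2 * (K + 1)) := by field_simp
    rw [e] at h1
    have h2 : (K : ℝ) * (1 / (2 * (K + 1))) ≤ 1 / 2 := by
      rw [mul_one_div, div_le_div_iff₀ (by positivity) (by norm_num)]; linarith
    exact (mul_le_mul_of_nonneg_left h1 K.2).trans h2
  refine ⟨ε, hε0, fun a L ha hL => ?_⟩
  have hmem : ∀ χ ∈ Metric.closedBall (0 : X) R, ‖a + L χ‖ ≤ ε * (1 + R) := by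
    intro χ hχ
    rw [mem_closedBall_zero_iff] at hχ
    calc ‖a + L χ‖ ≤ ‖a‖ + ‖L‖ * ‖χ‖ := (norm_add_le _ _).trans (by gcongr; exact L.le_opNorm _)
      _ ≤ ε + ε * R := by gcongr
      _ = _ := by ring
  have hmt : ∀ χ ∈ Metric.closedBall (0 : X) R, a + L χ ∈ t := fun χ hχ =>
    hrt (by rw [Metric.mem_ball, dist_zero_right]; exact (hmem χ hχ).trans_lt hε1)
  have hmaps : MapsTo (fun χ => N (a + L χ)) (Metric.closedBall (0 : X) R)
      (Metric.closedBall (0 : X) R) := by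
    intro χ hχ
    rw [mem_closedBall_zero_iff]
    have h1 := hK.dist_le_mul _ (hmt χ hχ) 0 (hrt (Metric.mem_ball_self hr))
    rw [dist_zero_right, dist_eq_norm] at h1
    have h2 : K * ‖a + L χ‖ ≤ 1 / 2 := (mul_le_mul_of_nonneg_left (hmem χ hχ) K.2).trans hε2
    have h3 := norm_sub_norm_le (N (a + L χ)) (N 0)
    linarith
  have hlip : LipschitzOnWith (1 / 2) (fun χ => N (a + L χ)) (Metric.closedBall (0 : X) R) := by
    refine LipschitzOnWith.of_dist_le_mul fun χ hχ χ' hχ' => ?_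
    have h1 := hK.dist_le_mul _ (hmt χ hχ) _ (hmt χ' hχ')
    have h2 : dist (a + L χ) (a + L χ') ≤ ε * dist χ χ' := by
      rw [dist_add_left, dist_eq_norm, dist_eq_norm, ← map_sub]
      exact L.le_of_opNorm_le hL _
    have h3 : K * ε ≤ 1 / 2 := by
      have : (K : ℝ) * ε * 1 ≤ K * ε * (1 + R) := by gcongr; linarith
      linarith
    calc _ ≤ K * (ε * dist χ χ') := h1.trans (by gcongr)
      _ = (K * ε) * dist χ χ' := by ring
      _ ≤ (1 / 2) * dist χ χ' := by gcongr
      _ = _ := by simp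
  have hcomplete : IsComplete (Metric.closedBall (0 : X) R) := Metric.isClosed_closedBall.isComplete
  have hcontr : ContractingWith (1 / 2) (hmaps.restrict (fun χ => N (a + L χ)) _ _) :=
    ⟨by rw [← NNReal.coe_lt_coe]; norm_num, hlip.mapsToRestrict hmaps⟩
  obtain ⟨χ, hχ, hfix, -⟩ := hcontr.exists_fixedPoint' hcomplete hmaps
    (show (0 : X) ∈ Metric.closedBall 0 R from Metric.mem_closedBall_self (by linarith))
    (edist_ne_top _ _)
  exact ⟨χ, hfix.symm, mem_closedBall_zero_iff.1 hχ⟩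

namespace InnerSystem

variable (S : InnerSystem)

/-- The leading coefficient of the radius as a function of `1 / s`. -/
def radius₀ : ℂ := -I * (Real.sqrt ((S.d + 1) / S.b) : ℂ)

/-- The coefficient of `s² ψ` in the square root. -/
def coupling : ℂ := 2 * S.b / (S.d + 1)

theorem rho_eq (ψ s : ℂ) :
    S.rho ψ s = S.radius₀ * s⁻¹ * (1 - S.coupling * s ^ 2 * ψ) ^ ((1 : ℂ) / 2) := by
  rw [rho, radius₀, coupling, div_eq_mul_inv]

theorem analyticAt_sqrt : AnalyticAt ℂ (fun w : ℂ => (1 - w) ^ ((1 : ℂ) / 2)) 0 := by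
  refine AnalyticAt.cpow (by fun_prop) analyticAt_const ?_
  simp

theorem analyticAt_sqrt_inv : AnalyticAt ℂ (fun w : ℂ => ((1 - w) ^ ((1 : ℂ) / 2))⁻¹) 0 :=
  analyticAt_sqrt.fun_inv (by simp)

variable {A : Type*} [NormedCommRing A] [NormedAlgebra ℂ A]

/-- The leading coefficient of the point of evaluation as a function of `1 / s`. -/
def dir₀ (C Z : A) : Fin 3 → A := ![S.radius₀ • C, S.radius₀ • Z, 1]

/-- Functions on a Banach algebra that induce the nonlinear terms of the inner equation, in the
variables `1 / s` and `2 b s² ψ / (d + 1)`. -/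
structure Lifts (C Z : A) (F G H : A × A → A) : Prop where
  F_eq : ∀ᶠ p : A × A in 𝓝 0, ∀ χ : A →ₐ[ℂ] ℂ, IsContractive χ → ∀ s θ ψ : ℂ, s ≠ 0 →
    χ C = cos θ → χ Z = sin θ → χ p.1 = s⁻¹ → χ p.2 = S.coupling * s ^ 2 * ψ →
    S.Fhat ψ s θ = (s⁻¹) ^ 4 * χ (F p) ∧ S.Ghat ψ s θ = (s⁻¹) ^ 2 * χ (G p) ∧
      S.Hhat ψ s θ = (s⁻¹) ^ 3 * χ (H p)

variable [CompleteSpace A] [NormOneClass A]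

/-- The radius is `radius₀ / s` times `√(1 - w)`, where `w` is the rescaled unknown, so the point of
evaluation is `1 / s` times a bounded direction. For the first and third functions the value at zero
is kept apart because it enters at leading order; the second one enters only with additional powers
of `1 / s`, and analyticity suffices. -/
theorem exists_lifts {cf cg ch : Fin 3 → Fin 3 → Fin 3 → ℂ} (hf : HasCubicPart S.f cf)
    (hg : HasCubicPart S.g cg) (hh : HasCubicPart S.h ch) (C Z : A) :
    ∃ F G H : A × A → A, S.Lifts C Z F G H ∧
      HasRem F (S.radius₀ • (C * cubicForm cf (S.dir₀ C Z) + Z * cubicForm cg (S.dir₀ C Z))) ∧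
      AnalyticAt ℂ G 0 ∧ HasRem H (cubicForm ch (S.dir₀ C Z)) := by
  obtain ⟨r, hr, hχr⟩ := exists_lift_hasRem (A := A) analyticAt_sqrt
  obtain ⟨q, hq, hχq⟩ := exists_lift_hasRem (A := A) analyticAt_sqrt_inv
  have hr1 : algebraMap ℂ A ((1 - 0) ^ ((1 : ℂ) / 2)) = 1 := by simp
  rw [hr1] at hr
  let V : Fin 3 → A × A → A := ![fun p => S.radius₀ • (r p * C), fun p => S.radius₀ • (r p * Z),
    fun _ => 1]
  have hV : ∀ i, HasRem (V i) (S.dir₀ C Z i) := by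
    intro i
    fin_cases i
    · simpa [V, dir₀] using (hr.mul (HasRem.const C)).smul S.radius₀
    · simpa [V, dir₀] using (hr.mul (HasRem.const Z)).smul S.radius₀
    · simpa [V, dir₀] using HasRem.const (1 : A)
  obtain ⟨f', hf', hχf⟩ := exists_lift_cubicPart hf hV
  obtain ⟨g', hg', hχg⟩ := exists_lift_cubicPart hg hV
  obtain ⟨h', hh', hχh⟩ := exists_lift_cubicPart hh hV
  have hF := (hr.mul (((HasRem.const C).mul hf').add ((HasRem.const Z).mul hg'))).smul S.radius₀
  have hG := (hq.mul (((HasRem.const C).mul hg').add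
    (((HasRem.const Z).mul hf').smul (-1)))).smul S.radius₀⁻¹
  rw [one_mul] at hF
  refine ⟨_, _, h', ⟨?_⟩, hF, hG.analyticAt, hh'⟩
  filter_upwards [hχr, hχq, hχf, hχg, hχh] with p er eq ef eg eh χ hχ s θ ψ hs hC hZ hz hw
  have er := er χ hχ
  have eq := eq χ hχ
  have ef := ef χ hχ
  have eg := eg χ hχ
  have eh := eh χ hχ
  rw [hw] at er eq
  have hρ : S.rho ψ s = S.radius₀ * s⁻¹ * χ (r p) := by rw [er, rho_eq]
  have hρi : (S.rho ψ s)⁻¹ = S.radius₀⁻¹ * s * χ (q p) := by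
    rw [eq, rho_eq, mul_inv, mul_inv, inv_inv]
  have hpt : S.point ψ s θ = (χ p.1 * χ (V 0 p), χ p.1 * χ (V 1 p), χ p.1 * χ (V 2 p)) := by
    simp only [point, V, hρ, hz, ← hC, ← hZ, Matrix.cons_val_zero, Matrix.cons_val_one,
      Matrix.cons_val_two, Matrix.tail_cons, Matrix.head_cons, map_smul, map_mul, map_one,
      smul_eq_mul]
    refine Prod.ext ?_ (Prod.ext ?_ ?_) <;> simp <;> ring
  refine ⟨?_, ?_, ?_⟩
  · rw [Fhat, hpt, ef, eg, hρ, hz, ← hC, ← hZ]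
    simp only [map_smul, map_mul, map_add, smul_eq_mul]
    ring
  · rw [Ghat, hpt, ef, eg, hρi, hz, ← hC, ← hZ]
    simp only [map_smul, map_mul, map_add, smul_eq_mul]
    field_simp
    ring
  · rw [Hhat, hpt, eh, hz]

end InnerSystem

namespace WienerAlg

variable {U : Opens ℂ} {σ : ℝ≥0}

theorem meanL_eq_smul_one {u : WienerAlg (HolB U) σ} {f : ℝ → ℂ}
    (h : ∀ s ∈ U, ∀ t : ℝ, ev u s t = f t) :
    meanL u = ((1 / (2 * Real.pi)) * ∫ t in (0 : ℝ)..(2 * Real.pi), f t : ℂ) • 1 := by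
  rw [meanL_eq_single, one_def, ← map_smul]
  congr 1
  refine HolB.ext_fn fun s hs => ?_
  have h1 := integral_ev u s
  simp only [h s hs] at h1
  have hπ : (Real.pi : ℂ) ≠ 0 := by exact_mod_cast Real.pi_ne_zero
  rw [HolB.fn_smul _ _ hs, HolB.fn_one hs, h1]
  field_simp

theorem HasPartials.const_smul_one {κ : ℝ} (c : ℂ) :
    HasPartials κ (c • (1 : WienerAlg (HolB U) σ)) 0 0 where
  angle s hs θ hθ := by
    have h0 : ev (0 : WienerAlg (HolB U) σ) (s / κ) θ = 0 := by
      rw [← evHom_apply hs hθ.le, map_zero]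
    rw [h0]
    refine (hasDerivAt_const θ (c * 1)).congr_of_eventuallyEq ?_
    filter_upwards [eventually_im_lt hθ] with w hw
    rw [ev_smul _ _ hs hw.le, ev_one hs hw.le]
  fst s hs θ hθ := by
    have h0 : ev (0 : WienerAlg (HolB U) σ) (s / κ) θ = 0 := by
      rw [← evHom_apply hs hθ.le, map_zero]
    rw [h0]
    refine (hasDerivAt_const s (c * 1)).congr_of_eventuallyEq ?_
    filter_upwards [eventually_div_mem hs] with x hx
    rw [ev_smul _ _ hx hθ.le, ev_one hx hθ.le]

end WienerAlg

namespace InnerSystem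

open WienerAlg

variable (S : InnerSystem) (cf cg ch : Fin 3 → Fin 3 → Fin 3 → ℂ)

/-- The leading part of the inhomogeneous term of the inner equation. -/
def lead {A : Type*} [NormedCommRing A] [NormedAlgebra ℂ A] (C Z : A) : A :=
  S.radius₀ • (C * cubicForm cf (S.dir₀ C Z) + Z * cubicForm cg (S.dir₀ C Z)) +
    ((S.d + 1) / S.b : ℂ) • cubicForm ch (S.dir₀ C Z)

theorem map_dir₀ {A : Type*} [NormedCommRing A] [NormedAlgebra ℂ A] (χ : A →ₐ[ℂ] ℂ) (C Z : A) :
    (fun i => χ (S.dir₀ C Z i)) = S.dir₀ (χ C) (χ Z) := by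
  ext i; fin_cases i <;> simp [dir₀]

theorem map_lead {A : Type*} [NormedCommRing A] [NormedAlgebra ℂ A] (χ : A →ₐ[ℂ] ℂ) (C Z : A) :
    χ (S.lead cf cg ch C Z) = S.lead cf cg ch (χ C) (χ Z) := by
  simp only [lead, map_add, map_smul, map_mul, map_cubicForm, map_dir₀]

/-- The mean of the leading part. -/
def leadMean : ℂ := (1 / (2 * Real.pi)) *
  ∫ t in (0 : ℝ)..(2 * Real.pi), S.lead cf cg ch (cos (t : ℂ)) (sin (t : ℂ))

/-- The coefficient of `s⁻³` of the inner solutions. -/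
def psi₀ : ℂ := -S.leadMean cf cg ch / (3 * S.d + 2)

variable {S cf cg ch}

set_option maxHeartbeats 2000000 in
-- The ansatz is `s⁻³ (ψ₀ + s⁻¹ (q + g + s⁻¹ O))`. At order `s⁻⁴` the oscillating part of the
-- leading term is compensated by `q` and its mean by `ψ₀`. The rest is written for a single unknown
-- `χ`, with `g` and `O` obtained from `χ` by the radial and oscillatory inverses; every occurrence
-- of `χ` on the right then carries a factor `1 / s`.
theorem exists_formal_solution (hα : 0 < S.α) (hd : 0 < S.d) (hf : HasCubicPart S.f cf)
    (hg : HasCubicPart S.g cg) (hh : HasCubicPart S.h ch) {U : Opens ℂ} [Nonempty U]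
    (D : ModeDomain U) (σ : ℝ≥0) :
    ∃ κ₀ ρ : ℝ, 0 < κ₀ ∧ ∀ κ, κ₀ ≤ κ → ∃ Ψ Ψθ Ψs : WienerAlg (HolB U) σ,
      ‖Ψ‖ ≤ ρ ∧ ‖Ψθ‖ ≤ ρ ∧ ‖Ψs‖ ≤ ρ ∧
      HasPartials κ (zEl D σ κ ^ 3 * (S.psi₀ cf cg ch • 1 + zEl D σ κ * Ψ)) (zEl D σ κ ^ 4 * Ψθ)
        (zEl D σ κ ^ 4 * Ψs) ∧
      ∀ s : ℂ, s / κ ∈ U → ∀ θ : ℂ, |θ.im| < σ →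
        S.InnerEquationAt (fun s θ => ev (zEl D σ κ ^ 3 * (S.psi₀ cf cg ch • 1 + zEl D σ κ * Ψ))
          (s / κ) θ) s θ := by
  obtain ⟨F, G, H, hlift, ⟨hFa, F₁, F₂, hF₁, hF₂, hFe⟩, hG, hHa, H₁, H₂, hH₁, hH₂, hHe⟩ :=
    S.exists_lifts hf hg hh (cosEl U σ) (sinEl U σ)
  have hα' : (S.α : ℂ) ≠ 0 := by exact_mod_cast hα.ne'
  have hd' : (S.d : ℂ) ≠ 0 := by exact_mod_cast hd.ne'
  have h3d : (3 * S.d + 2 : ℂ) ≠ 0 := by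
    have : (3 * S.d + 2 : ℝ) ≠ 0 := by positivity
    exact_mod_cast this
  set K : WienerAlg (HolB U) σ := S.lead cf cg ch (cosEl U σ) (sinEl U σ) with hK
  have hKev : ∀ s ∈ U, ∀ t : ℝ, ev K s t = S.lead cf cg ch (cos (t : ℂ)) (sin (t : ℂ)) := by
    intro s hs t
    have ht : |(t : ℂ).im| ≤ (σ : ℝ) := by simp
    rw [← evHom_apply hs ht, hK, map_lead, evHom_apply, evHom_apply, ev_cosEl hs ht, ev_sinEl hs ht]
  have hKc : IsConst K := isConst_of_ev hKev
  have hKm : meanL K = S.leadMean cf cg ch • 1 := meanL_eq_smul_one hKev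
  set k₀ := S.psi₀ cf cg ch with hk₀
  have hk₀m : (3 * S.d + 2) * k₀ = -S.leadMean cf cg ch := by
    rw [hk₀, psi₀, mul_div_cancel₀ _ h3d]
  set q : WienerAlg (HolB U) σ := (-(S.α : ℂ)⁻¹) • primL K with hq
  set qθ : WienerAlg (HolB U) σ := (-(S.α : ℂ)⁻¹) • (K - meanL K) with hqθ
  -- With `ν - 1 = 4 + 2 / d` the radial operator inverts `d ∂_s - 2 / s` on functions `s⁻⁴ g` of
  -- `s` alone.
  set ν : ℝ := 5 + 2 / S.d with hν
  have hν1 : 1 < ν := by have : 0 < 2 / S.d := by positivity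
                         linarith
  set e : ℂ := (S.d + 1) / S.b with he
  let B := WienerAlg (HolB U) σ
  -- The five arguments stand for `z`, `z g`, `z O`, `z ∂_θ O` and `z χ`, where `z` is `1 / s`. All
  -- are small with `z`, so `N` is evaluated near the origin.
  let Pf : (Fin 5 → B) → B := fun p => k₀ • 1 + p 0 * q + p 1 + p 0 * p 2
  let w : (Fin 5 → B) → B := fun p => S.coupling • (p 0 * Pf p)
  let Xz : (Fin 5 → B) → B := fun p =>
    (S.d⁻¹ : ℂ) • (p 4 + (2 : ℂ) • p 1 + (S.α : ℂ) • p 3) - (5 : ℂ) • (p 0 * p 2)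
  let N : (Fin 5 → B) → B := fun p =>
    (4 * S.d + 2 : ℂ) • q + (5 * S.d + 2 : ℂ) • p 2 + (S.c : ℂ) • (qθ + p 3) +
    (F₁ (p 0, w p) + S.coupling • (Pf p * F₂ (p 0, w p))) +
    e • (H₁ (p 0, w p) + S.coupling • (Pf p * H₂ (p 0, w p))) -
    p 0 * G (p 0, w p) * (qθ + p 3) +
    ((2 * S.b : ℂ) • Pf p + H (p 0, w p)) *
      ((-3 * k₀) • 1 - (4 : ℂ) • (p 0 * q) + Xz p)
  have hp : ∀ i, AnalyticAt ℂ (fun p : Fin 5 → B => p i) 0 := fun i =>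
    (ContinuousLinearMap.proj (R := ℂ) (φ := fun _ : Fin 5 => B) i).analyticAt 0
  have hPf : AnalyticAt ℂ Pf 0 :=
    ((analyticAt_const.add ((hp 0).mul analyticAt_const)).add (hp 1)).add ((hp 0).mul (hp 2))
  have hw : AnalyticAt ℂ w 0 := analyticAt_const.fun_smul ((hp 0).mul hPf)
  have hXz : AnalyticAt ℂ Xz 0 :=
    (analyticAt_const.fun_smul (((hp 4).add (analyticAt_const.fun_smul (hp 1))).add
      (analyticAt_const.fun_smul (hp 3)))).sub (analyticAt_const.fun_smul ((hp 0).mul (hp 2)))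
  have hzw : AnalyticAt ℂ (fun p => (p 0, w p)) 0 := (hp 0).prod hw
  have hzw0 : ((0 : Fin 5 → B) 0, w 0) = (0 : B × B) := by simp [w]
  have hcomp : ∀ {f : B × B → B}, AnalyticAt ℂ f 0 → AnalyticAt ℂ (fun p => f (p 0, w p)) 0 :=
    fun {f} hf => AnalyticAt.fun_comp (g := f) (f := fun p => (p 0, w p)) (by rw [hzw0]; exact hf) hzw
  have hN : AnalyticAt ℂ N 0 := by
    refine AnalyticAt.add (AnalyticAt.sub (AnalyticAt.add (AnalyticAt.add (AnalyticAt.add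
      (AnalyticAt.add analyticAt_const ?_) ?_) ?_) ?_) ?_) ?_
    · exact analyticAt_const.fun_smul (hp 2)
    · exact analyticAt_const.fun_smul (analyticAt_const.add (hp 3))
    · exact (hcomp hF₁).add (analyticAt_const.fun_smul (hPf.mul (hcomp hF₂)))
    · exact analyticAt_const.fun_smul
        ((hcomp hH₁).add (analyticAt_const.fun_smul (hPf.mul (hcomp hH₂))))
    · exact ((hp 0).mul (hcomp hG)).mul (analyticAt_const.add (hp 3))
    · exact ((analyticAt_const.fun_smul hPf).add (hcomp hHa)).mul
        ((analyticAt_const.sub (analyticAt_const.fun_smul ((hp 0).mul analyticAt_const))).add hXz)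
  obtain ⟨ε, hε, hsol⟩ := exists_fixedPoint_of_analyticAt hN
  set R := ‖N 0‖ + 1 with hR
  have hR0 : 0 < R := by positivity
  obtain ⟨δ, hδ, hall⟩ := Metric.eventually_nhds_iff.1 (hlift.F_eq.and (hFe.and hHe))
  set Cm : ℝ := 1 + |S.d|⁻¹ * (1 / (ν - 1)) + D.C / S.α with hCm
  have hν0 : 0 < ν - 1 := by linarith
  have hDC := D.C_nonneg
  have hc1 : (0 : ℝ) ≤ |S.d|⁻¹ * (1 / (ν - 1)) := by positivity
  have hc2 : 0 ≤ D.C / S.α := by positivity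
  have hCm0 : 0 < Cm := by positivity
  set Q : ℝ := ‖q‖ + Cm * R + Cm * R with hQ
  have hQ0 : 0 ≤ Q := by positivity
  set P₀ : ℝ := ‖k₀‖ + Q with hP₀
  -- The three bounds give norm at most one for `z`, data small enough for the fixed point, and an
  -- argument `(z, wv)` at which the lifted identities are valid.
  set ζ : ℝ := min 1 (min (ε / (1 + Cm)) (δ / (2 * (1 + ‖S.coupling‖ * P₀)))) with hζ
  have hζ0 : 0 < ζ := by positivity
  have hr := D.radius_pos
  refine ⟨D.radius⁻¹ / ζ, max Q (max (‖qθ‖ + Cm * R)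
    (3 * ‖k₀‖ + 4 * ‖q‖ + (‖(S.d⁻¹ : ℂ)‖ * (R + 2 * (Cm * R) + S.α * (Cm * R)) + 5 * (Cm * R)))),
    by positivity, fun κ hκ => ?_⟩
  have hκ0 : 0 < κ := lt_of_lt_of_le (by positivity) hκ
  set z := zEl D σ κ with hz
  have hzn : ‖z‖ ≤ ζ := by
    refine (norm_zEl_le D hκ0).trans ?_
    rw [div_le_iff₀ hκ0]
    rwa [div_le_iff₀' hζ0] at hκ
  have hz1 : ‖z‖ ≤ 1 := hzn.trans (min_le_left _ _)
  have hzε : ‖z‖ ≤ ε / (1 + Cm) := hzn.trans ((min_le_right _ _).trans (min_le_left _ _))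
  have hzδ : ‖z‖ ≤ δ / (2 * (1 + ‖S.coupling‖ * P₀)) :=
    hzn.trans ((min_le_right _ _).trans (min_le_right _ _))
  let M : Fin 5 → B →L[ℂ] B := ![0, radL D hν1 S.d, oscL D hα hd hκ0, oscθL D hα hd hκ0,
    ContinuousLinearMap.id ℂ B]
  have hM : ∀ i, ‖M i‖ ≤ Cm := by
    intro i
    fin_cases i
    · change ‖(0 : B →L[ℂ] B)‖ ≤ Cm; rw [_root_.norm_zero]; exact hCm0.le
    · change ‖radL D hν1 S.d‖ ≤ Cm; exact (norm_radL_le D hν1 S.d).trans (by linarith)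
    · change ‖oscL D hα hd hκ0‖ ≤ Cm; exact (norm_oscL_le D hα hd hκ0).trans (by linarith)
    · change ‖oscθL D hα hd hκ0‖ ≤ Cm; exact (norm_oscθL_le D hα hd hκ0).trans (by linarith)
    · change ‖ContinuousLinearMap.id ℂ B‖ ≤ Cm
      exact ContinuousLinearMap.norm_id_le.trans (by linarith)
  let L : B →L[ℂ] (Fin 5 → B) := ContinuousLinearMap.pi fun i =>
    (ContinuousLinearMap.mul ℂ B z).comp (M i)
  have hLn : ‖L‖ ≤ ε := by
    refine ContinuousLinearMap.opNorm_le_bound _ hε.le fun χ => ?_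
    refine (pi_norm_le_iff_of_nonneg (by positivity)).2 fun i => ?_
    change ‖z * M i χ‖ ≤ _
    calc ‖z * M i χ‖ ≤ ‖z‖ * (Cm * ‖χ‖) :=
          (norm_mul_le _ _).trans (by gcongr; exact (M i).le_of_opNorm_le (hM i) χ)
      _ ≤ ε / (1 + Cm) * (Cm * ‖χ‖) := by gcongr
      _ = ε * ‖χ‖ * (Cm / (1 + Cm)) := by ring
      _ ≤ ε * ‖χ‖ * 1 := by
          gcongr
          rw [div_le_one (by positivity)]; linarith
      _ = _ := mul_one _
  have han : ‖(![z, 0, 0, 0, 0] : Fin 5 → B)‖ ≤ ε := by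
    refine (pi_norm_le_iff_of_nonneg hε.le).2 fun i => ?_
    have hzε' : ‖z‖ ≤ ε := hzε.trans (div_le_self hε.le (by linarith))
    fin_cases i <;> simp [hzε', hε.le]
  obtain ⟨χ, hχ, hχR⟩ := hsol _ L han hLn
  set g := radL D hν1 S.d χ with hgdef
  set O := oscL D hα hd hκ0 χ with hO
  set Oθ := oscθL D hα hd hκ0 χ with hOθ
  have hpt : ![z, 0, 0, 0, 0] + L χ = ![z, z * g, z * O, z * Oθ, z * χ] := by
    ext i; fin_cases i <;> simp [L, M, g, O, Oθ]
  rw [hpt] at hχ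
  set Ψ : B := q + g + z * O with hΨ
  set Pv : B := k₀ • 1 + z * Ψ with hPv
  set wv : B := S.coupling • (z * Pv) with hwv
  set X : B := (S.d⁻¹ : ℂ) • (χ + (2 : ℂ) • g + (S.α : ℂ) • Oθ) - (5 : ℂ) • (z * O) with hX
  have hPfe : Pf ![z, z * g, z * O, z * Oθ, z * χ] = Pv := by
    change k₀ • 1 + z * q + z * g + z * (z * O) = Pv
    rw [hPv, hΨ]; ring
  have hwe : w ![z, z * g, z * O, z * Oθ, z * χ] = wv := by
    change S.coupling • (z * Pf _) = _
    rw [hPfe]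
  have hXe : Xz ![z, z * g, z * O, z * Oθ, z * χ] = z * X := by
    change (S.d⁻¹ : ℂ) • (z * χ + (2 : ℂ) • (z * g) + (S.α : ℂ) • (z * Oθ)) -
      (5 : ℂ) • (z * (z * O)) = _
    rw [hX]; simp only [mul_sub, mul_add, mul_smul_comm, smul_add]
  have hχe : χ = (4 * S.d + 2 : ℂ) • q + (5 * S.d + 2 : ℂ) • (z * O) + (S.c : ℂ) • (qθ + z * Oθ) +
    (F₁ (z, wv) + S.coupling • (Pv * F₂ (z, wv))) +
    e • (H₁ (z, wv) + S.coupling • (Pv * H₂ (z, wv))) -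
    z * G (z, wv) * (qθ + z * Oθ) +
    ((2 * S.b : ℂ) • Pv + H (z, wv)) * ((-3 * k₀) • 1 - (4 : ℂ) • (z * q) + z * X) := by
    have h1 : N ![z, z * g, z * O, z * Oθ, z * χ] = (4 * S.d + 2 : ℂ) • q +
      (5 * S.d + 2 : ℂ) • (z * O) + (S.c : ℂ) • (qθ + z * Oθ) +
      (F₁ (z, w ![z, z * g, z * O, z * Oθ, z * χ]) + S.coupling •
        (Pf ![z, z * g, z * O, z * Oθ, z * χ] * F₂ (z, w ![z, z * g, z * O, z * Oθ, z * χ]))) +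
      e • (H₁ (z, w ![z, z * g, z * O, z * Oθ, z * χ]) + S.coupling •
        (Pf ![z, z * g, z * O, z * Oθ, z * χ] * H₂ (z, w ![z, z * g, z * O, z * Oθ, z * χ]))) -
      z * G (z, w ![z, z * g, z * O, z * Oθ, z * χ]) * (qθ + z * Oθ) +
      ((2 * S.b : ℂ) • Pf ![z, z * g, z * O, z * Oθ, z * χ] +
        H (z, w ![z, z * g, z * O, z * Oθ, z * χ])) *
        ((-3 * k₀) • 1 - (4 : ℂ) • (z * q) + Xz ![z, z * g, z * O, z * Oθ, z * χ]) := rfl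
    rw [hPfe, hwe, hXe] at h1
    exact hχ.trans h1
  have hgn : ‖g‖ ≤ Cm * R := ((M 1).le_of_opNorm_le (hM 1) χ).trans (by gcongr)
  have hOn : ‖O‖ ≤ Cm * R := ((M 2).le_of_opNorm_le (hM 2) χ).trans (by gcongr)
  have hOθn : ‖Oθ‖ ≤ Cm * R := ((M 3).le_of_opNorm_le (hM 3) χ).trans (by gcongr)
  have hzm : ∀ u : B, ‖z * u‖ ≤ ‖u‖ := fun u =>
    (norm_mul_le _ _).trans (mul_le_of_le_one_left (norm_nonneg _) hz1)
  have hΨn : ‖Ψ‖ ≤ Q := by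
    refine (norm_add_le _ _).trans (add_le_add ((norm_add_le _ _).trans (by gcongr)) ?_)
    exact (hzm O).trans hOn
  have hPvn : ‖Pv‖ ≤ P₀ := by
    refine (norm_add_le _ _).trans (add_le_add ?_ ((hzm _).trans hΨn))
    rw [norm_smul, norm_one, mul_one]
  have hsmall : dist (z, wv) 0 < δ := by
    rw [dist_zero_right, Prod.norm_def]
    have h1 : ‖wv‖ ≤ ‖z‖ * (‖S.coupling‖ * P₀) := by
      rw [hwv, norm_smul]
      calc _ ≤ ‖S.coupling‖ * (‖z‖ * P₀) := by
            gcongr; exact (norm_mul_le _ _).trans (by gcongr)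
        _ = _ := by ring
    have h2 : ‖z‖ * (1 + ‖S.coupling‖ * P₀) ≤ δ / 2 := by
      have hpos : 0 < 1 + ‖S.coupling‖ * P₀ := by positivity
      calc _ ≤ δ / (2 * (1 + ‖S.coupling‖ * P₀)) * (1 + ‖S.coupling‖ * P₀) := by gcongr
        _ = δ / 2 := by field_simp
    have h3 : 0 ≤ ‖z‖ * (‖S.coupling‖ * P₀) := by positivity
    have h4 := norm_nonneg z
    exact max_lt (by nlinarith) (by nlinarith)
  obtain ⟨hval, hFv, hHv⟩ := hall hsmall
  -- In the `s`-derivative the mean of `χ` produced by `g` cancels the mean subtracted in the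
  -- equation of `O`, so `χ` itself remains.
  have hpart : HasPartials κ (z ^ 3 * Pv) (z ^ 4 * (qθ + z * Oθ))
      (z ^ 4 * ((-3 * k₀) • 1 - (4 : ℂ) • (z * q) + z * X)) := by
    have hzp : HasPartials κ z 0 (-(z * z)) := hasPartials_zEl D hκ0.ne'
    have hqp : HasPartials κ q qθ ((-(S.α : ℂ)⁻¹) • 0) := (HasPartials.of_prim hκ0.ne' hKc).smul _
    have hgp := hasPartials_radL D hκ0 hν1 S.d χ
    have hOp := hasPartials_oscL D hα hd hκ0 χ
    have h := (((hzp.mul hzp).mul hzp).mul ((HasPartials.const_smul_one k₀).add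
      (hzp.mul ((hqp.add hgp).add (hzp.mul hOp)))))
    have hν' : ((ν - 1 : ℝ) : ℂ) = 4 + 2 * (S.d : ℂ)⁻¹ := by rw [hν]; push_cast; ring
    rw [hν'] at h
    convert h using 1
    · rw [pow_three']
    · simp only [Algebra.smul_def]; ring
    · rw [hX]
      simp only [Algebra.smul_def, map_add, map_mul, map_ofNat, map_neg, one_div, ← hz, ← hgdef,
        ← hO, ← hOθ]
      ring
  refine ⟨Ψ, qθ + z * Oθ, (-3 * k₀) • 1 - (4 : ℂ) • (z * q) + z * X,
    hΨn.trans (le_max_left _ _), ?_, ?_, hpart, ?_⟩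
  · refine le_trans ?_ ((le_max_left _ _).trans (le_max_right _ _))
    exact (norm_add_le _ _).trans (by gcongr; exact (hzm _).trans hOθn)
  · refine le_trans ?_ ((le_max_right _ _).trans (le_max_right _ _))
    refine (norm_add_le _ _).trans (add_le_add ((norm_sub_le _ _).trans (add_le_add ?_ ?_))
      ((hzm _).trans ?_))
    · rw [norm_smul, norm_one, mul_one, norm_mul]; simp
    · rw [norm_smul]
      have : ‖(4 : ℂ)‖ = 4 := by simp
      rw [this]; gcongr; exact hzm q
    · have h2 : ‖(2 : ℂ)‖ = 2 := by simp
      have h5 : ‖(5 : ℂ)‖ = 5 := by simp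
      refine (norm_sub_le _ _).trans (add_le_add ?_ ?_)
      · rw [norm_smul]
        gcongr
        refine (norm_add_le _ _).trans (add_le_add ((norm_add_le _ _).trans (add_le_add hχR ?_)) ?_)
        · rw [norm_smul, h2]; gcongr
        · rw [norm_smul, Complex.norm_real, Real.norm_of_nonneg hα.le]; gcongr
      · rw [norm_smul, h5]; gcongr; exact (hzm O).trans hOn
  · intro s hs θ hθ
    have hs0 : s ≠ 0 := fun h => zero_notMem D (by simpa [h] using hs)
    set η := evHom (U := U) (σ := σ) hs hθ.le with hη
    have hηz : η z = s⁻¹ := by rw [hη, evHom_apply, hz, ev_zEl D hκ0.ne' hs hθ.le]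
    have hηP : η (z ^ 3 * Pv) = (s⁻¹) ^ 3 * η Pv := by rw [map_mul, map_pow, hηz]
    have hηw : η wv = S.coupling * s ^ 2 * ((s⁻¹) ^ 3 * η Pv) := by
      rw [hwv, map_smul, map_mul, hηz, smul_eq_mul]; field_simp
    obtain ⟨eF, eG, eH⟩ := hval η (isContractive_evHom hs hθ.le) s θ _ hs0
      ((evHom_apply _ _ _).trans (ev_cosEl hs hθ.le)) ((evHom_apply _ _ _).trans (ev_sinEl hs hθ.le))
      hηz hηw
    have hFv' := congrArg η hFv
    have hHv' := congrArg η hHv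
    have hχ' := congrArg η hχe
    have hK' := congrArg η hK
    have hqθ' := congrArg η hqθ
    have hX' := congrArg η hX
    have hΨ' := congrArg η hΨ
    have hPv' := congrArg η hPv
    rw [hKm] at hqθ'
    simp only [lead, map_add, map_sub, map_smul, map_mul, map_one, smul_eq_mul, mul_one, hηz, hηw]
      at hFv' hHv' hχ' hK' hqθ' hX' hΨ' hPv'
    unfold InnerEquationAt
    rw [hpart.pds_eq hs hθ, hpart.pdθ_eq hs hθ]
    beta_reduce
    simp only [← evHom_apply hs hθ.le]
    rw [← hPv, ← hη, hηP, eF, eG, eH]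
    simp only [map_add, map_sub, map_smul, map_mul, map_pow, map_one, smul_eq_mul, mul_one, hηz]
    set Z := s⁻¹ with hZ
    have hsZ : s * Z = 1 := mul_inv_cancel₀ hs0
    have hs2 : ∀ a b : ℂ, s ^ 2 * (2 * S.b * (Z ^ 3 * a) + Z ^ 3 * b) = Z * (2 * S.b * a + b) := by
      intro a b
      linear_combination Z * (2 * S.b * a + b) * (s * Z + 1) * hsZ
    have hw2 : S.coupling * s ^ 2 * (Z ^ 3 * η Pv) = S.coupling * (Z * η Pv) := by
      linear_combination S.coupling * Z * η Pv * (s * Z + 1) * hsZ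
    rw [hs2]
    rw [hw2] at hFv' hHv'
    have hαq : S.α * η qθ = -(η K - S.leadMean cf cg ch) := by
      rw [hqθ']; field_simp
    have hdX : S.d * η X = η χ + 2 * η g + S.α * η Oθ - 5 * S.d * (Z * η O) := by
      rw [hX']; field_simp
    rw [← he] at hK' ⊢
    generalize η (F (z, wv)) = vF at *
    generalize η (G (z, wv)) = vG at *
    generalize η (H (z, wv)) = vH at *
    generalize η (F₁ (z, wv)) = vF₁ at *
    generalize η (F₂ (z, wv)) = vF₂ at *
    generalize η (H₁ (z, wv)) = vH₁ at *
    generalize η (H₂ (z, wv)) = vH₂ at *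
    -- Order `s⁻⁴` closes by the choice of `q` and `ψ₀`, the higher orders by the fixed-point
    -- equation for `χ`.
    linear_combination Z ^ 5 * hdX + Z ^ 5 * hχ' - Z ^ 4 * hFv' - Z ^ 4 * e * hHv' -
      Z ^ 4 * hαq + Z ^ 4 * hK' - Z ^ 4 * hk₀m - 2 * Z ^ 4 * hPv' - 2 * Z ^ 5 * hΨ'

end InnerSystem

open WienerAlg in
theorem InnerSystem.isInnerSolution_of_formal {S : InnerSystem} {U : Opens ℂ} (D : ModeDomain U)
    {σ : ℝ≥0} {τ κ : ℝ} (hτ : τ < σ) (hκ : 0 < κ) {E : Set ℂ} (hE : ∀ s ∈ E, s / κ ∈ U) {c : ℂ}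
    {Ψ Ψθ Ψs : WienerAlg (HolB U) σ} [Nonempty U]
    (hpart : HasPartials κ (zEl D σ κ ^ 3 * (c • 1 + zEl D σ κ * Ψ)) (zEl D σ κ ^ 4 * Ψθ)
      (zEl D σ κ ^ 4 * Ψs))
    (heq : ∀ s : ℂ, s / κ ∈ U → ∀ θ : ℂ, |θ.im| < σ →
        S.InnerEquationAt (fun s θ => ev (zEl D σ κ ^ 3 * (c • 1 + zEl D σ κ * Ψ)) (s / κ) θ) s θ) :
    S.IsInnerSolution E τ
      (fun s θ => ev (zEl D σ κ ^ 3 * (c • 1 + zEl D σ κ * Ψ)) (s / κ) θ) where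
  regular := isAnalyticPeriodic_ev hτ _ hE
  equation s hs θ hθ := heq s (hE s hs) θ (lt_of_le_of_lt hθ hτ)
  bound := by
    set z := zEl D σ κ with hz
    refine ⟨max ‖c • 1 + z * Ψ‖ (max ‖Ψs‖ ‖Ψθ‖), fun s hs θ hθ => ?_⟩
    have hθ' : |θ.im| < σ := lt_of_le_of_lt hθ hτ
    have hs' := hE s hs
    have hb : ∀ (n : ℕ) (u : WienerAlg (HolB U) σ), ‖ev (z ^ n * u) (s / κ) θ‖ ≤ ‖u‖ / ‖s‖ ^ n := by
      intro n u
      rw [← evHom_apply hs' hθ'.le, map_mul, map_pow, evHom_apply, evHom_apply, hz,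
        ev_zEl D hκ.ne' hs' hθ'.le, norm_mul, norm_pow, norm_inv, inv_pow, inv_mul_eq_div]
      gcongr
      exact norm_ev_le u _ hθ'.le
    rw [hpart.pds_eq hs' hθ', hpart.pdθ_eq hs' hθ']
    refine ⟨(hb 3 _).trans ?_, (hb 4 _).trans ?_, (hb 4 _).trans ?_⟩
    · gcongr; exact le_max_left _ _
    · gcongr; exact (le_max_left _ _).trans (le_max_right _ _)
    · gcongr; exact (le_max_right _ _).trans (le_max_right _ _)

/-! ### Fourier expansion of arbitrary inner solutions. -/

theorem integral_deriv_mul_exp {h h' : ℝ → ℂ} (hd : ∀ t, HasDerivAt h (h' t) t)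
    (hc : Continuous h') (hper : h (2 * Real.pi) = h 0) (l : ℤ) :
    ∫ t in (0 : ℝ)..(2 * Real.pi), h' t * exp (-(I * l * t)) =
      I * l * ∫ t in (0 : ℝ)..(2 * Real.pi), h t * exp (-(I * l * t)) := by
  have hcont : Continuous h := continuous_iff_continuousAt.2 fun t => (hd t).continuousAt
  have he : ∀ t : ℝ, HasDerivAt (fun t : ℝ => exp (-(I * l * t)))
      (exp (-(I * l * t)) * -(I * l * 1)) t := fun t =>
    (Complex.ofRealCLM.hasDerivAt.const_mul (I * (l : ℂ))).neg.cexp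
  have key := intervalIntegral.integral_eq_sub_of_hasDerivAt (a := 0) (b := 2 * Real.pi)
    (fun t _ => (hd t).mul (he t)) (Continuous.intervalIntegrable (by fun_prop) _ _)
  rw [intervalIntegral.integral_add (Continuous.intervalIntegrable (by fun_prop) _ _)
    (Continuous.intervalIntegrable (by fun_prop) _ _)] at key
  have h2 : ∫ t in (0 : ℝ)..(2 * Real.pi), h t * (exp (-(I * l * t)) * -(I * l * 1)) =
      -(I * l) * ∫ t in (0 : ℝ)..(2 * Real.pi), h t * exp (-(I * l * t)) := by
    rw [← intervalIntegral.integral_const_mul]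
    congr 1; ext t; ring
  rw [h2] at key
  have h3 : exp (-(I * l * ((2 * Real.pi : ℝ) : ℂ))) = 1 := by
    have : -(I * l * ((2 * Real.pi : ℝ) : ℂ)) = (-l : ℤ) * (2 * Real.pi * I) := by push_cast; ring
    rw [this, Complex.exp_int_mul_two_pi_mul_I]
  simp only [Pi.mul_apply, h3, hper, Complex.ofReal_zero, mul_zero, neg_zero, Complex.exp_zero,
    sub_self] at key
  linear_combination key

/-- The Fourier coefficients of a smooth function are of second order. -/
theorem norm_fourier_le {h h' h'' : ℝ → ℂ} (hd : ∀ t, HasDerivAt h (h' t) t)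
    (hd' : ∀ t, HasDerivAt h' (h'' t) t) (hc : Continuous h'') (hper : h (2 * Real.pi) = h 0)
    (hper' : h' (2 * Real.pi) = h' 0) {M M'' : ℝ} (hM : ∀ t, ‖h t‖ ≤ M) (hM'' : ∀ t, ‖h'' t‖ ≤ M'')
    (l : ℤ) : ‖(1 / (2 * Real.pi) : ℂ) * ∫ t in (0 : ℝ)..(2 * Real.pi), h t * exp (-(I * l * t))‖ ≤
      (M + M'') * (1 / (l : ℝ) ^ 2 + if l = 0 then 1 else 0) := by
  have hM0 : 0 ≤ M := (norm_nonneg _).trans (hM 0)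
  have hM0'' : 0 ≤ M'' := (norm_nonneg _).trans (hM'' 0)
  have hbd : ∀ (k : ℝ → ℂ) (N : ℝ), (∀ t, ‖k t‖ ≤ N) →
      ‖(1 / (2 * Real.pi) : ℂ) * ∫ t in (0 : ℝ)..(2 * Real.pi), k t * exp (-(I * l * t))‖ ≤ N := by
    intro k N hk
    have h1 : ‖∫ t in (0 : ℝ)..(2 * Real.pi), k t * exp (-(I * l * t))‖ ≤ N * |2 * Real.pi - 0| := by
      refine intervalIntegral.norm_integral_le_of_norm_le_const fun t _ => ?_
      have : ‖exp (-(I * l * t))‖ = 1 := by rw [Complex.norm_exp]; simp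
      rw [norm_mul, this, mul_one]
      exact hk t
    have hπ := Real.pi_pos
    rw [sub_zero, abs_of_pos (by positivity)] at h1
    have h2 : ‖(1 / (2 * Real.pi) : ℂ)‖ = 1 / (2 * Real.pi) := by
      simp [abs_of_pos hπ]
    rw [norm_mul, h2, one_div, inv_mul_le_iff₀ (by positivity), mul_comm (2 * Real.pi)]
    exact h1
  by_cases hl : l = 0
  · refine (hbd h M hM).trans ?_
    rw [if_pos hl, hl]
    simp
    exact hM0''
  · rw [if_neg hl, add_zero]
    have hcont' : Continuous h' := continuous_iff_continuousAt.2 fun t => (hd' t).continuousAt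
    have h1 := integral_deriv_mul_exp hd hcont' hper l
    have h2 := integral_deriv_mul_exp hd' hc hper' l
    have h3 := hbd h'' M'' hM''
    rw [h2, h1] at h3
    have e : (1 / (2 * Real.pi) : ℂ) * (I * l * (I * l * ∫ t in (0 : ℝ)..(2 * Real.pi),
        h t * exp (-(I * l * t)))) = -((l : ℂ) ^ 2) * ((1 / (2 * Real.pi) : ℂ) *
        ∫ t in (0 : ℝ)..(2 * Real.pi), h t * exp (-(I * l * t))) := by
      linear_combination (1 / (2 * Real.pi) : ℂ) * l ^ 2 * (∫ t in (0 : ℝ)..(2 * Real.pi),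
        h t * exp (-(I * l * t))) * I_sq
    have hl' : (0 : ℝ) < (l : ℝ) ^ 2 := by positivity
    rw [e, norm_mul, norm_neg, norm_pow, Complex.norm_intCast, sq_abs, ← le_div_iff₀' hl'] at h3
    refine h3.trans ?_
    rw [mul_one_div]
    gcongr
    linarith

/-- At `l = 0` the quotient `1 / l ^ 2` is `0` by convention; the added indicator accounts for the
mean. -/
theorem summable_fourier_bound :
    Summable fun l : ℤ => (1 / (l : ℝ) ^ 2 + if l = 0 then (1 : ℝ) else 0) :=
  (Real.summable_one_div_int_pow.2 (by norm_num)).add (hasSum_ite_eq 0 (1 : ℝ)).summable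

/-- A continuous periodic function with summable Fourier coefficients is the sum of its Fourier
series. -/
theorem hasSum_fourier_of_summable {h : ℝ → ℂ} (hc : Continuous h)
    (hper : Function.Periodic h (2 * Real.pi)) {a : ℤ → ℂ} (ha : ∀ l : ℤ,
      a l = (1 / (2 * Real.pi) : ℂ) * ∫ t in (0 : ℝ)..(2 * Real.pi), h t * exp (-(I * l * t)))
    (hs : Summable a) (t : ℝ) : HasSum (fun l : ℤ => a l * exp (I * l * t)) (h t) := by
  have : Fact (0 < 2 * Real.pi) := ⟨Real.two_pi_pos⟩
  let f : C(AddCircle (2 * Real.pi), ℂ) := ⟨hper.lift, continuous_coinduced_dom.2 hc⟩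
  have hf : ∀ x : ℝ, f (x : AddCircle (2 * Real.pi)) = h x := fun x => rfl
  have hπ : (Real.pi : ℂ) ≠ 0 := by exact_mod_cast Real.pi_ne_zero
  have hexp : ∀ (n : ℤ) (x : ℝ), fourier n (x : AddCircle (2 * Real.pi)) = exp (I * n * x) := by
    intro n x
    rw [fourier_coe_apply]
    congr 1
    push_cast
    field_simp
  have hcoef : ∀ l, fourierCoeff f l = a l := by
    intro l
    rw [fourierCoeff_eq_intervalIntegral f l 0, ha l, zero_add]
    simp only [hf, hexp]
    rw [Complex.real_smul]
    push_cast
    congr 1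
    refine intervalIntegral.integral_congr fun x _ => ?_
    simp only [smul_eq_mul]
    rw [mul_comm]
    congr 2
    ring
  have hsum : Summable (fourierCoeff f) := by
    refine hs.congr fun l => (hcoef l).symm
  have := has_pointwise_sum_fourier_series_of_summable hsum (t : AddCircle (2 * Real.pi))
  simp only [hcoef, hexp, smul_eq_mul] at this
  exact this

/-- A bound for the norm of the Fourier series of a function on a strip. -/
def fourierConst (σ : ℝ) : ℝ :=
  (1 + 1 / (σ / 3) / (σ / 3)) * ∑' l : ℤ, (1 / (l : ℝ) ^ 2 + if l = 0 then (1 : ℝ) else 0)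

/-- A bounded analytic periodic function is given by an absolutely convergent Fourier series with
holomorphic coefficients. -/
theorem WienerAlg.exists_ev_eq {V : Opens ℂ} {σ M : ℝ} (hσ : 0 < σ) {g : ℂ → ℂ → ℂ}
    (h1 : ∀ s ∈ V, DifferentiableOn ℂ (g s) {θ | |θ.im| < σ})
    (h2 : ∀ t : ℝ, DifferentiableOn ℂ (fun s => g s t) V)
    (h3 : ∀ s ∈ V, ∀ θ : ℂ, |θ.im| < σ → g s (θ + 2 * Real.pi) = g s θ) (hM0 : 0 ≤ M)
    (h4 : ∀ s ∈ V, ∀ θ : ℂ, |θ.im| < σ → ‖g s θ‖ ≤ M) :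
    ∃ u : WienerAlg (HolB V) 0, ‖u‖ ≤ fourierConst σ * M ∧ ∀ s ∈ V, ∀ t : ℝ, ev u s t = g s t := by
  have hopen : IsOpen {θ : ℂ | |θ.im| < σ} := isOpen_lt (by fun_prop) continuous_const
  have hr : 0 < σ / 3 := by positivity
  have hreal : ∀ t : ℝ, (t : ℂ) ∈ {θ : ℂ | |θ.im| < σ} := fun t => by simpa using hσ
  have hball : ∀ θ : ℂ, |θ.im| ≤ σ / 3 → ∀ w ∈ Metric.closedBall θ (σ / 3), |w.im| ≤ 2 * (σ / 3) := by
    intro θ hθ w hw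
    rw [Metric.mem_closedBall, dist_eq_norm] at hw
    have e1 := (Complex.abs_im_le_norm (w - θ)).trans hw
    rw [Complex.sub_im] at e1
    have e2 := abs_sub_abs_le_abs_sub w.im θ.im
    linarith
  -- Cauchy's estimate is used twice with radius `σ / 3`: for the first derivative on the strip of
  -- half-width `σ / 3`, then for the second derivative on the real line.
  have hd1 : ∀ s ∈ V, ∀ θ : ℂ, |θ.im| ≤ σ / 3 → ‖deriv (g s) θ‖ ≤ M / (σ / 3) := by
    intro s hs θ hθ
    refine Complex.norm_deriv_le_of_forall_mem_sphere_norm_le hr ?_ fun w hw => ?_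
    · refine ((h1 s hs).mono fun w hw => ?_).diffContOnCl_ball Subset.rfl
      have := hball θ hθ w hw
      change |w.im| < σ
      linarith
    · refine h4 s hs w ?_
      have := hball θ hθ w (Metric.sphere_subset_closedBall hw)
      linarith
  have hdd : ∀ s ∈ V, DifferentiableOn ℂ (deriv (g s)) {θ | |θ.im| < σ} := fun s hs =>
    (h1 s hs).deriv hopen
  have hd2 : ∀ s ∈ V, ∀ t : ℝ, ‖deriv (deriv (g s)) t‖ ≤ M / (σ / 3) / (σ / 3) := by
    intro s hs t
    refine Complex.norm_deriv_le_of_forall_mem_sphere_norm_le hr ?_ fun w hw => ?_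
    · refine ((hdd s hs).mono fun w hw => ?_).diffContOnCl_ball Subset.rfl
      have := hball t (by simpa using hr.le) w hw
      change |w.im| < σ
      linarith
    · refine hd1 s hs w ?_
      have hw' := Metric.sphere_subset_closedBall hw
      rw [Metric.mem_closedBall, dist_eq_norm] at hw'
      have e1 := (Complex.abs_im_le_norm (w - t)).trans hw'
      simpa using e1
  have hreal1 : ∀ s ∈ V, ∀ t : ℝ, HasDerivAt (fun t : ℝ => g s t) (deriv (g s) t) t := fun s hs t =>
    (((h1 s hs).differentiableAt (hopen.mem_nhds (hreal t))).hasDerivAt).comp_ofReal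
  have hreal2 : ∀ s ∈ V, ∀ t : ℝ,
      HasDerivAt (fun t : ℝ => deriv (g s) t) (deriv (deriv (g s)) t) t := fun s hs t =>
    (((hdd s hs).differentiableAt (hopen.mem_nhds (hreal t))).hasDerivAt).comp_ofReal
  have hcont2 : ∀ s ∈ V, Continuous fun t : ℝ => deriv (deriv (g s)) t := fun s hs =>
    ContinuousOn.comp_continuous (((hdd s hs).deriv hopen).continuousOn) Complex.continuous_ofReal hreal
  have hcont : ∀ s ∈ V, Continuous fun t : ℝ => g s t := fun s hs =>
    ContinuousOn.comp_continuous ((h1 s hs).continuousOn) Complex.continuous_ofReal hreal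
  have hper : ∀ s ∈ V, Function.Periodic (fun t : ℝ => g s t) (2 * Real.pi) := fun s hs t => by
    have := h3 s hs t (hreal t)
    push_cast
    exact this
  have hper' : ∀ s ∈ V, deriv (g s) ((2 * Real.pi : ℝ) : ℂ) = deriv (g s) ((0 : ℝ) : ℂ) := by
    intro s hs
    have e : (fun θ => g s (θ + 2 * Real.pi)) =ᶠ[𝓝 ((0 : ℝ) : ℂ)] g s := by
      filter_upwards [hopen.mem_nhds (hreal 0)] with θ hθ using h3 s hs θ hθ
    rw [← e.deriv_eq, deriv_comp_add_const]
    congr 1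
    push_cast
    ring
  have hbound : ∀ s ∈ V, ∀ l : ℤ, ‖(1 / (2 * Real.pi) : ℂ) * ∫ t in (0 : ℝ)..(2 * Real.pi),
      g s t * exp (-(I * l * t))‖ ≤ (M + M / (σ / 3) / (σ / 3)) *
        (1 / (l : ℝ) ^ 2 + if l = 0 then 1 else 0) := fun s hs l =>
    norm_fourier_le (hreal1 s hs) (hreal2 s hs) (hcont2 s hs)
      (by simpa using hper s hs 0) (hper' s hs) (fun t => h4 s hs t (hreal t)) (hd2 s hs) l
  have hdiff : ∀ l : ℤ, DifferentiableOn ℂ (fun s => (1 / (2 * Real.pi) : ℂ) *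
      ∫ t in (0 : ℝ)..(2 * Real.pi), g s t * exp (-(I * l * t))) V := by
    intro l s hs
    refine (DifferentiableAt.const_mul ?_ _).differentiableWithinAt
    simp only [intervalIntegral.integral_of_le Real.two_pi_pos.le]
    refine (hasDerivAt_integral_of_holomorphic (μ := volume.restrict (Ioc 0 (2 * Real.pi))) V.isOpen
      (H := fun (t : ℝ) x => g x t * exp (-(I * l * t))) (bound := fun _ => M)
      (Eventually.of_forall fun t => (h2 t).mul_const _) (fun x hx => ?_)
      (Eventually.of_forall fun t x hx => ?_) (integrable_const _) hs).2.differentiableAt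
    · exact ((hcont x hx).mul (by fun_prop)).aestronglyMeasurable
    · have : ‖exp (-(I * l * t))‖ = 1 := by rw [Complex.norm_exp]; simp
      rw [norm_mul, this, mul_one]
      exact h4 x hx t (hreal t)
  let a : ℤ → HolB V := fun l => HolB.ofFun _ (hdiff l) _ fun s hs => hbound s hs l
  have han : ∀ l, ‖a l‖ ≤ (M + M / (σ / 3) / (σ / 3)) * (1 / (l : ℝ) ^ 2 + if l = 0 then 1 else 0) := by
    intro l
    refine HolB.norm_le_of_fn (mul_nonneg (by positivity) ?_) fun s hs => ?_
    · split_ifs <;> positivity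
    · rw [HolB.fn_ofFun (hdiff l) _ hs]
      exact hbound s hs l
  have hsum : Summable fun l : ℤ =>
      (M + M / (σ / 3) / (σ / 3)) * (1 / (l : ℝ) ^ 2 + if l = 0 then (1 : ℝ) else 0) :=
    summable_fourier_bound.mul_left _
  have hasum : Summable fun l => ‖a l‖ := .of_nonneg_of_le (fun _ => norm_nonneg _) han hsum
  refine ⟨ofSummable a hasum, ?_, fun s hs t => ?_⟩
  · rw [← (hasSum_norm (ofSummable a hasum)).tsum_eq]
    refine (Summable.tsum_le_tsum han hasum hsum).trans (le_of_eq ?_)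
    rw [tsum_mul_left, fourierConst]
    ring
  · have hval : ∀ l, (a l).fn s = (1 / (2 * Real.pi) : ℂ) * ∫ t in (0 : ℝ)..(2 * Real.pi),
      g s t * exp (-(I * l * t)) := fun l => HolB.fn_ofFun (hdiff l) _ hs
    have h5 := hasSum_fourier_of_summable (hcont s hs) (hper s hs) hval
      (.of_norm_bounded hasum fun l => HolB.norm_fn_le _ _) t
    rw [ev, ← h5.tsum_eq]
    refine tsum_congr fun l => ?_
    rw [coeff_ofSummable, modeFun]
    simp [modeWeight]

section Partials

variable {ψ : ℂ → ℂ → ℂ} {s θ : ℂ}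

theorem hasDerivAt_pds (h : AnalyticAt ℂ (fun p : ℂ × ℂ => ψ p.1 p.2) (s, θ)) :
    HasDerivAt (fun x => ψ x θ) (pds ψ s θ) s := by
  have h1 : DifferentiableAt ℂ (fun x => ψ x θ) s :=
    DifferentiableAt.fun_comp' (g := fun p : ℂ × ℂ => ψ p.1 p.2) (f := fun x => (x, θ)) s
      h.differentiableAt (by fun_prop)
  exact h1.hasDerivAt

theorem hasDerivAt_pdθ (h : AnalyticAt ℂ (fun p : ℂ × ℂ => ψ p.1 p.2) (s, θ)) :
    HasDerivAt (fun w => ψ s w) (pdθ ψ s θ) θ := by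
  have h1 : DifferentiableAt ℂ (fun w => ψ s w) θ :=
    DifferentiableAt.fun_comp' (g := fun p : ℂ × ℂ => ψ p.1 p.2) (f := fun w => (s, w)) θ
      h.differentiableAt (by fun_prop)
  exact h1.hasDerivAt

theorem analyticAt_pds (h : AnalyticAt ℂ (fun p : ℂ × ℂ => ψ p.1 p.2) (s, θ)) :
    AnalyticAt ℂ (fun p : ℂ × ℂ => pds ψ p.1 p.2) (s, θ) := by
  have h1 : AnalyticAt ℂ (fun p => fderiv ℂ (fun p : ℂ × ℂ => ψ p.1 p.2) p (1, 0)) (s, θ) :=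
    ((ContinuousLinearMap.apply ℂ ℂ ((1, 0) : ℂ × ℂ)).analyticAt _).comp h.fderiv
  refine h1.congr ?_
  filter_upwards [h.eventually_analyticAt] with p hp
  have h2 : HasDerivAt (fun x : ℂ => (x, p.2)) ((1, 0) : ℂ × ℂ) p.1 :=
    (hasDerivAt_id p.1).prodMk (hasDerivAt_const _ _)
  have h3 := (hp.differentiableAt.hasFDerivAt (x := (p.1, p.2))).comp_hasDerivAt p.1 h2
  exact h3.deriv.symm

theorem analyticAt_pdθ (h : AnalyticAt ℂ (fun p : ℂ × ℂ => ψ p.1 p.2) (s, θ)) :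
    AnalyticAt ℂ (fun p : ℂ × ℂ => pdθ ψ p.1 p.2) (s, θ) := by
  have h1 : AnalyticAt ℂ (fun p => fderiv ℂ (fun p : ℂ × ℂ => ψ p.1 p.2) p (0, 1)) (s, θ) :=
    ((ContinuousLinearMap.apply ℂ ℂ ((0, 1) : ℂ × ℂ)).analyticAt _).comp h.fderiv
  refine h1.congr ?_
  filter_upwards [h.eventually_analyticAt] with p hp
  have h2 : HasDerivAt (fun x : ℂ => (p.1, x)) ((0, 1) : ℂ × ℂ) p.2 :=
    (hasDerivAt_const _ _).prodMk (hasDerivAt_id p.2)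
  have h3 := (hp.differentiableAt.hasFDerivAt (x := (p.1, p.2))).comp_hasDerivAt p.2 h2
  exact h3.deriv.symm

end Partials

namespace WienerAlg

variable {V : Opens ℂ}

/-- The norm bound does not involve `κ`, which permits enlarging `κ` after the bound is fixed. -/
theorem exists_ev_scaled_eq {σ M κ : ℝ} (hσ : 0 < σ) (hκ : κ ≠ 0) {g : ℂ → ℂ → ℂ}
    (h1 : ∀ s : ℂ, s / κ ∈ V → ∀ θ : ℂ, |θ.im| < σ → AnalyticAt ℂ (fun p : ℂ × ℂ => g p.1 p.2) (s, θ))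
    (h2 : ∀ s : ℂ, s / κ ∈ V → ∀ θ : ℂ, |θ.im| < σ → g s (θ + 2 * Real.pi) = g s θ) (hM0 : 0 ≤ M)
    (h3 : ∀ s : ℂ, s / κ ∈ V → ∀ θ : ℂ, |θ.im| < σ → ‖g s θ‖ ≤ M) :
    ∃ u : WienerAlg (HolB V) 0, ‖u‖ ≤ fourierConst σ * M ∧
      ∀ s : ℂ, s / κ ∈ V → ∀ t : ℝ, ev u (s / κ) t = g s t := by
  have hκ' : (κ : ℂ) ≠ 0 := by exact_mod_cast hκ
  have hm : ∀ s ∈ V, (κ * s) / (κ : ℂ) ∈ V := fun s hs => by rwa [mul_div_cancel_left₀ _ hκ']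
  obtain ⟨u, hu, he⟩ := exists_ev_eq (V := V) (g := fun s θ => g (κ * s) θ) hσ
    (fun s hs θ hθ => (hasDerivAt_pdθ (h1 _ (hm s hs) θ hθ)).differentiableAt.differentiableWithinAt)
    (fun t s hs => ((hasDerivAt_pds (h1 _ (hm s hs) t (by simpa using hσ))).differentiableAt.fun_comp'
      s (by fun_prop : DifferentiableAt ℂ (fun s : ℂ => (κ : ℂ) * s) s)).differentiableWithinAt)
    (fun s hs θ hθ => h2 _ (hm s hs) θ hθ) hM0 (fun s hs θ hθ => h3 _ (hm s hs) θ hθ)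
  refine ⟨u, hu, fun s hs t => ?_⟩
  rw [he _ hs, mul_div_cancel₀ _ hκ']

theorem continuous_ev_real {σ : ℝ≥0} (u : WienerAlg (HolB V) σ) (s : ℂ) :
    Continuous fun t : ℝ => ev u s t :=
  continuous_tsum (fun l => by simp only [modeFun]; fun_prop) u.summable_norm
    fun l t => norm_evTerm_le u s (by simp) l

theorem coeff_eq_of_hasDerivAt_angle {u v : WienerAlg (HolB V) 0}
    (h : ∀ s ∈ V, ∀ t : ℝ, HasDerivAt (fun t : ℝ => ev u s t) (ev v s t) t) (l : ℤ) :
    v.coeff l = (I * l) • u.coeff l := by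
  refine HolB.ext_fn fun s hs => ?_
  have hper : ev u s ((2 * Real.pi : ℝ) : ℂ) = ev u s ((0 : ℝ) : ℂ) := by
    have := ev_add_two_pi u s 0
    rw [zero_add] at this
    push_cast
    exact this
  have h1 := integral_deriv_mul_exp (h s hs) (continuous_ev_real v s) hper l
  rw [integral_ev_mul_exp, integral_ev_mul_exp] at h1
  have hw : (modeWeight 0 l : ℂ) ≠ 0 := by exact_mod_cast (modeWeight_pos 0 l).ne'
  have hπ : (Real.pi : ℂ) ≠ 0 := by exact_mod_cast Real.pi_ne_zero
  rw [HolB.fn_smul _ _ hs]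
  field_simp at h1
  linear_combination h1

theorem hasDerivAt_coeff {u v : WienerAlg (HolB V) 0}
    (h : ∀ s ∈ V, ∀ t : ℝ, HasDerivAt (fun x => ev u x t) (ev v s t) s) (l : ℤ) {s : ℂ} (hs : s ∈ V) :
    HasDerivAt (u.coeff l).fn ((v.coeff l).fn s) s := by
  have hw : (modeWeight 0 l : ℂ) = 1 := by simp [modeWeight]
  have hπ : (Real.pi : ℂ) ≠ 0 := by exact_mod_cast Real.pi_ne_zero
  have hc : ∀ (u : WienerAlg (HolB V) 0) (x : ℂ), (u.coeff l).fn x = (1 / (2 * Real.pi) : ℂ) *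
      ∫ t in (0 : ℝ)..(2 * Real.pi), ev u x t * exp (-(I * l * t)) := by
    intro u x
    rw [integral_ev_mul_exp, hw]; field_simp
  have hd := (hasDerivAt_integral_of_holomorphic (μ := volume.restrict (Ioc 0 (2 * Real.pi))) V.isOpen
      (H := fun (t : ℝ) x => ev u x t * exp (-(I * l * t))) (bound := fun _ => ‖u‖)
      (Eventually.of_forall fun t x hx =>
        ((h x hx t).differentiableAt.mul_const _).differentiableWithinAt)
      (fun x _ => ((continuous_ev_real u x).mul (by fun_prop)).aestronglyMeasurable)
      (Eventually.of_forall fun t x _ => ?_) (integrable_const _) hs).2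
  · have e1 : ∀ t : ℝ, deriv (fun x => ev u x t * exp (-(I * l * t))) s =
        ev v s t * exp (-(I * l * t)) := fun t => ((h s hs t).mul_const _).deriv
    simp only [e1] at hd
    have h2 := hd.const_mul (1 / (2 * Real.pi) : ℂ)
    simp only [← intervalIntegral.integral_of_le Real.two_pi_pos.le, ← hc] at h2
    exact h2
  · have : ‖exp (-(I * l * t))‖ = 1 := by rw [Complex.norm_exp]; simp
    rw [norm_mul, this, mul_one]
    exact norm_ev_le u x (by simp)

/-- The elements `s³ ψ`, `s⁴ ∂_θ ψ` and `s⁴ ∂_s ψ` of a function `ψ`. -/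
structure IsTriple (D : ModeDomain V) (κ : ℝ) (u uθ us : WienerAlg (HolB V) 0) : Prop where
  angle : ∀ l, (zEl D 0 κ * uθ).coeff l = (I * l) • u.coeff l
  fst : ∀ l, ∀ s ∈ V,
    HasDerivAt (u.coeff l).fn (κ * ((zEl D 0 κ * ((3 : ℂ) • u + us)).coeff l).fn s) s

theorem IsTriple.sub {D : ModeDomain V} {κ : ℝ} {u uθ us v vθ vs : WienerAlg (HolB V) 0}
    (hu : IsTriple D κ u uθ us) (hv : IsTriple D κ v vθ vs) :
    IsTriple D κ (u - v) (uθ - vθ) (us - vs) where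
  angle l := by rw [mul_sub, coeff_sub, coeff_sub, hu.angle, hv.angle, smul_sub]
  fst l s hs := by
    have hsub : ∀ (a b : HolB V), ∀ x ∈ V, (a - b).fn x = a.fn x - b.fn x := fun a b x hx =>
      map_sub (HolB.evalHom hx) a b
    have e : zEl D 0 κ * ((3 : ℂ) • (u - v) + (us - vs)) =
        zEl D 0 κ * ((3 : ℂ) • u + us) - zEl D 0 κ * ((3 : ℂ) • v + vs) := by
      rw [smul_sub]; ring
    rw [e, coeff_sub, coeff_sub, hsub _ _ s hs, mul_sub]
    refine ((hu.fst l s hs).sub (hv.fst l s hs)).congr_of_eventuallyEq ?_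
    filter_upwards [V.isOpen.mem_nhds hs] with x hx using hsub _ _ x hx

/-- On a nonzero mode, boundedness of `uθ` says that `s u_l` is bounded; it solves the mode
equation, so uniqueness on the domain identifies it. On the zeroth mode the bounded solution of the
radial equation is unique. In the formula for `u` the nonzero modes are recovered from `uθ` with an
additional factor `1 / s`. -/
theorem IsTriple.solve {D : ModeDomain V} (hD : D.IsUnique) {α d κ : ℝ} (hα : 0 < α) (hd : 0 < d)
    (hκ : 0 < κ) {ν : ℝ} (hν1 : 1 < ν) (hν : ν = 4 + 2 / d) {u uθ us ω : WienerAlg (HolB V) 0}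
    (h : IsTriple D κ u uθ us)
    (heq : (d : ℂ) • us = ω + (2 : ℂ) • u + (α : ℂ) • uθ) :
    uθ = oscθL D hα hd hκ (ω + (4 * d + 2 : ℂ) • u) ∧
      u = radL D hν1 d ω + zEl D 0 κ * primL uθ := by
  have hκ' : (κ : ℂ) ≠ 0 := by exact_mod_cast hκ.ne'
  have hd' : (d : ℂ) ≠ 0 := by exact_mod_cast hd.ne'
  have hs0 : ∀ s ∈ V, s ≠ 0 := fun s hs h => zero_notMem D (h ▸ hs)
  have hang : ∀ l, ∀ s ∈ V, (uθ.coeff l).fn s = I * l * (κ * s * (u.coeff l).fn s) := by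
    intro l s hs
    have h1 := congrArg (fun a => HolB.fn a s) (h.angle l)
    simp only [coeff_zEl_mul D κ _ l hs, HolB.fn_smul _ _ hs] at h1
    have := hs0 s hs
    field_simp at h1
    linear_combination h1
  have heq' : ∀ l, ∀ s ∈ V, d * (us.coeff l).fn s =
      (ω.coeff l).fn s + 2 * (u.coeff l).fn s + α * (uθ.coeff l).fn s := by
    intro l s hs
    have h1 := congrArg (fun a => HolB.fn (coeff a l) s) heq
    simp only [coeff_smul, coeff_add, HolB.fn_smul _ _ hs, HolB.fn_add _ _ hs] at h1
    exact h1
  have hder : ∀ l, ∀ s ∈ V, HasDerivAt (u.coeff l).fn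
      (s⁻¹ * (3 * (u.coeff l).fn s + (us.coeff l).fn s)) s := by
    intro l s hs
    refine (h.fst l s hs).congr_deriv ?_
    rw [coeff_zEl_mul D κ _ l hs, coeff_add, coeff_smul, HolB.fn_add _ _ hs, HolB.fn_smul _ _ hs]
    field_simp
  constructor
  · refine ext_coeff fun l => ?_
    rw [oscθL, coeff_diag]
    by_cases hl : l = 0
    · subst hl
      rw [if_pos rfl, zero_apply]
      refine HolB.ext_fn fun s hs => ?_
      rw [hang 0 s hs, HolB.fn_zero]; simp
    · have hl' : I * (l : ℂ) ≠ 0 := mul_ne_zero I_ne_zero (by exact_mod_cast hl)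
      have hlr : (l : ℝ) ≠ 0 := by exact_mod_cast hl
      rw [if_neg hl]
      have key := hD (α * l * κ / d) (by positivity)
        ((κ / d : ℂ) • (ω + (4 * d + 2 : ℂ) • u).coeff l) ((I * l : ℂ)⁻¹ • uθ.coeff l) ?_
      · rw [map_smul] at key
        rw [smul_apply, smul_apply, key, smul_smul, mul_inv_cancel₀ hl', one_smul]
      · intro s hs
        have e : ∀ x ∈ V, ((I * l : ℂ)⁻¹ • uθ.coeff l).fn x = κ * x * (u.coeff l).fn x := by
          intro x hx
          rw [HolB.fn_smul _ _ hx, hang l x hx]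
          field_simp
        have h1 := ((hasDerivAt_id s).const_mul (κ : ℂ)).mul (hder l s hs)
        refine (h1.congr_deriv ?_).congr_of_eventuallyEq ?_
        · have := hs0 s hs
          have h2 := heq' l s hs
          rw [hang l s hs] at h2
          rw [e s hs, coeff_add, coeff_smul, HolB.fn_smul _ _ hs, HolB.fn_add _ _ hs,
            HolB.fn_smul _ _ hs]
          push_cast
          simp only [id]
          field_simp
          linear_combination h2
        · filter_upwards [V.isOpen.mem_nhds hs] with x hx using e x hx
  · refine ext_coeff fun l => ?_
    rw [coeff_add, radL, coeff_diag]
    by_cases hl : l = 0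
    · subst hl
      rw [if_pos rfl]
      refine HolB.ext_fn fun s hs => ?_
      have hc0 : (primL uθ).coeff 0 = 0 := by rw [coeff_primL, if_pos rfl]
      rw [HolB.fn_add _ _ hs, coeff_zEl_mul D κ _ 0 hs, hc0, HolB.fn_zero, mul_zero, add_zero,
        smul_apply, ← map_smul, HolB.fn_radialL _ _ _ _ hs]
      refine (HolB.radialFun_eq_of_hasDerivAt D.dilate hν1 (fun x hx => ?_) hs).symm
      have h2 := heq' 0 x hx
      rw [hang 0 x hx] at h2
      have := hs0 x hx
      rw [(hder 0 x hx).deriv, HolB.fn_smul _ _ hx, hν]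
      push_cast at h2 ⊢
      field_simp
      linear_combination h2
    · have hl' : (l : ℂ) ≠ 0 := by exact_mod_cast hl
      rw [if_neg hl, zero_apply, zero_add]
      refine HolB.ext_fn fun s hs => ?_
      have := hs0 s hs
      rw [coeff_zEl_mul D κ _ l hs, coeff_primL, if_neg hl, HolB.fn_smul _ _ hs, hang l s hs]
      field_simp

end WienerAlg

/-! ### Uniqueness of inner solutions. -/

/-- The closed domain bounded by two half lines of slope `m`. -/
def closedWedge (m κ : ℝ) : Set ℂ := {s | m * s.re + κ ≤ |s.im|}

theorem unstableDomain_eq (β₀ κ : ℝ) : unstableDomain β₀ κ = closedWedge (Real.tan β₀) κ := rfl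

theorem stableDomain_eq (β₀ κ : ℝ) : stableDomain β₀ κ = closedWedge (-Real.tan β₀) κ := by
  ext s
  simp [stableDomain, unstableDomain, closedWedge]

/-- The set is the union of two half-planes that share the real point `-κ / m`. -/
theorem isPreconnected_closedWedge {m : ℝ} (hm : m ≠ 0) (κ : ℝ) :
    IsPreconnected (closedWedge m κ) := by
  have h : closedWedge m κ = {s : ℂ | m * s.re + κ ≤ s.im} ∪ {s : ℂ | m * s.re + κ ≤ -s.im} := by
    ext s
    exact (le_abs : m * s.re + κ ≤ |s.im| ↔ _)
  have hc : ∀ e : ℝ, Convex ℝ {s : ℂ | m * s.re + κ ≤ e * s.im} := by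
    intro e x hx y hy a b ha hb hab
    simp only [mem_ofPred_eq, Complex.add_re, Complex.add_im, Complex.real_smul,
      Complex.re_ofReal_mul, Complex.im_ofReal_mul] at *
    calc m * (a * x.re + b * y.re) + κ = a * (m * x.re + κ) + b * (m * y.re + κ) := by
          linear_combination (-κ) * hab
      _ ≤ a * (e * x.im) + b * (e * y.im) := by gcongr
      _ = _ := by ring
  rw [h]
  refine IsPreconnected.union (((-κ / m : ℝ)) : ℂ) ?_ ?_ ?_ ?_
  · simp only [mem_ofPred_eq, Complex.ofReal_re, Complex.ofReal_im]
    rw [mul_div_cancel₀ _ hm]; simp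
  · simp only [mem_ofPred_eq, Complex.ofReal_re, Complex.ofReal_im]
    rw [mul_div_cancel₀ _ hm]; simp
  · simpa using (hc 1).isPreconnected
  · simpa using (hc (-1)).isPreconnected

theorem isPreconnected_strip (σ : ℝ) : IsPreconnected (strip σ) := by
  have : strip σ = {θ : ℂ | θ.im ≤ σ} ∩ {θ : ℂ | -σ ≤ θ.im} := by
    ext θ; simp only [strip, mem_ofPred_eq, mem_inter_iff, abs_le]; tauto
  rw [this]
  exact ((convex_halfSpace_im_le σ).inter (convex_halfSpace_im_ge (-σ))).isPreconnected

theorem mem_closedWedge_of_wedge {m κ κ' : ℝ} (hκ' : 0 < κ') (h : 2 * κ ≤ κ') {s : ℂ}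
    (hs : s / κ' ∈ wedge m) : s ∈ closedWedge m κ := by
  rw [mem_wedge, Complex.div_ofReal_re, Complex.div_ofReal_im, abs_div, abs_of_pos hκ',
    lt_div_iff₀ hκ'] at hs
  have e : (m * (s.re / κ') + 1 / 2) * κ' = m * s.re + κ' / 2 := by field_simp
  rw [e] at hs
  change m * s.re + κ ≤ |s.im|
  linarith

namespace InnerSystem

open WienerAlg

variable {S : InnerSystem} {cf cg ch : Fin 3 → Fin 3 → Fin 3 → ℂ}

/-- A solution known only through pointwise bounds enters the algebra of weight zero, with norms
bounded by an `M` fixed before `κ'`. The factors `s³` and `s⁴` match the decay required of inner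
solutions. -/
theorem IsInnerSolution.exists_triple {m κ σ : ℝ} {ψ : ℂ → ℂ → ℂ} (hm : m ≠ 0) (hσ : 0 < σ)
    (h : S.IsInnerSolution (closedWedge m κ) σ ψ) :
    ∃ M, ∀ κ' : ℝ, 0 < κ' → 2 * κ ≤ κ' → ∃ u uθ us : WienerAlg (HolB (wedge m)) 0,
      ‖u‖ ≤ M ∧ ‖uθ‖ ≤ M ∧ ‖us‖ ≤ M ∧ IsTriple (wedgeDomain m hm) κ' u uθ us ∧
      ∀ s : ℂ, s / κ' ∈ wedge m → ∀ t : ℝ, ev u (s / κ') t = s ^ 3 * ψ s t ∧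
        ev uθ (s / κ') t = s ^ 4 * pdθ ψ s t ∧ ev us (s / κ') t = s ^ 4 * pds ψ s t := by
  obtain ⟨M, hM⟩ := h.bound
  refine ⟨fourierConst σ * |M|, fun κ' hκ' h2κ => ?_⟩
  set D := wedgeDomain m hm with hD
  have hκc : (κ' : ℂ) ≠ 0 := by exact_mod_cast hκ'.ne'
  have hmem : ∀ s : ℂ, s / κ' ∈ wedge m → s ∈ closedWedge m κ := fun s hs =>
    mem_closedWedge_of_wedge hκ' h2κ hs
  have hs0 : ∀ s : ℂ, s / κ' ∈ wedge m → s ≠ 0 := fun s hs h0 =>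
    zero_notMem D (by simpa [h0] using hs)
  have han : ∀ s : ℂ, s / κ' ∈ wedge m → ∀ θ : ℂ, |θ.im| < σ →
      AnalyticAt ℂ (fun p : ℂ × ℂ => ψ p.1 p.2) (s, θ) := fun s hs θ hθ =>
    h.regular.analytic (s, θ) ⟨hmem s hs, hθ.le⟩
  have hper : ∀ s : ℂ, s / κ' ∈ wedge m → ∀ θ : ℂ, |θ.im| < σ →
      ψ s (θ + 2 * Real.pi) = ψ s θ := fun s hs θ hθ => h.regular.periodic s (hmem s hs) θ hθ.le
  have hpow : ∀ n : ℕ, ∀ s θ : ℂ, AnalyticAt ℂ (fun p : ℂ × ℂ => p.1 ^ n) (s, θ) := fun n s θ =>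
    analyticAt_fst.pow n
  have hb : ∀ (n : ℕ) (s x : ℂ), s ≠ 0 → ‖x‖ ≤ M / ‖s‖ ^ n → ‖s ^ n * x‖ ≤ |M| := by
    intro n s x hs hx
    have : 0 < ‖s‖ ^ n := by positivity
    rw [norm_mul, norm_pow]
    rw [le_div_iff₀' this] at hx
    exact hx.trans (le_abs_self M)
  have hpers : ∀ s : ℂ, s / κ' ∈ wedge m → ∀ θ : ℂ, |θ.im| < σ →
      pds ψ s (θ + 2 * Real.pi) = pds ψ s θ := by
    intro s hs θ hθ
    refine Filter.EventuallyEq.deriv_eq ?_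
    filter_upwards [eventually_div_mem hs] with x hx using hper x hx θ hθ
  have hperθ : ∀ s : ℂ, s / κ' ∈ wedge m → ∀ θ : ℂ, |θ.im| < σ →
      pdθ ψ s (θ + 2 * Real.pi) = pdθ ψ s θ := by
    intro s hs θ hθ
    have e : (fun θ => ψ s (θ + 2 * Real.pi)) =ᶠ[𝓝 θ] ψ s := by
      filter_upwards [(isOpen_lt (by fun_prop) continuous_const :
        IsOpen {θ : ℂ | |θ.im| < σ}).mem_nhds hθ] with w hw using hper s hs w hw
    have := e.deriv_eq
    rw [deriv_comp_add_const] at this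
    exact this
  obtain ⟨u, hu, hue⟩ := exists_ev_scaled_eq (V := wedge m) (κ := κ') (M := |M|)
    (g := fun s θ => s ^ 3 * ψ s θ) hσ hκ'.ne' (fun s hs θ hθ => (hpow 3 s θ).mul (han s hs θ hθ))
    (fun s hs θ hθ => by rw [hper s hs θ hθ]) (abs_nonneg M)
    (fun s hs θ hθ => hb 3 s _ (hs0 s hs) (hM s (hmem s hs) θ hθ.le).1)
  obtain ⟨us, hus, huse⟩ := exists_ev_scaled_eq (V := wedge m) (κ := κ') (M := |M|)
    (g := fun s θ => s ^ 4 * pds ψ s θ) hσ hκ'.ne'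
    (fun s hs θ hθ => (hpow 4 s θ).mul (analyticAt_pds (han s hs θ hθ)))
    (fun s hs θ hθ => by rw [hpers s hs θ hθ]) (abs_nonneg M)
    (fun s hs θ hθ => hb 4 s _ (hs0 s hs) (hM s (hmem s hs) θ hθ.le).2.1)
  obtain ⟨uθ, huθ, huθe⟩ := exists_ev_scaled_eq (V := wedge m) (κ := κ') (M := |M|)
    (g := fun s θ => s ^ 4 * pdθ ψ s θ) hσ hκ'.ne'
    (fun s hs θ hθ => (hpow 4 s θ).mul (analyticAt_pdθ (han s hs θ hθ)))
    (fun s hs θ hθ => by rw [hperθ s hs θ hθ]) (abs_nonneg M)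
    (fun s hs θ hθ => hb 4 s _ (hs0 s hs) (hM s (hmem s hs) θ hθ.le).2.2)
  have hreal : ∀ t : ℝ, |(t : ℂ).im| < σ := fun t => by simpa using hσ
  have hreal0 : ∀ t : ℝ, |(t : ℂ).im| ≤ ((0 : ℝ≥0) : ℝ) := fun t => by simp
  have hscale : ∀ s ∈ wedge m, (κ' * s) / (κ' : ℂ) = s := fun s _ => mul_div_cancel_left₀ _ hκc
  refine ⟨u, uθ, us, hu, huθ, hus, ⟨fun l => ?_, fun l s hs => ?_⟩, fun s hs t =>
    ⟨hue s hs t, huθe s hs t, huse s hs t⟩⟩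
  · refine coeff_eq_of_hasDerivAt_angle (fun s hs t => ?_) l
    have hs' : (κ' * s) / (κ' : ℂ) ∈ wedge m := by rwa [hscale s hs]
    have h1 := ((hasDerivAt_pdθ (han _ hs' t (hreal t))).comp_ofReal).const_mul ((κ' * s) ^ 3)
    have h2 : ∀ t : ℝ, ev u s t = (κ' * s) ^ 3 * ψ (κ' * s) t := fun t => by
      rw [← hue _ hs' t, hscale s hs]
    simp only [h2]
    refine h1.congr_deriv ?_
    have h3 := ev_zEl D hκ'.ne' hs' (hreal0 t)
    rw [hscale s hs] at h3
    rw [ev_mul _ _ hs (hreal0 t), h3]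
    have h4 := huθe _ hs' t
    rw [hscale s hs] at h4
    have := hs0 _ hs'
    rw [h4]
    field_simp
  · have h5 := hasDerivAt_coeff (u := u) (v := (κ' : ℂ) • (zEl D 0 κ' * ((3 : ℂ) • u + us)))
      (fun s hs t => ?_) l hs
    · rwa [coeff_smul, HolB.fn_smul _ _ hs] at h5
    · have hs' : (κ' * s) / (κ' : ℂ) ∈ wedge m := by rwa [hscale s hs]
      have hlin : HasDerivAt (fun x : ℂ => κ' * x) ((κ' : ℂ) * 1) s :=
        (hasDerivAt_id s).const_mul (κ' : ℂ)
      have h1 : HasDerivAt (fun x => ψ (κ' * x) t) (pds ψ (κ' * s) t * ((κ' : ℂ) * 1)) s :=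
        HasDerivAt.comp (h₂ := fun x => ψ x t) s (hasDerivAt_pds (han _ hs' t (hreal t))) hlin
      have h2 := (hlin.pow 3).mul h1
      have h3 := ev_zEl D hκ'.ne' hs' (hreal0 t)
      rw [hscale s hs] at h3
      have h4 := huse _ hs' t
      have h6 := hue _ hs' t
      rw [hscale s hs] at h4 h6
      have := hs0 _ hs'
      have hsne : s ≠ 0 := fun h => this (by rw [h, mul_zero])
      refine (h2.congr_deriv ?_).congr_of_eventuallyEq ?_
      · rw [ev_smul _ _ hs (hreal0 t), ev_mul _ _ hs (hreal0 t), ev_add _ _ hs (hreal0 t),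
          ev_smul _ _ hs (hreal0 t), h3, h4, h6]
        simp only [Pi.pow_apply]
        push_cast
        field_simp
      · filter_upwards [(wedge m).isOpen.mem_nhds hs] with x hx
        have hx' : (κ' * x) / (κ' : ℂ) ∈ wedge m := by rwa [hscale x hx]
        have h7 := hue _ hx' t
        rw [hscale x hx] at h7
        rw [h7]; rfl

end InnerSystem

theorem AnalyticAt.exists_lipschitz_ball {X Y : Type*} [NormedAddCommGroup X] [NormedSpace ℂ X]
    [CompleteSpace X] [NormedAddCommGroup Y] [NormedSpace ℂ Y] [CompleteSpace Y] {f : X → Y}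
    (hf : AnalyticAt ℂ f 0) :
    ∃ K δ : ℝ, 0 ≤ K ∧ 0 < δ ∧ (∀ x y, ‖x‖ < δ → ‖y‖ < δ → ‖f x - f y‖ ≤ K * ‖x - y‖) ∧
      ∀ x, ‖x‖ < δ → ‖f x‖ ≤ K := by
  obtain ⟨K, t, ht, hK⟩ := (hf.contDiffAt (n := 1)).exists_lipschitzOnWith
  obtain ⟨r, hr, hrt⟩ := Metric.mem_nhds_iff.1 ht
  have hm : ∀ x, ‖x‖ < min r 1 → x ∈ t := fun x hx =>
    hrt (by rw [mem_ball_zero_iff]; exact hx.trans_le (min_le_left _ _))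
  refine ⟨K + ‖f 0‖, min r 1, by positivity, by positivity, fun x y hx hy => ?_, fun x hx => ?_⟩
  · have h1 := hK.dist_le_mul x (hm x hx) y (hm y hy)
    rw [dist_eq_norm, dist_eq_norm] at h1
    refine h1.trans ?_
    gcongr
    linarith [norm_nonneg (f 0)]
  · have h1 := hK.dist_le_mul x (hm x hx) 0 (hm 0 (by rw [norm_zero]; positivity))
    rw [dist_eq_norm, dist_zero_right] at h1
    have h2 : K * ‖x‖ ≤ K * 1 := by gcongr; exact (hx.le.trans (min_le_right _ _))
    have h3 := norm_sub_norm_le (f x) (f 0)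
    linarith

namespace InnerSystem

open WienerAlg

variable {S : InnerSystem} {cf cg ch : Fin 3 → Fin 3 → Fin 3 → ℂ}

/-- The right-hand side of the inner equation in the algebra. -/
def rhsEl {A : Type*} [NormedCommRing A] [NormedAlgebra ℂ A] (S : InnerSystem) (F G H : A × A → A)
    (z u uθ us : A) : A :=
  (S.c : ℂ) • (z * uθ) + F (z, S.coupling • (z * u)) +
    ((S.d + 1) / S.b : ℂ) • H (z, S.coupling • (z * u)) - z ^ 2 * G (z, S.coupling • (z * u)) * uθ +
    z * ((2 * S.b : ℂ) • u + H (z, S.coupling • (z * u))) * us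

/-- The difference of the right-hand sides carries a full factor `z`: the lifted functions depend on
the unknown only through `coupling * z * u`, and every other term has an explicit power of `z`. -/
theorem norm_rhsEl_sub_le {A : Type*} [NormedCommRing A] [NormedAlgebra ℂ A] {F G H : A × A → A}
    {K δ m : ℝ} (hK : 0 ≤ K)
    (hF : ∀ x y, ‖x‖ < δ → ‖y‖ < δ → ‖F x - F y‖ ≤ K * ‖x - y‖)
    (hG : ∀ x y, ‖x‖ < δ → ‖y‖ < δ → ‖G x - G y‖ ≤ K * ‖x - y‖)
    (hG' : ∀ x, ‖x‖ < δ → ‖G x‖ ≤ K)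
    (hH : ∀ x y, ‖x‖ < δ → ‖y‖ < δ → ‖H x - H y‖ ≤ K * ‖x - y‖)
    (hH' : ∀ x, ‖x‖ < δ → ‖H x‖ ≤ K) {z u uθ us v vθ vs : A} (hz1 : ‖z‖ ≤ 1) (hzδ : ‖z‖ < δ)
    (hzu : ‖S.coupling • (z * u)‖ < δ) (hzv : ‖S.coupling • (z * v)‖ < δ) (huθ : ‖uθ‖ ≤ m)
    (hus : ‖us‖ ≤ m) (hv : ‖v‖ ≤ m) :
    ‖rhsEl S F G H z u uθ us - rhsEl S F G H z v vθ vs‖ ≤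
      ‖z‖ * ((|S.c| + K * ‖S.coupling‖ * (1 + ‖((S.d + 1) / S.b : ℂ)‖ + 2 * m) + K +
        ‖(2 * S.b : ℂ)‖ * (2 * m) + K) * (‖u - v‖ + ‖uθ - vθ‖ + ‖us - vs‖)) := by
  have hm : 0 ≤ m := (norm_nonneg _).trans hv
  have hx := norm_nonneg (u - v)
  have hy := norm_nonneg (uθ - vθ)
  have hw := norm_nonneg (us - vs)
  have hn := norm_nonneg z
  set p : A × A := (z, S.coupling • (z * u)) with hp
  set q : A × A := (z, S.coupling • (z * v)) with hq
  have hpδ : ‖p‖ < δ := max_lt hzδ hzu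
  have hqδ : ‖q‖ < δ := max_lt hzδ hzv
  have hpq : ‖p - q‖ ≤ ‖S.coupling‖ * (‖z‖ * ‖u - v‖) := by
    have : p - q = (0, S.coupling • (z * (u - v))) := by
      rw [hp, hq, Prod.mk_sub_mk, sub_self, mul_sub, smul_sub]
    rw [this, Prod.norm_def, _root_.norm_zero, max_eq_right (norm_nonneg _), norm_smul]
    gcongr
    exact norm_mul_le _ _
  have lip : ∀ {f : A × A → A}, (∀ x y, ‖x‖ < δ → ‖y‖ < δ → ‖f x - f y‖ ≤ K * ‖x - y‖) →
      ‖f p - f q‖ ≤ ‖z‖ * (K * ‖S.coupling‖ * ‖u - v‖) := by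
    intro f hf
    calc _ ≤ K * (‖S.coupling‖ * (‖z‖ * ‖u - v‖)) := (hf p q hpδ hqδ).trans (by gcongr)
      _ = _ := by ring
  have lF := lip hF
  have lG := lip hG
  have lH := lip hH
  have e : rhsEl S F G H z u uθ us - rhsEl S F G H z v vθ vs =
      (S.c : ℂ) • (z * (uθ - vθ)) + (F p - F q) + ((S.d + 1) / S.b : ℂ) • (H p - H q) -
      z * (z * ((G p - G q) * uθ + G q * (uθ - vθ))) +
      z * (((2 * S.b : ℂ) • (u - v) + (H p - H q)) * us + ((2 * S.b : ℂ) • v + H q) * (us - vs)) := by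
    simp only [rhsEl, ← hp, ← hq]
    clear_value p q
    simp only [Algebra.smul_def]
    ring
  have b1 : ‖(S.c : ℂ) • (z * (uθ - vθ))‖ ≤ ‖z‖ * (|S.c| * ‖uθ - vθ‖) := by
    rw [norm_smul, Complex.norm_real, Real.norm_eq_abs]
    calc _ ≤ |S.c| * (‖z‖ * ‖uθ - vθ‖) := by gcongr; exact norm_mul_le _ _
      _ = _ := by ring
  have b3 : ‖((S.d + 1) / S.b : ℂ) • (H p - H q)‖ ≤
      ‖z‖ * (‖((S.d + 1) / S.b : ℂ)‖ * (K * ‖S.coupling‖ * ‖u - v‖)) := by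
    rw [norm_smul]
    calc _ ≤ ‖((S.d + 1) / S.b : ℂ)‖ * (‖z‖ * (K * ‖S.coupling‖ * ‖u - v‖)) := by gcongr
      _ = _ := by ring
  have lG' : ‖G p - G q‖ ≤ K * ‖S.coupling‖ * ‖u - v‖ :=
    lG.trans (mul_le_of_le_one_left (by positivity) hz1)
  have lH' : ‖H p - H q‖ ≤ K * ‖S.coupling‖ * ‖u - v‖ :=
    lH.trans (mul_le_of_le_one_left (by positivity) hz1)
  have b4 : ‖z * (z * ((G p - G q) * uθ + G q * (uθ - vθ)))‖ ≤
      ‖z‖ * (K * ‖S.coupling‖ * ‖u - v‖ * m + K * ‖uθ - vθ‖) := by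
    refine (norm_mul_le _ _).trans ?_
    gcongr
    refine (norm_mul_le _ _).trans ((mul_le_of_le_one_left (norm_nonneg _) hz1).trans ?_)
    refine (norm_add_le _ _).trans (add_le_add ?_ ?_)
    · exact (norm_mul_le _ _).trans (by gcongr)
    · exact (norm_mul_le _ _).trans (by gcongr; exact hG' q hqδ)
  have b5 : ‖z * (((2 * S.b : ℂ) • (u - v) + (H p - H q)) * us +
      ((2 * S.b : ℂ) • v + H q) * (us - vs))‖ ≤
      ‖z‖ * ((‖(2 * S.b : ℂ)‖ * ‖u - v‖ + K * ‖S.coupling‖ * ‖u - v‖) * m +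
        (‖(2 * S.b : ℂ)‖ * m + K) * ‖us - vs‖) := by
    refine (norm_mul_le _ _).trans ?_
    gcongr
    refine (norm_add_le _ _).trans (add_le_add ?_ ?_)
    · refine (norm_mul_le _ _).trans ?_
      gcongr
      refine (norm_add_le _ _).trans ?_
      rw [norm_smul]
      gcongr
    · refine (norm_mul_le _ _).trans ?_
      gcongr
      refine (norm_add_le _ _).trans ?_
      rw [norm_smul]
      gcongr
      exact hH' q hqδ
  rw [e]
  refine (norm_add_le _ _).trans ((add_le_add ((norm_sub_le _ _).trans (add_le_add
    ((norm_add_le _ _).trans (add_le_add ((norm_add_le _ _).trans (add_le_add b1 lF)) b3)) b4)) b5).trans ?_)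
  simp only [← mul_add]
  gcongr
  set c := |S.c|
  set k := K * ‖S.coupling‖
  set e' := ‖((S.d + 1) / S.b : ℂ)‖
  set b := ‖(2 * S.b : ℂ)‖
  set x := ‖u - v‖
  set y := ‖uθ - vθ‖
  set w := ‖us - vs‖
  have hc : 0 ≤ c := abs_nonneg _
  have hk : 0 ≤ k := by positivity
  have he : 0 ≤ e' := norm_nonneg _
  have hb : 0 ≤ b := norm_nonneg _
  have hrest : 0 ≤ c * (x + w) + k * (1 + e' + 2 * m) * (y + w) + K * (x + w) +
      b * m * (x + 2 * y + w) + K * (x + y) := by positivity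
  nlinarith [hrest]

/-- The inner equation multiplied by `s⁴`, read as an identity in the algebra. Real angles are
enough by `ext_ev`. -/
theorem IsInnerSolution.eq_rhsEl (hb : 0 < S.b) {m κ κ' σ : ℝ} {ψ : ℂ → ℂ → ℂ}
    (hm : m ≠ 0) (hσ : 0 < σ) (h : S.IsInnerSolution (closedWedge m κ) σ ψ) (hκ' : 0 < κ')
    (h2κ : 2 * κ ≤ κ') {u uθ us : WienerAlg (HolB (wedge m)) 0}
    (hev : ∀ s : ℂ, s / κ' ∈ wedge m → ∀ t : ℝ, ev u (s / κ') t = s ^ 3 * ψ s t ∧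
        ev uθ (s / κ') t = s ^ 4 * pdθ ψ s t ∧ ev us (s / κ') t = s ^ 4 * pds ψ s t)
    {F G H : WienerAlg (HolB (wedge m)) 0 × WienerAlg (HolB (wedge m)) 0 → WienerAlg (HolB (wedge m)) 0}
    (hval : ∀ χ : WienerAlg (HolB (wedge m)) 0 →ₐ[ℂ] ℂ, IsContractive χ → ∀ s θ ψ : ℂ, s ≠ 0 →
      χ (cosEl (wedge m) 0) = cos θ → χ (sinEl (wedge m) 0) = sin θ →
      χ (zEl (wedgeDomain m hm) 0 κ') = s⁻¹ →
      χ (S.coupling • (zEl (wedgeDomain m hm) 0 κ' * u)) = S.coupling * s ^ 2 * ψ →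
      S.Fhat ψ s θ = (s⁻¹) ^ 4 * χ (F (zEl (wedgeDomain m hm) 0 κ',
        S.coupling • (zEl (wedgeDomain m hm) 0 κ' * u))) ∧
      S.Ghat ψ s θ = (s⁻¹) ^ 2 * χ (G (zEl (wedgeDomain m hm) 0 κ',
        S.coupling • (zEl (wedgeDomain m hm) 0 κ' * u))) ∧
      S.Hhat ψ s θ = (s⁻¹) ^ 3 * χ (H (zEl (wedgeDomain m hm) 0 κ',
        S.coupling • (zEl (wedgeDomain m hm) 0 κ' * u)))) :
    (S.d : ℂ) • us = rhsEl S F G H (zEl (wedgeDomain m hm) 0 κ') u uθ us + (2 : ℂ) • u +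
      (S.α : ℂ) • uθ := by
  have hκc : (κ' : ℂ) ≠ 0 := by exact_mod_cast hκ'.ne'
  set z := zEl (wedgeDomain m hm) 0 κ' with hz
  refine ext_ev fun x hx t => ?_
  obtain ⟨s, rfl⟩ : ∃ s : ℂ, s / κ' = x := ⟨κ' * x, mul_div_cancel_left₀ _ hκc⟩
  have hs0 : s ≠ 0 := fun h => zero_notMem (wedgeDomain m hm) (by simpa [h] using hx)
  have ht : |(t : ℂ).im| ≤ ((0 : ℝ≥0) : ℝ) := by simp
  set η := evHom (U := wedge m) (σ := 0) hx ht with hη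
  obtain ⟨e1, e2, e3⟩ := hev s hx t
  have hηz : η z = s⁻¹ := by rw [hη, evHom_apply, hz, ev_zEl _ hκ'.ne' hx ht]
  have hηu : η u = s ^ 3 * ψ s t := by rw [hη, evHom_apply, e1]
  have hηθ : η uθ = s ^ 4 * pdθ ψ s t := by rw [hη, evHom_apply, e2]
  have hηs : η us = s ^ 4 * pds ψ s t := by rw [hη, evHom_apply, e3]
  obtain ⟨vF, vG, vH⟩ := hval η (isContractive_evHom hx ht) s t (ψ s t) hs0
    ((evHom_apply _ _ _).trans (ev_cosEl hx ht)) ((evHom_apply _ _ _).trans (ev_sinEl hx ht)) hηz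
    (by rw [map_smul, map_mul, hηz, hηu, smul_eq_mul]; field_simp)
  have heq := h.equation s (mem_closedWedge_of_wedge hκ' h2κ hx) t
    (by change |(t : ℂ).im| ≤ σ; simpa using hσ.le)
  unfold InnerEquationAt at heq
  rw [vF, vG, vH] at heq
  rw [← evHom_apply hx ht, ← evHom_apply hx ht, ← hη]
  simp only [rhsEl, map_add, map_sub, map_smul, map_mul, map_pow, smul_eq_mul, hηz, hηu, hηθ, hηs]
  generalize η (F (z, S.coupling • (z * u))) = a at *
  generalize η (G (z, S.coupling • (z * u))) = b at *
  generalize η (H (z, S.coupling • (z * u))) = c at *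
  have hbc : (S.b : ℂ) ≠ 0 := by exact_mod_cast hb.ne'
  field_simp at heq ⊢
  linear_combination heq

set_option maxHeartbeats 2000000 in
-- Applied to the difference of two solutions, the inverse operators return all three norms
-- multiplied by `O(‖z‖)`. At a sufficiently large scale `κ'` this forces agreement on a smaller
-- wedge, and the identity theorem extends it to the given domain, so no largeness of `κ` is
-- assumed.
theorem IsInnerSolution.unique (hα : 0 < S.α) (hb : 0 < S.b) (hd : 0 < S.d)
    (hf : HasCubicPart S.f cf) (hg : HasCubicPart S.g cg) (hh : HasCubicPart S.h ch) {m κ σ : ℝ}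
    (hm : m ≠ 0) (hσ : 0 < σ) {ψ₁ ψ₂ : ℂ → ℂ → ℂ} (h₁ : S.IsInnerSolution (closedWedge m κ) σ ψ₁)
    (h₂ : S.IsInnerSolution (closedWedge m κ) σ ψ₂) :
    ∀ s ∈ closedWedge m κ, ∀ θ ∈ strip σ, ψ₁ s θ = ψ₂ s θ := by
  obtain ⟨M₁, hM₁⟩ := h₁.exists_triple hm hσ
  obtain ⟨M₂, hM₂⟩ := h₂.exists_triple hm hσ
  obtain ⟨F, G, H, hlift, ⟨hFa, -⟩, hG, hHa, -⟩ :=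
    S.exists_lifts hf hg hh (cosEl (wedge m) 0) (sinEl (wedge m) 0)
  obtain ⟨K₁, δ₁, hK₁, hδ₁, hF₁, -⟩ := hFa.exists_lipschitz_ball
  obtain ⟨K₂, δ₂, hK₂, hδ₂, hG₁, hG₂⟩ := hG.exists_lipschitz_ball
  obtain ⟨K₃, δ₃, hK₃, hδ₃, hH₁, hH₂⟩ := hHa.exists_lipschitz_ball
  obtain ⟨δ₄, hδ₄, hlift⟩ := Metric.eventually_nhds_iff.1 hlift.F_eq
  simp only [dist_zero_right] at hlift
  set K := K₁ + K₂ + K₃ with hK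
  set δ := min (min δ₁ δ₂) (min δ₃ δ₄) with hδ
  have hδ0 : 0 < δ := by positivity
  have hK0 : 0 ≤ K := by positivity
  set D := wedgeDomain m hm with hD
  set M := max M₁ M₂ with hM
  have hr := D.radius_pos
  have hC := D.C_nonneg
  set ν : ℝ := 4 + 2 / S.d with hν
  have hν1 : 1 < ν := by have : 0 < 2 / S.d := by positivity
                         linarith
  have hν0 : 0 < ν - 1 := by linarith
  set cr : ℝ := |S.d|⁻¹ * (1 / (ν - 1)) with hcr
  have hcr0 : 0 ≤ cr := by positivity
  set cθ : ℝ := D.C / S.α with hcθ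
  have hcθ0 : 0 ≤ cθ := by positivity
  set Λ : ℝ := |S.c| + K * ‖S.coupling‖ * (1 + ‖((S.d + 1) / S.b : ℂ)‖ + 2 * |M|) + K +
        ‖(2 * S.b : ℂ)‖ * (2 * |M|) + K with hΛ
  have hΛ0 : 0 ≤ Λ := by positivity
  -- `X` and `Y` bound the differences of `u` and `uθ` relative to `‖z‖ * N`; `W` adds the bound for
  -- `us`, which the equation gives.
  set X := cr * Λ + 1 with hX
  set Y := cθ * (Λ + (4 * S.d + 2) * X) with hY
  set W := X + Y + S.d⁻¹ * (Λ + 2 * X + S.α * Y) with hW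
  have hX0 : 0 < X := by positivity
  have hY0 : 0 ≤ Y := by positivity
  have hW0 : 0 < W := by positivity
  set ζ : ℝ := min (min 1 (1 / (2 * W))) (δ / (2 * (1 + ‖S.coupling‖ * |M|))) with hζ
  have hζ0 : 0 < ζ := by positivity
  set κ' : ℝ := max (2 * κ) (D.radius⁻¹ / ζ) with hκ'
  have hκ'0 : 0 < κ' := lt_of_lt_of_le (by positivity) (le_max_right _ _)
  have h2κ : 2 * κ ≤ κ' := le_max_left _ _
  set z := zEl D 0 κ' with hz
  have hzn : ‖z‖ ≤ ζ := by
    refine (norm_zEl_le D hκ'0).trans ?_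
    rw [div_le_iff₀ hκ'0, ← div_le_iff₀' hζ0]
    exact le_max_right _ _
  have hz1 : ‖z‖ ≤ 1 := hzn.trans ((min_le_left _ _).trans (min_le_left _ _))
  have hzW : ‖z‖ ≤ 1 / (2 * W) := hzn.trans ((min_le_left _ _).trans (min_le_right _ _))
  have hzδ' : ‖z‖ * (1 + ‖S.coupling‖ * |M|) ≤ δ / 2 := by
    calc _ ≤ δ / (2 * (1 + ‖S.coupling‖ * |M|)) * (1 + ‖S.coupling‖ * |M|) := by
          gcongr; exact hzn.trans (min_le_right _ _)
      _ = δ / 2 := by field_simp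
  have hzM : 0 ≤ ‖z‖ * (‖S.coupling‖ * |M|) := by positivity
  have hz0 := norm_nonneg z
  rw [mul_add, mul_one] at hzδ'
  have hzδ : ‖z‖ < δ := by linarith only [hzδ', hzM, hδ0]
  have hl1 : δ ≤ δ₁ := (min_le_left _ _).trans (min_le_left _ _)
  have hl2 : δ ≤ δ₂ := (min_le_left _ _).trans (min_le_right _ _)
  have hl3 : δ ≤ δ₃ := (min_le_right _ _).trans (min_le_left _ _)
  have hl4 : δ ≤ δ₄ := (min_le_right _ _).trans (min_le_right _ _)
  clear_value κ' ζ δ ν K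
  obtain ⟨u, uθ, us, hu, huθ, hus, hutr, huev⟩ := hM₁ κ' hκ'0 h2κ
  obtain ⟨v, vθ, vs, hv, hvθ, hvs, hvtr, hvev⟩ := hM₂ κ' hκ'0 h2κ
  have hMM₁ : M₁ ≤ |M| := (le_max_left _ _).trans (le_abs_self _)
  have hMM₂ : M₂ ≤ |M| := (le_max_right _ _).trans (le_abs_self _)
  have hw : ∀ a : WienerAlg (HolB (wedge m)) 0, ‖a‖ ≤ |M| → ‖S.coupling • (z * a)‖ < δ := by
    intro a ha
    rw [norm_smul]
    have : ‖S.coupling‖ * ‖z * a‖ ≤ ‖z‖ * (‖S.coupling‖ * |M|) := by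
      calc _ ≤ ‖S.coupling‖ * (‖z‖ * |M|) := by
            gcongr; exact (norm_mul_le _ _).trans (by gcongr)
        _ = _ := by ring
    linarith only [this, hzδ', hz0, hδ0]
  have hwu := hw u (hu.trans hMM₁)
  have hwv := hw v (hv.trans hMM₂)
  have e1 := h₁.eq_rhsEl hb hm hσ hκ'0 h2κ huev (F := F) (G := G) (H := H)
    (fun χ hχ s θ ψ hs => hlift (show ‖(z, S.coupling • (z * u))‖ < δ₄ from
      (max_lt hzδ hwu).trans_le hl4) χ hχ s θ ψ hs)
  have e2 := h₂.eq_rhsEl hb hm hσ hκ'0 h2κ hvev (F := F) (G := G) (H := H)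
    (fun χ hχ s θ ψ hs => hlift (show ‖(z, S.coupling • (z * v))‖ < δ₄ from
      (max_lt hzδ hwv).trans_le hl4) χ hχ s θ ψ hs)
  set ω := rhsEl S F G H z u uθ us - rhsEl S F G H z v vθ vs with hω
  have heq : (S.d : ℂ) • (us - vs) = ω + (2 : ℂ) • (u - v) + (S.α : ℂ) • (uθ - vθ) := by
    rw [smul_sub, e1, e2, hω, smul_sub, smul_sub]; abel
  obtain ⟨hi, hii⟩ := (hutr.sub hvtr).solve (wedgeDomain_isUnique m hm) hα hd hκ'0 hν1 hν heq
  have mono : ∀ {K' : ℝ} {f : WienerAlg (HolB (wedge m)) 0 × WienerAlg (HolB (wedge m)) 0 →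
      WienerAlg (HolB (wedge m)) 0} {δ' : ℝ}, K' ≤ K → δ ≤ δ' →
      (∀ x y, ‖x‖ < δ' → ‖y‖ < δ' → ‖f x - f y‖ ≤ K' * ‖x - y‖) →
      ∀ x y, ‖x‖ < δ → ‖y‖ < δ → ‖f x - f y‖ ≤ K * ‖x - y‖ := fun hKK hdd hfl x y hx hy =>
    (hfl x y (hx.trans_le hdd) (hy.trans_le hdd)).trans (by gcongr)
  have hωn : ‖ω‖ ≤ ‖z‖ * (Λ * (‖u - v‖ + ‖uθ - vθ‖ + ‖us - vs‖)) :=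
    norm_rhsEl_sub_le hK0 (mono (by linarith) hl1 hF₁) (mono (by linarith) hl2 hG₁)
      (fun x hx => (hG₂ x (hx.trans_le hl2)).trans (by linarith)) (mono (by linarith) hl3 hH₁)
      (fun x hx => (hH₂ x (hx.trans_le hl3)).trans (by linarith)) hz1 hzδ hwu hwv
      (huθ.trans hMM₁) (hus.trans hMM₁) (hv.trans hMM₂)
  clear_value ω
  set N := ‖u - v‖ + ‖uθ - vθ‖ + ‖us - vs‖ with hN
  have hN0 : 0 ≤ N := by positivity
  have hn := norm_nonneg z
  have hx0 := norm_nonneg (u - v)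
  have hy0 := norm_nonneg (uθ - vθ)
  have hw0 := norm_nonneg (us - vs)
  have bx : ‖u - v‖ ≤ ‖z‖ * (X * N) := by
    calc ‖u - v‖ ≤ ‖radL D hν1 S.d ω‖ + ‖z * primL (uθ - vθ)‖ := by
          conv_lhs => rw [hii]
          exact norm_add_le _ _
      _ ≤ cr * ‖ω‖ + ‖z‖ * (1 * ‖uθ - vθ‖) := by
          gcongr
          · exact ContinuousLinearMap.le_of_opNorm_le _ (norm_radL_le D hν1 S.d) _
          · exact (norm_mul_le _ _).trans
              (by gcongr; exact ContinuousLinearMap.le_of_opNorm_le _ norm_primL_le _)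
      _ ≤ cr * (‖z‖ * (Λ * N)) + ‖z‖ * (1 * N) := by gcongr; linarith
      _ = _ := by ring
  have by' : ‖uθ - vθ‖ ≤ ‖z‖ * (Y * N) := by
    calc ‖uθ - vθ‖ = ‖oscθL D hα hd hκ'0 (ω + (4 * S.d + 2 : ℂ) • (u - v))‖ := by rw [← hi]
      _ ≤ cθ * (‖ω‖ + (4 * S.d + 2) * ‖u - v‖) := by
          refine (ContinuousLinearMap.le_of_opNorm_le _ (norm_oscθL_le D hα hd hκ'0) _).trans ?_
          gcongr
          refine (norm_add_le _ _).trans ?_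
          rw [norm_smul]
          gcongr
          have : (4 * S.d + 2 : ℂ) = ((4 * S.d + 2 : ℝ) : ℂ) := by push_cast; rfl
          rw [this, Complex.norm_real, Real.norm_of_nonneg (by positivity)]
      _ ≤ cθ * (‖z‖ * (Λ * N) + (4 * S.d + 2) * (‖z‖ * (X * N))) := by gcongr
      _ = _ := by ring
  have bw : ‖us - vs‖ ≤ ‖z‖ * (S.d⁻¹ * (Λ + 2 * X + S.α * Y) * N) := by
    have hd' : (S.d : ℂ) ≠ 0 := by exact_mod_cast hd.ne'
    have h1 : S.d * ‖us - vs‖ ≤ ‖ω‖ + 2 * ‖u - v‖ + S.α * ‖uθ - vθ‖ := by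
      have h2 := congrArg norm heq
      rw [norm_smul, Complex.norm_real, Real.norm_of_nonneg hd.le] at h2
      rw [h2]
      refine (norm_add_le _ _).trans (add_le_add ((norm_add_le _ _).trans ?_) ?_)
      · rw [norm_smul]; simp
      · rw [norm_smul, Complex.norm_real, Real.norm_of_nonneg hα.le]
    have h3 : S.d * ‖us - vs‖ ≤ ‖z‖ * ((Λ + 2 * X + S.α * Y) * N) := by
      refine h1.trans ?_
      calc _ ≤ ‖z‖ * (Λ * N) + 2 * (‖z‖ * (X * N)) + S.α * (‖z‖ * (Y * N)) := by gcongr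
        _ = _ := by ring
    calc ‖us - vs‖ = S.d⁻¹ * (S.d * ‖us - vs‖) := by field_simp
      _ ≤ S.d⁻¹ * (‖z‖ * ((Λ + 2 * X + S.α * Y) * N)) := by gcongr
      _ = _ := by ring
  have hNle : N ≤ (1 / 2) * N := by
    calc N ≤ ‖z‖ * (X * N) + ‖z‖ * (Y * N) + ‖z‖ * (S.d⁻¹ * (Λ + 2 * X + S.α * Y) * N) :=
          add_le_add (add_le_add bx by') bw
      _ = ‖z‖ * W * N := by rw [hW]; ring
      _ ≤ 1 / (2 * W) * W * N := by gcongr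
      _ = _ := by field_simp
  have huv : u = v := by
    have hN' : N ≤ 0 := by linarith only [hNle]
    have : ‖u - v‖ ≤ 0 := by linarith only [hN', hN, hx0, hy0, hw0]
    rwa [norm_le_zero_iff, sub_eq_zero] at this
  have hreal : ∀ s : ℂ, s / κ' ∈ wedge m → ∀ t : ℝ, ψ₁ s t = ψ₂ s t := by
    intro s hs t
    have hs0 : s ≠ 0 := fun h => zero_notMem D (by simpa [h] using hs)
    have h1 := (huev s hs t).1
    rw [huv, (hvev s hs t).1] at h1
    exact (mul_left_cancel₀ (pow_ne_zero 3 hs0) h1).symm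
  -- The identity theorem is used twice: from real angles to the strip, where the real points
  -- accumulate at `0`, and afterwards from the rescaled wedge to the connected closed wedge.
  have hstrip : ∀ s : ℂ, s / κ' ∈ wedge m → ∀ θ ∈ strip σ, ψ₁ s θ = ψ₂ s θ := by
    intro s hs
    have hs' := mem_closedWedge_of_wedge hκ'0 h2κ hs
    have ha : ∀ {ψ : ℂ → ℂ → ℂ}, S.IsInnerSolution (closedWedge m κ) σ ψ →
        AnalyticOnNhd ℂ (ψ s) (strip σ) := fun {ψ} h θ hθ =>
      AnalyticAt.fun_comp (g := fun p : ℂ × ℂ => ψ p.1 p.2) (f := fun w => (s, w))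
        (h.regular.analytic (s, θ) ⟨hs', hθ⟩) (analyticAt_const.prod analyticAt_id)
    refine (ha h₁).eqOn_of_preconnected_of_frequently_eq (ha h₂) (isPreconnected_strip σ)
      (z₀ := 0) (by change |(0 : ℂ).im| ≤ σ; simpa using hσ.le) ?_
    have ht : Tendsto (fun n : ℕ => ((1 / ((n : ℝ) + 1) : ℝ) : ℂ)) atTop (𝓝[≠] 0) := by
      refine tendsto_nhdsWithin_iff.2 ⟨?_, Eventually.of_forall fun n => ?_⟩
      · have := (Complex.continuous_ofReal.tendsto 0).comp
          (tendsto_one_div_add_atTop_nhds_zero_nat (𝕜 := ℝ))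
        exact this
      · have : (0 : ℝ) < 1 / ((n : ℝ) + 1) := by positivity
        exact Complex.ofReal_ne_zero.2 this.ne'
    exact ht.frequently (Eventually.of_forall fun n => hreal s hs _).frequently
  intro s hs θ hθ
  have ha : ∀ {ψ : ℂ → ℂ → ℂ}, S.IsInnerSolution (closedWedge m κ) σ ψ →
      AnalyticOnNhd ℂ (fun x => ψ x θ) (closedWedge m κ) := fun {ψ} h x hx =>
    AnalyticAt.fun_comp (g := fun p : ℂ × ℂ => ψ p.1 p.2) (f := fun x => (x, θ))
      (h.regular.analytic (x, θ) ⟨hx, hθ⟩) (analyticAt_id.prod analyticAt_const)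
  have hI : (κ' * I : ℂ) / κ' ∈ wedge m := by
    have hκc : (κ' : ℂ) ≠ 0 := by exact_mod_cast hκ'0.ne'
    rw [mul_div_cancel_left₀ _ hκc, mem_wedge]; simp; norm_num
  refine (ha h₁).eqOn_of_preconnected_of_eventuallyEq (ha h₂) (isPreconnected_closedWedge hm κ)
    (mem_closedWedge_of_wedge hκ'0 h2κ hI) ?_ hs
  filter_upwards [eventually_div_mem hI] with x hx using hstrip x hx θ hθ

end InnerSystem

/-! ### The linear equation satisfied by the difference. -/

/-- The derivative in the second variable is controlled too, because `a₁` is built from its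
integrals along the segment. -/
theorem AnalyticAt.eventually_partial {A : Type*} [NormedCommRing A] [NormedAlgebra ℂ A]
    [CompleteSpace A] {f : A × A → A} (hf : AnalyticAt ℂ f 0) :
    ∃ K, 0 ≤ K ∧ ∀ᶠ p in 𝓝 (0 : A × A), ‖f p‖ ≤ K ∧ ‖fderiv ℂ f p (0, 1)‖ ≤ K ∧ ContinuousAt f p ∧
      ContinuousAt (fun p => fderiv ℂ f p (0, 1)) p ∧ DifferentiableAt ℂ f p := by
  have hg : AnalyticAt ℂ (fun p => fderiv ℂ f p ((0, 1) : A × A)) 0 :=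
    AnalyticAt.fun_comp (g := fun L => ContinuousLinearMap.apply ℂ A ((0, 1) : A × A) L)
      (f := fderiv ℂ f) (ContinuousLinearMap.analyticAt _ _) hf.fderiv
  have b : ∀ {g : A × A → A}, AnalyticAt ℂ g 0 → ∀ᶠ p in 𝓝 (0 : A × A), ‖g p‖ < ‖g 0‖ + 1 :=
    fun {g} hg => hg.continuousAt.norm.eventually_lt_const (lt_add_one _)
  refine ⟨max (‖f 0‖ + 1) (‖fderiv ℂ f 0 ((0, 1) : A × A)‖ + 1), by positivity, ?_⟩
  filter_upwards [b hf, b hg, hf.eventually_analyticAt, hg.eventually_analyticAt] with p h1 h2 h3 h4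
  exact ⟨h1.le.trans (le_max_left _ _), h2.le.trans (le_max_right _ _), h3.continuousAt,
    h4.continuousAt, h3.differentiableAt⟩

/-- The difference of the values of a product at the end points of a segment. -/
theorem segment_sub_eq {N : ℂ → ℂ} {u v a b : ℂ}
    (hN : ∀ l ∈ Icc (-1 : ℝ) 1, DifferentiableAt ℂ N ((u + v) / 2 + l * ((u - v) / 2)))
    (hc : ContinuousOn (fun l : ℝ => deriv N ((u + v) / 2 + l * ((u - v) / 2))) (Icc (-1) 1)) :
    N u * a - N v * b =
      (u - v) / 2 * (∫ l in (-1 : ℝ)..1, deriv N ((u + v) / 2 + l * ((u - v) / 2)) *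
        ((a + b) / 2 + l * ((a - b) / 2))) +
      (a - b) / 2 * ∫ l in (-1 : ℝ)..1, N ((u + v) / 2 + l * ((u - v) / 2)) := by
  have haff : ∀ (p q : ℂ) (l : ℝ), HasDerivAt (fun l : ℝ => p + l * q) q l := fun p q l => by
    have := ((hasDerivAt_id l).ofReal_comp.mul_const q).const_add p
    simpa using this
  have hI : uIcc (-1 : ℝ) 1 = Icc (-1) 1 := uIcc_of_le (by norm_num)
  have hN' : ∀ l ∈ Icc (-1 : ℝ) 1, HasDerivAt (fun l : ℝ => N ((u + v) / 2 + l * ((u - v) / 2)))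
      (deriv N ((u + v) / 2 + l * ((u - v) / 2)) * ((u - v) / 2)) l := fun l hl =>
    (hN l hl).hasDerivAt.comp l (haff _ _ l)
  have hNc : ContinuousOn (fun l : ℝ => N ((u + v) / 2 + l * ((u - v) / 2))) (Icc (-1) 1) :=
    fun l hl => (hN' l hl).continuousAt.continuousWithinAt
  have i1 : IntervalIntegrable (fun l : ℝ => deriv N ((u + v) / 2 + l * ((u - v) / 2)) *
      ((a + b) / 2 + l * ((a - b) / 2))) volume (-1) 1 :=
    ContinuousOn.intervalIntegrable (by rw [hI]; exact hc.mul (by fun_prop))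
  have i2 : IntervalIntegrable (fun l : ℝ => N ((u + v) / 2 + l * ((u - v) / 2))) volume (-1) 1 :=
    ContinuousOn.intervalIntegrable (by rw [hI]; exact hNc)
  rw [← intervalIntegral.integral_const_mul, ← intervalIntegral.integral_const_mul,
    ← intervalIntegral.integral_add (i1.const_mul _) (i2.const_mul _)]
  -- The product of `N` and the affine interpolation of `a`, `b` takes the values `N v * b` and `N u
  -- * a` at the end points `-1` and `1`.
  have key := intervalIntegral.integral_eq_sub_of_hasDerivAt (a := (-1 : ℝ)) (b := 1)
    (f := fun l : ℝ => N ((u + v) / 2 + l * ((u - v) / 2)) * ((a + b) / 2 + l * ((a - b) / 2)))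
    (f' := fun l : ℝ => (u - v) / 2 * (deriv N ((u + v) / 2 + l * ((u - v) / 2)) *
        ((a + b) / 2 + l * ((a - b) / 2))) + (a - b) / 2 * N ((u + v) / 2 + l * ((u - v) / 2)))
    (fun l hl => ((hN' l (hI ▸ hl)).mul (haff _ _ l)).congr_deriv (by ring))
    ((i1.const_mul _).add (i2.const_mul _))
  rw [key]
  push_cast
  ring_nf

namespace InnerSystem

open WienerAlg

variable {S : InnerSystem} {ψu ψv : ℂ → ℂ → ℂ} {s θ : ℂ}

theorem pds_seg (hu : DifferentiableAt ℂ (fun z => ψu z θ) s)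
    (hv : DifferentiableAt ℂ (fun z => ψv z θ) s) (l : ℝ) :
    pds (seg ψu ψv l) s θ = (pds ψu s θ + pds ψv s θ) / 2 + l * ((pds ψu s θ - pds ψv s θ) / 2) :=
  (((hu.hasDerivAt.add hv.hasDerivAt).div_const 2).add
    (((hu.hasDerivAt.sub hv.hasDerivAt).div_const 2).const_mul (l : ℂ))).deriv

theorem pdθ_seg (hu : DifferentiableAt ℂ (fun w => ψu s w) θ)
    (hv : DifferentiableAt ℂ (fun w => ψv s w) θ) (l : ℝ) :
    pdθ (seg ψu ψv l) s θ = (pdθ ψu s θ + pdθ ψv s θ) / 2 + l * ((pdθ ψu s θ - pdθ ψv s θ) / 2) :=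
  (((hu.hasDerivAt.add hv.hasDerivAt).div_const 2).add
    (((hu.hasDerivAt.sub hv.hasDerivAt).div_const 2).const_mul (l : ℂ))).deriv

/-- A function can be differentiated along the segment between the two solutions. -/
def SegSmooth (N : ℂ → ℂ) (ψu ψv : ℂ → ℂ → ℂ) (s θ : ℂ) : Prop :=
  (∀ l ∈ Icc (-1 : ℝ) 1, DifferentiableAt ℂ N (seg ψu ψv l s θ)) ∧
    ContinuousOn (fun l : ℝ => deriv N (seg ψu ψv l s θ)) (Icc (-1) 1)

/-- The nonlinear terms are subtracted by integrating along the segment between the solutions. In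
the products with `∂_θ ψ` and `∂_s ψ`, the derivative of the first factor contributes to `a₁`, that
of the second to `a₃` and `a₂`; the term `2 b s² ψ ∂_s ψ` is split symmetrically. -/
theorem differenceEquationAt_sub
    (hus : DifferentiableAt ℂ (fun z => ψu z θ) s) (hvs : DifferentiableAt ℂ (fun z => ψv z θ) s)
    (huθ : DifferentiableAt ℂ (fun w => ψu s w) θ) (hvθ : DifferentiableAt ℂ (fun w => ψv s w) θ)
    (hF : SegSmooth (fun w => S.Fhat w s θ) ψu ψv s θ)
    (hG : SegSmooth (fun w => S.Ghat w s θ) ψu ψv s θ)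
    (hH : SegSmooth (fun w => S.Hhat w s θ) ψu ψv s θ)
    (hu : S.InnerEquationAt ψu s θ) (hv : S.InnerEquationAt ψv s θ) :
    S.DifferenceEquationAt ψu ψv (fun s θ => ψu s θ - ψv s θ) s θ := by
  have ds : pds (fun s θ => ψu s θ - ψv s θ) s θ = pds ψu s θ - pds ψv s θ :=
    (hus.hasDerivAt.sub hvs.hasDerivAt).deriv
  have dθ : pdθ (fun s θ => ψu s θ - ψv s θ) s θ = pdθ ψu s θ - pdθ ψv s θ :=
    (huθ.hasDerivAt.sub hvθ.hasDerivAt).deriv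
  have e1 := segment_sub_eq (a := 1) (b := 1) hF.1 hF.2
  have e2 := segment_sub_eq (a := 1) (b := 1) hH.1 hH.2
  have e3 := segment_sub_eq (a := pdθ ψu s θ) (b := pdθ ψv s θ) hG.1 hG.2
  have e4 := segment_sub_eq (a := pds ψu s θ) (b := pds ψv s θ) hH.1 hH.2
  norm_num at e1 e2
  unfold InnerEquationAt at hu hv
  unfold DifferenceEquationAt
  simp only [a₁, a₂, a₃, ds, dθ, pds_seg hus hvs, pdθ_seg huθ hvθ]
  simp only [seg]
  linear_combination hu - hv + e1 + (S.d + 1) / S.b * s⁻¹ * e2 - e3 + s ^ 2 * e4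

variable {U : Opens ℂ} {σ : ℝ≥0}

theorem ev_integral {c : ℝ → WienerAlg (HolB U) σ} (hc : ContinuousOn c (Icc (-1) 1)) {s θ : ℂ}
    (hs : s ∈ U) (hθ : |θ.im| ≤ σ) :
    ev (∫ l in (-1 : ℝ)..1, c l) s θ = ∫ l in (-1 : ℝ)..1, ev (c l) s θ := by
  have hi : IntervalIntegrable c volume (-1) 1 :=
    ContinuousOn.intervalIntegrable (by rwa [uIcc_of_le (by norm_num)])
  rw [← evL_apply hs hθ, ← ContinuousLinearMap.intervalIntegral_comp_comm _ hi]
  simp only [evL_apply]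

theorem norm_segment_integral_le {c : ℝ → WienerAlg (HolB U) σ} {K : ℝ}
    (h : ∀ l ∈ Icc (-1 : ℝ) 1, ‖c l‖ ≤ K) : ‖∫ l in (-1 : ℝ)..1, c l‖ ≤ 2 * K := by
  have := intervalIntegral.norm_integral_le_of_norm_le_const (a := (-1 : ℝ)) (b := 1) (f := c) (C := K)
    fun l hl => h l (Ioc_subset_Icc_self (by rwa [uIoc_of_le (by norm_num)] at hl))
  norm_num at this
  linarith

theorem segment_of_lift {f : WienerAlg (HolB U) σ × WienerAlg (HolB U) σ → WienerAlg (HolB U) σ}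
    {N : ℂ → ℂ} {c₀ c x θ : ℂ} (hx : x ∈ U) (hθ : |θ.im| ≤ σ) {z : WienerAlg (HolB U) σ}
    {w : ℝ → WienerAlg (HolB U) σ} (hwc : Continuous w) {ψ : ℝ → ℂ}
    (hw : ∀ l, ev (w l) x θ = c * ψ l)
    (hd : ∀ l ∈ Icc (-1 : ℝ) 1, ContinuousAt (fun p => fderiv ℂ f p (0, 1)) (z, w l) ∧
      DifferentiableAt ℂ f (z, w l))
    (hN : ∀ l ∈ Icc (-1 : ℝ) 1, ∀ᶠ p in 𝓝 (z, w l), ∀ y : ℂ, ev p.1 x θ = ev z x θ →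
      ev p.2 x θ = c * y → N y = c₀ * ev (f p) x θ) :
    (∀ l ∈ Icc (-1 : ℝ) 1, DifferentiableAt ℂ N (ψ l)) ∧
      ContinuousOn (fun l => deriv N (ψ l)) (Icc (-1) 1) ∧
      (∫ l in (-1 : ℝ)..1, N (ψ l)) = c₀ * ev (∫ l in (-1 : ℝ)..1, f (z, w l)) x θ ∧
      ∀ a : ℝ → WienerAlg (HolB U) σ, Continuous a →
        (∫ l in (-1 : ℝ)..1, deriv N (ψ l) * ev (a l) x θ) =
          c₀ * c * ev (∫ l in (-1 : ℝ)..1, fderiv ℂ f (z, w l) (0, 1) * a l) x θ := by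
  have hI : uIcc (-1 : ℝ) 1 = Icc (-1) 1 := uIcc_of_le (by norm_num)
  have hzw : Continuous fun l => (z, w l) := by fun_prop
  have hD : ∀ l ∈ Icc (-1 : ℝ) 1,
      HasDerivAt N (c₀ * c * ev (fderiv ℂ f (z, w l) (0, 1)) x θ) (ψ l) := by
    intro l hl
    -- Adding a scalar multiple of the unit moves the value at `(x, θ)` to `c * y`. The numerical
    -- derivative of `N` is therefore the value of the partial derivative of `f` in the algebra.
    set γ : ℂ → WienerAlg (HolB U) σ × WienerAlg (HolB U) σ :=
      fun y => (z, w l + (c * (y - ψ l)) • 1) with hγ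
    have hγ0 : γ (ψ l) = (z, w l) := by simp [hγ]
    have hγd : HasDerivAt γ (0, c • 1) (ψ l) := by
      refine (hasDerivAt_const _ z).prodMk ?_
      have h1 := ((((hasDerivAt_id (ψ l)).sub_const (ψ l)).const_mul c).smul_const
        (1 : WienerAlg (HolB U) σ)).const_add (w l)
      simpa using h1
    have hev := (evL hx hθ).hasFDerivAt.comp_hasDerivAt (ψ l)
      (((hγ0 ▸ (hd l hl).2).hasFDerivAt).comp_hasDerivAt (ψ l) hγd)
    have e : (0, c • (1 : WienerAlg (HolB U) σ)) = c • ((0, 1) : WienerAlg (HolB U) σ × _) := by simp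
    rw [hγ0, e, map_smul, map_smul, evL_apply, smul_eq_mul] at hev
    refine ((hev.const_mul c₀).congr_deriv (by ring)).congr_of_eventuallyEq ?_
    have ht : Tendsto γ (𝓝 (ψ l)) (𝓝 (z, w l)) := hγ0 ▸ hγd.continuousAt.tendsto
    filter_upwards [ht.eventually (hN l hl)] with y hy
    rw [hy y rfl, Function.comp_apply, Function.comp_apply, evL_apply]
    rw [ev_add _ _ hx hθ, ev_smul _ _ hx hθ, ev_one hx hθ, hw]
    ring
  have hfc : ContinuousOn (fun l => f (z, w l)) (Icc (-1) 1) := fun l hl =>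
    (ContinuousAt.comp (g := f) (f := fun l => (z, w l)) (hd l hl).2.continuousAt
      hzw.continuousAt).continuousWithinAt
  have hf'c : ContinuousOn (fun l => fderiv ℂ f (z, w l) (0, 1)) (Icc (-1) 1) := fun l hl =>
    (ContinuousAt.comp (g := fun p => fderiv ℂ f p (0, 1)) (f := fun l => (z, w l)) (hd l hl).1
      hzw.continuousAt).continuousWithinAt
  refine ⟨fun l hl => (hD l hl).differentiableAt, ?_, ?_, fun a ha => ?_⟩
  · refine ContinuousOn.congr ?_ fun l hl => (hD l hl).deriv
    refine continuousOn_const.mul ?_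
    simp only [← evL_apply hx hθ]
    exact (evL hx hθ).continuous.comp_continuousOn hf'c
  · rw [ev_integral hfc hx hθ, ← intervalIntegral.integral_const_mul]
    refine intervalIntegral.integral_congr fun l hl => ?_
    exact (hN l (hI ▸ hl)).self_of_nhds (ψ l) rfl (hw l)
  · have hm : ContinuousOn (fun l => fderiv ℂ f (z, w l) (0, 1) * a l) (Icc (-1) 1) :=
      hf'c.mul ha.continuousOn
    rw [ev_integral hm hx hθ, ← intervalIntegral.integral_const_mul]
    refine intervalIntegral.integral_congr fun l hl => ?_
    simp only [(hD l (hI ▸ hl)).deriv, ev_mul _ _ hx hθ]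
    ring

/-- The segment between two elements. -/
def segEl (a b : WienerAlg (HolB U) σ) (l : ℝ) : WienerAlg (HolB U) σ :=
  (1 / 2 : ℂ) • (a + b) + (l : ℂ) • ((1 / 2 : ℂ) • (a - b))

theorem continuous_segEl (a b : WienerAlg (HolB U) σ) : Continuous (segEl a b) :=
  continuous_const.add (Complex.continuous_ofReal.smul continuous_const)

theorem ev_segEl (a b : WienerAlg (HolB U) σ) (l : ℝ) {x θ : ℂ} (hx : x ∈ U) (hθ : |θ.im| ≤ σ) :
    ev (segEl a b l) x θ = (ev a x θ + ev b x θ) / 2 + l * ((ev a x θ - ev b x θ) / 2) := by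
  simp only [segEl, ← evHom_apply hx hθ, map_add, map_sub, map_smul, smul_eq_mul]
  ring

theorem norm_segEl_le {a b : WienerAlg (HolB U) σ} {ρ : ℝ} (ha : ‖a‖ ≤ ρ) (hb : ‖b‖ ≤ ρ) {l : ℝ}
    (hl : l ∈ Icc (-1 : ℝ) 1) : ‖segEl a b l‖ ≤ 2 * ρ := by
  have hl' : ‖(l : ℂ)‖ ≤ 1 := by rw [Complex.norm_real, Real.norm_eq_abs, abs_le]; exact hl
  have h2 : ‖(1 / 2 : ℂ)‖ = 1 / 2 := by norm_num
  calc ‖segEl a b l‖ ≤ 1 / 2 * (‖a‖ + ‖b‖) + 1 * (1 / 2 * (‖a‖ + ‖b‖)) := by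
        refine (norm_add_le _ _).trans ?_
        rw [norm_smul, norm_smul, norm_smul, h2]
        gcongr
        · exact norm_add_le _ _
        · exact norm_sub_le _ _
    _ ≤ _ := by linarith

end InnerSystem

namespace InnerSystem

open WienerAlg

variable {S : InnerSystem} {cf cg ch : Fin 3 → Fin 3 → Fin 3 → ℂ} {U : Opens ℂ} {σ : ℝ≥0}

set_option maxHeartbeats 2000000 in
/-- The coefficients of the equation for the difference, as elements of the algebra. -/
theorem exists_coefficients (hf : HasCubicPart S.f cf) (hg : HasCubicPart S.g cg)
    (hh : HasCubicPart S.h ch) [Nonempty U] (D : ModeDomain U) (σ : ℝ≥0) (k₀ : ℂ) (ρ : ℝ) :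
    ∃ κ₀ K : ℝ, 0 < κ₀ ∧ ∀ κ, κ₀ ≤ κ → ∀ Ψu Ψθu Ψsu Ψv Ψθv Ψsv : WienerAlg (HolB U) σ,
      ‖Ψu‖ ≤ ρ → ‖Ψθu‖ ≤ ρ → ‖Ψsu‖ ≤ ρ → ‖Ψv‖ ≤ ρ → ‖Ψθv‖ ≤ ρ → ‖Ψsv‖ ≤ ρ →
      HasPartials κ (zEl D σ κ ^ 3 * (k₀ • 1 + zEl D σ κ * Ψu)) (zEl D σ κ ^ 4 * Ψθu)
        (zEl D σ κ ^ 4 * Ψsu) →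
      HasPartials κ (zEl D σ κ ^ 3 * (k₀ • 1 + zEl D σ κ * Ψv)) (zEl D σ κ ^ 4 * Ψθv)
        (zEl D σ κ ^ 4 * Ψsv) →
      ∃ A₁ A₂ A₃ : WienerAlg (HolB U) σ, ‖A₁‖ ≤ K ∧ ‖A₂‖ ≤ K ∧ ‖A₃‖ ≤ K ∧
        ∀ ψu ψv : ℂ → ℂ → ℂ,
        ψu = (fun s θ => ev (zEl D σ κ ^ 3 * (k₀ • 1 + zEl D σ κ * Ψu)) (s / κ) θ) →
        ψv = (fun s θ => ev (zEl D σ κ ^ 3 * (k₀ • 1 + zEl D σ κ * Ψv)) (s / κ) θ) →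
        ∀ s : ℂ, s / κ ∈ U → ∀ θ : ℂ, |θ.im| < σ →
          S.a₁ ψu ψv s θ = ev (zEl D σ κ ^ 2 * A₁) (s / κ) θ ∧
          S.a₂ ψu ψv s θ = ev (zEl D σ κ * ((2 * S.b * k₀) • 1 +
            cubicForm ch (S.dir₀ (cosEl U σ) (sinEl U σ)) + zEl D σ κ * A₂)) (s / κ) θ ∧
          S.a₃ ψu ψv s θ = ev (zEl D σ κ ^ 2 * A₃) (s / κ) θ ∧
          (S.InnerEquationAt ψu s θ → S.InnerEquationAt ψv s θ →
            S.DifferenceEquationAt ψu ψv (fun s θ => ψu s θ - ψv s θ) s θ) := by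
  obtain ⟨F, G, H, hlift, ⟨hFa, -⟩, hGa, hHa, H₁, H₂, hH₁, hH₂, hHe⟩ :=
    S.exists_lifts hf hg hh (cosEl U σ) (sinEl U σ)
  obtain ⟨KF, hKF, hF⟩ := hFa.eventually_partial
  obtain ⟨KG, hKG, hG⟩ := hGa.eventually_partial
  obtain ⟨KH, hKH, hH⟩ := hHa.eventually_partial
  obtain ⟨K1, hK1, h1⟩ := hH₁.eventually_partial
  obtain ⟨K2, hK2, h2⟩ := hH₂.eventually_partial
  obtain ⟨δ, hδ, hball⟩ := Metric.eventually_nhds_iff.1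
    (hlift.F_eq.eventually_nhds.and (hF.and (hG.and (hH.and (h1.and (h2.and hHe))))))
  simp only [dist_zero_right] at hball
  set ρ' := |ρ| with hρ'
  have hρρ : ρ ≤ ρ' := le_abs_self ρ
  have hρ0 : 0 ≤ ρ' := abs_nonneg ρ
  have hr := D.radius_pos
  set m := ‖k₀‖ + 2 * ρ' with hm
  set ζ : ℝ := min 1 (δ / (2 * (1 + ‖S.coupling‖ * m))) with hζ
  have hζ0 : 0 < ζ := by positivity
  set c2 := ‖(1 / 2 * S.coupling : ℂ)‖
  set c3 := ‖((S.d + 1) / (2 * S.b) * S.coupling : ℂ)‖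
  set cb := ‖(S.b : ℂ)‖
  refine ⟨D.radius⁻¹ / ζ, c2 * (2 * KF) + c3 * (2 * KH) + c2 * (2 * (KG * (2 * ρ'))) +
    c2 * (2 * (KH * (2 * ρ'))) + cb * (2 * ρ') + 2 * K1 + ‖S.coupling‖ * m * (2 * K2) + 2 * KG,
    by positivity, fun κ hκ Ψu Ψθu Ψsu Ψv Ψθv Ψsv bu buθ bus bv bvθ bvs hpu hpv => ?_⟩
  have hκ0 : 0 < κ := lt_of_lt_of_le (by positivity) hκ
  set z := zEl D σ κ with hz
  have hzn : ‖z‖ ≤ ζ := by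
    refine (norm_zEl_le D hκ0).trans ?_
    rw [div_le_iff₀ hκ0, ← div_le_iff₀' hζ0]
    exact hκ
  have hz1 : ‖z‖ ≤ 1 := hzn.trans (min_le_left _ _)
  have h1m : 0 < 1 + ‖S.coupling‖ * m := by positivity
  have hzδ : ‖z‖ * (1 + ‖S.coupling‖ * m) < δ := by
    calc _ ≤ δ / (2 * (1 + ‖S.coupling‖ * m)) * (1 + ‖S.coupling‖ * m) := by
          gcongr; exact hzn.trans (min_le_right _ _)
      _ = δ / 2 := by field_simp
      _ < δ := by linarith
  rw [mul_add, mul_one] at hzδ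
  have hz0 := norm_nonneg z
  have hcm : 0 ≤ ‖z‖ * (‖S.coupling‖ * m) := by positivity
  -- At the point considered `s⁻³ Φ l` is the segment at parameter `l`, so `w l` represents the
  -- rescaled variable `coupling * s² * ψ_l`.
  set Φ : ℝ → WienerAlg (HolB U) σ := fun l => k₀ • 1 + z * segEl Ψu Ψv l with hΦ
  set w : ℝ → WienerAlg (HolB U) σ := fun l => S.coupling • (z * Φ l) with hwdef
  have hΦc : Continuous Φ := continuous_const.add (continuous_const.mul (continuous_segEl _ _))
  have hwc : Continuous w := by
    have : Continuous fun l => z * Φ l := continuous_const.mul hΦc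
    exact this.const_smul S.coupling
  have hΦn : ∀ l ∈ Icc (-1 : ℝ) 1, ‖Φ l‖ ≤ m := fun l hl => by
    refine (norm_add_le _ _).trans (add_le_add ?_ ?_)
    · rw [norm_smul, norm_one, mul_one]
    · refine (norm_mul_le _ _).trans ((mul_le_of_le_one_left (norm_nonneg _) hz1).trans ?_)
      exact norm_segEl_le (bu.trans hρρ) (bv.trans hρρ) hl
  have hzw : ∀ l ∈ Icc (-1 : ℝ) 1, ‖(z, w l)‖ < δ := fun l hl => by
    refine max_lt (by linarith) ?_
    rw [hwdef, norm_smul]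
    calc ‖S.coupling‖ * ‖z * Φ l‖ ≤ ‖S.coupling‖ * (‖z‖ * m) := by
          gcongr; exact (norm_mul_le _ _).trans (by gcongr; exact hΦn l hl)
      _ = ‖z‖ * (‖S.coupling‖ * m) := by ring
      _ < δ := by linarith
  have hb := fun l hl => hball (hzw l hl)
  set IF : WienerAlg (HolB U) σ := ∫ l in (-1 : ℝ)..1, fderiv ℂ F (z, w l) (0, 1) * 1 with hIF
  set IH : WienerAlg (HolB U) σ := ∫ l in (-1 : ℝ)..1, fderiv ℂ H (z, w l) (0, 1) * 1 with hIH
  set IG : WienerAlg (HolB U) σ :=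
    ∫ l in (-1 : ℝ)..1, fderiv ℂ G (z, w l) (0, 1) * segEl Ψθu Ψθv l with hIG
  set IS : WienerAlg (HolB U) σ :=
    ∫ l in (-1 : ℝ)..1, fderiv ℂ H (z, w l) (0, 1) * segEl Ψsu Ψsv l with hIS
  set J1 : WienerAlg (HolB U) σ := ∫ l in (-1 : ℝ)..1, H₁ (z, w l) with hJ1
  set J2 : WienerAlg (HolB U) σ := ∫ l in (-1 : ℝ)..1, Φ l * H₂ (z, w l) with hJ2
  set JG : WienerAlg (HolB U) σ := ∫ l in (-1 : ℝ)..1, G (z, w l) with hJG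
  have nIF : ‖IF‖ ≤ 2 * KF := norm_segment_integral_le fun l hl => by
    rw [mul_one]; exact (hb l hl).2.1.2.1
  have nIH : ‖IH‖ ≤ 2 * KH := norm_segment_integral_le fun l hl => by
    rw [mul_one]; exact (hb l hl).2.2.2.1.2.1
  have nIG : ‖IG‖ ≤ 2 * (KG * (2 * ρ')) := norm_segment_integral_le fun l hl =>
    (norm_mul_le _ _).trans (mul_le_mul (hb l hl).2.2.1.2.1
      (norm_segEl_le (buθ.trans hρρ) (bvθ.trans hρρ) hl) (norm_nonneg _) hKG)
  have nIS : ‖IS‖ ≤ 2 * (KH * (2 * ρ')) := norm_segment_integral_le fun l hl =>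
    (norm_mul_le _ _).trans (mul_le_mul (hb l hl).2.2.2.1.2.1
      (norm_segEl_le (bus.trans hρρ) (bvs.trans hρρ) hl) (norm_nonneg _) hKH)
  have nJ1 : ‖J1‖ ≤ 2 * K1 := norm_segment_integral_le fun l hl => (hb l hl).2.2.2.2.1.1
  have nJ2 : ‖J2‖ ≤ 2 * (m * K2) := norm_segment_integral_le fun l hl =>
    (norm_mul_le _ _).trans (mul_le_mul (hΦn l hl) (hb l hl).2.2.2.2.2.1.1 (norm_nonneg _)
      (by positivity))
  have nJG : ‖JG‖ ≤ 2 * KG := norm_segment_integral_le fun l hl => (hb l hl).2.2.1.1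
  have cJ1 : ContinuousOn (fun l => H₁ (z, w l)) (Icc (-1) 1) := fun l hl =>
    (ContinuousAt.comp (g := H₁) (f := fun l => (z, w l)) (hb l hl).2.2.2.2.1.2.2.1
      (by fun_prop)).continuousWithinAt
  have cJ2 : ContinuousOn (fun l => Φ l * H₂ (z, w l)) (Icc (-1) 1) := fun l hl =>
    (hΦc.continuousAt.mul (ContinuousAt.comp (g := H₂) (f := fun l => (z, w l))
      (hb l hl).2.2.2.2.2.1.2.2.1 (by fun_prop))).continuousWithinAt
  have iJ : ∀ {c : ℝ → WienerAlg (HolB U) σ}, ContinuousOn c (Icc (-1) 1) →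
      IntervalIntegrable c volume (-1) 1 := fun hc =>
    ContinuousOn.intervalIntegrable (by rwa [uIcc_of_le (by norm_num)])
  set H₀ := cubicForm ch (S.dir₀ (cosEl U σ) (sinEl U σ)) with hH₀
  -- Splitting off the remainder of `H` isolates its leading term, which is part of the `s⁻¹`
  -- coefficient of `a₂` and hence of the logarithmic constant.
  have hJH : (∫ l in (-1 : ℝ)..1, H (z, w l)) = (2 : ℂ) • H₀ + z * J1 +
      S.coupling • (z * J2) := by
    have e : ∀ l ∈ uIcc (-1 : ℝ) 1, H (z, w l) = H₀ + z * H₁ (z, w l) +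
        S.coupling • (z * (Φ l * H₂ (z, w l))) := fun l hl => by
      rw [uIcc_of_le (by norm_num)] at hl
      rw [(hb l hl).2.2.2.2.2.2]
      simp only [hwdef, smul_mul_assoc, mul_assoc]
    have i1 := iJ (continuousOn_const (c := H₀))
    have i2 : IntervalIntegrable (fun l => z * H₁ (z, w l)) volume (-1) 1 :=
      iJ ((continuousOn_const (c := z)).mul cJ1)
    have i3 : IntervalIntegrable (fun l => S.coupling • (z * (Φ l * H₂ (z, w l)))) volume (-1) 1 :=
      iJ (((continuousOn_const (c := z)).mul cJ2).const_smul S.coupling)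
    rw [intervalIntegral.integral_congr e, intervalIntegral.integral_add (i1.add i2) i3,
      intervalIntegral.integral_add i1 i2, intervalIntegral.integral_smul,
      intervalIntegral.integral_const]
    have hl : ∀ {c : ℝ → WienerAlg (HolB U) σ}, ContinuousOn c (Icc (-1) 1) →
        (∫ l in (-1 : ℝ)..1, z * c l) = z * ∫ l in (-1 : ℝ)..1, c l := fun {c} hc =>
      ContinuousLinearMap.intervalIntegral_comp_comm
        (ContinuousLinearMap.mul ℂ (WienerAlg (HolB U) σ) z) (iJ hc)
    rw [hl cJ1, hl cJ2]
    congr 2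
    rw [show (1 - (-1) : ℝ) = 2 by norm_num, ← Complex.coe_smul]; norm_num
  have bsum : ∀ {a b : WienerAlg (HolB U) σ}, ‖a‖ ≤ ρ → ‖b‖ ≤ ρ →
      ‖(S.b : ℂ) • (a + b)‖ ≤ cb * (2 * ρ') := fun {a b} ha hb' => by
    rw [norm_smul]
    gcongr
    exact (norm_add_le _ _).trans (by linarith)
  have hp1 : 0 ≤ c2 * (2 * KF) + c3 * (2 * KH) + c2 * (2 * (KG * (2 * ρ'))) := by positivity
  have hp2 : 0 ≤ c2 * (2 * (KH * (2 * ρ'))) := by positivity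
  have hp3 : 0 ≤ 2 * K1 + ‖S.coupling‖ * m * (2 * K2) := by positivity
  have hp4 : 0 ≤ cb * (2 * ρ') := by positivity
  refine ⟨(1 / 2 * S.coupling : ℂ) • IF + ((S.d + 1) / (2 * S.b) * S.coupling : ℂ) • IH -
      (1 / 2 * S.coupling : ℂ) • (z * (z * IG)) + (S.b : ℂ) • (Ψsu + Ψsv) +
      (1 / 2 * S.coupling : ℂ) • (z * IS),
    (S.b : ℂ) • (Ψu + Ψv) + (1 / 2 : ℂ) • (J1 + S.coupling • J2), (-(1 / 2) : ℂ) • JG,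
    ?_, ?_, ?_, ?_⟩
  · have t1 : ‖(1 / 2 * S.coupling : ℂ) • IF‖ ≤ c2 * (2 * KF) := by rw [norm_smul]; gcongr
    have t2 : ‖((S.d + 1) / (2 * S.b) * S.coupling : ℂ) • IH‖ ≤ c3 * (2 * KH) := by
      rw [norm_smul]; gcongr
    have t3 : ‖(1 / 2 * S.coupling : ℂ) • (z * (z * IG))‖ ≤ c2 * (2 * (KG * (2 * ρ'))) := by
      rw [norm_smul]; gcongr
      refine (norm_mul_le _ _).trans ((mul_le_of_le_one_left (norm_nonneg _) hz1).trans ?_)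
      exact (norm_mul_le _ _).trans ((mul_le_of_le_one_left (norm_nonneg _) hz1).trans nIG)
    have t4 : ‖(1 / 2 * S.coupling : ℂ) • (z * IS)‖ ≤ c2 * (2 * (KH * (2 * ρ'))) := by
      rw [norm_smul]; gcongr
      exact (norm_mul_le _ _).trans ((mul_le_of_le_one_left (norm_nonneg _) hz1).trans nIS)
    refine (norm_add_le _ _).trans ((add_le_add ((norm_add_le _ _).trans (add_le_add
      ((norm_sub_le _ _).trans (add_le_add ((norm_add_le _ _).trans (add_le_add t1 t2)) t3))
      (bsum bus bvs))) t4).trans ?_)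
    linarith
  · have t1 : ‖(1 / 2 : ℂ) • (J1 + S.coupling • J2)‖ ≤ 1 * (2 * K1 + ‖S.coupling‖ * (2 * (m * K2))) := by
      rw [norm_smul]
      gcongr
      · norm_num
      · refine (norm_add_le _ _).trans (add_le_add nJ1 ?_)
        rw [norm_smul]; gcongr
    refine (norm_add_le _ _).trans ((add_le_add (bsum bu bv) t1).trans ?_)
    linarith
  · rw [norm_smul]
    calc _ ≤ 1 * (2 * KG) := by gcongr; norm_num
      _ ≤ _ := by linarith
  rintro ψu ψv hψu hψv s hs θ hθ
  have hs0 : s ≠ 0 := fun h => zero_notMem D (by simpa [h] using hs)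
  have hzev : ev z (s / κ) θ = s⁻¹ := ev_zEl D hκ0.ne' hs hθ.le
  have hus : DifferentiableAt ℂ (fun x => ψu x θ) s := by
    rw [hψu]; exact (hpu.fst s hs θ hθ).differentiableAt
  have hvs : DifferentiableAt ℂ (fun x => ψv x θ) s := by
    rw [hψv]; exact (hpv.fst s hs θ hθ).differentiableAt
  have huθ : DifferentiableAt ℂ (fun y => ψu s y) θ := by
    rw [hψu]; exact (hpu.angle s hs θ hθ).differentiableAt
  have hvθ : DifferentiableAt ℂ (fun y => ψv s y) θ := by
    rw [hψv]; exact (hpv.angle s hs θ hθ).differentiableAt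
  have eu : pds ψu s θ = s⁻¹ ^ 4 * ev Ψsu (s / κ) θ := by
    rw [hψu, hpu.pds_eq hs hθ, ← hzev]
    simp only [← evHom_apply hs hθ.le, map_mul, map_pow]
  have ev' : pds ψv s θ = s⁻¹ ^ 4 * ev Ψsv (s / κ) θ := by
    rw [hψv, hpv.pds_eq hs hθ, ← hzev]
    simp only [← evHom_apply hs hθ.le, map_mul, map_pow]
  have euθ : pdθ ψu s θ = s⁻¹ ^ 4 * ev Ψθu (s / κ) θ := by
    rw [hψu, hpu.pdθ_eq hs hθ, ← hzev]
    simp only [← evHom_apply hs hθ.le, map_mul, map_pow]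
  have evθ : pdθ ψv s θ = s⁻¹ ^ 4 * ev Ψθv (s / κ) θ := by
    rw [hψv, hpv.pdθ_eq hs hθ, ← hzev]
    simp only [← evHom_apply hs hθ.le, map_mul, map_pow]
  have vu : ψu s θ = s⁻¹ ^ 3 * (k₀ + s⁻¹ * ev Ψu (s / κ) θ) := by
    rw [hψu, ← hzev]
    simp only [← evHom_apply hs hθ.le, map_add, map_mul, map_pow, map_smul, map_one, smul_eq_mul,
      mul_one]
  have vv : ψv s θ = s⁻¹ ^ 3 * (k₀ + s⁻¹ * ev Ψv (s / κ) θ) := by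
    rw [hψv, ← hzev]
    simp only [← evHom_apply hs hθ.le, map_add, map_mul, map_pow, map_smul, map_one, smul_eq_mul,
      mul_one]
  clear_value z m ζ
  clear hψu hψv hpu hpv
  have hseg : ∀ l, seg ψu ψv l s θ = s⁻¹ ^ 3 * ev (Φ l) (s / κ) θ := fun l => by
    rw [seg, vu, vv]
    simp only [hΦ]
    rw [ev_add _ _ hs hθ.le, ev_smul _ _ hs hθ.le, ev_one hs hθ.le, ev_mul _ _ hs hθ.le,
      ev_segEl _ _ _ hs hθ.le, hzev]
    ring
  have hwev : ∀ l, ev (w l) (s / κ) θ = S.coupling * s ^ 2 * seg ψu ψv l s θ := fun l => by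
    rw [hseg]
    simp only [hwdef]
    rw [ev_smul _ _ hs hθ.le, ev_mul _ _ hs hθ.le, hzev]
    field_simp
  have hval : ∀ l ∈ Icc (-1 : ℝ) 1, ∀ᶠ p in 𝓝 (z, w l), ∀ y : ℂ,
      ev p.1 (s / κ) θ = ev z (s / κ) θ → ev p.2 (s / κ) θ = S.coupling * s ^ 2 * y →
      S.Fhat y s θ = s⁻¹ ^ 4 * ev (F p) (s / κ) θ ∧ S.Ghat y s θ = s⁻¹ ^ 2 * ev (G p) (s / κ) θ ∧
        S.Hhat y s θ = s⁻¹ ^ 3 * ev (H p) (s / κ) θ := fun l hl => by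
    filter_upwards [(hb l hl).1] with p hp y h1 h2
    have := hp (evHom hs hθ.le) (isContractive_evHom hs hθ.le) s θ y hs0
      ((evHom_apply _ _ _).trans (ev_cosEl hs hθ.le)) ((evHom_apply _ _ _).trans (ev_sinEl hs hθ.le))
      ((evHom_apply _ _ _).trans (h1.trans hzev)) ((evHom_apply _ _ _).trans h2)
    simpa only [evHom_apply] using this
  obtain ⟨dF, cF, -, rF⟩ := segment_of_lift (f := F) (N := fun y => S.Fhat y s θ) hs hθ.le hwc hwev
    (fun l hl => (hb l hl).2.1.2.2.2) (fun l hl => (hval l hl).mono fun p hp y h1 h2 => (hp y h1 h2).1)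
  obtain ⟨dG, cG, iG, rG⟩ := segment_of_lift (f := G) (N := fun y => S.Ghat y s θ) hs hθ.le hwc hwev
    (fun l hl => (hb l hl).2.2.1.2.2.2)
    (fun l hl => (hval l hl).mono fun p hp y h1 h2 => (hp y h1 h2).2.1)
  obtain ⟨dH, cH, iH, rH⟩ := segment_of_lift (f := H) (N := fun y => S.Hhat y s θ) hs hθ.le hwc hwev
    (fun l hl => (hb l hl).2.2.2.1.2.2.2)
    (fun l hl => (hval l hl).mono fun p hp y h1 h2 => (hp y h1 h2).2.2)
  have rF1 := rF (fun _ => 1) continuous_const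
  have rH1 := rH (fun _ => 1) continuous_const
  have rGθ := rG _ (continuous_segEl Ψθu Ψθv)
  have rHs := rH _ (continuous_segEl Ψsu Ψsv)
  simp only [ev_one hs hθ.le, mul_one] at rF1 rH1
  have pθ : ∀ l, pdθ (seg ψu ψv l) s θ = s⁻¹ ^ 4 * ev (segEl Ψθu Ψθv l) (s / κ) θ := fun l => by
    rw [pdθ_seg huθ hvθ, euθ, evθ, ev_segEl _ _ _ hs hθ.le]; ring
  have ps : ∀ l, pds (seg ψu ψv l) s θ = s⁻¹ ^ 4 * ev (segEl Ψsu Ψsv l) (s / κ) θ := fun l => by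
    rw [pds_seg hus hvs, eu, ev', ev_segEl _ _ _ hs hθ.le]; ring
  refine ⟨?_, ?_, ?_, fun hu hv => differenceEquationAt_sub hus hvs huθ hvθ ⟨dF, cF⟩ ⟨dG, cG⟩
    ⟨dH, cH⟩ hu hv⟩
  · simp only [a₁, pθ, ps, mul_left_comm _ (s⁻¹ ^ 4), intervalIntegral.integral_const_mul]
    rw [rF1, rH1, rGθ, rHs, eu, ev']
    simp only [← evHom_apply hs hθ.le, map_add, map_sub, map_mul, map_pow, map_smul, smul_eq_mul]
    simp only [evHom_apply, hzev, hIF, hIH, hIG, hIS, mul_one]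
    field_simp
  · rw [a₂, iH, hJH, vu, vv]
    simp only [← evHom_apply hs hθ.le, map_add, map_mul, map_smul, smul_eq_mul, map_one]
    simp only [evHom_apply, hzev]
    field_simp
    ring
  · rw [a₃, iG]
    simp only [← evHom_apply hs hθ.le, map_mul, map_pow, map_smul, smul_eq_mul]
    simp only [evHom_apply, hzev, hJG]
    ring

end InnerSystem

/-! ### Corrections to the phase and to the prefactor. -/

namespace WienerAlg

variable {U : Opens ℂ} {σ : ℝ≥0}

set_option maxHeartbeats 1000000 in
/-- Decaying solutions of the linear transport equation with small coefficients. -/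
theorem exists_linear_solution (D : ModeDomain U) (σ : ℝ≥0) {α d : ℝ} (hα : 0 < α) (hd : 0 < d)
    (c K : ℝ) (hK : 0 ≤ K) :
    ∃ κ₀ C : ℝ, 0 < κ₀ ∧ ∀ κ, κ₀ ≤ κ → ∀ A₂ A₃ τ : WienerAlg (HolB U) σ,
      ‖A₂‖ ≤ K → ‖A₃‖ ≤ K → ‖τ‖ ≤ K → ∃ Y Yθ Ys : WienerAlg (HolB U) σ,
        ‖Y‖ ≤ C ∧ ‖Yθ‖ ≤ C ∧ ‖Ys‖ ≤ C ∧
        HasPartials κ (zEl D σ κ * Y) (zEl D σ κ ^ 2 * Yθ) (zEl D σ κ ^ 2 * Ys) ∧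
        (d : ℂ) • Ys = (α : ℂ) • Yθ + τ + zEl D σ κ * A₂ * Ys +
          ((c : ℂ) • zEl D σ κ + zEl D σ κ ^ 2 * A₃) * Yθ := by
  have hr := D.radius_pos
  have hC := D.C_nonneg
  have hd' : (d : ℂ) ≠ 0 := by exact_mod_cast hd.ne'
  set o := D.C / α with ho
  have ho0 : 0 ≤ o := by positivity
  set y := d⁻¹ * (α * o + 1) + 2 * o with hy
  have hy0 : 0 ≤ y := by positivity
  set W := 2 * d * o + K * y + (|c| + K) * o + 1 with hW
  have hW0 : 0 < W := by positivity
  set ζ := min 1 (1 / (2 * W)) with hζ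
  have hζ0 : 0 < ζ := by positivity
  refine ⟨D.radius⁻¹ / ζ, (|d|⁻¹ * (1 / (2 - 1)) + o + y) * (2 * K), by positivity,
    fun κ hκ A₂ A₃ τ hA₂ hA₃ hτ => ?_⟩
  have hκ0 : 0 < κ := lt_of_lt_of_le (by positivity) hκ
  set z := zEl D σ κ with hz
  have hzn : ‖z‖ ≤ ζ := by
    refine (norm_zEl_le D hκ0).trans ?_
    rw [div_le_iff₀ hκ0, ← div_le_iff₀' hζ0]
    exact hκ
  have hz1 : ‖z‖ ≤ 1 := hzn.trans (min_le_left _ _)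
  have hzW : ‖z‖ ≤ 1 / (2 * W) := hzn.trans (min_le_right _ _)
  set O := oscL (σ := σ) D hα hd hκ0 with hO
  set Oθ := oscθL (σ := σ) D hα hd hκ0 with hOθ
  let L : WienerAlg (HolB U) σ → WienerAlg (HolB U) σ →L[ℂ] WienerAlg (HolB U) σ := fun a =>
    ContinuousLinearMap.mul ℂ _ a
  -- For `Y = g + z O`, the value of `X` is the coefficient of `z²` in `∂_s (z Y)`. The choice `ν =
  -- 2` cancels the two terms in `g`.
  let X : WienerAlg (HolB U) σ →L[ℂ] WienerAlg (HolB U) σ :=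
    (d⁻¹ : ℂ) • ((α : ℂ) • Oθ + ContinuousLinearMap.id ℂ _) - (2 : ℂ) • (L z).comp O
  let R : WienerAlg (HolB U) σ →L[ℂ] WienerAlg (HolB U) σ :=
    (2 * d : ℂ) • (L z).comp O + (L (z * A₂)).comp X + (L ((c : ℂ) • z + z ^ 2 * A₃)).comp Oθ
  have bO : ∀ χ, ‖O χ‖ ≤ o * ‖χ‖ := fun χ =>
    ContinuousLinearMap.le_of_opNorm_le _ (norm_oscL_le D hα hd hκ0) χ
  have bOθ : ∀ χ, ‖Oθ χ‖ ≤ o * ‖χ‖ := fun χ =>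
    ContinuousLinearMap.le_of_opNorm_le _ (norm_oscθL_le D hα hd hκ0) χ
  have hX : ∀ χ, X χ = (d⁻¹ : ℂ) • ((α : ℂ) • Oθ χ + χ) - (2 : ℂ) • (z * O χ) := fun _ => rfl
  have hR : ∀ χ, R χ = (2 * d : ℂ) • (z * O χ) + z * A₂ * X χ +
      ((c : ℂ) • z + z ^ 2 * A₃) * Oθ χ := fun _ => rfl
  have nr : ∀ r : ℝ, 0 ≤ r → ‖(r : ℂ)‖ = r := fun r hr => by
    rw [Complex.norm_real, Real.norm_of_nonneg hr]
  have bX : ∀ χ, ‖X χ‖ ≤ y * ‖χ‖ := fun χ => by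
    rw [hX]
    calc _ ≤ d⁻¹ * (α * (o * ‖χ‖) + ‖χ‖) + 2 * (1 * (o * ‖χ‖)) := by
          refine (norm_sub_le _ _).trans (add_le_add ?_ ?_)
          · rw [norm_smul, norm_inv, nr d hd.le]
            gcongr
            refine (norm_add_le _ _).trans ?_
            rw [norm_smul, nr α hα.le]
            gcongr
            exact bOθ χ
          · rw [norm_smul]
            gcongr
            · simp
            · exact (norm_mul_le _ _).trans (by gcongr; exact bO χ)
      _ = _ := by ring
  have bR : ∀ χ, ‖R χ‖ ≤ 1 / 2 * ‖χ‖ := fun χ => by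
    have h1 : ‖(2 * d : ℂ) • (z * O χ)‖ ≤ ‖z‖ * (2 * d * o * ‖χ‖) := by
      rw [norm_smul, show (2 * d : ℂ) = ((2 * d : ℝ) : ℂ) by push_cast; rfl, nr _ (by positivity)]
      calc _ ≤ 2 * d * (‖z‖ * (o * ‖χ‖)) := by
            gcongr; exact (norm_mul_le _ _).trans (by gcongr; exact bO χ)
        _ = _ := by ring
    have h2 : ‖z * A₂ * X χ‖ ≤ ‖z‖ * (K * y * ‖χ‖) := by
      calc _ ≤ ‖z‖ * K * (y * ‖χ‖) := (norm_mul_le _ _).trans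
            (mul_le_mul ((norm_mul_le _ _).trans (by gcongr)) (bX χ) (norm_nonneg _) (by positivity))
        _ = _ := by ring
    have h3 : ‖(c : ℂ) • z + z ^ 2 * A₃‖ ≤ ‖z‖ * (|c| + K) := by
      calc _ ≤ |c| * ‖z‖ + ‖z‖ * (1 * K) := by
            refine (norm_add_le _ _).trans (add_le_add ?_ ?_)
            · rw [norm_smul, Complex.norm_real, Real.norm_eq_abs]
            · rw [pow_two, mul_assoc]
              exact (norm_mul_le _ _).trans (by gcongr; exact (norm_mul_le _ _).trans (by gcongr))
        _ = _ := by ring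
    have h4 : ‖((c : ℂ) • z + z ^ 2 * A₃) * Oθ χ‖ ≤ ‖z‖ * ((|c| + K) * o * ‖χ‖) := by
      calc _ ≤ ‖z‖ * (|c| + K) * (o * ‖χ‖) := (norm_mul_le _ _).trans
            (mul_le_mul h3 (bOθ χ) (norm_nonneg _) (by positivity))
        _ = _ := by ring
    rw [hR]
    calc _ ≤ ‖z‖ * (2 * d * o * ‖χ‖) + ‖z‖ * (K * y * ‖χ‖) + ‖z‖ * ((|c| + K) * o * ‖χ‖) :=
          (norm_add_le _ _).trans (add_le_add ((norm_add_le _ _).trans (add_le_add h1 h2)) h4)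
      _ = ‖z‖ * (W - 1) * ‖χ‖ := by rw [hW]; ring
      _ ≤ ‖z‖ * W * ‖χ‖ := by gcongr; linarith
      _ ≤ 1 / (2 * W) * W * ‖χ‖ := by gcongr
      _ = _ := by field_simp
  have hR1 : ‖R‖ < 1 := (R.opNorm_le_bound (by norm_num) bR).trans_lt (by norm_num)
  -- The equation has become `χ = τ + R χ` with `R` of norm at most `1 / 2`, solved by a Neumann
  -- series.
  set χ := (↑(Units.oneSub R hR1)⁻¹ : WienerAlg (HolB U) σ →L[ℂ] WienerAlg (HolB U) σ) τ with hχ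
  have hfix : χ = τ + R χ := by
    have h0 : (1 - R) * (↑(Units.oneSub R hR1)⁻¹ : WienerAlg (HolB U) σ →L[ℂ] WienerAlg (HolB U) σ) =
        1 := by
      rw [← Units.val_oneSub R hR1, Units.mul_inv]
    have h1 := congrArg (fun T : WienerAlg (HolB U) σ →L[ℂ] WienerAlg (HolB U) σ => T τ) h0
    have h2 : χ - R χ = τ := h1
    exact sub_eq_iff_eq_add.1 h2
  have hχn : ‖χ‖ ≤ 2 * K := by
    have h1 := bR χ
    have h2 := norm_add_le τ (R χ)
    rw [← hfix] at h2
    linarith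
  clear_value χ
  have hrad := hasPartials_radL D hκ0 (ν := 2) (by norm_num) d χ
  have hosc := hasPartials_oscL D hα hd hκ0 χ
  have hzp := hasPartials_zEl (σ := σ) D hκ0.ne'
  set g := radL (σ := σ) D (ν := 2) (by norm_num) d χ with hg
  have bg : ‖g‖ ≤ |d|⁻¹ * (1 / (2 - 1)) * ‖χ‖ :=
    ContinuousLinearMap.le_of_opNorm_le _ (norm_radL_le D (by norm_num) d) χ
  have hcd : 0 ≤ |d|⁻¹ * (1 / (2 - 1) : ℝ) := by norm_num
  have hK2 : 0 ≤ 2 * K := by positivity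
  refine ⟨g + z * O χ, Oθ χ, X χ, ?_, ?_, ?_, ?_, ?_⟩
  · calc ‖g + z * O χ‖ ≤ |d|⁻¹ * (1 / (2 - 1)) * (2 * K) + 1 * (o * (2 * K)) := by
          refine (norm_add_le _ _).trans (add_le_add (bg.trans (by gcongr)) ?_)
          exact (norm_mul_le _ _).trans (by gcongr; exact (bO χ).trans (by gcongr))
      _ ≤ _ := by nlinarith [mul_nonneg hy0 hK2]
  · refine (bOθ χ).trans ?_
    calc _ ≤ o * (2 * K) := by gcongr
      _ ≤ _ := by nlinarith [mul_nonneg hy0 hK2, mul_nonneg hcd hK2]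
  · refine (bX χ).trans ?_
    calc _ ≤ y * (2 * K) := by gcongr
      _ ≤ _ := by nlinarith [mul_nonneg ho0 hK2, mul_nonneg hcd hK2]
  · have h := (hzp.mul hrad).add ((hzp.mul hzp).mul hosc)
    rw [hX]
    rw [← hz, ← hO, ← hOθ] at h
    generalize O χ = a at *
    generalize Oθ χ = b at *
    generalize meanL χ = e at *
    clear_value g z
    convert h using 1
    · ring
    · ring
    · simp only [Algebra.smul_def, one_div, map_ofNat]
      norm_num
      ring
  · rw [hX, smul_sub, smul_smul, mul_inv_cancel₀ hd', one_smul]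
    nth_rewrite 2 [hfix]
    rw [hR, ← hX]
    simp only [Algebra.smul_def, map_mul, map_ofNat]
    ring

end WienerAlg

namespace InnerSystem

open WienerAlg

variable {S : InnerSystem} {ch : Fin 3 → Fin 3 → Fin 3 → ℂ} {U : Opens ℂ} {σ : ℝ≥0}

/-- The mean of the leading part of the third nonlinear term. -/
def cubicMean (S : InnerSystem) (ch : Fin 3 → Fin 3 → Fin 3 → ℂ) : ℂ := (1 / (2 * Real.pi)) *
  ∫ t in (0 : ℝ)..(2 * Real.pi), cubicForm ch (S.dir₀ (cos (t : ℂ)) (sin (t : ℂ)))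

theorem ev_cubicForm {s θ : ℂ} (hs : s ∈ U) (hθ : |θ.im| ≤ σ) :
    ev (cubicForm ch (S.dir₀ (cosEl U σ) (sinEl U σ))) s θ = cubicForm ch (S.dir₀ (cos θ) (sin θ)) := by
  rw [← evHom_apply hs hθ, map_cubicForm, map_dir₀, evHom_apply, evHom_apply, ev_cosEl hs hθ,
    ev_sinEl hs hθ]

theorem ev_cubicForm_real : ∀ s ∈ U, ∀ t : ℝ,
    ev (cubicForm ch (S.dir₀ (cosEl U σ) (sinEl U σ))) s t =
      cubicForm ch (S.dir₀ (cos (t : ℂ)) (sin (t : ℂ))) := fun _ hs _ => ev_cubicForm hs (by simp)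

set_option maxHeartbeats 1000000 in
/-- The corrections to the phase and to the logarithm of the prefactor. -/
theorem exists_phase_prefactor (hα : 0 < S.α) (hd : 0 < S.d) (D : ModeDomain U) (σ : ℝ≥0)
    {k₀ L : ℂ} (hL : 2 * S.b * k₀ + S.cubicMean ch = S.d * L) (K : ℝ) (hK : 0 ≤ K) :
    ∃ κ₀ C : ℝ, 0 < κ₀ ∧ ∀ κ, κ₀ ≤ κ → ∀ A₁ A₂ A₃ : WienerAlg (HolB U) σ,
      ‖A₁‖ ≤ K → ‖A₂‖ ≤ K → ‖A₃‖ ≤ K → ∃ u uθ us p pθ ps : WienerAlg (HolB U) σ,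
        ‖u‖ ≤ C ∧ ‖uθ‖ ≤ C ∧ ‖us‖ ≤ C ∧ ‖p‖ ≤ C ∧ ‖pθ‖ ≤ C ∧ ‖ps‖ ≤ C ∧
        HasPartials κ (zEl D σ κ * u) (zEl D σ κ * uθ) (zEl D σ κ ^ 2 * us) ∧
        HasPartials κ (zEl D σ κ * p) (zEl D σ κ ^ 2 * pθ) (zEl D σ κ ^ 2 * ps) ∧
        ∀ s : ℂ, s / κ ∈ U → ∀ θ : ℂ, |θ.im| < σ → ∀ a₁ a₂ a₃ : ℂ,
          a₁ = ev (zEl D σ κ ^ 2 * A₁) (s / κ) θ →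
          a₂ = ev (zEl D σ κ * ((2 * S.b * k₀) • 1 +
            cubicForm ch (S.dir₀ (cosEl U σ) (sinEl U σ)) + zEl D σ κ * A₂)) (s / κ) θ →
          a₃ = ev (zEl D σ κ ^ 2 * A₃) (s / κ) θ →
          -S.α * (1 + ev (zEl D σ κ * uθ) (s / κ) θ) + S.d * (S.α / S.d + (S.c + S.α * L) / S.d * s⁻¹ +
            ev (zEl D σ κ ^ 2 * us) (s / κ) θ) = a₂ * (S.α / S.d + (S.c + S.α * L) / S.d * s⁻¹ +
            ev (zEl D σ κ ^ 2 * us) (s / κ) θ) +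
            (S.c * s⁻¹ + a₃) * (1 + ev (zEl D σ κ * uθ) (s / κ) θ) ∧
          -S.α * ev (zEl D σ κ ^ 2 * pθ) (s / κ) θ + S.d * ev (zEl D σ κ ^ 2 * ps) (s / κ) θ =
            a₁ + a₂ * (2 / S.d * s⁻¹ + ev (zEl D σ κ ^ 2 * ps) (s / κ) θ) +
            (S.c * s⁻¹ + a₃) * ev (zEl D σ κ ^ 2 * pθ) (s / κ) θ := by
  have hr := D.radius_pos
  have hd' : (S.d : ℂ) ≠ 0 := by exact_mod_cast hd.ne'
  have hnorm : ∀ (c : ℂ) {x : WienerAlg (HolB U) σ} {r : ℝ}, ‖x‖ ≤ r → ‖c • x‖ ≤ ‖c‖ * r :=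
    fun c {x r} hx => by rw [norm_smul]; gcongr
  have hmul : ∀ {x y : WienerAlg (HolB U) σ} {r : ℝ}, ‖x‖ ≤ 1 → ‖y‖ ≤ r → ‖x * y‖ ≤ r :=
    fun hx hy => (norm_mul_le _ _).trans ((mul_le_of_le_one_left (norm_nonneg _) hx).trans hy)
  set H₀ : WienerAlg (HolB U) σ := cubicForm ch (S.dir₀ (cosEl U σ) (sinEl U σ)) with hH₀
  have hconst : IsConst H₀ := isConst_of_ev ev_cubicForm_real
  have hmean : meanL H₀ = S.cubicMean ch • 1 := meanL_eq_smul_one ev_cubicForm_real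
  set γ : ℂ := (S.c + S.α * L) / S.d with hγ
  have hγd : S.d * γ = S.c + S.α * L := by rw [hγ]; field_simp
  -- This removes the oscillating part of the `s⁻¹` coefficient of `a₂` from the phase equation. The
  -- mean has no periodic primitive and is left to the logarithm; `hL` says that it is absorbed
  -- exactly.
  set q : WienerAlg (HolB U) σ := (-(S.d : ℂ)⁻¹) • primL H₀ with hq
  set qθ : WienerAlg (HolB U) σ := (-(S.d : ℂ)⁻¹) • (H₀ - meanL H₀) with hqθ
  set B : WienerAlg (HolB U) σ := (2 * S.b * k₀) • 1 + H₀ with hB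
  set KA := ‖B‖ + K with hKA
  have hKA0 : 0 ≤ KA := by positivity
  set Kτ := ‖(S.d : ℂ)‖ * ‖q‖ + ‖(S.α / S.d : ℂ)‖ * K + ‖γ‖ * KA + K + KA * ‖q‖ + ‖(S.c : ℂ)‖ * ‖qθ‖ +
    K * ‖qθ‖ with hKτ
  set Kp := K + ‖(2 / S.d : ℂ)‖ * KA with hKp
  set K' := KA + K + Kτ + Kp with hK'
  have hKτ0 : 0 ≤ Kτ := by positivity
  have hKp0 : 0 ≤ Kp := by positivity
  obtain ⟨κ₀, C, hκ₀, hlin⟩ := exists_linear_solution D σ hα hd S.c K' (by positivity)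
  refine ⟨max κ₀ D.radius⁻¹, ‖q‖ + ‖qθ‖ + |C|, lt_max_of_lt_left hκ₀,
    fun κ hκ A₁ A₂ A₃ h₁ h₂ h₃ => ?_⟩
  have hκ0 : 0 < κ := hκ₀.trans_le ((le_max_left _ _).trans hκ)
  set z := zEl D σ κ with hz
  have hz1 : ‖z‖ ≤ 1 := (norm_zEl_le D hκ0).trans
    ((div_le_one hκ0).2 ((le_max_right _ _).trans hκ))
  set A := B + z * A₂ with hA
  have hAn : ‖A‖ ≤ KA := (norm_add_le _ _).trans (add_le_add le_rfl (hmul hz1 h₂))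
  -- The source of order `s⁻²` that remains in the phase equation when the correction is `s⁻¹ (q +
  -- Y)`.
  set τ := (S.d : ℂ) • q + (S.α / S.d : ℂ) • A₂ + γ • A + A₃ - z * (A * q) + (S.c : ℂ) • qθ +
    z * (A₃ * qθ) with hτ
  have hτn : ‖τ‖ ≤ Kτ := by
    refine (norm_add_le _ _).trans (add_le_add ((norm_add_le _ _).trans (add_le_add
      ((norm_sub_le _ _).trans (add_le_add ((norm_add_le _ _).trans (add_le_add ((norm_add_le _ _).trans
      (add_le_add ((norm_add_le _ _).trans (add_le_add (hnorm _ le_rfl) (hnorm _ h₂))) (hnorm _ hAn))) h₃))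
      (hmul hz1 ?_))) (hnorm _ le_rfl))) (hmul hz1 ?_))
    · exact (norm_mul_le _ _).trans (by gcongr)
    · exact (norm_mul_le _ _).trans (by gcongr)
  have hpn : ‖A₁ + (2 / S.d : ℂ) • A‖ ≤ Kp := (norm_add_le _ _).trans (add_le_add h₁ (hnorm _ hAn))
  obtain ⟨Y, Yθ, Ys, nY, nYθ, nYs, hYp, hYe⟩ := hlin κ ((le_max_left _ _).trans hκ) A A₃ τ
    (by linarith) (by linarith) (by linarith)
  -- The source for the logarithm of the prefactor collects `a₁` and the product of `a₂` with `2 /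
  -- (d s)`, the logarithmic derivative of `s^(2/d)`. Both are of order `s⁻²`.
  obtain ⟨p, pθ, ps, np, npθ, nps, hpp, hpe⟩ := hlin κ ((le_max_left _ _).trans hκ) A A₃
    (A₁ + (2 / S.d : ℂ) • A) (by linarith) (by linarith) (by linarith)
  have hC := le_abs_self C
  have hq0 := norm_nonneg q
  have hqθ0 := norm_nonneg qθ
  refine ⟨q + Y, qθ + z * Yθ, Ys - q, p, pθ, ps, ?_, ?_, ?_, by linarith, by linarith, by linarith,
    ?_, hpp, ?_⟩
  · exact (norm_add_le _ _).trans (by linarith)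
  · exact (norm_add_le _ _).trans (by linarith [hmul hz1 nYθ])
  · exact (norm_sub_le _ _).trans (by linarith)
  · have h := ((hasPartials_zEl (σ := σ) D hκ0.ne').mul
      ((HasPartials.of_prim hκ0.ne' hconst).smul (-(S.d : ℂ)⁻¹))).add hYp
    rw [← hq, ← hqθ, ← hz] at h
    clear_value z q qθ
    convert h using 1
    · ring
    · ring
    · rw [smul_zero]; ring
  · rintro s hs θ hθ a₁ a₂ a₃ rfl rfl rfl
    have hs0 : s ≠ 0 := fun h => zero_notMem D (by simpa [h] using hs)
    have hzev : evHom hs hθ.le z = s⁻¹ := (evHom_apply _ _ _).trans (ev_zEl D hκ0.ne' hs hθ.le)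
    set η := evHom (U := U) (σ := σ) hs hθ.le with hη
    simp only [← evHom_apply hs hθ.le, ← hη]
    rw [← hz] at hYe hpe
    have eY := congrArg η hYe
    have ep := congrArg η hpe
    have eq := congrArg η hqθ
    rw [hmean] at eq
    simp only [hτ, hA, hB, map_add, map_sub, map_mul, map_pow, map_smul, map_one, smul_eq_mul,
      hzev, mul_one] at eY ep eq ⊢
    have hh : η H₀ = S.cubicMean ch - S.d * η qθ := by rw [eq]; field_simp; ring
    have hm : S.cubicMean ch = S.d * L - 2 * S.b * k₀ := by rw [← hL]; ring
    rw [hh, hm] at eY ep ⊢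
    have ha : S.d * (S.α / S.d : ℂ) = S.α := by field_simp
    generalize (S.α / S.d : ℂ) = a at *
    generalize s⁻¹ = ζ at *
    constructor
    · linear_combination ζ ^ 2 * eY + (1 - ζ * (L - η qθ)) * ha + ζ * hγd
    · linear_combination ζ ^ 2 * ep

end InnerSystem

/-! ### Reality of the logarithmic constant. -/

/-- On the real line through `v` the function is `t³` times the form plus `O(t⁴)`; dividing by `t³`
and letting `t` tend to zero leaves the imaginary part of the form. -/
theorem HasCubicPart.im_eq_zero {f : ℂ × ℂ × ℂ → ℂ} {c : Fin 3 → Fin 3 → Fin 3 → ℂ}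
    (hf : HasCubicPart f c)
    (hr : ∀ᶠ p : ℝ × ℝ × ℝ in 𝓝 0, (f ((p.1 : ℂ), (p.2.1 : ℂ), (p.2.2 : ℂ))).im = 0) (v : Fin 3 → ℝ) :
    (cubicForm c fun i => (v i : ℂ)).im = 0 := by
  obtain ⟨ψ, hψ, h⟩ := hf
  have hsum : ∀ (t : ℂ) (g : Fin 3 → Fin 3 → Fin 3 → Fin 3 → ℂ),
      ∑ i, ∑ j, ∑ k, ∑ l, t * (v i : ℂ) * (t * v j) * (t * v k) * (t * v l) * g i j k l =
        t ^ 4 * ∑ i, ∑ j, ∑ k, ∑ l, (v i : ℂ) * v j * v k * v l * g i j k l := by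
    intro t g
    simp only [Finset.mul_sum]
    refine Finset.sum_congr rfl fun i _ => Finset.sum_congr rfl fun j _ =>
      Finset.sum_congr rfl fun k _ => Finset.sum_congr rfl fun l _ => ?_
    ring
  set B : ℝ → ℂ := fun t => ∑ i, ∑ j, ∑ k, ∑ l,
    (v i : ℂ) * v j * v k * v l * ψ i j k l (fun m => (t : ℂ) * v m) with hB
  have hline : ContinuousAt (fun t : ℝ => fun m => (t : ℂ) * (v m : ℂ)) 0 := by fun_prop
  have hline0 : (fun m => ((0 : ℝ) : ℂ) * (v m : ℂ)) = 0 := by ext; simp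
  have hBc : ContinuousAt B 0 := by
    refine tendsto_finsetSum _ fun i _ => tendsto_finsetSum _ fun j _ =>
      tendsto_finsetSum _ fun k _ => tendsto_finsetSum _ fun l _ => tendsto_const_nhds.mul ?_
    exact ContinuousAt.comp (g := ψ i j k l) (f := fun t : ℝ => fun m => (t : ℂ) * (v m : ℂ))
      (by rw [hline0]; exact (hψ i j k l).continuousAt) hline
  have hl3 : Tendsto (fun t : ℝ => (t * v 0, t * v 1, t * v 2)) (𝓝 0) (𝓝 0) := by
    have : ContinuousAt (fun t : ℝ => (t * v 0, t * v 1, t * v 2)) 0 := by fun_prop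
    have e : ((0 : ℝ) * v 0, (0 : ℝ) * v 1, (0 : ℝ) * v 2) = 0 := by simp
    rwa [ContinuousAt, e] at this
  have hl' : Tendsto (fun t : ℝ => fun m => (t : ℂ) * (v m : ℂ)) (𝓝 0)
      (𝓝 fun m => ((0 : ℝ) : ℂ) * (v m : ℂ)) := hline
  rw [hline0] at hl'
  have hev : ∀ᶠ t : ℝ in 𝓝[≠] 0, (cubicForm c fun i => (v i : ℂ)).im = -(t * (B t).im) := by
    have e1 := hl'.eventually h
    filter_upwards [nhdsWithin_le_nhds e1, nhdsWithin_le_nhds (hl3.eventually hr),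
      self_mem_nhdsWithin] with t h1 h2 ht
    have h3 : f ((t : ℂ) * v 0, (t : ℂ) * v 1, (t : ℂ) * v 2) =
        (t : ℂ) ^ 3 * cubicForm c (fun i => (v i : ℂ)) + (t : ℂ) ^ 4 * B t := by
      rw [h1, cubicForm_smul, hsum]
    push_cast at h2
    rw [h3, ← Complex.ofReal_pow, ← Complex.ofReal_pow, Complex.add_im, Complex.im_ofReal_mul,
      Complex.im_ofReal_mul] at h2
    have ht3 : t ^ 3 ≠ 0 := pow_ne_zero 3 ht
    have h4 : t ^ 3 * ((cubicForm c fun i => (v i : ℂ)).im + t * (B t).im) = 0 := by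
      rw [← h2]; ring
    linarith [(mul_eq_zero.1 h4).resolve_left ht3]
  have hlim : Tendsto (fun t : ℝ => -(t * (B t).im)) (𝓝[≠] 0) (𝓝 0) := by
    have : ContinuousAt (fun t : ℝ => -(t * (B t).im)) 0 :=
      (continuousAt_id.mul (Complex.continuous_im.continuousAt.comp hBc)).neg
    have h0 := this.tendsto.mono_left (nhdsWithin_le_nhds (s := {0}ᶜ))
    simpa using h0
  exact tendsto_nhds_unique (tendsto_const_nhds.congr' hev) hlim

/-- A cubic form restricted to a line is a cubic polynomial. -/
theorem cubicForm_line (c : Fin 3 → Fin 3 → Fin 3 → ℂ) (C Z : ℂ) :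
    ∃ a₀ a₁ a₂ a₃ : ℂ, ∀ x : ℂ, cubicForm c ![x * C, x * Z, 1] = a₀ + a₁ * x + a₂ * x ^ 2 + a₃ * x ^ 3 := by
  let w : Fin 3 → ℂ := ![C, Z, 0]
  let e : Fin 3 → ℂ := ![0, 0, 1]
  have hv : ∀ x : ℂ, ![x * C, x * Z, 1] = fun i => e i + x * w i := fun x => by
    ext i; fin_cases i <;> simp [w, e]
  refine ⟨∑ i, ∑ j, ∑ k, c i j k * (e i * e j * e k),
    ∑ i, ∑ j, ∑ k, c i j k * (w i * e j * e k + e i * w j * e k + e i * e j * w k),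
    ∑ i, ∑ j, ∑ k, c i j k * (w i * w j * e k + w i * e j * w k + e i * w j * w k),
    ∑ i, ∑ j, ∑ k, c i j k * (w i * w j * w k), fun x => ?_⟩
  rw [hv, cubicForm]
  simp only [Finset.sum_mul, ← Finset.sum_add_distrib, smul_eq_mul]
  refine Finset.sum_congr rfl fun i _ => Finset.sum_congr rfl fun j _ =>
    Finset.sum_congr rfl fun k _ => ?_
  ring

theorem continuous_cubicForm_circle (c : Fin 3 → Fin 3 → Fin 3 → ℂ) (x : ℂ) :
    Continuous fun t : ℝ => cubicForm c ![x * cos (t : ℂ), x * sin (t : ℂ), 1] := by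
  unfold cubicForm
  refine continuous_finsetSum _ fun i _ => continuous_finsetSum _ fun j _ =>
    continuous_finsetSum _ fun k _ => ?_
  have h : ∀ i : Fin 3, Continuous fun t : ℝ =>
      (![x * cos (t : ℂ), x * sin (t : ℂ), 1] : Fin 3 → ℂ) i := fun i => by
    fin_cases i <;> simp <;> fun_prop
  exact (((h i).mul (h j)).mul (h k)).const_smul (c i j k)

theorem HasCubicPart.im_circle_eq_zero {f : ℂ × ℂ × ℂ → ℂ} {c : Fin 3 → Fin 3 → Fin 3 → ℂ}
    (hf : HasCubicPart f c)
    (hr : ∀ᶠ p : ℝ × ℝ × ℝ in 𝓝 0, (f ((p.1 : ℂ), (p.2.1 : ℂ), (p.2.2 : ℂ))).im = 0) (x t : ℝ) :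
    (cubicForm c ![(x : ℂ) * cos (t : ℂ), (x : ℂ) * sin (t : ℂ), 1]).im = 0 := by
  have h := hf.im_eq_zero hr ![x * Real.cos t, x * Real.sin t, 1]
  convert h using 3
  ext i; fin_cases i <;> simp

/-- The integral of a function that is a real polynomial of degree four in a parameter and that is
invariant under a half turn is real at imaginary parameters. -/
theorem im_integral_eq_zero {P : ℝ → ℂ → ℂ} (hc : ∀ x, Continuous fun t => P t x)
    (hpoly : ∀ t, ∃ a₀ a₁ a₂ a₃ a₄ : ℂ, ∀ x, P t x = a₀ + a₁ * x + a₂ * x ^ 2 + a₃ * x ^ 3 + a₄ * x ^ 4)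
    (hturn : ∀ t x, P (t + Real.pi) x = P t (-x)) (hreal : ∀ t (x : ℝ), (P t x).im = 0) {r : ℂ} {R : ℝ}
    (hr : r ^ 2 = (R : ℂ)) : (∫ t in (0 : ℝ)..(2 * Real.pi), P t r).im = 0 := by
  have hper : ∀ x, Function.Periodic (fun t => P t x) (2 * Real.pi) := fun x t => by
    change P (t + 2 * Real.pi) x = P t x
    rw [two_mul, ← add_assoc, hturn, hturn, neg_neg]
  have hneg : ∀ x, ∫ t in (0 : ℝ)..(2 * Real.pi), P t (-x) = ∫ t in (0 : ℝ)..(2 * Real.pi), P t x := by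
    intro x
    simp only [← hturn]
    rw [intervalIntegral.integral_comp_add_right (fun t => P t x)]
    have := (hper x).intervalIntegral_add_eq Real.pi 0
    rw [zero_add] at this
    rw [zero_add, add_comm (2 * Real.pi), this]
  have hi : ∀ x, IntervalIntegrable (fun t => P t x) volume 0 (2 * Real.pi) := fun x =>
    (hc x).intervalIntegrable _ _
  -- The even part is a quadratic polynomial in `R = r ^ 2`. Lagrange interpolation at `R = 0, 1, 4`
  -- expresses it with real weights through values at the real arguments `0, ±1, ±2`.
  have hpt : ∀ t, (P t r + P t (-r)) / 2 = (((R - 1) * (R - 4) / 4 : ℝ) : ℂ) * P t (0 : ℝ) +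
      ((-(R * (R - 4) / 6) : ℝ) : ℂ) * (P t (1 : ℝ) + P t (-1 : ℝ)) +
      ((R * (R - 1) / 24 : ℝ) : ℂ) * (P t (2 : ℝ) + P t (-2 : ℝ)) := fun t => by
    obtain ⟨a₀, a₁, a₂, a₃, a₄, h⟩ := hpoly t
    simp only [h]
    push_cast
    rw [← hr]
    ring
  have hI : ∫ t in (0 : ℝ)..(2 * Real.pi), P t r =
      ∫ t in (0 : ℝ)..(2 * Real.pi), (P t r + P t (-r)) / 2 := by
    rw [intervalIntegral.integral_div, intervalIntegral.integral_add (hi _) (hi _), hneg]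
    ring
  have him : ∀ t, ((P t r + P t (-r)) / 2).im = 0 := fun t => by
    rw [hpt, Complex.add_im, Complex.add_im, Complex.im_ofReal_mul, Complex.im_ofReal_mul,
      Complex.im_ofReal_mul, Complex.add_im, Complex.add_im]
    simp only [hreal]
    ring
  have hint : IntervalIntegrable (fun t => (P t r + P t (-r)) / 2) volume 0 (2 * Real.pi) :=
    ((hi r).add (hi (-r))).div_const 2
  rw [hI]
  have := Complex.imCLM.intervalIntegral_comp_comm hint
  simp only [Complex.imCLM_apply, him, intervalIntegral.integral_zero] at this
  exact this.symm

namespace InnerSystem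

variable {S : InnerSystem} {cf cg ch : Fin 3 → Fin 3 → Fin 3 → ℂ}

theorem radius₀_sq (hb : 0 < S.b) (hd : 0 < S.d) : S.radius₀ ^ 2 = ((-((S.d + 1) / S.b) : ℝ) : ℂ) := by
  rw [radius₀, mul_pow, neg_sq, I_sq, ← Complex.ofReal_pow, Real.sq_sqrt (by positivity)]
  push_cast; ring

theorem cubicForm_turn (c : Fin 3 → Fin 3 → Fin 3 → ℂ) (t : ℝ) (x : ℂ) :
    cubicForm c ![x * cos ((t + Real.pi : ℝ) : ℂ), x * sin ((t + Real.pi : ℝ) : ℂ), 1] =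
      cubicForm c ![-x * cos (t : ℂ), -x * sin (t : ℂ), 1] := by
  push_cast
  rw [Complex.cos_add_pi, Complex.sin_add_pi]
  simp

theorem cubicMean_im (hb : 0 < S.b) (hd : 0 < S.d) (hh : HasCubicPart S.h ch)
    (hrh : IsCubicRemainder S.h) : (S.cubicMean ch).im = 0 := by
  have h := im_integral_eq_zero
    (P := fun t x => cubicForm ch ![x * cos (t : ℂ), x * sin (t : ℂ), 1])
    (continuous_cubicForm_circle ch)
    (fun t => by
      obtain ⟨a₀, a₁, a₂, a₃, h⟩ := cubicForm_line ch (cos (t : ℂ)) (sin (t : ℂ))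
      exact ⟨a₀, a₁, a₂, a₃, 0, fun x => by rw [h]; ring⟩)
    (cubicForm_turn ch) (fun t x => hh.im_circle_eq_zero hrh.real x t) (radius₀_sq hb hd)
  rw [cubicMean, show (1 / (2 * Real.pi) : ℂ) = ((1 / (2 * Real.pi) : ℝ) : ℂ) by push_cast; rfl,
    Complex.im_ofReal_mul]
  simp only [dir₀, smul_eq_mul]
  rw [h, mul_zero]

theorem leadMean_im (hb : 0 < S.b) (hd : 0 < S.d) (hf : HasCubicPart S.f cf)
    (hg : HasCubicPart S.g cg) (hh : HasCubicPart S.h ch) (hrf : IsCubicRemainder S.f)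
    (hrg : IsCubicRemainder S.g) (hrh : IsCubicRemainder S.h) : (S.leadMean cf cg ch).im = 0 := by
  have hcos : Continuous fun t : ℝ => cos (t : ℂ) := by fun_prop
  have hsin : Continuous fun t : ℝ => sin (t : ℂ) := by fun_prop
  have h := im_integral_eq_zero
    (P := fun t x => x * (cos (t : ℂ) * cubicForm cf ![x * cos (t : ℂ), x * sin (t : ℂ), 1] +
      sin (t : ℂ) * cubicForm cg ![x * cos (t : ℂ), x * sin (t : ℂ), 1]) +
      (((S.d + 1) / S.b : ℝ) : ℂ) * cubicForm ch ![x * cos (t : ℂ), x * sin (t : ℂ), 1])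
    (fun x => (continuous_const.mul ((hcos.mul (continuous_cubicForm_circle cf x)).add
      (hsin.mul (continuous_cubicForm_circle cg x)))).add
      (continuous_const.mul (continuous_cubicForm_circle ch x)))
    (fun t => by
      obtain ⟨a₀, a₁, a₂, a₃, h1⟩ := cubicForm_line cf (cos (t : ℂ)) (sin (t : ℂ))
      obtain ⟨b₀, b₁, b₂, b₃, h2⟩ := cubicForm_line cg (cos (t : ℂ)) (sin (t : ℂ))
      obtain ⟨c₀, c₁, c₂, c₃, h3⟩ := cubicForm_line ch (cos (t : ℂ)) (sin (t : ℂ))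
      set C := cos (t : ℂ)
      set Z := sin (t : ℂ)
      set e := (((S.d + 1) / S.b : ℝ) : ℂ)
      exact ⟨e * c₀, C * a₀ + Z * b₀ + e * c₁, C * a₁ + Z * b₁ + e * c₂, C * a₂ + Z * b₂ + e * c₃,
        C * a₃ + Z * b₃, fun x => by rw [h1, h2, h3]; ring⟩)
    (fun t x => by
      simp only [cubicForm_turn]
      push_cast
      rw [Complex.cos_add_pi, Complex.sin_add_pi]
      ring)
    (fun t x => by
      have e1 := hf.im_circle_eq_zero hrf.real x t
      have e2 := hg.im_circle_eq_zero hrg.real x t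
      have e3 := hh.im_circle_eq_zero hrh.real x t
      rw [Complex.add_im, Complex.im_ofReal_mul, Complex.im_ofReal_mul, Complex.add_im,
        ← Complex.ofReal_cos, ← Complex.ofReal_sin, Complex.im_ofReal_mul, Complex.im_ofReal_mul] at *
      rw [e1, e2, e3]; ring)
    (radius₀_sq hb hd)
  rw [leadMean, show (1 / (2 * Real.pi) : ℂ) = ((1 / (2 * Real.pi) : ℝ) : ℂ) by push_cast; rfl,
    Complex.im_ofReal_mul]
  simp only [lead, dir₀, smul_eq_mul]
  push_cast at h
  rw [h, mul_zero]

/-- The constant of the logarithmic term of the phase. -/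
theorem exists_phase_constant (hb : 0 < S.b) (hd : 0 < S.d) (hf : HasCubicPart S.f cf)
    (hg : HasCubicPart S.g cg) (hh : HasCubicPart S.h ch) (hrf : IsCubicRemainder S.f)
    (hrg : IsCubicRemainder S.g) (hrh : IsCubicRemainder S.h) :
    ∃ L : ℝ, 2 * S.b * S.psi₀ cf cg ch + S.cubicMean ch = S.d * L := by
  obtain ⟨x, hx⟩ : ∃ x : ℝ, S.cubicMean ch = x :=
    ⟨_, Complex.ext rfl (by simpa using cubicMean_im hb hd hh hrh)⟩
  obtain ⟨y, hy⟩ : ∃ y : ℝ, S.leadMean cf cg ch = y :=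
    ⟨_, Complex.ext rfl (by simpa using leadMean_im hb hd hf hg hh hrf hrg hrh)⟩
  refine ⟨(2 * S.b * (-y / (3 * S.d + 2)) + x) / S.d, ?_⟩
  have hd' : (S.d : ℂ) ≠ 0 := by exact_mod_cast hd.ne'
  rw [psi₀, hx, hy]
  push_cast
  field_simp

end InnerSystem

/-! ### First integrals as functions of the phase. -/

theorem convex_open_strip (τ : ℝ) : Convex ℝ {θ : ℂ | |θ.im| < τ} := by
  have : {θ : ℂ | |θ.im| < τ} = Complex.imLm ⁻¹' (Ioo (-τ) τ) := by
    ext θ; simp [abs_lt]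
  rw [this]
  exact (convex_Ioo _ _).linear_preimage _

/-- A first integral `K` of the foliation given by the levels of `θ + a s + γ log s + φ`. -/
structure TransportChart (E : Set ℂ) (τ a γ Y : ℝ) (φ K : ℂ → ℂ → ℂ) : Prop where
  isOpen : IsOpen E
  convex : Convex ℝ E
  im_neg : ∀ s ∈ E, s.im < 0
  axis : ∀ y : ℝ, Y < y → -I * y ∈ E
  analytic_φ : ∀ s ∈ E, ∀ θ : ℂ, |θ.im| < τ → AnalyticAt ℂ (fun p : ℂ × ℂ => φ p.1 p.2) (s, θ)
  analytic_K : ∀ s ∈ E, ∀ θ : ℂ, |θ.im| < τ → AnalyticAt ℂ (fun p : ℂ × ℂ => K p.1 p.2) (s, θ)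
  periodic_φ : ∀ s θ, φ s (θ + 2 * Real.pi) = φ s θ
  periodic_K : ∀ s θ, K s (θ + 2 * Real.pi) = K s θ
  norm_φ : ∀ s ∈ E, ∀ θ : ℂ, |θ.im| < τ → ‖φ s θ‖ ≤ 1 / 4
  norm_pdθ : ∀ s ∈ E, ∀ θ : ℂ, |θ.im| < τ → ‖pdθ φ s θ‖ ≤ 1 / 4
  parallel : ∀ s ∈ E, ∀ θ : ℂ, |θ.im| < τ →
    pds K s θ * (1 + pdθ φ s θ) = pdθ K s θ * (a + γ * s⁻¹ + pds φ s θ)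
  decay : ∀ ε > 0, ∃ R : ℝ, ∀ s ∈ E, R ≤ ‖s‖ → ∀ θ : ℂ, |θ.im| < τ → ‖K s θ‖ ≤ ε

/-- The derivative of a function of two variables in terms of its partial derivatives. -/
theorem hasFDerivAt_of_partials {ψ : ℂ → ℂ → ℂ} {s θ : ℂ}
    (h : AnalyticAt ℂ (fun p : ℂ × ℂ => ψ p.1 p.2) (s, θ)) :
    HasFDerivAt (fun p : ℂ × ℂ => ψ p.1 p.2)
      (pds ψ s θ • ContinuousLinearMap.fst ℂ ℂ ℂ + pdθ ψ s θ • ContinuousLinearMap.snd ℂ ℂ ℂ) (s, θ) := by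
  have h0 := h.differentiableAt.hasFDerivAt
  have h1 : HasDerivAt (fun x => ψ x θ) (fderiv ℂ (fun p : ℂ × ℂ => ψ p.1 p.2) (s, θ) (1, 0)) s :=
    HasFDerivAt.comp_hasDerivAt (f := fun x => (x, θ)) (l := fun p : ℂ × ℂ => ψ p.1 p.2) s h0
      ((hasDerivAt_id s).prodMk (hasDerivAt_const s θ))
  have h2 : HasDerivAt (fun y => ψ s y) (fderiv ℂ (fun p : ℂ × ℂ => ψ p.1 p.2) (s, θ) (0, 1)) θ :=
    HasFDerivAt.comp_hasDerivAt (f := fun y => (s, y)) (l := fun p : ℂ × ℂ => ψ p.1 p.2) θ h0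
      ((hasDerivAt_const θ s).prodMk (hasDerivAt_id θ))
  have e1 : pds ψ s θ = _ := h1.deriv
  have e2 : pdθ ψ s θ = _ := h2.deriv
  refine h0.congr_fderiv ?_
  ext <;> simp [e1, e2]

namespace TransportChart

variable {E : Set ℂ} {τ a γ Y : ℝ} {φ K : ℂ → ℂ → ℂ} (hc : TransportChart E τ a γ Y φ K)

include hc

theorem mem_slitPlane {s : ℂ} (hs : s ∈ E) : s ∈ slitPlane := Or.inr (hc.im_neg s hs).ne

theorem norm_correction_sub_le {s θ θ' : ℂ} (hs : s ∈ E) (h : |θ.im| < τ) (h' : |θ'.im| < τ) :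
    ‖φ s θ - φ s θ'‖ ≤ 1 / 4 * ‖θ - θ'‖ :=
  (convex_open_strip τ).norm_image_sub_le_of_norm_hasDerivWithin_le
    (f := fun w => φ s w) (f' := fun w => pdθ φ s w)
    (fun w hw => (hasDerivAt_pdθ (hc.analytic_φ s hs w hw)).hasDerivWithinAt)
    (fun w hw => hc.norm_pdθ s hs w hw) h' h

/-- The correction contracts by `1 / 4` in the angle, so adding it to the identity is injective. -/
theorem angle_unique {s θ θ' : ℂ} (hs : s ∈ E) (h : |θ.im| < τ) (h' : |θ'.im| < τ)
    (he : θ + φ s θ = θ' + φ s θ') : θ = θ' := by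
  have h1 := hc.norm_correction_sub_le hs h' h
  have h2 : θ - θ' = φ s θ' - φ s θ := by linear_combination he
  rw [← h2, norm_sub_rev θ'] at h1
  have : ‖θ - θ'‖ ≤ 0 := by linarith [norm_nonneg (θ - θ')]
  rwa [norm_le_zero_iff, sub_eq_zero] at this

/-- Banach's fixed-point theorem on a ball of radius `1 / 4`; the margin `1` in the strip keeps that
ball inside. -/
theorem exists_angle {s η : ℂ} (hs : s ∈ E) (hη : |η.im| < τ - 1) :
    ∃ θ : ℂ, |θ.im| < τ ∧ θ + φ s θ = η := by
  have hstrip : ∀ w ∈ Metric.closedBall η (1 / 4), |w.im| < τ := fun w hw => by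
    rw [mem_closedBall_iff_norm] at hw
    have h1 := Complex.abs_im_le_norm (w - η)
    have h2 : w.im = η.im + (w - η).im := by simp
    rw [h2]
    linarith [abs_add_le η.im (w - η).im]
  have hmaps : MapsTo (fun w => η - φ s w) (Metric.closedBall η (1 / 4))
      (Metric.closedBall η (1 / 4)) := fun w hw => by
    rw [mem_closedBall_iff_norm]
    simpa using hc.norm_φ s hs w (hstrip w hw)
  have hlip : LipschitzOnWith (1 / 4) (fun w => η - φ s w) (Metric.closedBall η (1 / 4)) := by
    refine LipschitzOnWith.of_dist_le_mul fun w hw w' hw' => ?_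
    rw [dist_eq_norm, dist_eq_norm, sub_sub_sub_cancel_left, norm_sub_rev w]
    simpa using hc.norm_correction_sub_le hs (hstrip w' hw') (hstrip w hw)
  have hcontr : ContractingWith (1 / 4) (hmaps.restrict (fun w => η - φ s w) _ _) :=
    ⟨by rw [← NNReal.coe_lt_coe]; norm_num, hlip.mapsToRestrict hmaps⟩
  obtain ⟨θ, hθ, hfix, -⟩ := hcontr.exists_fixedPoint' Metric.isClosed_closedBall.isComplete hmaps
    (Metric.mem_closedBall_self (by norm_num)) (edist_ne_top _ _)
  refine ⟨θ, hstrip θ hθ, ?_⟩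
  have h1 : η - φ s θ = θ := hfix
  linear_combination -h1

omit hc in
/-- The value of the first integral on the level `x` above the point `s`. -/
def levelVal (τ a γ : ℝ) (φ K : ℂ → ℂ → ℂ) (x s : ℂ) : ℂ :=
  K s (Classical.epsilon fun θ : ℂ => |θ.im| < τ ∧ θ + φ s θ = x - a * s - γ * log s)

theorem levelVal_eq {x s θ : ℂ} (hs : s ∈ E) (hθ : |θ.im| < τ)
    (he : θ + φ s θ = x - a * s - γ * log s) : levelVal τ a γ φ K x s = K s θ := by
  have h := Classical.epsilon_spec (p := fun θ : ℂ => |θ.im| < τ ∧ θ + φ s θ = x - a * s - γ * log s)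
    ⟨θ, hθ, he⟩
  rw [levelVal, hc.angle_unique hs h.1 hθ (h.2.trans he.symm)]

/-- The derivative has no component along `s`: at a fixed level the first integral is locally
constant in `s`. This is the parallelism of the differentials of `K` and of the phase. -/
theorem hasFDerivAt_levelVal {x s : ℂ} (hs : s ∈ E) (hx : |(x - a * s - γ * log s).im| < τ - 1) :
    ∃ l : ℂ, HasFDerivAt (fun p : ℂ × ℂ => levelVal τ a γ φ K p.1 p.2)
      (l • ContinuousLinearMap.fst ℂ ℂ ℂ) (x, s) := by
  obtain ⟨θ, hθ, he⟩ := hc.exists_angle hs hx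
  set η : ℂ × ℂ → ℂ := fun p => p.1 - a * p.2 - γ * log p.2 with hη
  have hsl := hc.mem_slitPlane hs
  have hηd : DifferentiableAt ℂ η (x, s) := by
    have h2 : DifferentiableAt ℂ (fun p : ℂ × ℂ => log p.2) (x, s) :=
      differentiableAt_snd.clog hsl
    exact (differentiableAt_fst.sub (differentiableAt_snd.const_mul _)).sub (h2.const_mul _)
  have hlogd : HasDerivAt (fun z => γ * log z) (γ * s⁻¹) s := (hasDerivAt_log hsl).const_mul _
  set Θ : ℂ × ℂ → ℂ := fun p =>
    Classical.epsilon fun w : ℂ => |w.im| < τ ∧ w + φ p.2 w = η p with hΘ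
  have hnear : ∀ᶠ p in 𝓝 (x, s), p.2 ∈ E ∧ |(η p).im| < τ - 1 :=
    (continuousAt_snd.eventually (hc.isOpen.mem_nhds hs)).and
      ((Complex.continuous_im.continuousAt.comp hηd.continuousAt).abs.eventually_lt_const hx)
  have hΘs : ∀ᶠ p in 𝓝 (x, s), p.2 ∈ E ∧ |(Θ p).im| < τ ∧ Θ p + φ p.2 (Θ p) = η p := by
    filter_upwards [hnear] with p hp
    exact ⟨hp.1, Classical.epsilon_spec (hc.exists_angle hp.1 hp.2)⟩
  have hΘ0 : Θ (x, s) = θ := by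
    have h := hΘs.self_of_nhds
    exact hc.angle_unique hs h.2.1 hθ (h.2.2.trans he.symm)
  have hφd : DifferentiableAt ℂ (fun p : ℂ × ℂ => φ p.2 θ) (x, s) :=
    DifferentiableAt.comp (g := fun z => φ z θ) (f := fun p : ℂ × ℂ => p.2) (x, s)
      (hasDerivAt_pds (hc.analytic_φ s hs θ hθ)).differentiableAt differentiableAt_snd
  -- This Lipschitz bound at the base point replaces the implicit function theorem: `φ` contracts in
  -- the angle, so the variation of `φ` with `Θ` is absorbed on the left.
  have hΘO : (fun p => Θ p - θ) =O[𝓝 (x, s)] fun p => p - (x, s) := by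
    have h1 : (fun p => (η p - η (x, s)) - (φ p.2 θ - φ s θ)) =O[𝓝 (x, s)] fun p => p - (x, s) :=
      hηd.hasFDerivAt.isBigO_sub.sub hφd.hasFDerivAt.isBigO_sub
    refine IsBigO.trans (IsBigO.of_bound 2 ?_) h1
    filter_upwards [hΘs] with p hp
    have h2 := hc.norm_correction_sub_le hp.1 hp.2.1 hθ
    have h3 : Θ p - θ = ((η p - η (x, s)) - (φ p.2 θ - φ s θ)) - (φ p.2 (Θ p) - φ p.2 θ) := by
      have : η (x, s) = θ + φ s θ := he.symm
      rw [this]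
      linear_combination hp.2.2
    have h4 := norm_sub_le ((η p - η (x, s)) - (φ p.2 θ - φ s θ)) (φ p.2 (Θ p) - φ p.2 θ)
    rw [← h3] at h4
    linarith [norm_nonneg (Θ p - θ)]
  have hden : 1 + pdθ φ s θ ≠ 0 := fun h0 => by
    have h1 := hc.norm_pdθ s hs θ hθ
    rw [show pdθ φ s θ = -1 by linear_combination h0] at h1
    norm_num at h1
  set l := pdθ K s θ / (1 + pdθ φ s θ) with hl
  refine ⟨l, ?_⟩
  -- Subtracting `l` times the phase removes the differential of `K`, because the two differentials
  -- are proportional.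
  have hG : HasFDerivAt (fun q : ℂ × ℂ => K q.1 q.2 -
      l * (q.2 + a * q.1 + γ * log q.1 + φ q.1 q.2)) (0 : ℂ × ℂ →L[ℂ] ℂ) (s, θ) := by
    have h1 := hasFDerivAt_of_partials (hc.analytic_K s hs θ hθ)
    have h2 := hasFDerivAt_of_partials (hc.analytic_φ s hs θ hθ)
    have h3 : HasFDerivAt (fun q : ℂ × ℂ => γ * log q.1)
        ((γ * s⁻¹) • ContinuousLinearMap.fst ℂ ℂ ℂ) (s, θ) :=
      HasDerivAt.comp_hasFDerivAt (h₂ := fun z => γ * log z) (s, θ) hlogd hasFDerivAt_fst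
    have h4 := h1.sub ((((hasFDerivAt_snd.add (hasFDerivAt_fst.const_mul (a : ℂ))).add h3).add
      h2).const_mul l)
    refine h4.congr_fderiv ?_
    have e1 : pds K s θ = l * (a + γ * s⁻¹ + pds φ s θ) := by
      have := hc.parallel s hs θ hθ
      rw [hl]; field_simp at this ⊢; linear_combination this
    have e2 : pdθ K s θ = l * (1 + pdθ φ s θ) := by rw [hl]; field_simp
    ext
    · simp [e1]; ring
    · simp [e2]; ring
  have hpt : Tendsto (fun p : ℂ × ℂ => (p.2, Θ p)) (𝓝 (x, s)) (𝓝 (s, θ)) := by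
    refine continuousAt_snd.prodMk_nhds ?_
    have h1 : Tendsto (fun p => Θ p - θ) (𝓝 (x, s)) (𝓝 0) := by
      refine hΘO.trans_tendsto ?_
      have : ContinuousAt (fun p : ℂ × ℂ => p - (x, s)) (x, s) := by fun_prop
      simpa [ContinuousAt] using this
    simpa using h1.add_const θ
  have hlo := hG.isLittleO.comp_tendsto hpt
  have hbig : (fun p : ℂ × ℂ => (p.2, Θ p) - (s, θ)) =O[𝓝 (x, s)] fun p => p - (x, s) := by
    refine IsBigO.prod_left (IsBigO.of_bound 1 (Eventually.of_forall fun p => ?_)) hΘO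
    rw [one_mul]
    exact norm_snd_le (p - (x, s))
  have hfin := hlo.trans_isBigO hbig
  refine HasFDerivAt.of_isLittleO (hfin.congr' ?_ (EventuallyEq.refl _ _))
  filter_upwards [hΘs] with p hp
  have e1 : levelVal τ a γ φ K p.1 p.2 = K p.2 (Θ p) := hc.levelVal_eq hp.1 hp.2.1 hp.2.2
  have e0 : levelVal τ a γ φ K x s = K s θ := hc.levelVal_eq hs hθ he
  have e2 : Θ p + φ p.2 (Θ p) = p.1 - a * p.2 - γ * log p.2 := hp.2.2
  simp only [Function.comp_apply, e1, e0, zero_apply, smul_apply, ContinuousLinearMap.coe_fst',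
    Prod.fst_sub, smul_eq_mul, sub_zero]
  linear_combination l * (he - e2)

/-- The sector is convex and the derivative in `s` vanishes, so the value is transported unchanged
as long as the level keeps an angle inside the strip. -/
theorem levelVal_eq_of_segment {x s₀ s₁ : ℂ} (h₀ : s₀ ∈ E) (h₁ : s₁ ∈ E)
    (h : ∀ t ∈ Icc (0 : ℝ) 1, |(x - a * (s₀ + t * (s₁ - s₀)) - γ * log (s₀ + t * (s₁ - s₀))).im| < τ - 1) :
    levelVal τ a γ φ K x s₁ = levelVal τ a γ φ K x s₀ := by
  set p : ℝ → ℂ := fun t => s₀ + t * (s₁ - s₀) with hp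
  have hpE : ∀ t ∈ Icc (0 : ℝ) 1, p t ∈ E := fun t ht => by
    have := hc.convex.add_smul_sub_mem h₀ h₁ ht
    simpa [hp] using this
  have hd : ∀ t ∈ Icc (0 : ℝ) 1, HasDerivAt (fun t => levelVal τ a γ φ K x (p t)) 0 t := fun t ht => by
    obtain ⟨l, hl⟩ := hc.hasFDerivAt_levelVal (hpE t ht) (h t ht)
    have hpd : HasDerivAt (fun t => (x, p t)) (0, s₁ - s₀) t := by
      refine (hasDerivAt_const t x).prodMk ?_
      have h1 : HasDerivAt p (1 * (s₁ - s₀)) t :=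
        ((hasDerivAt_id t).ofReal_comp.mul_const (s₁ - s₀)).const_add s₀
      rwa [one_mul] at h1
    have h2 : HasDerivAt (fun t => levelVal τ a γ φ K x (p t)) _ t := HasFDerivAt.comp_hasDerivAt (l := fun p : ℂ × ℂ => levelVal τ a γ φ K p.1 p.2)
      (f := fun t => (x, p t)) t (hl.restrictScalars ℝ) hpd
    exact h2.congr_deriv (by simp)
  have h3 := constant_of_has_deriv_right_zero (f := fun t => levelVal τ a γ φ K x (p t)) (a := 0)
    (b := 1) (fun t ht => (hd t ht).continuousAt.continuousWithinAt)
    (fun t ht => (hd t ⟨ht.1, ht.2.le⟩).hasDerivWithinAt) 1 (by norm_num)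
  simpa [hp] using h3

omit hc in
/-- The point on the negative imaginary axis at which a level is read off. -/
def axisPoint (a γ : ℝ) (x : ℂ) : ℂ := -I * ((-(x.im + γ * (Real.pi / 2)) / a : ℝ) : ℂ)

omit hc in
-- The logarithm has imaginary part `-π / 2` on the negative imaginary axis; the point is placed
-- where the level meets a real value of `θ + φ`, in the middle of the strip.
theorem axisPoint_level (ha : 0 < a) {x : ℂ} (hx : 0 < -(x.im + γ * (Real.pi / 2)) / a) :
    (x - a * axisPoint a γ x - γ * log (axisPoint a γ x)).im = 0 := by
  have h1 : (log (axisPoint a γ x)).im = -(Real.pi / 2) := by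
    rw [axisPoint, Complex.log_im, mul_comm, Complex.arg_real_mul _ hx, Complex.arg_neg_I]
  have h2 : (axisPoint a γ x).im = (x.im + γ * (Real.pi / 2)) / a := by
    rw [axisPoint, neg_mul, Complex.neg_im, mul_comm, Complex.im_ofReal_mul, Complex.I_im]; ring
  rw [Complex.sub_im, Complex.sub_im, Complex.im_ofReal_mul, Complex.im_ofReal_mul, h1, h2]
  field_simp
  ring

/-- A decaying first integral is a holomorphic function of the exponential of the phase. -/
theorem exists_cusp (ha : 0 < a) (hY : 0 ≤ Y) {σ : ℝ} (hτ : σ + 2 * (|γ| * Real.pi) + 2 = τ)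
    (hσ : 0 < σ) :
    ∃ F : ℂ → ℂ, DifferentiableOn ℂ F (Metric.ball 0 (Real.exp (-(a * Y + |γ| * Real.pi)))) ∧
      F 0 = 0 ∧ ∀ s ∈ E, ∀ θ : ℂ, |θ.im| ≤ σ →
        (θ + a * s + γ * log s + φ s θ).im < -(a * Y + |γ| * Real.pi) →
          K s θ = F (exp (-(I * (θ + a * s + γ * log s + φ s θ)))) := by
  have hπ := Real.pi_pos
  have hγ0 := abs_nonneg γ
  have hγπ : 0 ≤ |γ| * Real.pi := by positivity
  have hτ1 : 0 < τ - 1 := by linarith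
  set T : ℝ := a * Y + |γ| * Real.pi with hT
  have hT0 : 0 ≤ T := by positivity
  have hgp : |γ * (Real.pi / 2)| ≤ |γ| * Real.pi := by
    rw [abs_mul, abs_of_pos (by positivity : 0 < Real.pi / 2)]; nlinarith
  have hy : ∀ (R : ℝ) (x : ℂ), x.im < -(T + a * R) → Y + R < -(x.im + γ * (Real.pi / 2)) / a := by
    intro R x hx
    rw [lt_div_iff₀ ha]
    have := (abs_le.1 hgp).2
    nlinarith
  have hy0 : ∀ x : ℂ, x.im < -T → Y < -(x.im + γ * (Real.pi / 2)) / a := fun x hx => by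
    have := hy 0 x (by linarith)
    linarith
  have hypos : ∀ x : ℂ, x.im < -T → 0 < -(x.im + γ * (Real.pi / 2)) / a := fun x hx =>
    hY.trans_lt (hy0 x hx)
  have hbE : ∀ x : ℂ, x.im < -T → axisPoint a γ x ∈ E := fun x hx =>
    hc.axis _ (hy0 x hx)
  have hb0 : ∀ x : ℂ, x.im < -T → |(x - a * axisPoint a γ x - γ * log (axisPoint a γ x)).im| < τ - 1 :=
    fun x hx => by rw [axisPoint_level ha (hypos x hx), abs_zero]; exact hτ1
  set k : ℂ → ℂ := fun x => if x.im < -T then levelVal τ a γ φ K x (axisPoint a γ x) else 0 with hk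
  have hkeq : ∀ x : ℂ, x.im < -T → k x = levelVal τ a γ φ K x (axisPoint a γ x) := fun x hx => if_pos hx
  have hopen : IsOpen {x : ℂ | x.im < -T} := isOpen_lt Complex.continuous_im continuous_const
  -- The axis point depends on `x` only through its imaginary part, so not holomorphically. Since
  -- the derivative in the base point vanishes, `k` is nevertheless holomorphic.
  have hkd : ∀ x : ℂ, x.im < -T → DifferentiableAt ℂ k x := by
    intro x hx
    obtain ⟨l, hl⟩ := hc.hasFDerivAt_levelVal (hbE x hx) (hb0 x hx)
    have hbs : ∀ x' : ℂ, ‖axisPoint a γ x' - axisPoint a γ x‖ ≤ a⁻¹ * ‖x' - x‖ := fun x' => by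
      have : axisPoint a γ x' - axisPoint a γ x = I * ((a⁻¹ * (x' - x).im : ℝ) : ℂ) := by
        rw [axisPoint, axisPoint, Complex.sub_im]; push_cast; field_simp; ring
      rw [this, norm_mul, Complex.norm_I, one_mul, Complex.norm_real, Real.norm_eq_abs, abs_mul,
        abs_of_pos (inv_pos.2 ha)]
      gcongr
      exact Complex.abs_im_le_norm _
    have hO : (fun x' => (x', axisPoint a γ x') - (x, axisPoint a γ x)) =O[𝓝 x] fun x' => x' - x :=
      IsBigO.prod_left (isBigO_refl _ _) (IsBigO.of_bound a⁻¹ (Eventually.of_forall hbs))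
    have ht : Tendsto (fun x' => (x', axisPoint a γ x')) (𝓝 x) (𝓝 (x, axisPoint a γ x)) := by
      have : Continuous fun x' => axisPoint a γ x' := by
        unfold axisPoint
        fun_prop
      exact (continuous_id.prodMk this).continuousAt
    have hlo := (hl.isLittleO.comp_tendsto ht).trans_isBigO hO
    refine HasDerivAt.differentiableAt (f' := l) (hasDerivAt_iff_isLittleO.2
      (hlo.congr' ?_ (EventuallyEq.refl _ _)))
    filter_upwards [hopen.mem_nhds hx] with x' hx'
    simp only [Function.comp_apply, hkeq x hx, hkeq x' hx', smul_apply,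
      ContinuousLinearMap.coe_fst', Prod.fst_sub, smul_eq_mul]
    ring
  have hval : ∀ x : ℂ, x.im < -T → ∃ θ : ℂ, |θ.im| < τ ∧
      θ + φ (axisPoint a γ x) θ = x - a * axisPoint a γ x - γ * log (axisPoint a γ x) ∧
      k x = K (axisPoint a γ x) θ := fun x hx => by
    obtain ⟨θ, h1, h2⟩ := hc.exists_angle (hbE x hx) (hb0 x hx)
    exact ⟨θ, h1, h2, (hkeq x hx).trans (hc.levelVal_eq (hbE x hx) h1 h2)⟩
  -- The sign is reversed because cusp functions describe periodic functions as the imaginary part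
  -- tends to `+∞`, whereas levels descend.
  have hper : Function.Periodic (fun w => k (-w)) ((2 * Real.pi : ℝ) : ℂ) := by
    have key : ∀ x : ℂ, k (x + 2 * Real.pi) = k x := by
      intro x
      have him : (x + 2 * Real.pi).im = x.im := by simp
      have hax : axisPoint a γ (x + 2 * Real.pi) = axisPoint a γ x := by rw [axisPoint, axisPoint, him]
      by_cases hx : x.im < -T
      · obtain ⟨θ, h1, h2, h3⟩ := hval x hx
        have hx' : (x + 2 * Real.pi).im < -T := by rwa [him]
        rw [hkeq _ hx', hax, h3, ← hc.periodic_K]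
        refine hc.levelVal_eq (hbE x hx) (by simpa using h1) ?_
        rw [hc.periodic_φ]
        linear_combination h2
      · rw [hk]; simp only [him, if_neg hx]
    intro w
    change k (-(w + _)) = k (-w)
    rw [← key (-(w + _))]
    congr 1
    push_cast; ring
  have hπ2 : (0 : ℝ) < 2 * Real.pi := by positivity
  have hatT : ∀ b : ℝ, ∀ᶠ w in comap Complex.im atTop, b < w.im := fun b =>
    tendsto_comap.eventually (eventually_gt_atTop b)
  have hhol : ∀ᶠ w in comap Complex.im atTop, DifferentiableAt ℂ (fun w => k (-w)) w := by
    filter_upwards [hatT T] with w hw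
    have h1 : (-w).im < -T := by simpa using hw
    exact DifferentiableAt.comp (g := k) (f := fun w => -w) w (hkd _ h1) differentiableAt_id.neg
  -- Deep levels are read off far down the axis, where `K` is small.
  have hzero : ZeroAtFilter (comap Complex.im atTop) (fun w => k (-w)) := by
    rw [ZeroAtFilter, Metric.tendsto_nhds]
    intro ε hε
    obtain ⟨R, hR⟩ := hc.decay (ε / 2) (by positivity)
    filter_upwards [hatT (T + a * |R|)] with w hw
    have h1 : (-w).im < -(T + a * |R|) := by simpa using hw
    have h2 : (-w).im < -T := by nlinarith [abs_nonneg R]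
    obtain ⟨θ, h3, -, h5⟩ := hval _ h2
    rw [dist_zero_right, h5]
    refine (hR _ (hbE _ h2) ?_ θ h3).trans_lt (by linarith)
    rw [axisPoint, norm_mul, norm_neg, Complex.norm_I, one_mul, Complex.norm_real]
    have h6 := hy |R| _ h1
    exact ((le_abs_self R).trans (by linarith)).trans (h6.le.trans (le_abs_self _))
  set F := Function.Periodic.cuspFunction (2 * Real.pi) fun w => k (-w) with hF
  have hF0 : F 0 = 0 := Function.Periodic.cuspFunction_zero_of_zero_at_inf hπ2 hzero
  have hFd0 : DifferentiableAt ℂ F 0 :=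
    Function.Periodic.differentiableAt_cuspFunction_zero hπ2 hper hhol hzero.boundedAtFilter
  refine ⟨F, fun q hq => ?_, hF0, fun s hs θ hθ hxT => ?_⟩
  · rcases eq_or_ne q 0 with rfl | hq0
    · exact hFd0.differentiableWithinAt
    · have him := Function.Periodic.im_invQParam (2 * Real.pi) q
      have hlog : Real.log ‖q‖ < -T := by
        rw [Real.log_lt_iff_lt_exp (norm_pos_iff.2 hq0)]
        exact mem_ball_zero_iff.1 hq
      rw [neg_div, div_self hπ2.ne', neg_one_mul] at him
      have := Function.Periodic.differentiableAt_cuspFunction hπ2.ne' hper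
        (DifferentiableAt.comp (g := k) (f := fun w => -w) (Function.Periodic.invQParam (2 * Real.pi) q)
          (hkd _ (by rw [Complex.neg_im, him]; linarith)) differentiableAt_id.neg)
      rw [Function.Periodic.qParam_right_inv hπ2.ne' hq0] at this
      exact this.differentiableWithinAt
  · set x := θ + a * s + γ * log s + φ s θ with hx
    have hθτ : |θ.im| < τ := by linarith
    have hφn := (Complex.abs_im_le_norm _).trans (hc.norm_φ s hs θ hθτ)
    have harg : ∀ z : ℂ, |γ * z.arg| ≤ |γ| * Real.pi := fun z => by
      rw [abs_mul]; gcongr; exact Complex.abs_arg_le_pi z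
    have hxim : x.im = θ.im + a * s.im + γ * s.arg + (φ s θ).im := by
      rw [hx, Complex.add_im, Complex.add_im, Complex.add_im, Complex.im_ofReal_mul,
        Complex.im_ofReal_mul, Complex.log_im]
    have hlev : levelVal τ a γ φ K x s = K s θ := hc.levelVal_eq hs hθτ (by rw [hx]; ring)
    set b := axisPoint a γ x with hb
    -- Along the segment from `s` to the axis all contributions to the imaginary part are affine
    -- except the argument, which varies by a bounded amount. The excess of `τ` over `σ` is chosen
    -- to contain the sum.
    have hseg : levelVal τ a γ φ K x b = levelVal τ a γ φ K x s := by
      refine hc.levelVal_eq_of_segment hs (hbE x hxT) fun t ht => ?_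
      have h0 := axisPoint_level ha (hypos x hxT)
      rw [← hb, Complex.sub_im, Complex.sub_im, Complex.im_ofReal_mul, Complex.im_ofReal_mul,
        Complex.log_im] at h0
      have him : (x - a * (s + t * (b - s)) - γ * log (s + t * (b - s))).im =
          x.im - a * (s.im + t * (b.im - s.im)) - γ * (s + t * (b - s)).arg := by
        clear_value x
        rw [Complex.sub_im, Complex.sub_im, Complex.im_ofReal_mul, Complex.im_ofReal_mul,
          Complex.log_im, Complex.add_im, Complex.im_ofReal_mul, Complex.sub_im]
      rw [him]
      have e : x.im - a * (s.im + t * (b.im - s.im)) =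
          (1 - t) * (θ.im + γ * s.arg + (φ s θ).im) + t * (γ * b.arg) := by
        have e1 : x.im - a * s.im = θ.im + γ * s.arg + (φ s θ).im := by rw [hxim]; ring
        linear_combination (1 - t) * e1 + t * h0
      have hp : |θ.im + γ * s.arg + (φ s θ).im| ≤ σ + |γ| * Real.pi + 1 / 4 :=
        (abs_add_le _ _).trans (add_le_add ((abs_add_le _ _).trans (add_le_add hθ (harg s))) hφn)
      have hcomb : |(1 - t) * (θ.im + γ * s.arg + (φ s θ).im) + t * (γ * b.arg)| ≤
          σ + |γ| * Real.pi + 1 / 4 := by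
        refine (abs_add_le _ _).trans ?_
        rw [abs_mul, abs_mul t, abs_of_nonneg ht.1, abs_of_nonneg (by linarith [ht.2] : 0 ≤ 1 - t)]
        have h1 := mul_le_mul_of_nonneg_left hp (by linarith [ht.2] : 0 ≤ 1 - t)
        have h2 := mul_le_mul_of_nonneg_left (harg b) ht.1
        have h3 := mul_nonneg ht.1 (by linarith : 0 ≤ σ + 1 / 4)
        linarith
      rw [e]
      refine (abs_sub _ _).trans_lt ?_
      linarith [harg (s + t * (b - s))]
    have hcusp := Function.Periodic.eq_cuspFunction hπ2.ne' hper (-x)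
    rw [neg_neg, hkeq x hxT, ← hb, hseg, hlev] at hcusp
    rw [← hcusp, ← hF]
    congr 1
    rw [Function.Periodic.qParam]
    congr 1
    have hπc : (Real.pi : ℂ) ≠ 0 := by exact_mod_cast hπ.ne'
    push_cast
    field_simp

end TransportChart

/-! ### Replacing given inner solutions by the constructed ones. -/

/-- `ψ` and `ψ'` agree near `(s, θ)` in each variable separately. -/
def SliceEq (ψ ψ' : ℂ → ℂ → ℂ) (s θ : ℂ) : Prop :=
  (fun x => ψ x θ) =ᶠ[𝓝 s] (fun x => ψ' x θ) ∧ ψ s =ᶠ[𝓝 θ] ψ' s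

namespace SliceEq

variable {S : InnerSystem} {ψ ψ' χ χ' : ℂ → ℂ → ℂ} {s θ : ℂ}

theorem eq (h : SliceEq ψ ψ' s θ) : ψ s θ = ψ' s θ := h.2.eq_of_nhds

theorem pds_eq (h : SliceEq ψ ψ' s θ) : pds ψ s θ = pds ψ' s θ := h.1.deriv_eq

theorem pdθ_eq (h : SliceEq ψ ψ' s θ) : pdθ ψ s θ = pdθ ψ' s θ := h.2.deriv_eq

theorem seg (h : SliceEq ψ ψ' s θ) (h' : SliceEq χ χ' s θ) (l : ℝ) :
    SliceEq (InnerSystem.seg ψ χ l) (InnerSystem.seg ψ' χ' l) s θ := by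
  constructor
  · filter_upwards [h.1, h'.1] with x hx hx'
    simp only [InnerSystem.seg, hx, hx']
  · filter_upwards [h.2, h'.2] with x hx hx'
    simp only [InnerSystem.seg, hx, hx']

theorem innerEquationAt (h : SliceEq ψ ψ' s θ) (he : S.InnerEquationAt ψ s θ) :
    S.InnerEquationAt ψ' s θ := by
  simpa only [InnerSystem.InnerEquationAt, h.eq, h.pds_eq, h.pdθ_eq] using he

theorem a₁_eq (h : SliceEq ψ ψ' s θ) (h' : SliceEq χ χ' s θ) : S.a₁ ψ χ s θ = S.a₁ ψ' χ' s θ := by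
  simp only [InnerSystem.a₁, fun l => (h.seg h' l).eq, fun l => (h.seg h' l).pds_eq,
    fun l => (h.seg h' l).pdθ_eq, h.pds_eq, h'.pds_eq]

theorem a₂_eq (h : SliceEq ψ ψ' s θ) (h' : SliceEq χ χ' s θ) : S.a₂ ψ χ s θ = S.a₂ ψ' χ' s θ := by
  simp only [InnerSystem.a₂, fun l => (h.seg h' l).eq, h.eq, h'.eq]

theorem a₂mean_eq (h : ∀ t : ℝ, SliceEq ψ ψ' s t) (h' : ∀ t : ℝ, SliceEq χ χ' s t) :
    S.a₂mean ψ χ s = S.a₂mean ψ' χ' s := by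
  rw [InnerSystem.a₂mean, InnerSystem.a₂mean]
  congr 1
  exact intervalIntegral.integral_congr fun t _ => (h t).a₂_eq (h' t)

theorem a₃_eq (h : SliceEq ψ ψ' s θ) (h' : SliceEq χ χ' s θ) : S.a₃ ψ χ s θ = S.a₃ ψ' χ' s θ := by
  simp only [InnerSystem.a₃, fun l => (h.seg h' l).eq]

theorem differenceEquationAt (h : SliceEq ψ ψ' s θ) (h' : SliceEq χ χ' s θ) {P : ℂ → ℂ → ℂ}
    (he : S.DifferenceEquationAt ψ' χ' P s θ) : S.DifferenceEquationAt ψ χ P s θ := by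
  simpa only [InnerSystem.DifferenceEquationAt, h.a₁_eq h', h.a₂_eq h', h.a₃_eq h'] using he

theorem transportEquationAt (h : SliceEq ψ ψ' s θ) (h' : SliceEq χ χ' s θ) {k : ℂ → ℂ → ℂ}
    (he : S.TransportEquationAt ψ' χ' k s θ) : S.TransportEquationAt ψ χ k s θ := by
  simpa only [InnerSystem.TransportEquationAt, h.a₂_eq h', h.a₃_eq h'] using he

end SliceEq

/-- Analytic functions that agree on a ray agree near its endpoint. -/
theorem AnalyticAt.eventuallyEq_of_ray {f g : ℂ → ℂ} {z v : ℂ} (hf : AnalyticAt ℂ f z)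
    (hg : AnalyticAt ℂ g z) (hv : v ≠ 0) (h : ∀ t : ℝ, 0 < t → f (z + t * v) = g (z + t * v)) :
    f =ᶠ[𝓝 z] g := by
  refine (hf.frequently_eq_iff_eventually_eq hg).1 ?_
  have ht : Tendsto (fun t : ℝ => z + t * v) (𝓝[>] 0) (𝓝[≠] z) := by
    refine tendsto_nhdsWithin_iff.2 ⟨?_, ?_⟩
    · have : ContinuousAt (fun t : ℝ => z + t * v) 0 := by fun_prop
      have h2 := this.tendsto
      simp only [Complex.ofReal_zero, zero_mul, add_zero] at h2
      exact h2.mono_left nhdsWithin_le_nhds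
    · filter_upwards [self_mem_nhdsWithin] with t ht
      have : (t : ℂ) ≠ 0 := by exact_mod_cast (ne_of_gt ht)
      simp [this, hv]
  refine ht.frequently (Eventually.frequently ?_)
  filter_upwards [self_mem_nhdsWithin] with t ht using h t ht

/-- Agreement on a closed set does not at once give equal derivatives at boundary points. Each point
is the origin of a vertical ray in the wedge, leading away from the real axis, and of a horizontal
ray in the strip; agreement on a ray determines the germ. -/
theorem SliceEq.of_eqOn {m κ σ : ℝ} {ψ ψ' : ℂ → ℂ → ℂ} {s θ : ℂ}
    (h : AnalyticAt ℂ (fun p : ℂ × ℂ => ψ p.1 p.2) (s, θ))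
    (h' : AnalyticAt ℂ (fun p : ℂ × ℂ => ψ' p.1 p.2) (s, θ))
    (he : ∀ s ∈ closedWedge m κ, ∀ θ ∈ strip σ, ψ s θ = ψ' s θ) (hs : s ∈ closedWedge m κ)
    (hθ : θ ∈ strip σ) : SliceEq ψ ψ' s θ := by
  have h1 : ∀ {χ : ℂ → ℂ → ℂ}, AnalyticAt ℂ (fun p : ℂ × ℂ => χ p.1 p.2) (s, θ) →
      AnalyticAt ℂ (fun x => χ x θ) s := fun {χ} hχ =>
    AnalyticAt.fun_comp (g := fun p : ℂ × ℂ => χ p.1 p.2) (f := fun x => (x, θ)) hχ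
      (analyticAt_id.prod analyticAt_const)
  have h2 : ∀ {χ : ℂ → ℂ → ℂ}, AnalyticAt ℂ (fun p : ℂ × ℂ => χ p.1 p.2) (s, θ) →
      AnalyticAt ℂ (fun w => χ s w) θ := fun {χ} hχ =>
    AnalyticAt.fun_comp (g := fun p : ℂ × ℂ => χ p.1 p.2) (f := fun w => (s, w)) hχ
      (analyticAt_const.prod analyticAt_id)
  refine ⟨?_, (h2 h).eventuallyEq_of_ray (h2 h') one_ne_zero fun t _ => he s hs _ ?_⟩
  · obtain ⟨ε, hε, hεs⟩ : ∃ ε : ℝ, ε ≠ 0 ∧ ∀ t : ℝ, 0 < t → |s.im| ≤ |s.im + t * ε| := by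
      rcases le_total 0 s.im with hi | hi
      · refine ⟨1, one_ne_zero, fun t ht => ?_⟩
        rw [abs_of_nonneg hi, abs_of_nonneg (by linarith)]; linarith
      · refine ⟨-1, by norm_num, fun t ht => ?_⟩
        rw [abs_of_nonpos hi, abs_of_nonpos (by linarith)]; linarith
    refine (h1 h).eventuallyEq_of_ray (h1 h') (v := ε * I) (by simp [hε]) fun t ht => he _ ?_ θ hθ
    have hs' : m * s.re + κ ≤ |s.im| := hs
    have := hs'.trans (hεs t ht)
    simpa [closedWedge] using this
  · simpa [strip] using hθ

namespace WienerAlg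

variable {U V : Opens ℂ} {σ : ℝ≥0} (D : ModeDomain U)

theorem ev_zEl_pow_mul {κ : ℝ} (hκ : κ ≠ 0) (n : ℕ) (u : WienerAlg (HolB U) σ) {s θ : ℂ}
    (hs : s / κ ∈ U) (hθ : |θ.im| ≤ σ) :
    ev (zEl D σ κ ^ n * u) (s / κ) θ = s⁻¹ ^ n * ev u (s / κ) θ := by
  have h := map_pow (evHom hs hθ) (zEl D σ κ) n
  rw [evHom_apply, evHom_apply, ev_zEl D hκ hs hθ] at h
  rw [ev_mul _ _ hs hθ, h]

theorem ev_leading {κ : ℝ} (hκ : κ ≠ 0) (c : ℂ) (u : WienerAlg (HolB U) σ) {s θ : ℂ}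
    (hs : s / κ ∈ U) (hθ : |θ.im| ≤ σ) :
    ev (zEl D σ κ ^ 3 * (c • 1 + zEl D σ κ * u)) (s / κ) θ = s⁻¹ ^ 3 * (c + s⁻¹ * ev u (s / κ) θ) := by
  rw [ev_zEl_pow_mul D hκ 3 _ hs hθ, ev_add _ _ hs hθ, ev_smul _ _ hs hθ, ev_one hs hθ,
    ev_mul _ _ hs hθ, ev_zEl D hκ hs hθ, mul_one]

theorem HasPartials.of_ev_eq {κ : ℝ} (hVU : V ≤ U) {u uθ us : WienerAlg (HolB U) σ}
    (hu : HasPartials κ u uθ us) {v vθ vs : WienerAlg (HolB V) σ}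
    (e : ∀ s : ℂ, s / κ ∈ V → ∀ θ : ℂ, |θ.im| < σ → ev v (s / κ) θ = ev u (s / κ) θ)
    (eθ : ∀ s : ℂ, s / κ ∈ V → ∀ θ : ℂ, |θ.im| < σ → ev vθ (s / κ) θ = ev uθ (s / κ) θ)
    (es : ∀ s : ℂ, s / κ ∈ V → ∀ θ : ℂ, |θ.im| < σ → ev vs (s / κ) θ = ev us (s / κ) θ) :
    HasPartials κ v vθ vs where
  angle s hs θ hθ := by
    rw [eθ s hs θ hθ]
    refine (hu.angle s (hVU hs) θ hθ).congr_of_eventuallyEq ?_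
    filter_upwards [eventually_im_lt hθ] with w hw using e s hs w hw
  fst s hs θ hθ := by
    rw [es s hs θ hθ]
    refine (hu.fst s (hVU hs) θ hθ).congr_of_eventuallyEq ?_
    filter_upwards [eventually_div_mem hs] with x hx using e x hx θ hθ

end WienerAlg

open WienerAlg in
/-- Existence of the inner solution, and its description on the overlap of the inner domains. -/
theorem InnerSystem.exists_reference {S : InnerSystem} {cf cg ch : Fin 3 → Fin 3 → Fin 3 → ℂ}
    (hα : 0 < S.α) (hb : 0 < S.b) (hd : 0 < S.d) (hf : HasCubicPart S.f cf)
    (hg : HasCubicPart S.g cg) (hh : HasCubicPart S.h ch) {m n σ : ℝ} (hm : m ≠ 0) (hn : 0 < 3 / 4 * n)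
    (hmn : |m| = n) (hσ : 0 < σ) {τ : ℝ≥0} (hτ : σ < τ) :
    ∃ κ₀ ρ : ℝ, 0 < κ₀ ∧ ∀ κ, κ₀ ≤ κ → (∃ ψ, S.IsInnerSolution (closedWedge m κ) σ ψ) ∧
      ∃ Ψ Ψθ Ψs : WienerAlg (HolB (lowerSector (3 / 4 * n))) τ, ‖Ψ‖ ≤ ρ ∧ ‖Ψθ‖ ≤ ρ ∧ ‖Ψs‖ ≤ ρ ∧
      HasPartials κ
        (zEl (lowerDomain _ hn) τ κ ^ 3 * (S.psi₀ cf cg ch • 1 + zEl (lowerDomain _ hn) τ κ * Ψ))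
        (zEl (lowerDomain _ hn) τ κ ^ 4 * Ψθ) (zEl (lowerDomain _ hn) τ κ ^ 4 * Ψs) ∧
      (∀ s : ℂ, s / κ ∈ lowerSector (3 / 4 * n) → ∀ θ : ℂ, |θ.im| < τ →
        S.InnerEquationAt (fun s θ => ev (zEl (lowerDomain _ hn) τ κ ^ 3 *
          (S.psi₀ cf cg ch • 1 + zEl (lowerDomain _ hn) τ κ * Ψ)) (s / κ) θ) s θ) ∧
      ∀ ψ, S.IsInnerSolution (closedWedge m κ) σ ψ → ∀ s : ℂ, s ∈ closedWedge m κ →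
        s / κ ∈ lowerSector (3 / 4 * n) → ∀ θ ∈ strip σ,
        SliceEq ψ (fun s θ => ev (zEl (lowerDomain _ hn) τ κ ^ 3 *
          (S.psi₀ cf cg ch • 1 + zEl (lowerDomain _ hn) τ κ * Ψ)) (s / κ) θ) s θ := by
  have hm' : 3 / 4 * m ≠ 0 := by simpa using hm
  have hle : lowerSector (3 / 4 * n) ≤ wedge (3 / 4 * m) :=
    lowerSector_le_wedge (by rw [abs_mul, hmn, abs_of_pos (by norm_num : (0 : ℝ) < 3 / 4)])
  set D := wedgeDomain (3 / 4 * m) hm'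
  set D' := lowerDomain (3 / 4 * n) hn
  obtain ⟨κ₀, ρ, hκ₀, H⟩ := exists_formal_solution hα hd hf hg hh D τ
  refine ⟨κ₀, ρ, hκ₀, fun κ hκ => ?_⟩
  have hκ0 : 0 < κ := hκ₀.trans_le hκ
  obtain ⟨Ψ, Ψθ, Ψs, hΨ, hΨθ, hΨs, hpart, heq⟩ := H κ hκ
  have hmem : ∀ s ∈ closedWedge m κ, s / (κ : ℂ) ∈ wedge (3 / 4 * m) := fun s hs => by
    have hs' : m * s.re + κ ≤ |s.im| := hs
    rw [mem_wedge, Complex.div_ofReal_re, Complex.div_ofReal_im, abs_div, abs_of_pos hκ0,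
      lt_div_iff₀ hκ0]
    have e : (3 / 4 * m * (s.re / κ) + 1 / 2) * κ = 3 / 4 * (m * s.re) + κ / 2 := by field_simp
    rw [e]
    rcases le_total (m * s.re) (-(2 * κ)) with h | h
    · linarith [abs_nonneg s.im]
    · by_contra hcon
      push Not at hcon
      have h0 : m * s.re = -(2 * κ) := by linarith
      linarith [abs_nonneg s.im]
  have hsol := isInnerSolution_of_formal D hτ hκ0 hmem hpart heq
  -- Restriction to the lower sector places the unstable and the stable solution in one algebra,
  -- although their wedges are different.
  set R : WienerAlg (HolB (wedge (3 / 4 * m))) τ →L[ℂ] WienerAlg (HolB (lowerSector (3 / 4 * n))) τ :=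
    map τ (HolB.restrict hle) (HolB.norm_restrict_le hle) with hR
  have hRn : ∀ u, ‖R u‖ ≤ ‖u‖ := fun u =>
    (R.le_opNorm u).trans (mul_le_of_le_one_left (norm_nonneg _) (norm_map_le _ _))
  have hRe : ∀ u, ∀ s ∈ lowerSector (3 / 4 * n), ∀ θ, ev (R u) s θ = ev u s θ :=
    fun u s hs θ => ev_restrict hle u hs θ
  have e3 : ∀ s : ℂ, s / κ ∈ lowerSector (3 / 4 * n) → ∀ θ : ℂ, |θ.im| < τ →
      ev (zEl D' τ κ ^ 3 * (S.psi₀ cf cg ch • 1 + zEl D' τ κ * R Ψ)) (s / κ) θ =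
      ev (zEl D τ κ ^ 3 * (S.psi₀ cf cg ch • 1 + zEl D τ κ * Ψ)) (s / κ) θ := fun s hs θ hθ => by
    rw [ev_leading D' hκ0.ne' _ _ hs hθ.le, ev_leading D hκ0.ne' _ _ (hle hs) hθ.le, hRe _ _ hs]
  have e4 : ∀ u, ∀ s : ℂ, s / κ ∈ lowerSector (3 / 4 * n) → ∀ θ : ℂ, |θ.im| < τ →
      ev (zEl D' τ κ ^ 4 * R u) (s / κ) θ = ev (zEl D τ κ ^ 4 * u) (s / κ) θ := fun u s hs θ hθ => by
    rw [ev_zEl_pow_mul D' hκ0.ne' _ _ hs hθ.le, ev_zEl_pow_mul D hκ0.ne' _ _ (hle hs) hθ.le, hRe _ _ hs]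
  have hslice : ∀ s : ℂ, s / κ ∈ lowerSector (3 / 4 * n) → ∀ θ : ℂ, |θ.im| < τ →
      SliceEq (fun s θ => ev (zEl D τ κ ^ 3 * (S.psi₀ cf cg ch • 1 + zEl D τ κ * Ψ)) (s / κ) θ)
        (fun s θ => ev (zEl D' τ κ ^ 3 * (S.psi₀ cf cg ch • 1 + zEl D' τ κ * R Ψ)) (s / κ) θ) s θ :=
    fun s hs θ hθ => by
      constructor
      · filter_upwards [eventually_div_mem hs] with x hx using (e3 x hx θ hθ).symm
      · filter_upwards [eventually_im_lt hθ] with w hw using (e3 s hs w hw).symm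
  refine ⟨⟨_, hsol⟩, R Ψ, R Ψθ, R Ψs, (hRn _).trans hΨ, (hRn _).trans hΨθ, (hRn _).trans hΨs,
    HasPartials.of_ev_eq hle hpart e3 (e4 _) (e4 _),
    fun s hs θ hθ => (hslice s hs θ hθ).innerEquationAt (heq s (hle hs) θ hθ),
    fun ψ hψ s hs hs' θ hθ => ?_⟩
  have h1 : SliceEq ψ (fun s θ => ev (zEl D τ κ ^ 3 * (S.psi₀ cf cg ch • 1 + zEl D τ κ * Ψ)) (s / κ) θ)
      s θ := SliceEq.of_eqOn (hψ.regular.analytic (s, θ) ⟨hs, hθ⟩) (hsol.regular.analytic (s, θ) ⟨hs, hθ⟩)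
    (hψ.unique hα hb hd hf hg hh hm hσ hsol) hs hθ
  have h2 := hslice s hs' θ (lt_of_le_of_lt hθ hτ)
  exact ⟨h1.1.trans h2.1, h1.2.trans h2.2⟩

/-! ### Factorization of the difference. -/

/-- The leading monomial of a holomorphic function that vanishes at the centre of a disc. -/
theorem exists_leading_factor {r : ℝ} (hr : 0 < r) {F : ℂ → ℂ}
    (hF : DifferentiableOn ℂ F (Metric.ball 0 r)) (hF0 : F 0 = 0) :
    ∃ (m : ℕ) (Υ : ℂ) (H : ℂ → ℂ), 0 < m ∧ DifferentiableOn ℂ H (Metric.ball 0 r) ∧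
      ∀ q ∈ Metric.ball (0 : ℂ) r, F q = Υ * q ^ m * (1 + q * H q) := by
  have hball : Metric.ball (0 : ℂ) r ∈ 𝓝 0 := Metric.ball_mem_nhds _ hr
  have hFa : AnalyticOnNhd ℂ F (Metric.ball 0 r) := hF.analyticOnNhd Metric.isOpen_ball
  by_cases hz : ∀ᶠ q in 𝓝 0, F q = 0
  · have := hFa.eqOn_zero_of_preconnected_of_eventuallyEq_zero (convex_ball _ _).isPreconnected
      (Metric.mem_ball_self hr) hz
    -- When `F` vanishes identically the coefficient is zero and the exponent is arbitrary, as long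
    -- as it is positive.
    exact ⟨1, 0, 0, one_pos, differentiableOn_const _, fun q hq => by simpa using this hq⟩
  · obtain ⟨m, G, hG, hG0, hFG⟩ :=
      (hFa 0 (Metric.mem_ball_self hr)).exists_eventuallyEq_pow_smul_nonzero_iff.2 hz
    simp only [sub_zero, smul_eq_mul] at hFG
    have hm : m ≠ 0 := fun h => by
      have := hFG.self_of_nhds
      rw [h, hF0, pow_zero, one_mul] at this
      exact hG0 this.symm
    -- The quotient by the leading monomial has a removable singularity with value one, so `J - 1`
    -- is divisible by `q` throughout the disc.
    set J : ℂ → ℂ := fun q => if q = 0 then 1 else F q / (G 0 * q ^ m) with hJ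
    have hJG : J =ᶠ[𝓝 0] fun q => G q / G 0 := by
      filter_upwards [hFG] with q hq
      rcases eq_or_ne q 0 with rfl | h
      · simp [hJ, hG0]
      · simp only [hJ, if_neg h, hq]
        field_simp
    have hJd : DifferentiableOn ℂ J (Metric.ball 0 r) := fun q hq => by
      rcases eq_or_ne q 0 with rfl | h
      · exact ((hG.differentiableAt.div_const _).congr_of_eventuallyEq hJG).differentiableWithinAt
      · have h1 : J =ᶠ[𝓝 q] fun q => F q / (G 0 * q ^ m) := by
          filter_upwards [isOpen_ne.mem_nhds h] with x hx using if_neg hx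
        refine (DifferentiableAt.congr_of_eventuallyEq ?_ h1).differentiableWithinAt
        exact (hFa q hq).differentiableAt.div (by fun_prop) (by positivity)
    refine ⟨m, G 0, dslope J 0, hm.bot_lt, (Complex.differentiableOn_dslope hball).2 hJd, fun q _ => ?_⟩
    have h1 := sub_smul_dslope J 0 q
    rw [sub_zero, smul_eq_mul] at h1
    rw [h1]
    have hJ0 : J 0 = 1 := if_pos rfl
    rcases eq_or_ne q 0 with rfl | h
    · simp [hF0, hm]
    · rw [hJ0, hJ]
      simp only [if_neg h]
      field_simp
      ring

/-- A truncated open sector around the negative imaginary axis. -/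
def openSector (n κ : ℝ) : Set ℂ := {s | n * |s.re| + κ < -s.im}

theorem isOpen_openSector (n κ : ℝ) : IsOpen (openSector n κ) := isOpen_lt (by fun_prop) (by fun_prop)

theorem convex_openSector {n : ℝ} (hn : 0 < n) (κ : ℝ) : Convex ℝ (openSector n κ) := by
  intro x hx y hy a b ha hb hab
  have hx' : n * |x.re| + κ < -x.im := hx
  have hy' : n * |y.re| + κ < -y.im := hy
  have h1 : |a * x.re + b * y.re| ≤ a * |x.re| + b * |y.re| := by
    refine (abs_add_le _ _).trans ?_
    rw [abs_mul, abs_mul, abs_of_nonneg ha, abs_of_nonneg hb]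
  have h2 : n * |a * x.re + b * y.re| + κ < -(a * x.im + b * y.im) := by
    have h3 := mul_le_mul_of_nonneg_left h1 hn.le
    have h4 := mul_le_mul_of_nonneg_left hx'.le ha
    have h5 := mul_le_mul_of_nonneg_left hy'.le hb
    have e : κ = a * κ + b * κ := by rw [← add_mul, hab, one_mul]
    rcases ha.eq_or_lt with rfl | ha
    · have : b = 1 := by linarith
      subst this; linarith
    · have h4 := mul_lt_mul_of_pos_left hx' ha
      linarith
  simpa [openSector] using h2

theorem norm_of_mem_openSector {n κ : ℝ} (hn : 0 < n) {s : ℂ} (hs : s ∈ openSector n κ) : κ < ‖s‖ := by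
  have hs' : n * |s.re| + κ < -s.im := hs
  have := mul_nonneg hn.le (abs_nonneg s.re)
  linarith [(neg_le_abs s.im).trans (Complex.abs_im_le_norm s)]

/-- Corrections to the phase and to the prefactor that straighten the equation for the difference of
two functions, with uniform bounds. -/
structure Straightening (S : InnerSystem) (ψu ψv φ p : ℂ → ℂ → ℂ) (L n κ τ C : ℝ) : Prop where
  C_nonneg : 0 ≤ C
  analytic_Δ : ∀ s ∈ openSector n (κ / 2), ∀ θ : ℂ, |θ.im| < τ →
    AnalyticAt ℂ (fun q : ℂ × ℂ => ψu q.1 q.2 - ψv q.1 q.2) (s, θ)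
  analytic_φ : ∀ s ∈ openSector n (κ / 2), ∀ θ : ℂ, |θ.im| < τ →
    AnalyticAt ℂ (fun q : ℂ × ℂ => φ q.1 q.2) (s, θ)
  analytic_p : ∀ s ∈ openSector n (κ / 2), ∀ θ : ℂ, |θ.im| < τ →
    AnalyticAt ℂ (fun q : ℂ × ℂ => p q.1 q.2) (s, θ)
  periodic_Δ : ∀ s θ, ψu s (θ + 2 * Real.pi) - ψv s (θ + 2 * Real.pi) = ψu s θ - ψv s θ
  periodic_φ : ∀ s θ, φ s (θ + 2 * Real.pi) = φ s θ
  periodic_p : ∀ s θ, p s (θ + 2 * Real.pi) = p s θ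
  bound : ∀ s ∈ openSector n (κ / 2), ∀ θ : ℂ, |θ.im| < τ →
    ‖ψu s θ - ψv s θ‖ ≤ C / ‖s‖ ∧ ‖φ s θ‖ ≤ C / ‖s‖ ∧ ‖pdθ φ s θ‖ ≤ C / ‖s‖ ∧
    ‖pds φ s θ‖ ≤ C / ‖s‖ ∧ ‖p s θ‖ ≤ C / ‖s‖ ∧ ‖pds p s θ‖ ≤ C / ‖s‖ ^ 2 ∧
    ‖S.a₂ ψu ψv s θ‖ ≤ C / ‖s‖
  difference : ∀ s ∈ openSector n (κ / 2), ∀ θ : ℂ, |θ.im| < τ →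
    S.DifferenceEquationAt ψu ψv (fun s θ => ψu s θ - ψv s θ) s θ
  phase_eq : ∀ s ∈ openSector n (κ / 2), ∀ θ : ℂ, |θ.im| < τ →
    -S.α * (1 + pdθ φ s θ) + S.d * (S.α / S.d + (S.c + S.α * L) / S.d * s⁻¹ + pds φ s θ) =
      S.a₂ ψu ψv s θ * (S.α / S.d + (S.c + S.α * L) / S.d * s⁻¹ + pds φ s θ) +
        (S.c * s⁻¹ + S.a₃ ψu ψv s θ) * (1 + pdθ φ s θ)
  prefactor_eq : ∀ s ∈ openSector n (κ / 2), ∀ θ : ℂ, |θ.im| < τ →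
    -S.α * pdθ p s θ + S.d * pds p s θ = S.a₁ ψu ψv s θ +
      S.a₂ ψu ψv s θ * (2 / S.d * s⁻¹ + pds p s θ) + (S.c * s⁻¹ + S.a₃ ψu ψv s θ) * pdθ p s θ

namespace Straightening

variable {S : InnerSystem} {ψu ψv φ p : ℂ → ℂ → ℂ} {L n κ τ C : ℝ}
  (h : Straightening S ψu ψv φ p L n κ τ C)

include h

theorem hasDerivAt_phase_fst {s θ : ℂ} (hs : s ∈ openSector n (κ / 2)) (hs0 : s ∈ slitPlane)
    (hθ : |θ.im| < τ) : HasDerivAt (fun x => S.phase L φ x θ)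
      (S.α / S.d + (S.c + S.α * L) / S.d * s⁻¹ + pds φ s θ) s := by
  have h1 := ((((hasDerivAt_id s).const_mul (S.α / S.d : ℂ)).const_add θ).add
    ((Complex.hasDerivAt_log hs0).const_mul ((S.c + S.α * L) / S.d : ℂ))).add
    (hasDerivAt_pds (h.analytic_φ s hs θ hθ))
  exact h1.congr_deriv (by rw [mul_one])

theorem hasDerivAt_phase_snd {s θ : ℂ} (hs : s ∈ openSector n (κ / 2))
    (hθ : |θ.im| < τ) : HasDerivAt (fun w => S.phase L φ s w) (1 + pdθ φ s θ) θ :=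
  (((hasDerivAt_id θ).add_const _).add_const _).add (hasDerivAt_pdθ (h.analytic_φ s hs θ hθ))

theorem transportEquationAt {s θ : ℂ} (hs : s ∈ openSector n (κ / 2)) (hs0 : s ∈ slitPlane)
    (hθ : |θ.im| < τ) : S.TransportEquationAt ψu ψv (S.phase L φ) s θ := by
  have e1 : pds (S.phase L φ) s θ = _ := (h.hasDerivAt_phase_fst hs hs0 hθ).deriv
  have e2 : pdθ (S.phase L φ) s θ = _ := (h.hasDerivAt_phase_snd hs hθ).deriv
  rw [InnerSystem.TransportEquationAt, e1, e2]
  exact h.phase_eq s hs θ hθ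

/-- The normalized prefactors `exp p * (1 + W (exp (-i ξ)))` solve the difference equation. -/
theorem prefactor_derivs {W : ℂ → ℂ} {s θ : ℂ} (hs : s ∈ openSector n (κ / 2)) (hs0 : s ∈ slitPlane)
    (hθ : |θ.im| < τ) (hW : DifferentiableAt ℂ W (exp (-(I * S.phase L φ s θ)))) (P₁ : ℂ → ℂ → ℂ)
    (hP : P₁ = fun s θ => exp (p s θ) * (1 + W (exp (-(I * S.phase L φ s θ)))) - 1) :
    pds P₁ s θ = exp (p s θ) * (pds p s θ * (1 + W (exp (-(I * S.phase L φ s θ)))) -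
      deriv W (exp (-(I * S.phase L φ s θ))) * (exp (-(I * S.phase L φ s θ)) *
        (I * (S.α / S.d + (S.c + S.α * L) / S.d * s⁻¹ + pds φ s θ)))) ∧
    (S.d ≠ 0 → S.DifferenceEquationAt ψu ψv (S.prefactor P₁) s θ) := by
  set q := exp (-(I * S.phase L φ s θ)) with hq
  have hcomp : ∀ {ξ : ℂ → ℂ} {ξ' z : ℂ}, HasDerivAt ξ ξ' z → exp (-(I * ξ z)) = q →
      HasDerivAt (fun x => W (exp (-(I * ξ x)))) (deriv W q * (q * -(I * ξ'))) z := by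
    intro ξ ξ' z hξ he
    have h1 := (hξ.const_mul I).fun_neg.cexp
    rw [he] at h1
    refine HasDerivAt.comp (h₂ := W) (h := fun x => exp (-(I * ξ x))) z ?_ h1
    rw [he]
    exact hW.hasDerivAt
  have hps := hasDerivAt_pds (h.analytic_p s hs θ hθ)
  have hpθ := hasDerivAt_pdθ (h.analytic_p s hs θ hθ)
  have hWs := hcomp (h.hasDerivAt_phase_fst hs hs0 hθ) rfl
  have hWθ := hcomp (h.hasDerivAt_phase_snd hs hθ) rfl
  have hPs := (hps.cexp.fun_mul (hWs.const_add 1)).sub_const 1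
  have hPθ := (hpθ.cexp.fun_mul (hWθ.const_add 1)).sub_const 1
  subst hP
  refine ⟨hPs.deriv.trans (by rw [← hq]; ring), fun hd => ?_⟩
  have hd' : (S.d : ℂ) ≠ 0 := by exact_mod_cast hd
  have hsne : s ≠ 0 := slitPlane_ne_zero hs0
  have hpow : HasDerivAt (fun x : ℂ => x ^ ((2 / S.d : ℝ) : ℂ))
      (2 / S.d * s⁻¹ * s ^ ((2 / S.d : ℝ) : ℂ)) s := by
    refine ((hasDerivAt_id s).cpow_const hs0).congr_deriv ?_
    rw [id, Complex.cpow_sub _ _ hsne, Complex.cpow_one]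
    push_cast
    ring
  have eS := (hpow.fun_mul (hPs.const_add 1)).deriv
  have eΘ := ((hPθ.const_add 1).const_mul (s ^ ((2 / S.d : ℝ) : ℂ))).deriv
  have hph := h.phase_eq s hs θ hθ
  have hpre := h.prefactor_eq s hs θ hθ
  rw [InnerSystem.DifferenceEquationAt, pds, pdθ]
  simp only [InnerSystem.prefactor]
  rw [eS, eΘ, ← hq]
  generalize s ^ ((2 / S.d : ℝ) : ℂ) = z
  generalize hδ : (2 / S.d : ℂ) * s⁻¹ = δ at *
  have hδ' : 2 * s⁻¹ = S.d * δ := by rw [← hδ]; field_simp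
  rw [hδ']
  -- The terms without `W'` reduce to the equation for `p`; those with `W'` are a multiple of the
  -- transport equation, since `W` enters only through the phase.
  linear_combination z * exp (p s θ) * (1 + W q) * hpre - z * exp (p s θ) * deriv W q * q * I * hph

end Straightening

/-- A truncated closed sector around the negative imaginary axis. -/
def closedSector (n κ : ℝ) : Set ℂ := {s | n * |s.re| + κ ≤ -s.im}

theorem closedSector_subset {n κ : ℝ} (hκ : 0 < κ) : closedSector n κ ⊆ openSector n (κ / 2) :=
  fun s hs => by
    have hs' : n * |s.re| + κ ≤ -s.im := hs
    show n * |s.re| + κ / 2 < -s.im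
    linarith

theorem norm_le_of_mem_closedSector {n κ : ℝ} (hn : 0 < n) (hκ : 0 < κ) {s : ℂ}
    (hs : s ∈ closedSector n κ) : ‖s‖ ≤ (n⁻¹ + 1) * -s.im := by
  have hs' : n * |s.re| + κ ≤ -s.im := hs
  have h0 := mul_nonneg hn.le (abs_nonneg s.re)
  refine (Complex.norm_le_abs_re_add_abs_im s).trans ?_
  rw [abs_of_neg (by linarith : s.im < 0), add_mul, one_mul]
  gcongr
  rw [inv_mul_eq_div, le_div_iff₀ hn]
  linarith

theorem exp_neg_le_div_sq {c x : ℝ} (hc : 0 < c) (hx : 0 < x) :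
    Real.exp (-(c * x)) ≤ 2 / c ^ 2 / x ^ 2 := by
  have h := Real.quadratic_le_exp_of_nonneg (mul_pos hc hx).le
  have h2 : (c * x) ^ 2 / 2 ≤ Real.exp (c * x) := by linarith [mul_pos hc hx]
  rw [Real.exp_neg, div_div, ← mul_pow]
  refine (inv_anti₀ (by positivity) h2).trans_eq ?_
  rw [inv_div]

/-- A holomorphic function on a disc and its derivative are bounded on smaller discs. -/
theorem exists_bound_closedBall {r r' : ℝ} (hr : r' < r) {H : ℂ → ℂ}
    (hH : DifferentiableOn ℂ H (Metric.ball 0 r)) :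
    ∃ B : ℝ, 0 ≤ B ∧ ∀ q : ℂ, ‖q‖ ≤ r' → ‖H q‖ ≤ B ∧ ‖deriv H q‖ ≤ B := by
  have hsub : Metric.closedBall (0 : ℂ) r' ⊆ Metric.ball 0 r := Metric.closedBall_subset_ball hr
  obtain ⟨B₁, h1⟩ := (isCompact_closedBall (0 : ℂ) r').exists_bound_of_continuousOn
    (hH.continuousOn.mono hsub)
  obtain ⟨B₂, h2⟩ := (isCompact_closedBall (0 : ℂ) r').exists_bound_of_continuousOn
    ((hH.deriv Metric.isOpen_ball).continuousOn.mono hsub)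
  refine ⟨max 0 (max B₁ B₂), le_max_left _ _, fun q hq => ?_⟩
  have hq' := mem_closedBall_zero_iff.2 hq
  exact ⟨(h1 q hq').trans ((le_max_left _ _).trans (le_max_right _ _)),
    (h2 q hq').trans ((le_max_right _ _).trans (le_max_right _ _))⟩

namespace Straightening

variable {S : InnerSystem} {ψu ψv φ p : ℂ → ℂ → ℂ} {L n κ τ C : ℝ}
  (h : Straightening S ψu ψv φ p L n κ τ C)

include h

theorem mem_slitPlane (hn : 0 < n) (hκ : 0 < κ) {s : ℂ} (hs : s ∈ openSector n (κ / 2)) :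
    s ∈ slitPlane := by
  have hs' : n * |s.re| + κ / 2 < -s.im := hs
  have := mul_nonneg hn.le (abs_nonneg s.re)
  exact Or.inr (by linarith)

theorem div_norm_le (hn : 0 < n) (hκ : 0 < κ) {s : ℂ} (hs : s ∈ openSector n (κ / 2)) {x y : ℝ}
    (hx : 0 ≤ x) (hxy : 2 * x ≤ y * κ) : x / ‖s‖ ≤ y := by
  have h1 := norm_of_mem_openSector hn hs
  rw [div_le_iff₀ (by linarith)]
  have h2 : 0 ≤ y := by
    by_contra hy
    have := mul_neg_of_neg_of_pos (not_le.1 hy) hκ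
    linarith
  nlinarith

/-- The difference, divided by the prefactor, is a first integral. -/
theorem transportChart (hn : 0 < n) (hd : 0 < S.d) (hκ : 2 ≤ κ) (h1 : 8 * C ≤ κ)
    (h2 : 4 * C ≤ S.d * κ) :
    TransportChart (openSector n (κ / 2)) τ (S.α / S.d) ((S.c + S.α * L) / S.d) (κ / 2) φ
      (fun s θ => (ψu s θ - ψv s θ) * exp (-(p s θ + 2 / S.d * log s))) := by
  have hκ0 : 0 < κ := by linarith
  have hC := h.C_nonneg
  have hd' : (S.d : ℂ) ≠ 0 := by exact_mod_cast hd.ne'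
  have h4 : ∀ {s : ℂ}, s ∈ openSector n (κ / 2) → C / ‖s‖ ≤ 1 / 4 := fun hs =>
    h.div_norm_le hn hκ0 hs hC (by linarith)
  refine ⟨isOpen_openSector _ _, convex_openSector hn _, fun s hs => ?_, fun y hy => ?_, h.analytic_φ,
    fun s hs θ hθ => ?_, h.periodic_φ, fun s θ => ?_,
    fun s hs θ hθ => ((h.bound s hs θ hθ).2.1).trans (h4 hs),
    fun s hs θ hθ => ((h.bound s hs θ hθ).2.2.1).trans (h4 hs), fun s hs θ hθ => ?_, fun ε hε => ?_⟩
  · have hs' : n * |s.re| + κ / 2 < -s.im := hs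
    have := mul_nonneg hn.le (abs_nonneg s.re)
    linarith
  · show n * |(-I * (y : ℂ)).re| + κ / 2 < -(-I * (y : ℂ)).im
    rw [neg_mul, mul_comm I, Complex.neg_re, Complex.neg_im, Complex.re_ofReal_mul, Complex.im_ofReal_mul]
    simpa using hy
  · have hl : AnalyticAt ℂ (fun q : ℂ × ℂ => log q.1) (s, θ) :=
      analyticAt_fst.clog (h.mem_slitPlane hn hκ0 hs)
    exact (h.analytic_Δ s hs θ hθ).mul (((h.analytic_p s hs θ hθ).add (analyticAt_const.mul hl)).neg.cexp)
  · simp only [h.periodic_Δ, h.periodic_p]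
  · have hs0 := h.mem_slitPlane hn hκ0 hs
    have hl := (Complex.hasDerivAt_log hs0).const_mul (2 / S.d : ℂ)
    have hps := hasDerivAt_pds (h.analytic_p s hs θ hθ)
    have hpθ := hasDerivAt_pdθ (h.analytic_p s hs θ hθ)
    have hΔs := hasDerivAt_pds (ψ := fun s θ => ψu s θ - ψv s θ) (h.analytic_Δ s hs θ hθ)
    have hΔθ := hasDerivAt_pdθ (ψ := fun s θ => ψu s θ - ψv s θ) (h.analytic_Δ s hs θ hθ)
    have hdiff := h.difference s hs θ hθ
    rw [InnerSystem.DifferenceEquationAt] at hdiff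
    have eS := (hΔs.fun_mul (hps.fun_add hl).fun_neg.cexp).deriv
    have eΘ := (hΔθ.fun_mul (hpθ.add_const (2 / S.d * log s)).fun_neg.cexp).deriv
    have hph := h.phase_eq s hs θ hθ
    have hpre := h.prefactor_eq s hs θ hθ
    -- The quotient and the phase solve the same transport equation. Proportionality of their
    -- gradients follows on eliminating the common coefficients, provided that the coefficient of
    -- `∂_s` is not zero.
    have ha₂ : (S.d : ℂ) - S.a₂ ψu ψv s θ ≠ 0 := fun h0 => by
      have e : S.a₂ ψu ψv s θ = S.d := (sub_eq_zero.1 h0).symm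
      have hb := (h.bound s hs θ hθ).2.2.2.2.2.2
      rw [e, Complex.norm_real, Real.norm_of_nonneg hd.le] at hb
      have := hb.trans (h.div_norm_le hn hκ0 hs (y := S.d / 2) hC (by linarith))
      linarith
    rw [show pds (fun s θ => (ψu s θ - ψv s θ) * exp (-(p s θ + 2 / S.d * log s))) s θ = _ from eS,
      show pdθ (fun s θ => (ψu s θ - ψv s θ) * exp (-(p s θ + 2 / S.d * log s))) s θ = _ from eΘ]
    push_cast
    generalize exp (-(p s θ + 2 / S.d * log s)) = e
    generalize pds (fun s θ => ψu s θ - ψv s θ) s θ = Δs at *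
    generalize pdθ (fun s θ => ψu s θ - ψv s θ) s θ = Δθ at *
    generalize ψu s θ - ψv s θ = Δ at *
    generalize hδ : (2 / S.d : ℂ) * s⁻¹ = δ at *
    have hδ' : 2 * s⁻¹ = S.d * δ := by rw [← hδ]; field_simp
    rw [hδ'] at hdiff
    refine mul_left_cancel₀ ha₂ ?_
    generalize (S.α / S.d + (S.c + S.α * L) / S.d * s⁻¹ + pds φ s θ : ℂ) = ξs at *
    linear_combination e * (1 + pdθ φ s θ) * (hdiff - Δ * hpre) - e * (Δθ - Δ * pdθ p s θ) * hph
  -- Division by `s^(2/d)` only helps and `exp (-p)` is bounded, so the decay of the difference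
  -- suffices.
  · refine ⟨C * Real.exp 1 / ε, fun s hs hsε θ hθ => ?_⟩
    have hs1 : 1 < ‖s‖ := by linarith [norm_of_mem_openSector hn hs]
    have hb := h.bound s hs θ hθ
    rw [norm_mul, Complex.norm_exp, Complex.neg_re, Complex.add_re]
    have e1 : (2 / S.d * log s : ℂ).re = 2 / S.d * Real.log ‖s‖ := by
      rw [← Complex.log_re, ← Complex.re_ofReal_mul]; push_cast; rfl
    have e2 : 0 ≤ 2 / S.d * Real.log ‖s‖ := mul_nonneg (by positivity) (Real.log_nonneg hs1.le)
    have e3 := (Complex.abs_re_le_norm _).trans (hb.2.2.2.2.1.trans (h4 hs))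
    calc _ ≤ C / ‖s‖ * Real.exp 1 := by
          gcongr
          · exact hb.1
          · rw [e1]; linarith [(abs_le.1 e3).1]
      _ ≤ ε := by
          rw [div_mul_eq_mul_div, div_le_iff₀ (by linarith)]
          rwa [div_le_iff₀ hε, mul_comm ‖s‖] at hsε

theorem norm_pds_phase_sub_le (hn : 0 < n) (hκ : 2 ≤ κ)
    (h3 : 4 * (|(S.c + S.α * L) / S.d| + C) ≤ S.α / S.d * κ) {s θ : ℂ}
    (hs : s ∈ openSector n (κ / 2)) (hθ : |θ.im| < τ) :
    ‖(S.c + S.α * L) / S.d * s⁻¹ + pds φ s θ‖ ≤ S.α / S.d / 2 := by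
  have hκ0 : 0 < κ := by linarith
  refine le_trans ?_ (h.div_norm_le hn hκ0 hs (x := |(S.c + S.α * L) / S.d| + C)
    (add_nonneg (abs_nonneg _) (h.C_nonneg)) (by linarith))
  rw [add_div _ C]
  refine (norm_add_le _ _).trans (add_le_add (le_of_eq ?_) (h.bound s hs θ hθ).2.2.2.1)
  rw [norm_mul, norm_inv, ← div_eq_mul_inv]
  congr 1
  rw [← Real.norm_eq_abs, ← Complex.norm_real]
  push_cast
  rfl

/-- For a fixed angle the `s`-derivative of the phase stays within half of `α / d` from `α / d`; on
a convex set this gives injectivity in `s`. -/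
theorem injOn_phase (hn : 0 < n) (hα : 0 < S.α) (hd : 0 < S.d) (hκ : 2 ≤ κ)
    (h3 : 4 * (|(S.c + S.α * L) / S.d| + C) ≤ S.α / S.d * κ) {G : Set ℂ}
    (hG : G ⊆ openSector n (κ / 2)) {σ : ℝ} (hσ : σ < τ) :
    InjOn (fun q : ℂ × ℂ => (S.phase L φ q.1 q.2, q.2)) (G ×ˢ strip σ) := by
  rintro ⟨s, θ⟩ ⟨hs, hθ⟩ ⟨s', θ'⟩ ⟨hs', -⟩ he
  obtain ⟨e1, rfl⟩ := Prod.mk.inj he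
  have ha : 0 < S.α / S.d := by positivity
  have hθ' : |θ.im| < τ := lt_of_le_of_lt hθ hσ
  have hlip := (convex_openSector hn (κ / 2)).norm_image_sub_le_of_norm_hasDerivWithin_le
    (f := fun x => S.phase L φ x θ - (S.α / S.d : ℂ) * x)
    (f' := fun x => (S.c + S.α * L) / S.d * x⁻¹ + pds φ x θ) (C := S.α / S.d / 2) (fun x hx => by
      have h0 := (h.hasDerivAt_phase_fst hx (h.mem_slitPlane hn (by linarith) hx) hθ').sub
        ((hasDerivAt_id x).const_mul (S.α / S.d : ℂ))
      exact (h0.congr_deriv (by ring)).hasDerivWithinAt)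
    (fun x hx => h.norm_pds_phase_sub_le hn hκ h3 hx hθ') (hG hs') (hG hs)
  have e2 : S.phase L φ s θ - (S.α / S.d : ℂ) * s - (S.phase L φ s' θ - (S.α / S.d : ℂ) * s') =
      ((S.α / S.d : ℝ) : ℂ) * (s' - s) := by
    have e1' : S.phase L φ s θ = S.phase L φ s' θ := e1
    push_cast
    linear_combination e1'
  rw [e2, norm_mul, Complex.norm_real, Real.norm_of_nonneg ha.le, norm_sub_rev s s'] at hlip
  have h0 : ‖s' - s‖ ≤ 0 := by nlinarith [norm_nonneg (s' - s)]
  rw [sub_eq_zero.1 (norm_le_zero_iff.1 h0)]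

end Straightening

namespace Straightening

variable {S : InnerSystem} {ψu ψv φ p : ℂ → ℂ → ℂ} {L n κ τ C : ℝ}
  (h : Straightening S ψu ψv φ p L n κ τ C)

include h

theorem exp_phase_periodic (s θ : ℂ) :
    exp (-(I * S.phase L φ s (θ + 2 * Real.pi))) = exp (-(I * S.phase L φ s θ)) := by
  have e : -(I * S.phase L φ s (θ + 2 * Real.pi)) = -(I * S.phase L φ s θ) - 2 * Real.pi * I := by
    simp only [InnerSystem.phase, h.periodic_φ]
    ring
  rw [e, Complex.exp_periodic.sub_eq]

/-- The logarithm contributes only a bounded argument, so the imaginary part of the phase is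
governed by `(α / d) Im s`. This makes `exp (-i ξ)` exponentially small. -/
theorem phase_im_le (hn : 0 < n) (hκ : 2 ≤ κ) (h1 : 8 * C ≤ κ) {σ : ℝ} {s θ : ℂ}
    (hs : s ∈ closedSector n κ) (hθ : |θ.im| < τ) (hθσ : |θ.im| ≤ σ) : (S.phase L φ s θ).im ≤
      σ + |(S.c + S.α * L) / S.d| * Real.pi + 1 / 4 - S.α / S.d * -s.im := by
  have hκ0 : 0 < κ := by linarith
  have hs' := closedSector_subset hκ0 hs
  have e : S.phase L φ s θ = θ + ((S.α / S.d : ℝ) : ℂ) * s +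
      (((S.c + S.α * L) / S.d : ℝ) : ℂ) * log s + φ s θ := by
    rw [InnerSystem.phase]; push_cast; rfl
  rw [e, Complex.add_im, Complex.add_im, Complex.add_im, Complex.im_ofReal_mul, Complex.im_ofReal_mul,
    Complex.log_im]
  have h2 : (S.c + S.α * L) / S.d * s.arg ≤ |(S.c + S.α * L) / S.d| * Real.pi := by
    refine (le_abs_self _).trans ?_
    rw [abs_mul]
    gcongr
    exact Complex.abs_arg_le_pi s
  have h3 := (Complex.abs_im_le_norm _).trans ((h.bound s hs' θ hθ).2.1.trans
    (h.div_norm_le hn hκ0 hs' (y := 1 / 4) h.C_nonneg (by linarith)))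
  linarith [(abs_le.1 h3).2, (abs_le.1 hθσ).2]

theorem analyticAt_phase (hn : 0 < n) (hκ : 0 < κ) {s θ : ℂ} (hs : s ∈ openSector n (κ / 2))
    (hθ : |θ.im| < τ) : AnalyticAt ℂ (fun q : ℂ × ℂ => S.phase L φ q.1 q.2) (s, θ) := by
  have hl : AnalyticAt ℂ (fun q : ℂ × ℂ => log q.1) (s, θ) :=
    analyticAt_fst.clog (h.mem_slitPlane hn hκ hs)
  exact ((analyticAt_snd.add (analyticAt_const.mul analyticAt_fst)).add (analyticAt_const.mul hl)).add
    (h.analytic_φ s hs θ hθ)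

/-- The difference is a prefactor times one exponential of the phase. -/
theorem exists_splitting (hn : 0 < n) (hα : 0 < S.α) (hd : 0 < S.d) (hκ : 2 ≤ κ) (h1 : 8 * C ≤ κ)
    (h2 : 4 * C ≤ S.d * κ) (h3 : 4 * (|(S.c + S.α * L) / S.d| + C) ≤ S.α / S.d * κ) {σ : ℝ}
    (hσ : 0 < σ) (hτ : σ + 2 * (|(S.c + S.α * L) / S.d| * Real.pi) + 2 = τ)
    (h4 : σ + 2 * (|(S.c + S.α * L) / S.d| * Real.pi) + 5 / 4 ≤ S.α / S.d * (κ / 2)) :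
    ∃ (P₁ : ℂ → ℂ → ℂ) (m : ℕ) (Υ : ℂ) (M : ℝ), 0 < m ∧
      IsAnalyticPeriodic (closedSector n κ) σ P₁ ∧
      ∀ s ∈ closedSector n κ, ∀ θ ∈ strip σ,
        ψu s θ - ψv s θ = S.prefactor P₁ s θ * (Υ * exp (m * -(I * S.phase L φ s θ))) ∧
        S.DifferenceEquationAt ψu ψv (S.prefactor P₁) s θ ∧
        ‖P₁ s θ‖ ≤ M / ‖s‖ ∧ ‖pds P₁ s θ‖ ≤ M / ‖s‖ ^ 2 := by
  have hκ0 : 0 < κ := by linarith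
  have ha : 0 < S.α / S.d := by positivity
  set a := S.α / S.d with ha_def
  set γ := (S.c + S.α * L) / S.d with hγ
  have hγ0 : 0 ≤ |γ| * Real.pi := mul_nonneg (abs_nonneg _) Real.pi_pos.le
  set T := a * (κ / 2) + |γ| * Real.pi with hT
  have hστ : σ < τ := by linarith
  obtain ⟨F, hFd, hF0, hF⟩ := (h.transportChart hn hd hκ h1 h2).exists_cusp ha (by positivity) hτ hσ
  -- The disc may have radius below one, so Cauchy's estimates would allow the Taylor coefficients
  -- of `F` to grow geometrically. Keeping only the leading monomial, and moving the factor `1 + q H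
  -- q` into the prefactor, avoids this.
  obtain ⟨m, Υ, H, hm, hH, hFH⟩ := exists_leading_factor (Real.exp_pos _) hFd hF0
  obtain ⟨B, hB0, hB⟩ := exists_bound_closedBall (r' := Real.exp (-(T + 1)))
    (Real.exp_lt_exp.2 (by linarith : -(T + 1) < -T)) hH
  set W : ℂ → ℂ := fun q => q * H q with hW
  set q : ℂ → ℂ → ℂ := fun s θ => exp (-(I * S.phase L φ s θ)) with hq
  set P₁ : ℂ → ℂ → ℂ := fun s θ => exp (p s θ) * (1 + W (exp (-(I * S.phase L φ s θ)))) - 1 with hP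
  set A := σ + |γ| * Real.pi + 1 / 4 with hA
  set c := a / (n⁻¹ + 1) with hc
  have hc0 : 0 < c := by positivity
  set Q := Real.exp A * (2 / c ^ 2) with hQ
  have hQ0 : 0 ≤ Q := by positivity
  have hqn : ∀ s θ, ‖q s θ‖ = Real.exp (S.phase L φ s θ).im := fun s θ => by
    rw [hq, Complex.norm_exp]; simp
  -- Hypothesis `h4` places `q` in the disc of radius `exp (-(T + 1))`, strictly inside the domain
  -- of `H`, where `H` and its derivative are bounded.
  have him : ∀ s ∈ closedSector n κ, ∀ θ ∈ strip σ, (S.phase L φ s θ).im ≤ -(T + 1) :=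
    fun s hs θ hθ => by
      have hi := h.phase_im_le hn hκ h1 hs (lt_of_le_of_lt hθ hστ) hθ
      have hs' : n * |s.re| + κ ≤ -s.im := hs
      have h5 := mul_le_mul_of_nonneg_left
        ((le_add_of_nonneg_left (mul_nonneg hn.le (abs_nonneg s.re))).trans hs') ha.le
      rw [hT]
      linarith
  have hqr : ∀ s ∈ closedSector n κ, ∀ θ ∈ strip σ, ‖q s θ‖ ≤ Real.exp (-(T + 1)) :=
    fun s hs θ hθ => by rw [hqn]; exact Real.exp_le_exp.2 (him s hs θ hθ)
  -- The exponential smallness is recorded as quadratic decay, which is what the bound on `∂_s P₁`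
  -- asks for.
  have hqQ : ∀ s ∈ closedSector n κ, ∀ θ ∈ strip σ, ‖q s θ‖ ≤ Q / ‖s‖ ^ 2 := fun s hs θ hθ => by
    have hi := h.phase_im_le hn hκ h1 hs (lt_of_le_of_lt hθ hστ) hθ
    have hs1 := norm_of_mem_openSector hn (closedSector_subset hκ0 hs)
    have h5 : c * ‖s‖ ≤ a * -s.im := by
      rw [hc, div_mul_eq_mul_div, div_le_iff₀ (by positivity), mul_assoc]
      gcongr
      rw [mul_comm]
      exact norm_le_of_mem_closedSector hn hκ0 hs
    rw [hqn, hQ, mul_div_assoc]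
    refine (Real.exp_le_exp.2 (by linarith : _ ≤ A + -(c * ‖s‖))).trans ?_
    rw [Real.exp_add]
    gcongr
    exact exp_neg_le_div_sq hc0 (by linarith)
  have hqball : ∀ s ∈ closedSector n κ, ∀ θ ∈ strip σ, q s θ ∈ Metric.ball (0 : ℂ) (Real.exp (-T)) :=
    fun s hs θ hθ => mem_ball_zero_iff.2 ((hqr s hs θ hθ).trans_lt (Real.exp_lt_exp.2 (by linarith)))
  have hHa : ∀ x ∈ Metric.ball (0 : ℂ) (Real.exp (-T)), AnalyticAt ℂ H x :=
    hH.analyticOnNhd Metric.isOpen_ball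
  have hWa : ∀ x ∈ Metric.ball (0 : ℂ) (Real.exp (-T)), AnalyticAt ℂ W x := fun x hx =>
    analyticAt_id.mul (hHa x hx)
  have hT0 : 0 ≤ T := by positivity
  have hq1 : ∀ s ∈ closedSector n κ, ∀ θ ∈ strip σ, ‖q s θ‖ ≤ 1 := fun s hs θ hθ =>
    (hqr s hs θ hθ).trans (Real.exp_le_one_iff.2 (by linarith))
  refine ⟨P₁, m, Υ, (2 * C * (1 + B) + B * Q) + Real.exp 1 * (C * (1 + B) + 2 * B * (Q * (2 * a))), hm,
    ⟨?_, fun s _ θ _ => ?_⟩, fun s hs θ hθ => ?_⟩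
  · rintro ⟨s, θ⟩ ⟨hs, hθ⟩
    have hs' := closedSector_subset hκ0 hs
    have hθ' := lt_of_le_of_lt hθ hστ
    have h5 : AnalyticAt ℂ (fun x : ℂ × ℂ => exp (-(I * S.phase L φ x.1 x.2))) (s, θ) :=
      (analyticAt_const.mul (h.analyticAt_phase hn hκ0 hs' hθ')).neg.cexp
    have h6 : AnalyticAt ℂ (fun x : ℂ × ℂ => W (exp (-(I * S.phase L φ x.1 x.2)))) (s, θ) :=
      AnalyticAt.fun_comp (g := W) (f := fun x : ℂ × ℂ => exp (-(I * S.phase L φ x.1 x.2)))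
        (hWa _ (hqball s hs θ hθ)) h5
    exact ((h.analytic_p s hs' θ hθ').cexp.mul (analyticAt_const.add h6)).sub analyticAt_const
  · simp only [hP, h.exp_phase_periodic, h.periodic_p]
  · have hs' := closedSector_subset hκ0 hs
    have hs0 := h.mem_slitPlane hn hκ0 hs'
    have hsne : s ≠ 0 := slitPlane_ne_zero hs0
    have hθ' : |θ.im| < τ := lt_of_le_of_lt hθ hστ
    have hsn : 1 < ‖s‖ := by linarith [norm_of_mem_openSector hn hs']
    have hd' : (S.d : ℂ) ≠ 0 := by exact_mod_cast hd.ne'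
    have hball := hqball s hs θ hθ
    obtain ⟨hps, hpd⟩ := h.prefactor_derivs hs' hs0 hθ' (hWa _ hball).differentiableAt P₁ hP
    have hb := h.bound s hs' θ hθ'
    have hp4 := hb.2.2.2.2.1.trans (h.div_norm_le hn hκ0 hs' (y := 1 / 4) h.C_nonneg (by linarith))
    have hHB := hB (q s θ) (hqr s hs θ hθ)
    have hWn : ‖W (q s θ)‖ ≤ B * ‖q s θ‖ := by
      rw [hW, norm_mul, mul_comm]; gcongr; exact hHB.1
    have hW1 : ‖1 + W (q s θ)‖ ≤ 1 + B := by
      refine (norm_add_le _ _).trans ?_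
      rw [norm_one]
      linarith [mul_le_mul_of_nonneg_left (hq1 s hs θ hθ) hB0]
    have hWd : ‖deriv W (q s θ)‖ ≤ 2 * B := by
      have e : deriv W (q s θ) = 1 * H (q s θ) + q s θ * deriv H (q s θ) :=
        ((hasDerivAt_id _).fun_mul (hHa _ hball).differentiableAt.hasDerivAt).deriv
      rw [e, one_mul]
      refine (norm_add_le _ _).trans ?_
      rw [norm_mul]
      have := mul_le_mul (hq1 s hs θ hθ) hHB.2 (norm_nonneg _) zero_le_one
      linarith [hHB.1]
    have hC := h.C_nonneg
    refine ⟨?_, hpd hd.ne', ?_, ?_⟩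
    · have e : θ + ((a : ℝ) : ℂ) * s + ((γ : ℝ) : ℂ) * log s + φ s θ = S.phase L φ s θ := by
        rw [InnerSystem.phase, ha_def, hγ]; push_cast; rfl
      have h5 := hF s hs' θ hθ
      rw [e] at h5
      have h6 := (h5 (by linarith [him s hs θ hθ])).trans (hFH _ hball)
      have h7 : exp (p s θ + 2 / S.d * log s) = s ^ ((2 / S.d : ℝ) : ℂ) * exp (p s θ) := by
        rw [Complex.cpow_def_of_ne_zero hsne, ← Complex.exp_add]
        congr 1
        push_cast
        ring
      have h8 : ψu s θ - ψv s θ = (ψu s θ - ψv s θ) * exp (-(p s θ + 2 / S.d * log s)) *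
          exp (p s θ + 2 / S.d * log s) := by
        rw [mul_assoc, ← Complex.exp_add, neg_add_cancel, Complex.exp_zero, mul_one]
      rw [h8, h6, h7, InnerSystem.prefactor, Complex.exp_nat_mul]
      simp only [hP, hW]
      ring
    · have e : P₁ s θ = (exp (p s θ) - 1) * (1 + W (q s θ)) + W (q s θ) := by
        simp only [hP, hq]; ring
      have h5 : ‖P₁ s θ‖ ≤ (2 * C * (1 + B) + B * Q) / ‖s‖ := by
        rw [e, add_div]
        refine (norm_add_le _ _).trans (add_le_add ?_ ?_)
        · rw [norm_mul]
          calc _ ≤ 2 * (C / ‖s‖) * (1 + B) := by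
                gcongr
                exact (Complex.norm_exp_sub_one_le (hp4.trans (by norm_num))).trans (by
                  linarith [hb.2.2.2.2.1])
            _ = _ := by ring
        · refine hWn.trans ?_
          rw [mul_div_assoc]
          gcongr
          refine (hqQ s hs θ hθ).trans ?_
          gcongr
          exact le_self_pow₀ hsn.le two_ne_zero
      exact h5.trans (div_le_div_of_nonneg_right (le_add_of_nonneg_right (by positivity))
        (norm_nonneg _))
    · have hpe : ‖exp (p s θ)‖ ≤ Real.exp 1 := by
        rw [Complex.norm_exp]
        exact Real.exp_le_exp.2 ((Complex.re_le_norm _).trans (hp4.trans (by norm_num)))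
      have hξ : ‖(S.α / S.d + (S.c + S.α * L) / S.d * s⁻¹ + pds φ s θ : ℂ)‖ ≤ 2 * a := by
        have h5 := h.norm_pds_phase_sub_le hn hκ h3 hs' hθ'
        have h6 : ‖(S.α / S.d : ℂ)‖ = a := by
          rw [← Complex.ofReal_div, Complex.norm_real, Real.norm_of_nonneg ha.le]
        rw [add_assoc]
        refine (norm_add_le _ _).trans ?_
        linarith
      have h5 : ‖pds P₁ s θ‖ ≤ Real.exp 1 * (C * (1 + B) + 2 * B * (Q * (2 * a))) / ‖s‖ ^ 2 := by
        rw [hps, norm_mul, mul_div_assoc, add_div (C * (1 + B))]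
        refine mul_le_mul hpe ((norm_sub_le _ _).trans (add_le_add ?_ ?_)) (norm_nonneg _)
          (Real.exp_pos _).le
        · rw [norm_mul, mul_div_right_comm]
          exact mul_le_mul hb.2.2.2.2.2.1 hW1 (norm_nonneg _) (by positivity)
        · rw [norm_mul, norm_mul, norm_mul, Complex.norm_I, one_mul, mul_div_assoc, mul_div_right_comm Q]
          exact mul_le_mul hWd (mul_le_mul (hqQ s hs θ hθ) hξ (norm_nonneg _) (by positivity))
            (by positivity) (by positivity)
      exact h5.trans (div_le_div_of_nonneg_right (le_add_of_nonneg_left (by positivity))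
        (by positivity))

end Straightening

/-! ### Assembly of the estimates. -/

theorem div_mem_lowerSector {n κ : ℝ} (hκ : 0 < κ) {s : ℂ} :
    s / κ ∈ lowerSector n ↔ s ∈ openSector n (κ / 2) := by
  rw [mem_lowerSector, Complex.div_ofReal_re, Complex.div_ofReal_im, abs_div, abs_of_pos hκ, ← neg_div,
    lt_div_iff₀ hκ]
  have e : (n * (|s.re| / κ) + 1 / 2) * κ = n * |s.re| + κ / 2 := by field_simp
  rw [e]
  rfl

open WienerAlg

namespace InnerSystem

variable {S : InnerSystem} {cf cg ch : Fin 3 → Fin 3 → Fin 3 → ℂ}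

/-- Averaging over the angle replaces the `s⁻¹` coefficient of `a₂` by its mean, which is `d L`; the
remainder `A₂` contributes one further factor `1 / s`. -/
theorem norm_mean_sub_le {U : Opens ℂ} [Nonempty U] (D : ModeDomain U) {τ : ℝ≥0} (hτ : 0 < τ) {κ : ℝ}
    (hκ : κ ≠ 0) {k₀ L : ℂ} (hL : 2 * S.b * k₀ + S.cubicMean ch = S.d * L) {K : ℝ}
    {A₂ : WienerAlg (HolB U) τ} (hA₂ : ‖A₂‖ ≤ K) {ψu ψv : ℂ → ℂ → ℂ} {s : ℂ} (hs : s / κ ∈ U)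
    (ha₂ : ∀ θ : ℂ, |θ.im| < τ → S.a₂ ψu ψv s θ = ev (zEl D τ κ * ((2 * S.b * k₀) • 1 +
      cubicForm ch (S.dir₀ (cosEl U τ) (sinEl U τ)) + zEl D τ κ * A₂)) (s / κ) θ) :
    ‖s * S.a₂mean ψu ψv s - S.d * L‖ ≤ K / ‖s‖ := by
  have hs0 : s ≠ 0 := fun h0 => zero_notMem D (by simpa [h0] using hs)
  set H : WienerAlg (HolB U) τ := cubicForm ch (S.dir₀ (cosEl U τ) (sinEl U τ)) with hH
  have hreal : ∀ t : ℝ, |(t : ℂ).im| < τ := fun t => by simpa using hτ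
  have e1 : ∀ t : ℝ, S.a₂ ψu ψv s t =
      s⁻¹ * ((2 * S.b * k₀ + ev H (s / κ) t) + s⁻¹ * ev A₂ (s / κ) t) := fun t => by
    have ht := (hreal t).le
    rw [ha₂ t (hreal t), ev_mul _ _ hs ht, ev_add _ _ hs ht, ev_add _ _ hs ht, ev_smul _ _ hs ht,
      ev_one hs ht, ev_mul _ _ hs ht, ev_zEl D hκ hs ht, mul_one]
  have hcH := continuous_ev_real H (s / κ)
  have hcA := continuous_ev_real A₂ (s / κ)
  have hπ : (Real.pi : ℂ) ≠ 0 := by exact_mod_cast Real.pi_ne_zero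
  have e2 : S.cubicMean ch = 1 / (2 * Real.pi) * ∫ t in (0 : ℝ)..(2 * Real.pi), ev H (s / κ) t := by
    rw [cubicMean]
    congr 1
    exact intervalIntegral.integral_congr fun t _ => (ev_cubicForm_real (s / κ) hs t).symm
  have e3 : s * S.a₂mean ψu ψv s - S.d * L =
      1 / (2 * Real.pi) * ∫ t in (0 : ℝ)..(2 * Real.pi), s⁻¹ * ev A₂ (s / κ) t := by
    rw [← hL, e2, a₂mean]
    simp only [e1]
    have c1 : Continuous fun t : ℝ => 2 * S.b * k₀ + ev H (s / κ) t := continuous_const.add hcH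
    have c2 : Continuous fun t : ℝ => s⁻¹ * ev A₂ (s / κ) t := continuous_const.mul hcA
    rw [intervalIntegral.integral_const_mul, intervalIntegral.integral_add
      (c1.intervalIntegrable _ _) (c2.intervalIntegrable _ _),
      intervalIntegral.integral_add (continuous_const.intervalIntegrable _ _) (hcH.intervalIntegrable _ _),
      intervalIntegral.integral_const]
    rw [sub_zero, Complex.real_smul]
    push_cast
    field_simp
    ring
  have h2π : (0 : ℝ) < 2 * Real.pi := by positivity
  have h4 : ‖∫ t in (0 : ℝ)..(2 * Real.pi), s⁻¹ * ev A₂ (s / κ) t‖ ≤ K / ‖s‖ * |2 * Real.pi - 0| := by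
    refine intervalIntegral.norm_integral_le_of_norm_le_const fun t _ => ?_
    rw [norm_mul, norm_inv, inv_mul_eq_div]
    gcongr
    exact (norm_ev_le _ _ (hreal t).le).trans hA₂
  rw [e3, norm_mul]
  have h5 : ‖(1 / (2 * Real.pi) : ℂ)‖ = 1 / (2 * Real.pi) := by
    rw [show (1 / (2 * Real.pi) : ℂ) = ((1 / (2 * Real.pi) : ℝ) : ℂ) by push_cast; rfl, Complex.norm_real,
      Real.norm_of_nonneg (by positivity)]
  rw [h5, one_div, inv_mul_le_iff₀ h2π]
  rwa [sub_zero, abs_of_pos h2π, mul_comm (K / ‖s‖)] at h4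

set_option maxHeartbeats 1000000 in
-- The constant `C` is fixed before `κ`, so all later conditions of the form `κ ≥ const * C` can be
-- met. The two functions share the leading coefficient `k₀`, hence their difference is `O(s⁻⁴)`;
-- only `O(s⁻¹)` is recorded.
theorem exists_straightening (hα : 0 < S.α) (hd : 0 < S.d) (hf : HasCubicPart S.f cf)
    (hg : HasCubicPart S.g cg) (hh : HasCubicPart S.h ch) {n : ℝ} (hn : 0 < n) {τ : ℝ≥0} (hτ : 0 < τ)
    {k₀ : ℂ} {L : ℝ} (hL : 2 * S.b * k₀ + S.cubicMean ch = S.d * L) (ρ : ℝ) :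
    ∃ κ₀ C : ℝ, 0 < κ₀ ∧ ∀ κ, κ₀ ≤ κ →
      ∀ Ψu Ψθu Ψsu Ψv Ψθv Ψsv : WienerAlg (HolB (lowerSector n)) τ,
      ‖Ψu‖ ≤ ρ → ‖Ψθu‖ ≤ ρ → ‖Ψsu‖ ≤ ρ → ‖Ψv‖ ≤ ρ → ‖Ψθv‖ ≤ ρ → ‖Ψsv‖ ≤ ρ →
      HasPartials κ (zEl (lowerDomain n hn) τ κ ^ 3 * (k₀ • 1 + zEl (lowerDomain n hn) τ κ * Ψu))
        (zEl (lowerDomain n hn) τ κ ^ 4 * Ψθu) (zEl (lowerDomain n hn) τ κ ^ 4 * Ψsu) →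
      HasPartials κ (zEl (lowerDomain n hn) τ κ ^ 3 * (k₀ • 1 + zEl (lowerDomain n hn) τ κ * Ψv))
        (zEl (lowerDomain n hn) τ κ ^ 4 * Ψθv) (zEl (lowerDomain n hn) τ κ ^ 4 * Ψsv) →
      ∀ ψu ψv : ℂ → ℂ → ℂ,
      ψu = (fun s θ => ev (zEl (lowerDomain n hn) τ κ ^ 3 *
        (k₀ • 1 + zEl (lowerDomain n hn) τ κ * Ψu)) (s / κ) θ) →
      ψv = (fun s θ => ev (zEl (lowerDomain n hn) τ κ ^ 3 *
        (k₀ • 1 + zEl (lowerDomain n hn) τ κ * Ψv)) (s / κ) θ) →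
      (∀ s : ℂ, s / κ ∈ lowerSector n → ∀ θ : ℂ, |θ.im| < τ → S.InnerEquationAt ψu s θ) →
      (∀ s : ℂ, s / κ ∈ lowerSector n → ∀ θ : ℂ, |θ.im| < τ → S.InnerEquationAt ψv s θ) →
      ∃ φ p : ℂ → ℂ → ℂ, Straightening S ψu ψv φ p L n κ τ C ∧
        ∀ s ∈ openSector n (κ / 2), ‖s * S.a₂mean ψu ψv s - S.d * L‖ ≤ C / ‖s‖ := by
  set D := lowerDomain n hn
  obtain ⟨κ₁, K, hκ₁, H₁⟩ := S.exists_coefficients hf hg hh D τ k₀ ρ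
  obtain ⟨κ₂, C₁, hκ₂, H₂⟩ := S.exists_phase_prefactor hα hd D τ hL |K| (abs_nonneg K)
  set H : WienerAlg (HolB (lowerSector n)) τ :=
    cubicForm ch (S.dir₀ (cosEl _ τ) (sinEl _ τ)) with hH
  set N := ‖(2 * S.b * k₀ : ℂ)‖ + ‖H‖ + |K| with hN
  refine ⟨max 2 (max κ₁ κ₂), 2 * |ρ| + |C₁| + N, by positivity,
    fun κ hκ Ψu Ψθu Ψsu Ψv Ψθv Ψsv hu hθu hsu hv hθv hsv hpu hpv ψu ψv eu ev' hiu hiv => ?_⟩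
  have hκ2 : 2 ≤ κ := (le_max_left _ _).trans hκ
  have hκ0 : 0 < κ := by linarith
  obtain ⟨A₁, A₂, A₃, hA₁, hA₂, hA₃, hA⟩ := H₁ κ ((le_max_left _ _).trans ((le_max_right _ _).trans hκ))
    Ψu Ψθu Ψsu Ψv Ψθv Ψsv hu hθu hsu hv hθv hsv hpu hpv
  replace hA := hA ψu ψv eu ev'
  obtain ⟨u, uθ, us, p, pθ, ps, nu, nuθ, nus, np, npθ, nps, hphu, hphp, hlin⟩ :=
    H₂ κ ((le_max_right _ _).trans ((le_max_right _ _).trans hκ)) A₁ A₂ A₃ (hA₁.trans (le_abs_self K))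
      (hA₂.trans (le_abs_self K)) (hA₃.trans (le_abs_self K))
  have hN0 : 0 ≤ N := by positivity
  have hC1 : C₁ ≤ 2 * |ρ| + |C₁| + N := by linarith [le_abs_self C₁, abs_nonneg ρ]
  have hdiv : ∀ {s : ℂ}, s ∈ openSector n (κ / 2) → s / κ ∈ lowerSector n := fun hs =>
    (div_mem_lowerSector hκ0).2 hs
  have hbd : ∀ (j : ℕ) (w : WienerAlg (HolB (lowerSector n)) τ) {s θ : ℂ}, s ∈ openSector n (κ / 2) →
      |θ.im| < τ → ‖w‖ ≤ 2 * |ρ| + |C₁| + N →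
      ‖ev (zEl D τ κ ^ j * w) (s / κ) θ‖ ≤ (2 * |ρ| + |C₁| + N) / ‖s‖ ^ j := by
    intro j w s θ hs hθ hw
    rw [ev_zEl_pow_mul D hκ0.ne' j _ (hdiv hs) hθ.le, norm_mul, norm_pow, norm_inv, inv_pow,
      inv_mul_eq_div]
    gcongr
    exact (norm_ev_le _ _ hθ.le).trans hw
  have hbd1 : ∀ (j : ℕ) (w : WienerAlg (HolB (lowerSector n)) τ) {s θ : ℂ}, j ≠ 0 →
      s ∈ openSector n (κ / 2) → |θ.im| < τ → ‖w‖ ≤ 2 * |ρ| + |C₁| + N →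
      ‖ev (zEl D τ κ ^ j * w) (s / κ) θ‖ ≤ (2 * |ρ| + |C₁| + N) / ‖s‖ := by
    intro j w s θ hj hs hθ hw
    have h1 : 1 < ‖s‖ := by linarith [norm_of_mem_openSector hn hs]
    refine (hbd j w hs hθ hw).trans ?_
    gcongr
    exact le_self_pow₀ h1.le hj
  have hbz : ∀ (w : WienerAlg (HolB (lowerSector n)) τ) {s θ : ℂ}, s ∈ openSector n (κ / 2) →
      |θ.im| < τ → ‖w‖ ≤ 2 * |ρ| + |C₁| + N →
      ‖ev (zEl D τ κ * w) (s / κ) θ‖ ≤ (2 * |ρ| + |C₁| + N) / ‖s‖ := fun w s θ hs hθ hw => by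
    have := hbd1 1 w one_ne_zero hs hθ hw
    rwa [pow_one] at this
  have han : ∀ (w : WienerAlg (HolB (lowerSector n)) τ) {s θ : ℂ}, s ∈ openSector n (κ / 2) →
      |θ.im| < τ → AnalyticAt ℂ (fun q : ℂ × ℂ => ev w (q.1 / κ) q.2) (s, θ) := fun w s θ hs hθ =>
    AnalyticAt.fun_comp (g := fun q : ℂ × ℂ => ev w q.1 q.2) (f := fun q : ℂ × ℂ => (q.1 / (κ : ℂ), q.2))
      (analyticAt_ev w (hdiv hs) hθ) ((analyticAt_fst.div_const).prod analyticAt_snd)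
  have eφs : ∀ {s θ : ℂ}, s ∈ openSector n (κ / 2) → |θ.im| < τ →
      pds (fun s θ => ev (zEl D τ κ * u) (s / κ) θ) s θ = ev (zEl D τ κ ^ 2 * us) (s / κ) θ :=
    fun {s θ} hs hθ => (hphu.fst s (hdiv hs) θ hθ).deriv
  have eφθ : ∀ {s θ : ℂ}, s ∈ openSector n (κ / 2) → |θ.im| < τ →
      pdθ (fun s θ => ev (zEl D τ κ * u) (s / κ) θ) s θ = ev (zEl D τ κ * uθ) (s / κ) θ :=
    fun {s θ} hs hθ => (hphu.angle s (hdiv hs) θ hθ).deriv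
  have eps : ∀ {s θ : ℂ}, s ∈ openSector n (κ / 2) → |θ.im| < τ →
      pds (fun s θ => ev (zEl D τ κ * p) (s / κ) θ) s θ = ev (zEl D τ κ ^ 2 * ps) (s / κ) θ :=
    fun {s θ} hs hθ => (hphp.fst s (hdiv hs) θ hθ).deriv
  have epθ : ∀ {s θ : ℂ}, s ∈ openSector n (κ / 2) → |θ.im| < τ →
      pdθ (fun s θ => ev (zEl D τ κ * p) (s / κ) θ) s θ = ev (zEl D τ κ ^ 2 * pθ) (s / κ) θ :=
    fun {s θ} hs hθ => (hphp.angle s (hdiv hs) θ hθ).deriv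
  refine ⟨fun s θ => ev (zEl D τ κ * u) (s / κ) θ, fun s θ => ev (zEl D τ κ * p) (s / κ) θ,
    ⟨by positivity, fun s hs θ hθ => ?_, fun s hs θ hθ => han _ hs hθ, fun s hs θ hθ => han _ hs hθ,
      fun s θ => ?_, fun s θ => ev_add_two_pi _ _ _, fun s θ => ev_add_two_pi _ _ _,
      fun s hs θ hθ => ⟨?_, hbz _ hs hθ (nu.trans hC1), ?_, ?_, hbz _ hs hθ (np.trans hC1), ?_, ?_⟩,
      fun s hs θ hθ => ?_, fun s hs θ hθ => ?_, fun s hs θ hθ => ?_⟩, fun s hs => ?_⟩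
  · rw [eu, ev']
    exact (han _ hs hθ).sub (han _ hs hθ)
  · rw [eu, ev']
    simp only [ev_add_two_pi]
  · have hzv : ψu s θ - ψv s θ = ev (zEl D τ κ ^ 4 * (Ψu - Ψv)) (s / κ) θ := by
      rw [eu, ev']
      simp only
      rw [ev_leading D hκ0.ne' _ _ (hdiv hs) hθ.le, ev_leading D hκ0.ne' _ _ (hdiv hs) hθ.le,
        ev_zEl_pow_mul D hκ0.ne' 4 _ (hdiv hs) hθ.le, ev_sub _ _ (hdiv hs) hθ.le]
      ring
    rw [hzv]
    refine hbd1 4 _ (by norm_num) hs hθ ((norm_sub_le _ _).trans ?_)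
    linarith [le_abs_self ρ, abs_nonneg C₁]
  · rw [eφθ hs hθ]; exact hbz _ hs hθ (nuθ.trans hC1)
  · rw [eφs hs hθ]; exact hbd1 2 _ two_ne_zero hs hθ (nus.trans hC1)
  · rw [eps hs hθ]; exact hbd 2 _ hs hθ (nps.trans hC1)
  · rw [(hA s (hdiv hs) θ hθ).2.1, ev_mul _ _ (hdiv hs) hθ.le, ev_zEl D hκ0.ne' (hdiv hs) hθ.le,
      ev_add _ _ (hdiv hs) hθ.le, ev_add _ _ (hdiv hs) hθ.le, ev_smul _ _ (hdiv hs) hθ.le,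
      ev_one (hdiv hs) hθ.le, mul_one, norm_mul, norm_inv, inv_mul_eq_div]
    gcongr
    have h1 : 1 < ‖s‖ := by linarith [norm_of_mem_openSector hn hs]
    have h2 : ‖ev (zEl D τ κ * A₂) (s / κ) θ‖ ≤ |K| := by
      rw [ev_mul _ _ (hdiv hs) hθ.le, ev_zEl D hκ0.ne' (hdiv hs) hθ.le, norm_mul, norm_inv]
      refine (mul_le_of_le_one_left (norm_nonneg _) (inv_le_one_of_one_le₀ h1.le)).trans ?_
      exact (norm_ev_le _ _ hθ.le).trans (hA₂.trans (le_abs_self K))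
    refine (norm_add₃_le).trans ?_
    have h3 := norm_ev_le H (s / κ) hθ.le
    linarith [abs_nonneg ρ, abs_nonneg C₁]
  · exact (hA s (hdiv hs) θ hθ).2.2.2 (hiu s (hdiv hs) θ hθ) (hiv s (hdiv hs) θ hθ)
  · have h0 := hA s (hdiv hs) θ hθ
    rw [eφs hs hθ, eφθ hs hθ]
    exact (hlin s (hdiv hs) θ hθ _ _ _ h0.1 h0.2.1 h0.2.2.1).1
  · have h0 := hA s (hdiv hs) θ hθ
    rw [eps hs hθ, epθ hs hθ]
    exact (hlin s (hdiv hs) θ hθ _ _ _ h0.1 h0.2.1 h0.2.2.1).2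
  · refine norm_mean_sub_le D hτ hκ0.ne' hL (hA₂.trans ?_) (hdiv hs) fun θ hθ =>
      (hA s (hdiv hs) θ hθ).2.1
    linarith [abs_nonneg ρ, abs_nonneg C₁, le_abs_self K, norm_nonneg (2 * S.b * k₀ : ℂ), norm_nonneg H]

end InnerSystem

end

theorem theorem2p4 (S : InnerSystem) (hα : 0 < S.α) (hb : 0 < S.b) (hd : 0 < S.d)
    (hf : IsCubicRemainder S.f) (hg : IsCubicRemainder S.g) (hh : IsCubicRemainder S.h) :
    ∃ L₀ : ℝ, ∀ β₀ σ : ℝ, 0 < β₀ → β₀ < Real.pi / 2 → 0 < σ →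
      ∃ κ₀ : ℝ, 0 < κ₀ ∧ ∀ κ : ℝ, κ₀ ≤ κ →
        -- both inner solutions exist
        (∃ ψu, S.IsInnerSolution (unstableDomain β₀ κ) σ ψu) ∧
        (∃ ψs, S.IsInnerSolution (stableDomain β₀ κ) σ ψs) ∧
        ∀ ψu ψs : ℂ → ℂ → ℂ,
          S.IsInnerSolution (unstableDomain β₀ κ) σ ψu →
          S.IsInnerSolution (stableDomain β₀ κ) σ ψs →
          -- the constant `L₀` is determined by the mean of `a₂`
          Tendsto (fun s => s * S.a₂mean ψu ψs s)
            (Bornology.cobounded ℂ ⊓ 𝓟 (innerOverlap β₀ κ)) (𝓝 ((S.d * L₀ : ℝ) : ℂ)) ∧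
          ∃ (P₁ φ : ℂ → ℂ → ℂ) (k : ℂ → ℂ) (Υ : {l : ℤ // l < 0} → ℂ) (M : ℝ),
            IsAnalyticPeriodic (innerOverlap β₀ κ) σ P₁ ∧
            IsAnalyticPeriodic (innerOverlap β₀ κ) σ φ ∧
            Function.Periodic k (2 * Real.pi) ∧
            InjOn (fun p : ℂ × ℂ => (S.phase L₀ φ p.1 p.2, p.2))
              (innerOverlap β₀ κ ×ˢ strip σ) ∧
            (∀ l, ‖Υ l‖ ≤ M) ∧
            ∀ s ∈ innerOverlap β₀ κ, ∀ θ ∈ strip σ,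
              ψu s θ - ψs s θ = S.prefactor P₁ s θ * k (S.phase L₀ φ s θ) ∧
              HasSum (fun l : {l : ℤ // l < 0} => Υ l * exp (I * (l : ℤ) * S.phase L₀ φ s θ))
                (k (S.phase L₀ φ s θ)) ∧
              S.DifferenceEquationAt ψu ψs (S.prefactor P₁) s θ ∧
              S.TransportEquationAt ψu ψs (S.phase L₀ φ) s θ ∧
              ‖φ s θ‖ ≤ M / ‖s‖ ∧ ‖pds φ s θ‖ ≤ M / ‖s‖ ∧
              ‖P₁ s θ‖ ≤ M / ‖s‖ ∧ ‖pds P₁ s θ‖ ≤ M / ‖s‖ ^ 2 := by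
  obtain ⟨cf, hcf⟩ := hf.exists_cubicPart
  obtain ⟨cg, hcg⟩ := hg.exists_cubicPart
  obtain ⟨ch, hch⟩ := hh.exists_cubicPart
  obtain ⟨L, hL⟩ := S.exists_phase_constant hb hd hcf hcg hch hf hg hh
  -- The constant comes from the cubic parts alone, before the opening angle and the strip are
  -- introduced.
  refine ⟨L, fun β₀ σ hβ hβ' hσ => ?_⟩
  have hm : 0 < Real.tan β₀ := Real.tan_pos_of_pos_of_lt_pi_div_two hβ hβ'
  set m := Real.tan β₀ with hmdef
  have hn : 0 < 3 / 4 * m := by positivity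
  set γ := (S.c + S.α * L) / S.d with hγ
  have hγ0 : 0 ≤ |γ| * Real.pi := mul_nonneg (abs_nonneg _) Real.pi_pos.le
  have ha : 0 < S.α / S.d := by positivity
  -- The wider strip provides the room that the variation of `γ log s` consumes when levels are
  -- moved to the imaginary axis.
  set τ : ℝ≥0 := ⟨σ + 2 * (|γ| * Real.pi) + 2, by positivity⟩ with hτdef
  have hτ : σ + 2 * (|γ| * Real.pi) + 2 = (τ : ℝ) := rfl
  have hστ : σ < τ := by rw [← hτ]; linarith
  have hτ0 : 0 < τ := by exact_mod_cast hσ.trans hστ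
  obtain ⟨κ₁, ρ₁, hκ₁, H₁⟩ := InnerSystem.exists_reference hα hb hd hcf hcg hch hm.ne' hn (abs_of_pos hm)
    hσ hστ
  obtain ⟨κ₂, ρ₂, -, H₂⟩ := InnerSystem.exists_reference hα hb hd hcf hcg hch (neg_ne_zero.2 hm.ne') hn
    ((abs_neg m).trans (abs_of_pos hm)) hσ hστ
  obtain ⟨κ₃, C, -, H₃⟩ := InnerSystem.exists_straightening hα hd hcf hcg hch hn hτ0 hL (max ρ₁ ρ₂)
  obtain ⟨κ₀, hκ₀⟩ := eventually_atTop.1 ((eventually_ge_atTop κ₁).and <| (eventually_ge_atTop κ₂).and <|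
    (eventually_ge_atTop κ₃).and <| (eventually_ge_atTop 2).and <| (eventually_ge_atTop (8 * C)).and <|
    ((tendsto_id.const_mul_atTop hd).eventually_ge_atTop (4 * C)).and <|
    ((tendsto_id.const_mul_atTop ha).eventually_ge_atTop (4 * (|γ| + C))).and
    ((tendsto_id.const_mul_atTop ha).eventually_ge_atTop (2 * (σ + 2 * (|γ| * Real.pi) + 5 / 4))))
  -- The threshold extracted from the eventual conditions is not known to be positive; the maximum
  -- with `κ₁` ensures it.
  refine ⟨max κ₁ κ₀, lt_max_of_lt_left hκ₁, fun κ hκ => ?_⟩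
  obtain ⟨g1, g2, g3, g4, g5, g6, g7, g8⟩ := hκ₀ κ ((le_max_right _ _).trans hκ)
  simp only [id] at g6 g7 g8
  have hκ0 : 0 < κ := by linarith
  obtain ⟨ex₁, Ψu, Ψθu, Ψsu, nu, nθu, nsu, hpu, hiu, hsu⟩ := H₁ κ g1
  obtain ⟨ex₂, Ψv, Ψθv, Ψsv, nv, nθv, nsv, hpv, hiv, hsv⟩ := H₂ κ g2
  rw [unstableDomain_eq, stableDomain_eq, ← hmdef]
  refine ⟨ex₁, ex₂, fun ψu ψs hψu hψs => ?_⟩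
  obtain ⟨φ, p, hstr, hmean⟩ := H₃ κ g3 Ψu Ψθu Ψsu Ψv Ψθv Ψsv (nu.trans (le_max_left _ _))
    (nθu.trans (le_max_left _ _)) (nsu.trans (le_max_left _ _)) (nv.trans (le_max_right _ _))
    (nθv.trans (le_max_right _ _)) (nsv.trans (le_max_right _ _)) hpu hpv _ _ rfl rfl hiu hiv
  obtain ⟨P₁, j, Υ, M, hj, hP₁, H⟩ := hstr.exists_splitting hn hα hd g4 g5 g6 g7 hσ hτ (by linarith)
  have hE : innerOverlap β₀ κ ⊆ closedSector (3 / 4 * m) κ := by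
    rintro s ⟨⟨h1, h2⟩, h3⟩
    rw [unstableDomain_eq] at h1
    rw [stableDomain_eq] at h2
    have h3' : s.im < 0 := h3
    have h1' : m * s.re + κ ≤ |s.im| := h1
    have h2' : -m * s.re + κ ≤ |s.im| := h2
    rw [abs_of_neg h3'] at h1' h2'
    -- In the lower half-plane the unstable and stable inequalities combine into a condition on `|Re
    -- s|`.
    have h4 : m * |s.re| + κ ≤ -s.im := by
      rcases abs_cases s.re with ⟨e, -⟩ | ⟨e, -⟩ <;> rw [e] <;> linarith
    have h5 := mul_nonneg hm.le (abs_nonneg s.re)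
    show 3 / 4 * m * |s.re| + κ ≤ -s.im
    linarith
  have hE' : innerOverlap β₀ κ ⊆ openSector (3 / 4 * m) (κ / 2) := hE.trans (closedSector_subset hκ0)
  have hu : ∀ s ∈ innerOverlap β₀ κ, ∀ θ ∈ strip σ, SliceEq ψu _ s θ := fun s hs θ hθ =>
    hsu ψu hψu s hs.1.1 ((div_mem_lowerSector hκ0).2 (hE' hs)) θ hθ
  have hv : ∀ s ∈ innerOverlap β₀ κ, ∀ θ ∈ strip σ, SliceEq ψs _ s θ := fun s hs θ hθ => by
    have h2 := hs.1.2
    rw [stableDomain_eq] at h2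
    exact hsv ψs hψs s h2 ((div_mem_lowerSector hκ0).2 (hE' hs)) θ hθ
  have hC := hstr.C_nonneg
  constructor
  · rw [tendsto_iff_norm_sub_tendsto_zero]
    have hlim : Tendsto (fun s : ℂ => C / ‖s‖) (Bornology.cobounded ℂ ⊓ 𝓟 (innerOverlap β₀ κ)) (𝓝 0) :=
      (tendsto_norm_cobounded_atTop.const_div_atTop C).mono_left inf_le_left
    refine squeeze_zero' (Eventually.of_forall fun s => norm_nonneg _) ?_ hlim
    filter_upwards [mem_inf_of_right (mem_principal_self _)] with s hs
    have ht : ∀ t : ℝ, (t : ℂ) ∈ strip σ := fun t => by simpa [strip] using hσ.le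
    rw [SliceEq.a₂mean_eq (fun t => hu s hs t (ht t)) (fun t => hv s hs t (ht t)), Complex.ofReal_mul]
    exact hmean s (hE' hs)
  -- The periodic function is a single exponential, so its only coefficient that may be nonzero has
  -- index `-j`; it is negative because `j > 0`.
  refine ⟨P₁, φ, fun w => Υ * exp (j * -(I * w)),
    fun l => if (l : ℤ) = -(j : ℤ) then Υ else 0, max (max M C) ‖Υ‖, ?_, ?_, fun w => ?_,
    hstr.injOn_phase hn hα hd g4 g7 hE' hστ, fun l => ?_, fun s hs θ hθ => ?_⟩
  · exact ⟨hP₁.analytic.mono (prod_mono_left hE), fun s hs => hP₁.periodic s (hE hs)⟩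
  · exact ⟨fun q hq => hstr.analytic_φ q.1 (hE' hq.1) q.2 (lt_of_le_of_lt hq.2 hστ),
      fun s _ θ _ => hstr.periodic_φ s θ⟩
  · have e : (j * -(I * (w + 2 * Real.pi)) : ℂ) = j * -(I * w) - j * (2 * Real.pi * I) := by ring
    simp only
    rw [e, Complex.exp_periodic.sub_nat_mul_eq]
  · beta_reduce
    split_ifs
    · exact le_max_right _ _
    · rw [norm_zero]; exact (norm_nonneg Υ).trans (le_max_right _ _)
  · obtain ⟨e1, e2, e3, e4⟩ := H s (hE hs) θ hθ
    have hθ' : |θ.im| < τ := lt_of_le_of_lt hθ hστ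
    have hb' := hstr.bound s (hE' hs) θ hθ'
    have hM : M ≤ max (max M C) ‖Υ‖ := (le_max_left _ _).trans (le_max_left _ _)
    have hCM : C ≤ max (max M C) ‖Υ‖ := (le_max_right _ _).trans (le_max_left _ _)
    refine ⟨?_, ?_, (hu s hs θ hθ).differenceEquationAt (hv s hs θ hθ) e2,
      (hu s hs θ hθ).transportEquationAt (hv s hs θ hθ)
        (hstr.transportEquationAt (hE' hs) (hstr.mem_slitPlane hn hκ0 (hE' hs)) hθ'),
      hb'.2.1.trans (by gcongr), hb'.2.2.2.1.trans (by gcongr), e3.trans (by gcongr),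
      e4.trans (by gcongr)⟩
    · rw [(hu s hs θ hθ).eq, (hv s hs θ hθ).eq, e1]
    · have hneg : -(j : ℤ) < 0 := by omega
      have hsum := hasSum_single (f := fun l : {l : ℤ // l < 0} =>
        (if (l : ℤ) = -(j : ℤ) then Υ else 0) * exp (I * (l : ℤ) * S.phase L φ s θ)) ⟨-(j : ℤ), hneg⟩
        fun l hl => by
          have : (l : ℤ) ≠ -(j : ℤ) := fun h0 => hl (Subtype.ext h0)
          simp [this]
      have e5 : (j * -(I * S.phase L φ s θ) : ℂ) = I * ((-(j : ℤ) : ℤ) : ℂ) * S.phase L φ s θ := by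
        push_cast; ring
      beta_reduce
      rw [e5]
      simpa only [if_true] using hsum
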